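/- Painlevé VI with parameters $\theta=(\theta_1,\theta_2,\theta_3,\theta_4)\in\mathbb C^4$ is $$\frac{d^2y}{dt^2}=\frac12\Bigl(\frac1y+\frac1{y-1}+\frac1{y-t}\Bigr)\Bigl(\frac{dy}{dt}\Bigr)^2-\Bigl(\frac1t+\frac1{t-1}+\frac1{y-t}\Bigr)\frac{dy}{dt}+\frac{y(y-1)(y-t)}{t^2(t-1)^2}\Bigl(\alpha+\beta\frac t{y^2}+\gamma\frac{t-1}{(y-1)^2}+\delta\frac{t(t-1)}{(y-t)^2}\Bigr),$$ where $\alpha=(\theta_4-1)^2/2$, $\beta=-\theta_1^2/2$, $\gamma=\theta_3^2/2$, $\delta=(1-\theta_2^2)/2$. An algebraic solution is a compact algebraic curve $\Pi$ with two rational functions $y,t$ such that $t$ is a Belyi map (branched only over $0,1,\infty$) and $y$, as a function of $t$, solves this equation. Two algebraic solutions are equivalent if, after a birational isomorphism of the curves, they are related by Okamoto's affine $F_4$ group of symmetries, which is generated by $\theta_i\mapsto-\theta_i$ ($i=1,2,3$) and $\theta_4\mapsto2-\theta_4$ (with $y,t$ fixed), by $$(\theta,y,t)\mapsto\bigl((\theta_3,\theta_2,\theta_1,\theta_4),1-y,1-t\bigr),\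 \bigl((\theta_1,\theta_3,\theta_2,\theta_4),\tfrac yt,\tfrac1t\bigr),\ \bigl((\theta_4-1,\theta_2,\theta_3,\theta_1+1),\tfrac1y,\tfrac1t\bigr),$$ and by $(\theta,y,t)\mapsto\bigl((\theta_i-e)_i,\,y+e/x,\,t\bigr)$, where $e=\frac12\sum_i\theta_i$ and $$x=\frac12\Bigl(\frac{(t-1)y'-\theta_1}{y}+\frac{y'-1-\theta_2}{y-t}-\frac{ty'+\theta_3}{y-1}\Bigr),\qquad y'=\frac{dy}{dt}.$$ The Dubrovin–Mazzocco icosahedral solution of degree $18$ is the algebraic solution $F(y,t)=0$, with $F$ an irreducible polynomial of degree $18$ in $y$ and with $\theta=(0,0,0,-\frac23)$, which controls the connections $$d-\Bigl(\frac{B_1}z+\frac{B_2}{z-t}+\frac{B_3}{z-1}\Bigr)dz$$ on the trivial rank three bundle whose monodromy group is the icosahedral reflection group $H_3\subset O_3(\mathbb R)$ of order $120$, where the $B_i$ have rank one and trace $\frac12$ and $B_1+B_2+B_3$ has the eigenvalues $\mu=(\mu_1,\mu_2,\mu_3)=(\frac12,\frac56,\frac16)$. Here, with $\lambda_i=\frac12$,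 only the $i$-th row of $B_i$ is nonzero, and the matrix of these three rows $(b_{ij})$ is $b_{ii}=\lambda_i$, $b_{12}=\lambda_1-\mu_3y+(\mu_1-xy)(y-1)$, $b_{13}=\lambda_1t-\mu_3y+(\mu_1-xy)(y-t)$, $b_{21}=\lambda_2+\frac{\mu_3(y-t)-\mu_1(y-1)+x(y-t)(y-1)}{t-1}$, $b_{23}=(\mu_2-\lambda_3)t-b_{13}$, $b_{31}=(\mu_2-\lambda_1-b_{21})/t$, $b_{32}=(\mu_2-\lambda_2-b_{12})/t$. **Theorem.** On the elliptic curve $u^2=s(8s^2-11s+8)$ the functions $$y=\frac12-\frac{8s^7-28s^6+75s^5+31s^4-269s^3+318s^2-166s+56}{18u(s-1)(3s^3-4s^2+4s+2)},$$ $$t=\frac12+\frac{(s+1)\bigl(32(s^8+1)-320(s^7+s)+1112(s^6+s^2)-2420(s^5+s^3)+3167s^4\bigr)}{54u^3s(s-1)}$$ form an algebraic solution of Painlevé VI with $\theta=(1,1,1,1)/3$. The Dubrovin–Mazzocco icosahedral solution of degree $18$ exists and is equivalent to it. In particular the curve $F(y,t)=0$ is birational to this elliptic curve. -/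

import Mathlib

namespace PainleveVI

open Polynomial
open scoped Polynomial.Bivariate IntermediateField Topology

noncomputable section

/-! ### Plane curves and their function fields -/

/-- An irreducible affine plane curve `poly = 0` over `ℂ`. In `ℂ[X][Y]` the inner variable `X` is the
first coordinate and the outer variable `Y` is the second coordinate. -/
structure PlaneCurve where
  poly : ℂ[X][Y]
  irreducible : Irreducible poly

namespace PlaneCurve

/-- The coordinate ring of an irreducible curve is a domain. -/
instance isDomain_coordinateRing (C : PlaneCurve) : IsDomain (AdjoinRoot C.poly) :=
  AdjoinRoot.isDomain_of_prime C.irreducible.prime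

/-- The function field of a plane curve, i.e. the field of rational functions on (the compact model
of) the curve. -/
abbrev FunctionField (C : PlaneCurve) : Type := FractionRing (AdjoinRoot C.poly)

/-- The first coordinate, as a rational function on the curve. -/
def fst (C : PlaneCurve) : C.FunctionField :=
  algebraMap (AdjoinRoot C.poly) C.FunctionField (AdjoinRoot.of C.poly X)

/-- The second coordinate, as a rational function on the curve. -/
def snd (C : PlaneCurve) : C.FunctionField :=
  algebraMap (AdjoinRoot C.poly) C.FunctionField (AdjoinRoot.root C.poly)

/-- Two curves are birational when their function fields are isomorphic over `ℂ`. -/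
def Birational (C C' : PlaneCurve) : Prop :=
  Nonempty (C.FunctionField ≃ₐ[ℂ] C'.FunctionField)

end PlaneCurve

/-! ### Algebraic solutions of Painlevé VI -/

section Field

variable {K : Type*} [Field K] [Algebra ℂ K]

/-- `y` satisfies the sixth Painlevé equation with parameters `θ = (θ₁, θ₂, θ₃, θ₄)`, where
`D = d/dt`. -/
def SolvesPVI (θ : Fin 4 → ℂ) (D : Derivation ℂ K K) (y t : K) : Prop :=
  let α : K := algebraMap ℂ K ((θ 3 - 1) ^ 2 / 2)
  let β : K := algebraMap ℂ K (-(θ 0) ^ 2 / 2)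
  let γ : K := algebraMap ℂ K ((θ 2) ^ 2 / 2)
  let δ : K := algebraMap ℂ K ((1 - (θ 1) ^ 2) / 2)
  y ≠ 0 ∧ y ≠ 1 ∧ y ≠ t ∧
  D (D y) =
    (1 / 2) * (1 / y + 1 / (y - 1) + 1 / (y - t)) * (D y) ^ 2
      - (1 / t + 1 / (t - 1) + 1 / (y - t)) * D y
      + y * (y - 1) * (y - t) / (t ^ 2 * (t - 1) ^ 2) *
        (α + β * (t / y ^ 2) + γ * ((t - 1) / (y - 1) ^ 2) + δ * (t * (t - 1) / (y - t) ^ 2))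

/-- The rational function `t` is a Belyi map: its branch locus lies in `{0, 1, ∞}`. A point of the
compact curve with function field `K` is a place, i.e. a valuation ring `O ≠ K` with `ℂ ⊆ O ⊆ K`.
At a point where `t` takes a finite value `a ≠ 0, 1`, the function `t - a` has to be a local
parameter: it divides every function that vanishes at the point. -/
def IsBelyi (t : K) : Prop :=
  ∀ O : ValuationSubring K, O ≠ ⊤ → (∀ c : ℂ, algebraMap ℂ K c ∈ O) →
    ∀ a : ℂ, a ≠ 0 → a ≠ 1 → t - algebraMap ℂ K a ∈ O.nonunits →
      ∀ f ∈ O.nonunits, f / (t - algebraMap ℂ K a) ∈ O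

variable (K) in
/-- Four parameters `θ` and two elements `y`, `t` of a field. -/
structure SolutionData where
  θ : Fin 4 → ℂ
  y : K
  t : K

/-- Transport along an isomorphism of fields. -/
def SolutionData.map {K' : Type*} [Field K'] [Algebra ℂ K'] (P : SolutionData K)
    (φ : K ≃ₐ[ℂ] K') : SolutionData K' :=
  ⟨P.θ, φ P.y, φ P.t⟩

/-- An algebraic solution of Painlevé VI: a curve (with function field `K`, a finite extension of
`ℂ(t)`) with two rational functions `y`, `t` such that `t` is a Belyi map and `y`, as a function of
`t`, solves Painlevé VI. The derivation `d/dt` of `K` is the only one with `D t = 1`. -/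
structure SolutionData.IsAlgebraicSolution (P : SolutionData K) : Prop where
  transcendental : Transcendental ℂ P.t
  finite : Module.Finite ℂ⟮P.t⟯ K
  belyi : IsBelyi P.t
  solves : ∃ D : Derivation ℂ K K, D P.t = 1 ∧ SolvesPVI P.θ D P.y P.t

/-- The variable `x` conjugate to `y`, in terms of `y`, `y' = dy/dt` and `t`. -/
def conjugateVar (θ : Fin 4 → ℂ) (y y' t : K) : K :=
  (1 / 2) * (((t - 1) * y' - algebraMap ℂ K (θ 0)) / y
    + (y' - 1 - algebraMap ℂ K (θ 1)) / (y - t)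
    - (t * y' + algebraMap ℂ K (θ 2)) / (y - 1))

/-- Generators of Okamoto's affine `F₄` Weyl group of symmetries of Painlevé VI. The first four
and the last one generate the affine Weyl group of type `D₄`, and act on the parameters by the
reflections in `θ₁ = 0`, `θ₂ = 0`, `θ₃ = 0`, `θ₄ = 1` and `θ₁ + θ₂ + θ₃ + θ₄ = 0`; the other three
generate the symmetric group of degree four, which permutes `θ₁, θ₂, θ₃, θ₄ - 1`. -/
inductive OkamotoStep : SolutionData K → SolutionData K → Prop
  | neg₁ (a b c d : ℂ) (y t : K) : OkamotoStep ⟨![a, b, c, d], y, t⟩ ⟨![-a, b, c, d], y, t⟩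
  | neg₂ (a b c d : ℂ) (y t : K) : OkamotoStep ⟨![a, b, c, d], y, t⟩ ⟨![a, -b, c, d], y, t⟩
  | neg₃ (a b c d : ℂ) (y t : K) : OkamotoStep ⟨![a, b, c, d], y, t⟩ ⟨![a, b, -c, d], y, t⟩
  | neg₄ (a b c d : ℂ) (y t : K) : OkamotoStep ⟨![a, b, c, d], y, t⟩ ⟨![a, b, c, 2 - d], y, t⟩
  | swap₁₃ (a b c d : ℂ) (y t : K) :
      OkamotoStep ⟨![a, b, c, d], y, t⟩ ⟨![c, b, a, d], 1 - y, 1 - t⟩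
  | swap₂₃ (a b c d : ℂ) (y t : K) (ht : t ≠ 0) :
      OkamotoStep ⟨![a, b, c, d], y, t⟩ ⟨![a, c, b, d], y / t, 1 / t⟩
  | swap₁₄ (a b c d : ℂ) (y t : K) (hy : y ≠ 0) (ht : t ≠ 0) :
      OkamotoStep ⟨![a, b, c, d], y, t⟩ ⟨![d - 1, b, c, a + 1], 1 / y, 1 / t⟩
  | okamoto (a b c d : ℂ) (y t : K) (D : Derivation ℂ K K) (hD : D t = 1)
      (h0 : y ≠ 0) (h1 : y ≠ 1) (ht : y ≠ t)
      (hx : conjugateVar ![a, b, c, d] y (D y) t ≠ 0) (e : ℂ) (he : e = (a + b + c + d) / 2) :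
      OkamotoStep ⟨![a, b, c, d], y, t⟩
        ⟨![a - e, b - e, c - e, d - e],
          y + algebraMap ℂ K e / conjugateVar ![a, b, c, d] y (D y) t, t⟩

end Field

/-- Equivalence of solutions: after an isomorphism of the function fields (a birational isomorphism
of the curves), the solutions are related by Okamoto's affine `F₄` symmetries. -/
def OkamotoEquivalent {K K' : Type*} [Field K] [Algebra ℂ K] [Field K'] [Algebra ℂ K']
    (P : SolutionData K) (Q : SolutionData K') : Prop :=
  ∃ φ : K ≃ₐ[ℂ] K', Relation.EqvGen OkamotoStep (P.map φ) Q

/-! ### Rank three connections with three finite poles, and their monodromy -/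

/-- The parameters of Painlevé VI attached to the traces `l` of the residues and to the eigenvalues
`m` of the sum of the residues. -/
def thetaOf (l m : Fin 3 → ℂ) : Fin 4 → ℂ :=
  ![l 0 - m 0, l 1 - m 0, l 2 - m 0, m 2 - m 1]

/-- The matrix whose rows are the nonzero rows of the rank one residues `B₁`, `B₂`, `B₃` attached to
the value `y` and the derivative `y'`, at `t`, of a solution of Painlevé VI with parameters
`thetaOf l m`. -/
def residueRows (l m : Fin 3 → ℂ) (y y' t : ℂ) : Matrix (Fin 3) (Fin 3) ℂ :=
  let x := conjugateVar (thetaOf l m) y y' t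
  let b₁₂ := l 0 - m 2 * y + (m 0 - x * y) * (y - 1)
  let b₁₃ := l 0 * t - m 2 * y + (m 0 - x * y) * (y - t)
  let b₂₁ := l 1 + (m 2 * (y - t) - m 0 * (y - 1) + x * (y - t) * (y - 1)) / (t - 1)
  let b₂₃ := (m 1 - l 2) * t - b₁₃
  let b₃₁ := (m 1 - l 0 - b₂₁) / t
  let b₃₂ := (m 1 - l 1 - b₁₂) / t
  !![l 0, b₁₂, b₁₃;
     b₂₁, l 1, b₂₃;
     b₃₁, b₃₂, l 2]

/-- The coefficient `B₁ / z + B₂ / (z - t) + B₃ / (z - 1)` of the connection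
`d - (B₁ / z + B₂ / (z - t) + B₃ / (z - 1)) dz`, where `Bᵢ` has the `i`-th row of `B` as its `i`-th
row and zeros elsewhere. -/
def connectionMatrix (B : Matrix (Fin 3) (Fin 3) ℂ) (t z : ℂ) : Matrix (Fin 3) (Fin 3) ℂ :=
  Matrix.diagonal ![1 / z, 1 / (z - t), 1 / (z - 1)] * B

/-- The monodromy group, based at `z₀`, of the linear system `dΦ/dz = A(z) Φ` on the complement of
`S`: all matrices `Φ(1)`, where `Φ` is the parallel transport with `Φ(0) = 1` along a loop. -/
def monodromyGroup (A : ℂ → Matrix (Fin 3) (Fin 3) ℂ) (S : Set ℂ) (z₀ : ℂ) :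
    Set (Matrix (Fin 3) (Fin 3) ℂ) :=
  {M | ∃ (γ : ℝ → ℂ) (Φ : ℝ → Matrix (Fin 3) (Fin 3) ℂ),
    ContDiff ℝ 1 γ ∧ γ 0 = z₀ ∧ γ 1 = z₀ ∧ (∀ r ∈ Set.Icc (0 : ℝ) 1, γ r ∉ S) ∧
    Φ 0 = 1 ∧ Φ 1 = M ∧
    ∀ r ∈ Set.Icc (0 : ℝ) 1, ∀ i j,
      HasDerivWithinAt (fun r => Φ r i j) (deriv γ r * (A (γ r) * Φ r) i j) (Set.Icc 0 1) r}

/-- The twelve vertices of a regular icosahedron. -/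
def icosahedronVertices : Set (Fin 3 → ℝ) :=
  {v | ∃ a b : ℝ, (a = 1 ∨ a = -1) ∧ (b = Real.goldenRatio ∨ b = -Real.goldenRatio) ∧
    (v = ![0, a, b] ∨ v = ![a, b, 0] ∨ v = ![b, 0, a])}

/-- The icosahedral reflection group: the full symmetry group of the icosahedron, of order `120`, in
`O₃(ℝ)` and regarded as a set of complex matrices. -/
def icosahedralReflectionGroup : Set (Matrix (Fin 3) (Fin 3) ℂ) :=
  {M | ∃ A ∈ Matrix.orthogonalGroup (Fin 3) ℝ,
    (∀ v ∈ icosahedronVertices, A.mulVec v ∈ icosahedronVertices) ∧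
    M = A.map (fun r : ℝ => (r : ℂ))}

/-! ### The Dubrovin–Mazzocco solution with eighteen branches -/

/-- The pair `(y, t)` of coordinate functions on a plane curve `F(y, t) = 0` (with `t` the first
coordinate of `ℂ[X][Y]` and `y` the second one), with the parameters `θ = (0, 0, 0, -2/3)`. -/
def dubrovinMazzoccoData (C : PlaneCurve) : SolutionData C.FunctionField :=
  ⟨![0, 0, 0, -2 / 3], C.snd, C.fst⟩

/-- Traces of the residues: the local monodromies are reflections of order two. -/
def dmTraces : Fin 3 → ℂ := ![1 / 2, 1 / 2, 1 / 2]

/-- The eigenvalues of the sum of the residues. -/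
def dmEigenvalues : Fin 3 → ℂ := ![1 / 2, 5 / 6, 1 / 6]

theorem thetaOf_dm : thetaOf dmTraces dmEigenvalues = ![0, 0, 0, -2 / 3] := by
  funext i
  fin_cases i <;> simp [thetaOf, dmTraces, dmEigenvalues]
  norm_num

/-- `F(y, t) = 0` is the (elliptic, degree `18`) icosahedral solution of Dubrovin and Mazzocco: an
algebraic solution of Painlevé VI with `θ = (0, 0, 0, -2/3)` and with `18` branches, some branch
`y = f(t)` of which has initial values `f(t₀)`, `f'(t₀)` specified by a rank three connection whose
monodromy group is the icosahedral reflection group. (The deformation in `t` being isomonodromic, the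
monodromy does not depend on the branch and on `t₀`.) The residues have trace `1/2`, so that the
monodromy around each finite pole is a reflection of order two, and the product of these reflections
has the eigenvalues `exp(2πi/6)`, `-1`, `exp(10πi/6)`; this singles out, up to equivalence, one of
the three inequivalent triples of generating reflections, the products of the other two being of
order ten. -/
structure IsDubrovinMazzocco (C : PlaneCurve) : Prop where
  isAlgebraicSolution : (dubrovinMazzoccoData C).IsAlgebraicSolution
  branches : C.poly.natDegree = 18
  monodromy : ∃ (t₀ : ℂ) (f : ℂ → ℂ), t₀ ≠ 0 ∧ t₀ ≠ 1 ∧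
    AnalyticAt ℂ f t₀ ∧ (∀ᶠ t in 𝓝 t₀, C.poly.evalEval t (f t) = 0) ∧
    f t₀ ≠ 0 ∧ f t₀ ≠ 1 ∧ f t₀ ≠ t₀ ∧
    ∃ z₀ : ℂ, z₀ ∉ ({0, t₀, 1} : Set ℂ) ∧ ∃ g : GL (Fin 3) ℂ,
      monodromyGroup
          (connectionMatrix (residueRows dmTraces dmEigenvalues (f t₀) (deriv f t₀) t₀) t₀)
          {0, t₀, 1} z₀ =
        {M | ∃ h ∈ icosahedralReflectionGroup,
          M = (g : Matrix (Fin 3) (Fin 3) ℂ) * h * ((g⁻¹ : GL (Fin 3) ℂ) : Matrix _ _ ℂ)}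

/-! ### The explicit solution -/

/-- The cubic `s (8 s² - 11 s + 8)`. -/
def cubic : ℂ[X] := X * (8 * X ^ 2 - 11 * X + 8)

theorem natDegree_cubic : cubic.natDegree = 3 := by
  have h : cubic = C 8 * X ^ 3 + C (-11) * X ^ 2 + C 8 * X + C 0 := by
    simp only [cubic, map_neg, map_ofNat, map_zero]
    ring
  rw [h]
  exact Polynomial.natDegree_cubic (by norm_num)

theorem irreducible_ellipticPoly : Irreducible (Y ^ 2 - C cubic : ℂ[X][Y]) := by
  have hd : (Y ^ 2 - C cubic : ℂ[X][Y]).natDegree = 2 := natDegree_X_pow_sub_C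
  have hm : (Y ^ 2 - C cubic : ℂ[X][Y]).Monic := monic_X_pow_sub_C _ two_ne_zero
  rw [hm.irreducible_iff_roots_eq_zero_of_degree_le_three (by omega) (by omega)]
  refine Multiset.eq_zero_of_forall_notMem fun r hr => ?_
  have h : r ^ 2 = cubic := by
    have := (mem_roots hm.ne_zero).1 hr
    simpa [sub_eq_zero] using this
  have h2 := congrArg natDegree h
  rw [natDegree_pow, natDegree_cubic] at h2
  omega

/-- The elliptic curve `u² = s (8 s² - 11 s + 8)`, with `s` the first and `u` the second
coordinate. -/
def ellipticCurve : PlaneCurve := ⟨Y ^ 2 - C cubic, irreducible_ellipticPoly⟩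

/-- The explicit pair `y`, `t` on the elliptic curve, with the parameters `(1, 1, 1, 1) / 3`. -/
def explicitSolution : SolutionData ellipticCurve.FunctionField :=
  let s := ellipticCurve.fst
  let u := ellipticCurve.snd
  { θ := ![1 / 3, 1 / 3, 1 / 3, 1 / 3]
    y := 1 / 2 - (8 * s ^ 7 - 28 * s ^ 6 + 75 * s ^ 5 + 31 * s ^ 4 - 269 * s ^ 3 + 318 * s ^ 2
        - 166 * s + 56) / (18 * u * (s - 1) * (3 * s ^ 3 - 4 * s ^ 2 + 4 * s + 2))
    t := 1 / 2 + ((s + 1) * (32 * (s ^ 8 + 1) - 320 * (s ^ 7 + s) + 1112 * (s ^ 6 + s ^ 2)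
        - 2420 * (s ^ 5 + s ^ 3) + 3167 * s ^ 4)) / (54 * u ^ 3 * s * (s - 1)) }

end

end PainleveVI

/-! The explicit solution. Both `t - 1/2` and `y - 1/2` are `u` times a rational function of `s`,
and for equal parameters Painlevé VI is compatible with `(y, t) ↦ (1 - y, 1 - t)`, that is with `u ↦
-u`. So the equation is `u` times an identity between rational functions of the single variable `s`
(`rhs_third`, `GenericPoint.solvesPVI`). For the Belyi property, `(t - 1/2)²` is a rational function
of `s` whose derivative factors completely, and the factors show that its critical values other than
`0` and `∞` equal `1/4` (`eval_tSqDen_critical`). Since `s - a` is a local parameter wherever `u` is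
finite and nonzero (`valuation_le_of_lt_one`), this passes to the places of the curve.

The equivalence. Okamoto's transformation keeps `x` and moves `y` by `e/x`; in Hamiltonian form its
invariance is a polynomial identity (`HamiltonianPVI.okamoto`). Two such steps, separated by three
changes of sign, lead from `(1,1,1,1)/3` to `(0,0,0,-2/3)`. Each step is inverted rationally in `t`,
`y` and `y'`, so `t` and the new `y` generate the same field as `t` and the old one. The latter pair
generates the whole function field `K`, because two elements of `ℂ(t, y)` have the coprime degrees
`14` and `9` over `ℂ(s)` (`eq_top_of_t_y`), and `[K : ℂ(t)] = 18` (`finrank_t`). Hence the plane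
model `F(y, t) = 0` has degree `18` in `y` and is birational to the elliptic curve.

The monodromy. At the point `s = -1`, `u = 3√-3` one has `t = 1/2`, and all values lie in `ℚ(√-3)`,
so the connection becomes one explicit matrix, `icosaResidues`. For the upper bound, a quadratic and
a sextic form on the fibre are invariant under parallel transport (`Transports.forms_eq`); in a
suitable frame they are the sum of squares and the product of the six axes of the icosahedron
(`exists_icosahedral_frame`), and a matrix preserving both lies in the icosahedral reflection group
(`mem_icosahedralReflectionGroup`).

For the lower bound, zooming in on a pole, or out from all of them, gives a family of loops on which
the trace of the monodromy is continuous. By the upper bound it takes finitely many values, so it is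
constant, and in the limit it is read off from the eigenvalues of the residue (`trace_gates`). Each
small loop thus has trace `1`, hence acts as a reflection, and the product of the three has trace
`0`. A finite check (`generates_of_mem`, `mem_of_reflections`) shows that three reflections of the
icosahedron whose product has trace `0` generate the whole group. The argument uses neither
isomonodromy nor homotopy invariance of parallel transport. -/

namespace PainleveVI

open Polynomial
open scoped Polynomial.Bivariate IntermediateField Topology

/-! ### The Hamiltonian form of Painlevé VI and Okamoto's transformation -/

section Okamoto

variable {K : Type*} [Field K] [Algebra ℂ K]

/-- The Hamiltonian form of Painlevé VI, for the pair `(x, y)`. -/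
structure HamiltonianPVI (θ : Fin 4 → ℂ) (D : Derivation ℂ K K) (x y t : K) : Prop where
  deriv_y : t * (t - 1) * D y = 2 * x * (y * (y - 1) * (y - t))
    + algebraMap ℂ K (θ 0) * ((y - 1) * (y - t)) + (1 + algebraMap ℂ K (θ 1)) * (y * (y - 1))
    + algebraMap ℂ K (θ 2) * (y * (y - t))
  deriv_x : t * (t - 1) * D x = -((3 * y ^ 2 - 2 * (1 + t) * y + t) * x ^ 2
    + x * (algebraMap ℂ K (θ 0) * (2 * y - 1 - t) + (1 + algebraMap ℂ K (θ 1)) * (2 * y - 1)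
      + algebraMap ℂ K (θ 2) * (2 * y - t))
    + algebraMap ℂ K ((θ 0 + θ 1 + θ 2 + θ 3) / 2 * ((θ 0 + θ 1 + θ 2 + θ 3) / 2 + 1 - θ 3)))

/-- Partial fractions in `y`: `(t - 1)/y + 1/(y - t) - t/(y - 1)` is `t(t - 1)/(y(y - 1)(y - t))`,
which collects the three occurrences of `y'` into one. -/
theorem two_mul_conjugateVar (θ : Fin 4 → ℂ) {y p t : K} (h0 : y ≠ 0) (h1 : y ≠ 1) (ht : y ≠ t) :
    2 * conjugateVar θ y p t = t * (t - 1) * p / (y * (y - 1) * (y - t))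
      - algebraMap ℂ K (θ 0) / y - (1 + algebraMap ℂ K (θ 1)) / (y - t)
      - algebraMap ℂ K (θ 2) / (y - 1) := by
  have h1' : y - 1 ≠ 0 := sub_ne_zero.2 h1
  have ht' : y - t ≠ 0 := sub_ne_zero.2 ht
  have : CharZero K := charZero_of_injective_algebraMap (algebraMap ℂ K).injective
  unfold conjugateVar
  field_simp
  ring

/-- The first Hamilton equation is linear in `x` with coefficient `2y(y - 1)(y - t)`, so away from
`y = 0, 1, t` it is the definition of the conjugate variable. -/
theorem eq_conjugateVar_iff (θ : Fin 4 → ℂ) {x y p t : K} (h0 : y ≠ 0) (h1 : y ≠ 1)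
    (ht : y ≠ t) :
    t * (t - 1) * p = 2 * x * (y * (y - 1) * (y - t))
      + algebraMap ℂ K (θ 0) * ((y - 1) * (y - t)) + (1 + algebraMap ℂ K (θ 1)) * (y * (y - 1))
      + algebraMap ℂ K (θ 2) * (y * (y - t)) ↔ conjugateVar θ y p t = x := by
  have h1' : y - 1 ≠ 0 := sub_ne_zero.2 h1
  have ht' : y - t ≠ 0 := sub_ne_zero.2 ht
  have : CharZero K := charZero_of_injective_algebraMap (algebraMap ℂ K).injective
  rw [← mul_right_inj' (two_ne_zero (α := K)) (b := conjugateVar θ y p t),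
    two_mul_conjugateVar θ h0 h1 ht]
  field_simp
  constructor <;> intro h <;> linear_combination h

theorem derivation_conjugateVar (θ : Fin 4 → ℂ) (D : Derivation ℂ K K) {y t : K} (hD : D t = 1)
    (h0 : y ≠ 0) (h1 : y ≠ 1) (ht : y ≠ t) :
    2 * D (conjugateVar θ y (D y) t) =
      ((2 * t - 1) * D y + t * (t - 1) * D (D y)) / (y * (y - 1) * (y - t))
      - t * (t - 1) * D y * (D y * ((y - 1) * (y - t)) + D y * (y * (y - t))
        + (D y - 1) * (y * (y - 1))) / (y * (y - 1) * (y - t)) ^ 2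
      + algebraMap ℂ K (θ 0) * D y / y ^ 2
      + (1 + algebraMap ℂ K (θ 1)) * (D y - 1) / (y - t) ^ 2
      + algebraMap ℂ K (θ 2) * D y / (y - 1) ^ 2 := by
  have h1' : y - 1 ≠ 0 := sub_ne_zero.2 h1
  have ht' : y - t ≠ 0 := sub_ne_zero.2 ht
  have h := congrArg D (two_mul_conjugateVar θ (p := D y) h0 h1 ht)
  have h2 : D (2 * conjugateVar θ y (D y) t) = 2 * D (conjugateVar θ y (D y) t) := by
    have : D (2 : K) = 0 := by simpa using D.map_natCast 2
    rw [Derivation.leibniz, this]; simp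
  rw [h2] at h
  rw [h]
  simp only [map_sub, Derivation.leibniz_div, Derivation.leibniz, map_add, D.map_algebraMap,
    D.map_one_eq_zero, hD, smul_eq_mul]
  field_simp
  ring

/-- The right-hand side of Painlevé VI is what the Hamiltonian system prescribes. -/
theorem hamiltonian_identity {K : Type*} [Field K] [CharZero K] {a b c d y p t x : K} (t0 : t ≠ 0) (t1 : t - 1 ≠ 0)
    (h0 : y ≠ 0) (h1 : y - 1 ≠ 0) (ht : y - t ≠ 0)
    (hx : 2 * x = t * (t - 1) * p / (y * (y - 1) * (y - t)) - a / y - (1 + b) / (y - t)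
      - c / (y - 1)) :
    t * (t - 1) * (((2 * t - 1) * p + t * (t - 1) *
      ((1 / 2) * (1 / y + 1 / (y - 1) + 1 / (y - t)) * p ^ 2
        - (1 / t + 1 / (t - 1) + 1 / (y - t)) * p
        + y * (y - 1) * (y - t) / (t ^ 2 * (t - 1) ^ 2) *
        ((d - 1) ^ 2 / 2 + -a ^ 2 / 2 * (t / y ^ 2) + c ^ 2 / 2 * ((t - 1) / (y - 1) ^ 2)
          + (1 - b ^ 2) / 2 * (t * (t - 1) / (y - t) ^ 2)))) / (y * (y - 1) * (y - t))
      - t * (t - 1) * p * (p * ((y - 1) * (y - t)) + p * (y * (y - t))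
        + (p - 1) * (y * (y - 1))) / (y * (y - 1) * (y - t)) ^ 2
      + a * p / y ^ 2 + (1 + b) * (p - 1) / (y - t) ^ 2 + c * p / (y - 1) ^ 2) =
    2 * -((3 * y ^ 2 - 2 * (1 + t) * y + t) * x ^ 2
      + x * (a * (2 * y - 1 - t) + (1 + b) * (2 * y - 1) + c * (2 * y - t))
      + (a + b + c + d) / 2 * ((a + b + c + d) / 2 + 1 - d)) := by
  have e : x = (t * (t - 1) * p / (y * (y - 1) * (y - t)) - a / y - (1 + b) / (y - t)
      - c / (y - 1)) / 2 := by rw [← hx]; field_simp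
  rw [e]
  field_simp
  ring

theorem SolvesPVI.hamiltonian {θ : Fin 4 → ℂ} {D : Derivation ℂ K K} {y t : K} (hD : D t = 1)
    (t0 : t ≠ 0) (t1 : t ≠ 1) (h : SolvesPVI θ D y t) :
    HamiltonianPVI θ D (conjugateVar θ y (D y) t) y t := by
  obtain ⟨h0, h1, ht, h⟩ := h
  have : CharZero K := charZero_of_injective_algebraMap (algebraMap ℂ K).injective
  refine ⟨(eq_conjugateVar_iff θ h0 h1 ht).2 rfl, ?_⟩
  have hx := derivation_conjugateVar θ D hD h0 h1 ht
  have h2 := hamiltonian_identity (d := algebraMap ℂ K (θ 3)) t0 (sub_ne_zero.2 t1) h0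
    (sub_ne_zero.2 h1) (sub_ne_zero.2 ht) (two_mul_conjugateVar θ (p := D y) h0 h1 ht)
  simp only [map_add, map_sub, map_mul, map_div₀, map_neg, map_pow, map_one, map_ofNat] at h ⊢
  rw [← h, ← hx] at h2
  refine mul_left_cancel₀ (two_ne_zero (α := K)) ?_
  linear_combination h2

theorem HamiltonianPVI.solvesPVI {θ : Fin 4 → ℂ} {D : Derivation ℂ K K} {x y t : K}
    (hD : D t = 1) (t0 : t ≠ 0) (t1 : t ≠ 1) (h0 : y ≠ 0) (h1 : y ≠ 1) (ht : y ≠ t)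
    (h : HamiltonianPVI θ D x y t) : SolvesPVI θ D y t := by
  have h1' : y - 1 ≠ 0 := sub_ne_zero.2 h1
  have t1' : t - 1 ≠ 0 := sub_ne_zero.2 t1
  have ht' : y - t ≠ 0 := sub_ne_zero.2 ht
  have : CharZero K := charZero_of_injective_algebraMap (algebraMap ℂ K).injective
  refine ⟨h0, h1, ht, ?_⟩
  have hc := (eq_conjugateVar_iff θ h0 h1 ht).1 h.deriv_y
  have hx := derivation_conjugateVar θ D hD h0 h1 ht
  have h2 := hamiltonian_identity (d := algebraMap ℂ K (θ 3)) t0 t1' h0 h1' ht'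
    (two_mul_conjugateVar θ (p := D y) h0 h1 ht)
  have h3 := h.deriv_x
  rw [hc] at hx h2
  simp only [map_add, map_sub, map_mul, map_div₀, map_neg, map_pow, map_one, map_ofNat] at h3 ⊢
  rw [← h3] at h2
  -- This is the coefficient of `y''` in `t(t - 1)` times the derivative of `2x`. Dividing by it
  -- recovers `y''` from the second Hamilton equation.
  have hG : t * (t - 1) * (t * (t - 1) / (y * (y - 1) * (y - t))) ≠ 0 := by positivity
  refine mul_left_cancel₀ hG ?_
  linear_combination -(t * (t - 1)) * hx - h2

/-- The second equation has constant term `e(e + 1 - θ₄)`, and its right-hand side does not change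
when `y` becomes `y + e/x` and every `θᵢ` becomes `θᵢ - e`, so that `e` becomes `-e`. The first
equation for the new `y` is then `x²` times the old first equation minus `e` times the second, up to
the factor `x²`. -/
theorem HamiltonianPVI.okamoto {θ θ' : Fin 4 → ℂ} {D : Derivation ℂ K K} {x y t : K}
    (hx : x ≠ 0) {e : ℂ} (he : e = (θ 0 + θ 1 + θ 2 + θ 3) / 2)
    (hθ : ∀ i, θ' i = θ i - e) (h : HamiltonianPVI θ D x y t) :
    HamiltonianPVI θ' D x (y + algebraMap ℂ K e / x) t := by
  have he' : (θ' 0 + θ' 1 + θ' 2 + θ' 3) / 2 = -e := by rw [hθ, hθ, hθ, hθ, he]; ring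
  have h3 : θ 3 = 2 * e - θ 0 - θ 1 - θ 2 := by rw [he]; ring
  obtain ⟨hy, hx'⟩ := h
  rw [← he, h3] at hx'
  constructor
  · simp only [hθ, map_add, map_sub, map_mul, map_one, map_ofNat, Derivation.leibniz_div,
      D.map_algebraMap, smul_eq_mul] at hx' ⊢
    field_simp
    linear_combination x ^ 2 * hy - (algebraMap ℂ K e) * hx'
  · rw [he', hx']
    simp only [hθ, h3, map_add, map_sub, map_mul, map_one, map_ofNat, map_neg]
    field_simp
    ring

/-- Okamoto's transformation maps solutions of Painlevé VI to solutions. -/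
theorem SolvesPVI.okamoto {θ θ' : Fin 4 → ℂ} {D : Derivation ℂ K K} {y t : K} (hD : D t = 1)
    (t0 : t ≠ 0) (t1 : t ≠ 1) (h : SolvesPVI θ D y t) (hx : conjugateVar θ y (D y) t ≠ 0) {e : ℂ}
    (he : e = (θ 0 + θ 1 + θ 2 + θ 3) / 2) (hθ : ∀ i, θ' i = θ i - e) {y' : K}
    (hy' : y' = y + algebraMap ℂ K e / conjugateVar θ y (D y) t)
    (h0 : y' ≠ 0) (h1 : y' ≠ 1) (ht : y' ≠ t) :
    SolvesPVI θ' D y' t ∧ conjugateVar θ' y' (D y') t = conjugateVar θ y (D y) t := by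
  have h' := (h.hamiltonian hD t0 t1).okamoto hx he hθ
  rw [← hy'] at h'
  exact ⟨h'.solvesPVI hD t0 t1 h0 h1 ht, (eq_conjugateVar_iff θ' h0 h1 ht).1 h'.deriv_y⟩

end Okamoto

end PainleveVI

namespace PainleveVI

open Polynomial
open scoped Polynomial.Bivariate IntermediateField Topology

/-! ### The function field of the elliptic curve -/

namespace Elliptic

/-- The function field of the elliptic curve. -/
abbrev FF : Type := ellipticCurve.FunctionField

noncomputable section

instance charZero_functionField : CharZero FF :=
  charZero_of_injective_algebraMap (algebraMap ℂ FF).injective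

/-- The coordinate function `s`. -/
def s : FF := ellipticCurve.fst

/-- The coordinate function `u`. -/
def u : FF := ellipticCurve.snd

theorem aeval_s (p : ℂ[X]) :
    aeval s p = algebraMap (AdjoinRoot ellipticCurve.poly) FF (AdjoinRoot.of _ p) := by
  induction p using Polynomial.induction_on' with
  | add p q hp hq => simp [hp, hq]
  | monomial n a =>
    rw [← C_mul_X_pow_eq_monomial]
    simp only [map_mul, aeval_C, map_pow, aeval_X]
    rfl

theorem mk_eq (P : ℂ[X][Y]) : ∃ p q : ℂ[X], AdjoinRoot.mk ellipticCurve.poly P =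
    AdjoinRoot.of _ p + AdjoinRoot.of _ q * AdjoinRoot.root ellipticCurve.poly := by
  have hm : ellipticCurve.poly.Monic := monic_X_pow_sub_C _ two_ne_zero
  have hd : ellipticCurve.poly.natDegree = 2 := natDegree_X_pow_sub_C
  have h : AdjoinRoot.mk ellipticCurve.poly P =
      AdjoinRoot.mk ellipticCurve.poly (P %ₘ ellipticCurve.poly) := by
    rw [AdjoinRoot.mk_eq_mk]
    exact ⟨_, by rw [sub_eq_iff_eq_add']; exact (modByMonic_add_div P _).symm⟩
  have hl : (P %ₘ ellipticCurve.poly).natDegree < 2 := by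
    rw [← hd]; exact natDegree_modByMonic_lt _ hm (by intro h; simp [h] at hd)
  refine ⟨(P %ₘ ellipticCurve.poly).coeff 0, (P %ₘ ellipticCurve.poly).coeff 1, ?_⟩
  rw [h]
  conv_lhs => rw [eq_X_add_C_of_natDegree_le_one (Nat.lt_succ_iff.1 hl)]
  rw [map_add, map_mul, AdjoinRoot.mk_C, AdjoinRoot.mk_C, AdjoinRoot.mk_X, add_comm]

theorem of_add_of_mul_root_eq_zero {p q : ℂ[X]} (h : AdjoinRoot.of ellipticCurve.poly p
    + AdjoinRoot.of _ q * AdjoinRoot.root ellipticCurve.poly = 0) : p = 0 ∧ q = 0 := by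
  have hd : ellipticCurve.poly.degree = 2 := degree_X_pow_sub_C two_pos _
  have h' : AdjoinRoot.mk ellipticCurve.poly (C q * X + C p) = 0 := by
    rw [← h, map_add, map_mul, AdjoinRoot.mk_C, AdjoinRoot.mk_C, AdjoinRoot.mk_X, add_comm]
  rw [AdjoinRoot.mk_eq_zero] at h'
  have h0 := eq_zero_of_dvd_of_degree_lt h' (by
    rw [hd]; exact lt_of_le_of_lt degree_linear_le (by norm_num))
  exact ⟨by simpa using congrArg (coeff · 0) h0, by simpa using congrArg (coeff · 1) h0⟩

theorem aeval_s_add_mul_u_eq_zero {p q : ℂ[X]} (h : aeval s p + aeval s q * u = 0) :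
    p = 0 ∧ q = 0 := by
  apply of_add_of_mul_root_eq_zero
  apply IsFractionRing.injective (AdjoinRoot ellipticCurve.poly) FF
  rw [map_add, map_mul, ← aeval_s, ← aeval_s, map_zero]
  exact h

theorem aeval_s_ne_zero {p : ℂ[X]} (hp : p ≠ 0) : aeval s p ≠ 0 := fun h =>
  hp (aeval_s_add_mul_u_eq_zero (p := p) (q := 0) (by simp [h])).1

theorem u_sq : u ^ 2 = s * (8 * s ^ 2 - 11 * s + 8) := by
  have h : (AdjoinRoot.root ellipticCurve.poly) ^ 2 = AdjoinRoot.of ellipticCurve.poly cubic := by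
    have : (Y ^ 2 - C cubic : ℂ[X][Y]).eval₂ (AdjoinRoot.of ellipticCurve.poly)
      (AdjoinRoot.root ellipticCurve.poly) = 0 := AdjoinRoot.eval₂_root ellipticCurve.poly
    rw [eval₂_sub, eval₂_pow, eval₂_X, eval₂_C, sub_eq_zero] at this
    exact this
  have h2 := congrArg (algebraMap (AdjoinRoot ellipticCurve.poly) FF) h
  rw [map_pow, ← aeval_s] at h2
  refine h2.trans ?_
  simp [cubic, map_ofNat]

/-- Multiplication by the conjugate `p' - q' u` replaces the denominator by its norm, a polynomial
in `s` alone. This normal form reduces questions about the field to polynomials in `s`. -/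
theorem exists_eq_div (k : FF) : ∃ p q r : ℂ[X], r ≠ 0 ∧ k = (aeval s p + aeval s q * u) / aeval s r := by
  obtain ⟨a, b, hb, rfl⟩ := IsFractionRing.div_surjective (A := AdjoinRoot ellipticCurve.poly) k
  obtain ⟨P, rfl⟩ := AdjoinRoot.mk_surjective a
  obtain ⟨Q, rfl⟩ := AdjoinRoot.mk_surjective b
  obtain ⟨p, q, hp⟩ := mk_eq P
  obtain ⟨p', q', hq⟩ := mk_eq Q
  have hb0 := nonZeroDivisors.ne_zero hb
  have hb1 : aeval s p' + aeval s q' * u ≠ 0 := by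
    intro h
    obtain ⟨rfl, rfl⟩ := aeval_s_add_mul_u_eq_zero h
    simp [hq] at hb0
  have hb2 : aeval s p' - aeval s q' * u ≠ 0 := by
    intro h
    obtain ⟨hp', hq'⟩ := aeval_s_add_mul_u_eq_zero (p := p') (q := -q') (by rw [← h]; simp; ring)
    rw [neg_eq_zero] at hq'
    simp [hp', hq'] at hb1
  rw [hp, hq]
  simp only [map_add, map_mul, ← aeval_s]
  change ∃ p_1 q_1 r : ℂ[X], r ≠ 0 ∧ (aeval s p + aeval s q * u) / (aeval s p' + aeval s q' * u) = _
  have hu : u ^ 2 = aeval s cubic := by rw [u_sq]; simp [cubic, map_ofNat]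
  refine ⟨p * p' - q * q' * cubic, q * p' - p * q', p' ^ 2 - q' ^ 2 * cubic, ?_, ?_⟩
  · intro h
    apply mul_ne_zero hb1 hb2
    have := congrArg (aeval s) h
    simp only [map_sub, map_mul, map_pow, ← hu, map_zero] at this
    linear_combination this
  · have e : aeval s (p' ^ 2 - q' ^ 2 * cubic) =
      (aeval s p' + aeval s q' * u) * (aeval s p' - aeval s q' * u) := by
      simp only [map_sub, map_mul, map_pow, ← hu]; ring
    rw [e, div_eq_div_iff hb1 (mul_ne_zero hb1 hb2)]
    simp only [map_sub, map_mul, ← hu]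
    ring

theorem u_ne_zero : u ≠ 0 := fun h => one_ne_zero
  (aeval_s_add_mul_u_eq_zero (p := 0) (q := 1) (by simp [h])).2

/-- A homomorphism out of the function field is determined by the images of `s` and `u`. -/
theorem algHom_ext {A : Type*} [CommRing A] [Algebra ℂ A] {f g : FF →ₐ[ℂ] A} (hs : f s = g s)
    (hu : f u = g u) : f = g := by
  refine AlgHom.ext fun k => ?_
  obtain ⟨p, q, r, hr, rfl⟩ := exists_eq_div k
  have h : ∀ p : ℂ[X], f (aeval s p) = g (aeval s p) := fun p => by
    rw [← aeval_algHom_apply, ← aeval_algHom_apply, hs]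
  have hr' := aeval_s_ne_zero hr
  have hi : f (aeval s r)⁻¹ = g (aeval s r)⁻¹ := by
    have h1 : f (aeval s r) * f (aeval s r)⁻¹ = 1 := by
      rw [← map_mul, mul_inv_cancel₀ hr', map_one]
    have h2 : g (aeval s r) * g (aeval s r)⁻¹ = 1 := by
      rw [← map_mul, mul_inv_cancel₀ hr', map_one]
    calc f (aeval s r)⁻¹ = f (aeval s r)⁻¹ * (g (aeval s r) * g (aeval s r)⁻¹) := by
          rw [h2, mul_one]
      _ = (f (aeval s r) * f (aeval s r)⁻¹) * g (aeval s r)⁻¹ := by rw [h]; ring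
      _ = _ := by rw [h1, one_mul]
  rw [div_eq_mul_inv, map_mul, map_mul, map_add, map_add, map_mul, map_mul, h, h, hu, hi]

/-- Homomorphisms from the function field to an algebra, given by a point of the curve. -/
theorem exists_algHom {A : Type*} [CommRing A] [Algebra ℂ A] (a b : A)
    (h : b ^ 2 = a * (8 * a ^ 2 - 11 * a + 8)) (π : A →ₐ[ℂ] FF) (ha : π a = s) (hb : π b = u)
    (hπ : ∀ x, π x ≠ 0 → IsUnit x) :
    ∃ f : FF →ₐ[ℂ] A, f s = a ∧ f u = b := by
  have h2 : ellipticCurve.poly.eval₂ (aeval a : ℂ[X] →ₐ[ℂ] A).toRingHom b = 0 := by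
    change (Y ^ 2 - C cubic : ℂ[X][Y]).eval₂ _ b = 0
    rw [eval₂_sub, eval₂_pow, eval₂_X, eval₂_C, h]
    simp [cubic, map_ofNat]
  let f₀ : AdjoinRoot ellipticCurve.poly →ₐ[ℂ] A :=
    { AdjoinRoot.lift (aeval a : ℂ[X] →ₐ[ℂ] A).toRingHom b h2 with
      commutes' := fun c => by
        change AdjoinRoot.lift (aeval a : ℂ[X] →ₐ[ℂ] A).toRingHom b h2 (AdjoinRoot.of _ (C c)) = _
        rw [AdjoinRoot.lift_of]
        simp }
  have hf₀ : ∀ r, π (f₀ r) = algebraMap _ FF r := by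
    intro r
    obtain ⟨P, rfl⟩ := AdjoinRoot.mk_surjective r
    obtain ⟨p, q, hp⟩ := mk_eq P
    have h3 : ∀ p, f₀ (AdjoinRoot.of _ p) = aeval a p := fun p => AdjoinRoot.lift_of h2
    have h4 : f₀ (AdjoinRoot.root _) = b := AdjoinRoot.lift_root h2
    rw [hp, map_add, map_mul, h3, h3, h4, map_add, map_mul, hb, map_add, map_mul, ← aeval_s,
      ← aeval_s, ← aeval_algHom_apply, ← aeval_algHom_apply, ha]
    rfl
  refine ⟨IsLocalization.liftAlgHom (M := nonZeroDivisors (AdjoinRoot ellipticCurve.poly))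
    (f := f₀) fun r => hπ _ ?_, ?_, ?_⟩
  · rw [hf₀]
    exact IsFractionRing.to_map_ne_zero_of_mem_nonZeroDivisors r.2
  · have := IsLocalization.lift_eq (M := nonZeroDivisors (AdjoinRoot ellipticCurve.poly)) (S := FF)
      (g := f₀.toRingHom) (fun r => hπ _ (by
        change π (f₀ _) ≠ 0
        rw [hf₀]; exact IsFractionRing.to_map_ne_zero_of_mem_nonZeroDivisors r.2))
      (AdjoinRoot.of _ X)
    refine this.trans ?_
    exact (AdjoinRoot.lift_of h2).trans (by simp)
  · have := IsLocalization.lift_eq (M := nonZeroDivisors (AdjoinRoot ellipticCurve.poly)) (S := FF)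
      (g := f₀.toRingHom) (fun r => hπ _ (by
        change π (f₀ _) ≠ 0
        rw [hf₀]; exact IsFractionRing.to_map_ne_zero_of_mem_nonZeroDivisors r.2))
      (AdjoinRoot.root _)
    refine this.trans ?_
    exact AdjoinRoot.lift_root h2

/-- The derivation of the function field with a prescribed value at `s`. -/
theorem exists_derivation (δ : FF) : ∃ D : Derivation ℂ FF FF, D s = δ ∧
    2 * u * D u = (24 * s ^ 2 - 22 * s + 8) * δ := by
  -- A derivation of the field is the `ε`-part of an algebra homomorphism into the dual numbers that
  -- lifts the identity, and such a homomorphism only needs a point of the curve with values in the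
  -- dual numbers.
  let ι : FF →ₐ[ℂ] DualNumber FF := TrivSqZeroExt.inlAlgHom ℂ FF FF
  -- The value at `u` is forced by differentiating `u² = 8s³ - 11s² + 8s`.
  let η : FF := (24 * s ^ 2 - 22 * s + 8) * δ / (2 * u)
  let a : DualNumber FF := ι s + ι δ * DualNumber.eps
  let b : DualNumber FF := ι u + ι η * DualNumber.eps
  have hu := u_ne_zero
  have hη : 2 * u * η = (24 * s ^ 2 - 22 * s + 8) * δ := by simp only [η]; field_simp
  have e1 := congrArg ι u_sq
  have e2 := congrArg ι hη
  have e3 : (DualNumber.eps : DualNumber FF) * DualNumber.eps = 0 := DualNumber.eps_mul_eps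
  simp only [map_mul, map_add, map_sub, map_pow, map_ofNat] at e1 e2
  have hsa : (a : DualNumber FF).fst = s := by simp [a, ι]
  have hub : (b : DualNumber FF).fst = u := by simp [b, ι]
  obtain ⟨f, hfs, hfu⟩ := exists_algHom a b (by
      simp only [a, b]
      linear_combination e1 + DualNumber.eps * e2 + ((ι η) ^ 2 - 24 * ι s * ι δ ^ 2 + 11 * ι δ ^ 2
        - 8 * ι δ ^ 3 * DualNumber.eps) * e3)
    (TrivSqZeroExt.fstHom ℂ FF FF) hsa hub
    (fun x hx => by
      rw [TrivSqZeroExt.isUnit_iff_isUnit_fst]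
      exact isUnit_iff_ne_zero.2 hx)
  have hid : (TrivSqZeroExt.fstHom ℂ FF FF).comp f = AlgHom.id ℂ FF :=
    algHom_ext (by simpa [hfs] using hsa) (by simpa [hfu] using hub)
  have hid' : ∀ k, (f k).fst = k := fun k => congrArg (fun g => g k) hid
  refine ⟨Derivation.mk' ((TrivSqZeroExt.sndHom FF FF).restrictScalars ℂ ∘ₗ f.toLinearMap) ?_, ?_, ?_⟩
  · intro k l
    simp [hid', mul_comm]
  · simp [hfs, a, ι]
  · simpa [hfu, b, ι] using hη

end

end Elliptic

end PainleveVI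

namespace PainleveVI

open Polynomial
open scoped Polynomial.Bivariate IntermediateField Topology

/-! ### The explicit solution, over an abstract field -/

section Explicit

/-- The point `(s, u)` of the curve `u² = s (8 s² - 11 s + 8)` avoids the zeros and poles of the
functions below. -/
structure GenericPoint {K : Type*} [Field K] (s u : K) : Prop where
  curve : u ^ 2 = s * (8 * s ^ 2 - 11 * s + 8)
  u0 : u ≠ 0
  s0 : s ≠ 0
  s1 : s - 1 ≠ 0
  q0 : 8 * s ^ 2 - 11 * s + 8 ≠ 0
  s2 : s - 2 ≠ 0
  s3 : 2 * s - 1 ≠ 0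
  b0 : 2 * s ^ 2 + s + 2 ≠ 0
  c0 : s ^ 2 - 7 * s + 1 ≠ 0
  c3 : 3 * s ^ 3 - 4 * s ^ 2 + 4 * s + 2 ≠ 0
  p2 : 6 * s ^ 2 - 2 * s + 1 ≠ 0
  p4 : 4 * s ^ 4 + 4 * s ^ 3 + 54 * s ^ 2 - 86 * s + 49 ≠ 0

section Functions

variable {K : Type*} [Field K]

/-- The function `t` of the explicit solution. -/
def tOf (s u : K) : K :=
  1 / 2 + ((s + 1) * (32 * (s ^ 8 + 1) - 320 * (s ^ 7 + s) + 1112 * (s ^ 6 + s ^ 2)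
    - 2420 * (s ^ 5 + s ^ 3) + 3167 * s ^ 4)) / (54 * u ^ 3 * s * (s - 1))

/-- The function `y` of the explicit solution. -/
def yOf (s u : K) : K :=
  1 / 2 - (8 * s ^ 7 - 28 * s ^ 6 + 75 * s ^ 5 + 31 * s ^ 4 - 269 * s ^ 3 + 318 * s ^ 2
    - 166 * s + 56) / (18 * u * (s - 1) * (3 * s ^ 3 - 4 * s ^ 2 + 4 * s + 2))

/-- The numerator of `(t - 1/2) / u`. -/
def tNum (s : K) : K := (s + 1) * (32 * s ^ 8 - 320 * s ^ 7 + 1112 * s ^ 6 - 2420 * s ^ 5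
  + 3167 * s ^ 4 - 2420 * s ^ 3 + 1112 * s ^ 2 - 320 * s + 32)

/-- The function `(t - 1/2) / u`. -/
def tOdd (s : K) : K := tNum s / (54 * s ^ 3 * (s - 1) * (8 * s ^ 2 - 11 * s + 8) ^ 2)

/-- The numerator of `(y - 1/2) / u`. -/
def yNum (s : K) : K := -(8 * s ^ 7 - 28 * s ^ 6 + 75 * s ^ 5 + 31 * s ^ 4 - 269 * s ^ 3
  + 318 * s ^ 2 - 166 * s + 56)

/-- The function `(y - 1/2) / u`. -/
def yOdd (s : K) : K :=
  yNum s / (18 * s * (s - 1) * (8 * s ^ 2 - 11 * s + 8) * (3 * s ^ 3 - 4 * s ^ 2 + 4 * s + 2))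

/-- The function `(ds/dt) / u`. -/
def dsOdd (s : K) : K := 27 * s ^ 3 * (s - 1) ^ 2 * (8 * s ^ 2 - 11 * s + 8) ^ 2 /
  (5 * (s - 2) ^ 4 * (2 * s - 1) ^ 4 * (2 * s ^ 2 + s + 2) ^ 2)

/-- The numerator of `dy/dt`. -/
def dyNum (s : K) : K := -216 * s ^ 7 + 192 * s ^ 6 - 966 * s ^ 5 + 2430 * s ^ 4
    - 3465 * s ^ 3 + 2256 * s ^ 2 - 522 * s - 84

/-- The derivative `dy/dt`. -/
def dyOf (s : K) : K := s ^ 2 * (8 * s ^ 2 - 11 * s + 8) * dyNum s / (10 * (s - 2)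
  * (2 * s - 1) ^ 3 * (2 * s ^ 2 + s + 2) * (3 * s ^ 3 - 4 * s ^ 2 + 4 * s + 2) ^ 2)

variable {s u : K}

section Values

variable [CharZero K] (h : GenericPoint s u)
include h

theorem GenericPoint.t_eq : tOf s u = 1 / 2 + u * tOdd s := by
  obtain ⟨hc, u0, s0, s1, q0, -⟩ := h
  unfold tOf tOdd tNum
  have e : u ^ 3 = u * (s * (8 * s ^ 2 - 11 * s + 8)) := by rw [← hc]; ring
  rw [e]
  generalize 8 * s ^ 2 - 11 * s + 8 = q at *
  field_simp
  linear_combination -(2 * ((s + 1) * (32 * s ^ 8 - 320 * s ^ 7 + 1112 * s ^ 6 - 2420 * s ^ 5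
    + 3167 * s ^ 4 - 2420 * s ^ 3 + 1112 * s ^ 2 - 320 * s + 32))) * hc

theorem GenericPoint.y_eq : yOf s u = 1 / 2 + u * yOdd s := by
  obtain ⟨hc, u0, s0, s1, q0, -, -, -, -, c3, -⟩ := h
  unfold yOf yOdd yNum
  generalize 8 * s ^ 2 - 11 * s + 8 = q at *
  generalize 3 * s ^ 3 - 4 * s ^ 2 + 4 * s + 2 = c at *
  field_simp
  linear_combination 2 * (8 * s ^ 7 - 28 * s ^ 6 + 75 * s ^ 5 + 31 * s ^ 4 - 269 * s ^ 3
    + 318 * s ^ 2 - 166 * s + 56) * hc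

/-- The left side is `t(t - 1)`. The exponents `5, 5, 3, 1` in the numerator display the
ramification of `t` over `0` and `1`. -/
theorem GenericPoint.tOdd_sq : s * (8 * s ^ 2 - 11 * s + 8) * tOdd s ^ 2 - 1 / 4 =
    (s - 2) ^ 5 * (2 * s - 1) ^ 5 * (2 * s ^ 2 + s + 2) ^ 3 * (s ^ 2 - 7 * s + 1) /
    (729 * s ^ 5 * (s - 1) ^ 2 * (8 * s ^ 2 - 11 * s + 8) ^ 3) := by
  obtain ⟨hc, u0, s0, s1, q0, -⟩ := h
  unfold tOdd tNum
  -- The denominator factors stay atomic while denominators are cleared, and are expanded only for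
  -- the final polynomial identity. The same device serves in the identities below.
  generalize hq : 8 * s ^ 2 - 11 * s + 8 = q at *
  field_simp
  rw [← hq]
  ring

theorem GenericPoint.yOdd_sq : s * (8 * s ^ 2 - 11 * s + 8) * yOdd s ^ 2 - 1 / 4 =
    (s - 2) ^ 4 * (2 * s - 1) ^ 2 * (2 * s ^ 2 + s + 2) ^ 2
      * (4 * s ^ 4 + 4 * s ^ 3 + 54 * s ^ 2 - 86 * s + 49) / (324 * s * (s - 1) ^ 2
      * (8 * s ^ 2 - 11 * s + 8) * (3 * s ^ 3 - 4 * s ^ 2 + 4 * s + 2) ^ 2) := by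
  obtain ⟨hc, u0, s0, s1, q0, -, -, -, -, c3, -⟩ := h
  unfold yOdd yNum
  generalize hq : 8 * s ^ 2 - 11 * s + 8 = q at *
  generalize hc : 3 * s ^ 3 - 4 * s ^ 2 + 4 * s + 2 = c at *
  field_simp
  rw [← hq, ← hc]
  ring

theorem GenericPoint.yOdd_sub_tOdd : yOdd s - tOdd s = -((s - 2) ^ 4 * (2 * s - 1) ^ 2
      * (2 * s ^ 2 + s + 2) ^ 2 * (6 * s ^ 2 - 2 * s + 1)) / (54 * s ^ 3 * (s - 1)
      * (8 * s ^ 2 - 11 * s + 8) ^ 2 * (3 * s ^ 3 - 4 * s ^ 2 + 4 * s + 2)) := by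
  obtain ⟨hc, u0, s0, s1, q0, -, -, -, -, c3, -⟩ := h
  unfold yOdd yNum tOdd tNum
  generalize hq : 8 * s ^ 2 - 11 * s + 8 = q at *
  generalize hc : 3 * s ^ 3 - 4 * s ^ 2 + 4 * s + 2 = c at *
  field_simp
  rw [← hq, ← hc]
  ring

theorem GenericPoint.y_ne_zero_and_ne_one : yOf s u ≠ 0 ∧ yOf s u ≠ 1 := by
  have e : yOf s u * (yOf s u - 1) ≠ 0 := by
    have : yOf s u * (yOf s u - 1) = s * (8 * s ^ 2 - 11 * s + 8) * yOdd s ^ 2 - 1 / 4 := by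
      rw [h.y_eq, ← h.curve]; ring
    rw [this, h.yOdd_sq]
    simp only [ne_eq, div_eq_zero_iff, mul_eq_zero, pow_eq_zero_iff, OfNat.ofNat_ne_zero,
      not_false_eq_true, h.s0, h.s1, h.q0, h.s2, h.s3, h.b0, h.c3, h.p4, or_self]
  exact ⟨left_ne_zero_of_mul e, sub_ne_zero.1 (right_ne_zero_of_mul e)⟩

theorem GenericPoint.y_sub_t_ne_zero : yOf s u - tOf s u ≠ 0 := by
  have : yOf s u - tOf s u = u * (yOdd s - tOdd s) := by rw [h.y_eq, h.t_eq]; ring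
  rw [this, h.yOdd_sub_tOdd]
  simp only [ne_eq, neg_eq_zero, div_eq_zero_iff, mul_eq_zero, pow_eq_zero_iff, OfNat.ofNat_ne_zero,
      not_false_eq_true, h.s0, h.s1, h.q0, h.s2, h.s3, h.b0, h.c3, h.p2, h.u0, or_self]

end Values

end Functions

section Derivation

variable {K : Type*} [Field K] [Algebra ℂ K] {s u : K} (D : Derivation ℂ K K)

theorem derivation_ofNat (n : ℕ) [n.AtLeastTwo] : D (ofNat(n) : K) = 0 := by
  rw [← Nat.cast_ofNat]; exact D.map_natCast _

variable [CharZero K] (h : GenericPoint s u) (hs : D s = u * dsOdd s)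
include h hs

theorem GenericPoint.derivation_u : D u = (12 * s ^ 2 - 11 * s + 4) * dsOdd s := by
  have e := congrArg D h.curve
  simp only [map_add, map_sub, Derivation.leibniz, Derivation.leibniz_pow, derivation_ofNat,
    smul_eq_mul, hs, nsmul_eq_mul, Nat.cast_ofNat, mul_zero, add_zero, Nat.add_one_sub_one,
    pow_one] at e
  have := h.u0
  refine mul_left_cancel₀ (mul_ne_zero two_ne_zero this) ?_
  linear_combination e

/-- Differentiating `1/2 + u f` along the curve. -/
theorem GenericPoint.derivation_half_add {f g : K} (hf : D f = g * D s) :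
    D (1 / 2 + u * f) = dsOdd s * ((12 * s ^ 2 - 11 * s + 4) * f
      + s * (8 * s ^ 2 - 11 * s + 8) * g) := by
  simp only [map_add, Derivation.leibniz_div, Derivation.leibniz, D.map_one_eq_zero,
    derivation_ofNat, h.derivation_u D hs, hf, hs, smul_eq_mul]
  linear_combination dsOdd s * g * h.curve

omit hs in
theorem GenericPoint.derivation_tOdd : D (tOdd s) = ((288 * s ^ 8 - 2304 * s ^ 7 + 5544 * s ^ 6
    - 7848 * s ^ 5 + 3735 * s ^ 4 + 2988 * s ^ 3 - 3924 * s ^ 2 + 1584 * s - 288)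
      / (54 * s ^ 3 * (s - 1) * (8 * s ^ 2 - 11 * s + 8) ^ 2) - tOdd s * (3 / s + 1 / (s - 1)
      + 2 * (16 * s - 11) / (8 * s ^ 2 - 11 * s + 8))) * D s := by
  obtain ⟨hc, u0, s0, s1, q0, -⟩ := h
  unfold tOdd tNum
  simp only [map_add, map_sub, Derivation.leibniz_div, Derivation.leibniz, Derivation.leibniz_pow,
    D.map_one_eq_zero, derivation_ofNat, smul_eq_mul, nsmul_eq_mul, Nat.cast_ofNat]
  generalize D s = E
  generalize hq : 8 * s ^ 2 - 11 * s + 8 = q at *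
  field_simp
  rw [← hq]
  ring

/-- The factor `dsOdd` is the reciprocal of `dt/ds`, divided by `u`; this identity is what makes the
derivation with `D s = u * dsOdd s` equal to `d/dt`. -/
theorem GenericPoint.derivation_t : D (tOf s u) = 1 := by
  rw [h.t_eq, h.derivation_half_add D hs (h.derivation_tOdd D)]
  obtain ⟨hc, u0, s0, s1, q0, s2, s3, b0, -⟩ := h
  unfold dsOdd tOdd tNum
  generalize hq : 8 * s ^ 2 - 11 * s + 8 = q at *
  generalize hd : 2 * s - 1 = d at *
  generalize hb : 2 * s ^ 2 + s + 2 = b at *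
  field_simp
  rw [← hq, ← hd, ← hb]
  ring

omit hs in
theorem GenericPoint.derivation_yOdd : D (yOdd s) = (-(56 * s ^ 6 - 168 * s ^ 5 + 375 * s ^ 4
    + 124 * s ^ 3 - 807 * s ^ 2 + 636 * s - 166) / (18 * s * (s - 1) * (8 * s ^ 2 - 11 * s + 8)
      * (3 * s ^ 3 - 4 * s ^ 2 + 4 * s + 2)) - yOdd s * (1 / s + 1 / (s - 1)
      + (16 * s - 11) / (8 * s ^ 2 - 11 * s + 8)
      + (9 * s ^ 2 - 8 * s + 4) / (3 * s ^ 3 - 4 * s ^ 2 + 4 * s + 2))) * D s := by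
  obtain ⟨hc, u0, s0, s1, q0, -, -, -, -, c3, -⟩ := h
  unfold yOdd yNum
  simp only [map_add, map_sub, map_neg, Derivation.leibniz_div, Derivation.leibniz,
    Derivation.leibniz_pow, D.map_one_eq_zero, derivation_ofNat, smul_eq_mul, nsmul_eq_mul,
    Nat.cast_ofNat]
  generalize D s = E
  generalize hq : 8 * s ^ 2 - 11 * s + 8 = q at *
  generalize hc : 3 * s ^ 3 - 4 * s ^ 2 + 4 * s + 2 = c at *
  field_simp
  rw [← hq, ← hc]
  ring

theorem GenericPoint.derivation_y : D (yOf s u) = dyOf s := by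
  rw [h.y_eq, h.derivation_half_add D hs (h.derivation_yOdd D)]
  obtain ⟨hc, u0, s0, s1, q0, s2, s3, b0, -, c3, -⟩ := h
  unfold dsOdd yOdd yNum dyOf dyNum
  generalize hq : 8 * s ^ 2 - 11 * s + 8 = q at *
  generalize hd : 2 * s - 1 = d at *
  generalize hb : 2 * s ^ 2 + s + 2 = b at *
  generalize hc : 3 * s ^ 3 - 4 * s ^ 2 + 4 * s + 2 = c at *
  field_simp
  rw [← hq, ← hd, ← hb, ← hc]
  ring

omit hs in
theorem GenericPoint.derivation_dy : D (dyOf s) = (dyOf s * (2 / s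
      + (16 * s - 11) / (8 * s ^ 2 - 11 * s + 8)
      - 1 / (s - 2) - 6 / (2 * s - 1) - (4 * s + 1) / (2 * s ^ 2 + s + 2)
      - 2 * (9 * s ^ 2 - 8 * s + 4) / (3 * s ^ 3 - 4 * s ^ 2 + 4 * s + 2))
      + s ^ 2 * (8 * s ^ 2 - 11 * s + 8) * (-1512 * s ^ 6 + 1152 * s ^ 5 - 4830 * s ^ 4
        + 9720 * s ^ 3 - 10395 * s ^ 2 + 4512 * s - 522) / (10 * (s - 2) * (2 * s - 1) ^ 3
        * (2 * s ^ 2 + s + 2) * (3 * s ^ 3 - 4 * s ^ 2 + 4 * s + 2) ^ 2)) * D s := by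
  obtain ⟨hc, u0, s0, s1, q0, s2, s3, b0, -, c3, -⟩ := h
  unfold dyOf
  have hN : D (dyNum s) = (-1512 * s ^ 6 + 1152 * s ^ 5 - 4830 * s ^ 4
        + 9720 * s ^ 3 - 10395 * s ^ 2 + 4512 * s - 522) * D s := by
    unfold dyNum
    simp only [map_add, map_sub, map_neg, Derivation.leibniz, Derivation.leibniz_pow,
      derivation_ofNat, smul_eq_mul, nsmul_eq_mul, Nat.cast_ofNat]
    ring
  generalize dyNum s = N at *
  simp only [map_add, map_sub, Derivation.leibniz_div, Derivation.leibniz,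
    Derivation.leibniz_pow, D.map_one_eq_zero, derivation_ofNat, smul_eq_mul, nsmul_eq_mul,
    Nat.cast_ofNat, hN]
  generalize D s = E
  generalize hq : 8 * s ^ 2 - 11 * s + 8 = q at *
  generalize hc : 3 * s ^ 3 - 4 * s ^ 2 + 4 * s + 2 = c at *
  generalize hd : 2 * s - 1 = d at *
  generalize hb : 2 * s ^ 2 + s + 2 = b at *
  field_simp
  ring

omit [Algebra ℂ K] h hs in
/-- The right-hand side of Painlevé VI with `θ = (1, 1, 1, 1) / 3`, at `y = 1/2 + u v` and
`t = 1/2 + u r`. -/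
theorem rhs_third {w v r p yy tt : K} (hw : u ^ 2 = w) (u0 : u ≠ 0)
    (hyy : w * v ^ 2 - 1 / 4 = yy) (htt : w * r ^ 2 - 1 / 4 = tt) (yy0 : yy ≠ 0) (tt0 : tt ≠ 0)
    {y t : K} (hy : y = 1 / 2 + u * v) (ht : t = 1 / 2 + u * r) (hyt : y - t ≠ 0) :
    (1 / 2) * (1 / y + 1 / (y - 1) + 1 / (y - t)) * p ^ 2
      - (1 / t + 1 / (t - 1) + 1 / (y - t)) * p
      + y * (y - 1) * (y - t) / (t ^ 2 * (t - 1) ^ 2) *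
        ((1 / 3 - 1) ^ 2 / 2 + -(1 / 3) ^ 2 / 2 * (t / y ^ 2)
          + (1 / 3) ^ 2 / 2 * ((t - 1) / (y - 1) ^ 2)
          + (1 - (1 / 3) ^ 2) / 2 * (t * (t - 1) / (y - t) ^ 2)) =
    u * (v * p ^ 2 / yy + p ^ 2 / (2 * w * (v - r)) - 2 * r * p / tt - p / (w * (v - r))
      + yy * (v - r) / tt ^ 2 * (2 / 9 - (w * (v - r) ^ 2 - tt) / (18 * yy ^ 2)
        + 4 * tt / (9 * w * (v - r) ^ 2))) := by
  have e1 : y * (y - 1) = yy := by rw [← hyy, ← hw, hy]; ring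
  have e2 : t * (t - 1) = tt := by rw [← htt, ← hw, ht]; ring
  have e3 : y - t = u * (v - r) := by rw [hy, ht]; ring
  have y0 : y ≠ 0 := fun h => yy0 (by rw [← e1, h]; ring)
  have y1 : y - 1 ≠ 0 := fun h => yy0 (by rw [← e1, h]; ring)
  have t0 : t ≠ 0 := fun h => tt0 (by rw [← e2, h]; ring)
  have t1 : t - 1 ≠ 0 := fun h => tt0 (by rw [← e2, h]; ring)
  have hZ : v - r ≠ 0 := fun h => hyt (by rw [e3, h]; ring)
  have f1 : 1 / y + 1 / (y - 1) = 2 * u * v / yy := by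
    rw [← e1]; field_simp; rw [hy]; ring
  have f2 : 1 / t + 1 / (t - 1) = 2 * u * r / tt := by
    rw [← e2]; field_simp; rw [ht]; ring
  -- The terms with `β` and `γ` combine because `θ₁² = θ₃²`; their sum is odd under the exchange of
  -- `(y, t)` and `(1 - y, 1 - t)`.
  have f3 : -(1 / 3) ^ 2 / 2 * (t / y ^ 2) + (1 / 3) ^ 2 / 2 * ((t - 1) / (y - 1) ^ 2) =
      -(w * (v - r) ^ 2 - tt) / (18 * yy ^ 2) := by
    have : w * (v - r) ^ 2 - tt = t * (y - 1) ^ 2 - (t - 1) * y ^ 2 := by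
      rw [← e2, ← hw]; linear_combination -(y - t + u * (v - r)) * e3
    rw [← e1, this]; field_simp; ring
  have f4 : t ^ 2 * (t - 1) ^ 2 = tt ^ 2 := by rw [← e2]; ring
  have f5 : (y - t) ^ 2 = w * (v - r) ^ 2 := by rw [e3, ← hw]; ring
  have f6 : ∀ k : K, k / (y - t) = u * k / (w * (v - r)) := by
    intro k; rw [e3, ← hw]; field_simp
  have w0 : w ≠ 0 := hw ▸ pow_ne_zero 2 u0
  rw [f1, f2, f4, e1, e2, f5, f6, add_assoc ((1 / 3 - 1 : K) ^ 2 / 2), f3, e3]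
  generalize v - r = Z at *
  field_simp
  ring

theorem GenericPoint.solvesPVI :
    SolvesPVI ![1 / 3, 1 / 3, 1 / 3, 1 / 3] D (yOf s u) (tOf s u) := by
  refine ⟨h.y_ne_zero_and_ne_one.1, h.y_ne_zero_and_ne_one.2, sub_ne_zero.1 h.y_sub_t_ne_zero, ?_⟩
  simp only [Matrix.cons_val_zero, Matrix.cons_val_one, Matrix.cons_val, map_div₀, map_sub, map_pow,
    map_neg, map_one, map_ofNat]
  rw [rhs_third h.curve h.u0 h.yOdd_sq h.tOdd_sq ?_ ?_ h.y_eq h.t_eq h.y_sub_t_ne_zero,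
    h.derivation_y D hs, h.derivation_dy D, hs, h.yOdd_sub_tOdd]
  · obtain ⟨hc, u0, s0, s1, q0, s2, s3, b0, c0, c3, p2, p4⟩ := h
    rw [mul_left_comm]
    -- Both sides carry a factor `u`. After it is removed, an identity between rational functions of
    -- `s` remains.
    congr 1
    unfold dsOdd dyOf tOdd yOdd
    generalize hq : 8 * s ^ 2 - 11 * s + 8 = q at *
    generalize hc' : 3 * s ^ 3 - 4 * s ^ 2 + 4 * s + 2 = c at *
    generalize hd : 2 * s - 1 = d at *
    generalize hb : 2 * s ^ 2 + s + 2 = b at *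
    generalize hp2 : 6 * s ^ 2 - 2 * s + 1 = P2 at *
    generalize hp4 : 4 * s ^ 4 + 4 * s ^ 3 + 54 * s ^ 2 - 86 * s + 49 = P4 at *
    generalize hce : s ^ 2 - 7 * s + 1 = ce at *
    generalize hN : dyNum s = N at *
    generalize hN1 : tNum s = N1 at *
    generalize hN2 : yNum s = N2 at *
    field_simp
    rw [← hN, ← hN1, ← hN2, ← hq, ← hc', ← hd, ← hb, ← hp2, ← hp4, ← hce]
    unfold dyNum tNum yNum
    ring
  · simp only [ne_eq, div_eq_zero_iff, mul_eq_zero, pow_eq_zero_iff, OfNat.ofNat_ne_zero,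
      not_false_eq_true, h.s0, h.s1, h.q0, h.s2, h.s3, h.b0, h.c3, h.p4, or_self]
  · simp only [ne_eq, div_eq_zero_iff, mul_eq_zero, pow_eq_zero_iff, OfNat.ofNat_ne_zero,
      not_false_eq_true, h.s0, h.s1, h.q0, h.s2, h.s3, h.b0, h.c0, or_self]

end Derivation

end Explicit

end PainleveVI

namespace PainleveVI

open Polynomial
open scoped Polynomial.Bivariate IntermediateField Topology

/-! ### Ramification of `t` -/

section Valuation

variable {K : Type*} [Field K] [Algebra ℂ K] {Γ : Type*} [LinearOrderedCommGroupWithZero Γ]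
  {v : Valuation K Γ} (hv : ∀ c : ℂ, v (algebraMap ℂ K c) ≤ 1) {s u : K}
include hv

theorem valuation_const {c : ℂ} (hc : c ≠ 0) : v (algebraMap ℂ K c) = 1 := by
  refine le_antisymm (hv c) ?_
  have h := hv c⁻¹
  rw [map_inv₀, map_inv₀] at h
  have h0 : v (algebraMap ℂ K c) ≠ 0 := by simpa using hc
  rwa [inv_le_one₀ (zero_lt_iff.2 h0)] at h

theorem valuation_aeval_le_one (hs : v s ≤ 1) (p : ℂ[X]) : v (aeval s p) ≤ 1 := by
  induction p using Polynomial.induction_on' with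
  | add p q hp hq => rw [map_add]; exact v.map_add_le hp hq
  | monomial n a =>
    rw [aeval_monomial, map_mul, map_pow]
    exact mul_le_one' (hv a) (pow_le_one' hs n)

/-- Horner's scheme: at a pole of `s` the leading term dominates the constant added at each stage.
-/
theorem valuation_aeval_of_one_lt (hs : 1 < v s) {p : ℂ[X]} (hp : p ≠ 0) :
    v (aeval s p) = v s ^ p.natDegree := by
  induction hn : p.natDegree generalizing p with
  | zero =>
    rw [natDegree_eq_zero] at hn
    obtain ⟨c, rfl⟩ := hn
    rw [aeval_C, pow_zero]
    exact valuation_const hv (by simpa using hp)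
  | succ n ih =>
    have hd : p.divX.natDegree = n := by rw [natDegree_divX_eq_natDegree_tsub_one, hn]; rfl
    have hd0 : p.divX ≠ 0 := by
      intro h
      rw [divX_eq_zero_iff] at h
      rw [h, natDegree_C] at hn
      omega
    have e : aeval s p = aeval s p.divX * s + algebraMap ℂ K (p.coeff 0) := by
      conv_lhs => rw [← divX_mul_X_add p]
      simp
    have e2 : v (aeval s p.divX * s) = v s ^ (n + 1) := by rw [map_mul, ih hd0 hd, pow_succ]
    rw [e, Valuation.map_add_eq_of_lt_left, e2]
    rw [e2]
    exact (hv _).trans_lt (one_lt_pow' hs (by omega))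

variable {a b : ℂ}

theorem valuation_aeval_sub_lt_one (hs : v (s - algebraMap ℂ K a) < 1) (p : ℂ[X]) :
    v (aeval s p - algebraMap ℂ K (p.eval a)) < 1 := by
  have hs1 : v s ≤ 1 := by
    have := v.map_add_le hs.le (hv a)
    rwa [sub_add_cancel] at this
  have h := X_sub_C_mul_divByMonic_eq_sub_modByMonic p a
  rw [modByMonic_X_sub_C_eq_C_eval] at h
  have h2 := congrArg (aeval s) h
  rw [map_mul, map_sub, map_sub, aeval_X, aeval_C, aeval_C] at h2
  rw [← h2, map_mul]
  exact mul_lt_one_of_lt_of_le hs (valuation_aeval_le_one hv hs1 _)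

theorem valuation_eq_one_of_sub_lt_one {k : K} {c : ℂ} (h : v (k - algebraMap ℂ K c) < 1)
    (hc : c ≠ 0) : v k = 1 := by
  have := Valuation.map_add_eq_of_lt_left v (h.trans_eq (valuation_const hv hc).symm)
  rwa [add_sub_cancel, valuation_const hv hc] at this

theorem valuation_aeval_eq_one (hs : v (s - algebraMap ℂ K a) < 1) {p : ℂ[X]}
    (hp : p.eval a ≠ 0) : v (aeval s p) = 1 :=
  valuation_eq_one_of_sub_lt_one hv (valuation_aeval_sub_lt_one hv hs p) hp

theorem valuation_aeval (hs : v (s - algebraMap ℂ K a) < 1) {p : ℂ[X]} (hp : p ≠ 0) :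
    v (aeval s p) = v (s - algebraMap ℂ K a) ^ p.rootMultiplicity a := by
  obtain ⟨q, hq, hd⟩ := exists_eq_pow_rootMultiplicity_mul_and_not_dvd p hp a
  rw [dvd_iff_isRoot] at hd
  conv_lhs => rw [hq]
  rw [map_mul, map_mul, valuation_aeval_eq_one hv hs hd, mul_one]
  simp

theorem valuation_aeval_add_sub_lt_one (hs : v (s - algebraMap ℂ K a) < 1)
    (hu : v (u - algebraMap ℂ K b) < 1) (p q : ℂ[X]) :
    v (aeval s p + aeval s q * u - algebraMap ℂ K (p.eval a + q.eval a * b)) < 1 := by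
  have hu1 : v u ≤ 1 := by
    have := v.map_add_le hu.le (hv b)
    rwa [sub_add_cancel] at this
  have e : aeval s p + aeval s q * u - algebraMap ℂ K (p.eval a + q.eval a * b) =
      (aeval s p - algebraMap ℂ K (p.eval a)) + ((aeval s q - algebraMap ℂ K (q.eval a)) * u
        + algebraMap ℂ K (q.eval a) * (u - algebraMap ℂ K b)) := by
    rw [map_add, map_mul]; ring
  rw [e]
  refine v.map_add_lt (valuation_aeval_sub_lt_one hv hs p) (v.map_add_lt ?_ ?_)
  · rw [map_mul]
    exact mul_lt_one_of_lt_of_le (valuation_aeval_sub_lt_one hv hs q) hu1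
  · rw [map_mul, mul_comm]
    exact mul_lt_one_of_lt_of_le hu (hv _)

/-- Every function vanishing at the point `(a, b)` of the curve is divisible by `s - a`. -/
theorem valuation_le_of_lt_one (hs : v (s - algebraMap ℂ K a) < 1)
    (hu : v (u - algebraMap ℂ K b) < 1) (hb : b ≠ 0) {w : ℂ[X]} (hw : u ^ 2 = aeval s w)
    {p q r : ℂ[X]} (hr : aeval s r ≠ 0)
    (hf : v ((aeval s p + aeval s q * u) / aeval s r) < 1) :
    v ((aeval s p + aeval s q * u) / aeval s r) ≤ v (s - algebraMap ℂ K a) := by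
  by_cases hf0 : aeval s p + aeval s q * u = 0
  · simp [hf0]
  have hr0 : r ≠ 0 := by rintro rfl; simp at hr
  set π := s - algebraMap ℂ K a with hπ
  -- If `p + q u` vanishes at the point, its conjugate `p - q u` does not, since `b ≠ 0` and `q(a) ≠
  -- 0`. So the valuation is that of the norm `p² - q² w`, which is a polynomial in `s`.
  have key : ∀ p q : ℂ[X], (p.eval a ≠ 0 ∨ q.eval a ≠ 0) → aeval s p + aeval s q * u ≠ 0 →
      ∃ m : ℕ, v (aeval s p + aeval s q * u) = v π ^ m := by
    intro p q hpq h0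
    by_cases hz : p.eval a + q.eval a * b = 0
    · have hq0 : q.eval a ≠ 0 := by
        rcases hpq with h | h
        · intro h'; apply h; simpa [h'] using hz
        · exact h
      have h2 : v (aeval s p + aeval s (-q) * u) = 1 := by
        refine valuation_eq_one_of_sub_lt_one hv (valuation_aeval_add_sub_lt_one hv hs hu p (-q)) ?_
        rw [eval_neg]
        intro h
        have : q.eval a * b = 0 := by linear_combination (hz - h) / 2
        exact mul_ne_zero hq0 hb this
      have e : aeval s (p ^ 2 - q ^ 2 * w) =
          (aeval s p + aeval s q * u) * (aeval s p + aeval s (-q) * u) := by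
        rw [map_sub, map_mul, ← hw, map_pow, map_pow, map_neg]; ring
      have h3 : p ^ 2 - q ^ 2 * w ≠ 0 := by
        intro h
        rw [h, map_zero] at e
        rcases mul_eq_zero.1 e.symm with h' | h'
        · exact h0 h'
        · rw [h', map_zero] at h2; exact zero_ne_one h2
      refine ⟨(p ^ 2 - q ^ 2 * w).rootMultiplicity a, ?_⟩
      rw [← valuation_aeval hv hs h3, e, map_mul, h2, mul_one]
    · exact ⟨0, by
        rw [pow_zero]
        exact valuation_eq_one_of_sub_lt_one hv (valuation_aeval_add_sub_lt_one hv hs hu p q) hz⟩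
  -- Common factors `s - a` of `p` and `q` are split off, by induction on the degrees, until `key`
  -- applies.
  have key2 : ∀ n : ℕ, ∀ p q : ℂ[X], p.natDegree + q.natDegree ≤ n →
      aeval s p + aeval s q * u ≠ 0 → ∃ m : ℕ, v (aeval s p + aeval s q * u) = v π ^ m := by
    intro n
    induction n with
    | zero =>
      intro p q hn h0
      by_cases hpq : p.eval a ≠ 0 ∨ q.eval a ≠ 0
      · exact key p q hpq h0
      · push Not at hpq
        rw [eq_C_of_natDegree_eq_zero (show p.natDegree = 0 by omega), eval_C,
          eq_C_of_natDegree_eq_zero (show q.natDegree = 0 by omega), eval_C] at hpq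
        exfalso
        apply h0
        rw [eq_C_of_natDegree_eq_zero (show p.natDegree = 0 by omega),
          eq_C_of_natDegree_eq_zero (show q.natDegree = 0 by omega), hpq.1, hpq.2]
        simp
    | succ n ih =>
      intro p q hn h0
      by_cases hpq : p.eval a ≠ 0 ∨ q.eval a ≠ 0
      · exact key p q hpq h0
      · push Not at hpq
        obtain ⟨p', rfl⟩ := dvd_iff_isRoot.2 hpq.1
        obtain ⟨q', rfl⟩ := dvd_iff_isRoot.2 hpq.2
        have hX : aeval s (X - C a) = π := by simp [hπ]
        have e : aeval s ((X - C a) * p') + aeval s ((X - C a) * q') * u =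
            π * (aeval s p' + aeval s q' * u) := by
          rw [map_mul, map_mul, hX]; ring
        rw [e] at h0 ⊢
        have h1 := right_ne_zero_of_mul h0
        have hdeg : p'.natDegree + q'.natDegree ≤ n := by
          by_cases hp0 : p' = 0
          · by_cases hq0 : q' = 0
            · simp [hp0, hq0]
            · rw [natDegree_mul (X_sub_C_ne_zero a) hq0, natDegree_X_sub_C] at hn
              rw [hp0] at hn ⊢; simp at hn ⊢; omega
          · rw [natDegree_mul (X_sub_C_ne_zero a) hp0, natDegree_X_sub_C] at hn
            by_cases hq0 : q' = 0
            · rw [hq0] at hn ⊢; simp at hn ⊢; omega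
            · rw [natDegree_mul (X_sub_C_ne_zero a) hq0, natDegree_X_sub_C] at hn
              omega
        obtain ⟨m, hm⟩ := ih p' q' hdeg h1
        exact ⟨m + 1, by rw [map_mul, hm, pow_succ, mul_comm]⟩
  obtain ⟨m, hm⟩ := key2 _ p q le_rfl hf0
  have hr1 := valuation_aeval hv hs hr0
  rw [← hπ] at hr1
  rw [map_div₀, hm, hr1] at hf ⊢
  have hπ0 : 0 < v π := by
    rw [zero_lt_iff]
    intro h
    rw [h] at hm hr1
    have h1 : v (aeval s r) ≠ 0 := by simpa using hr
    have hn : r.rootMultiplicity a = 0 := by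
      by_contra hc; rw [zero_pow hc] at hr1; exact h1 hr1
    have h2 : v (aeval s p + aeval s q * u) ≠ 0 := by simpa using hf0
    have hm0 : m = 0 := by
      by_contra hc; rw [zero_pow hc] at hm; exact h2 hm
    rw [h, hn, hm0] at hf
    simp at hf
  set n := r.rootMultiplicity a
  rw [div_lt_one₀ (pow_pos hπ0 n)] at hf
  rw [div_le_iff₀ (pow_pos hπ0 n), ← pow_succ']
  have hlt : n < m := by
    by_contra hc
    exact absurd (pow_le_pow_right_of_le_one' hs.le (not_lt.1 hc)) (not_le.2 hf)
  exact pow_le_pow_right_of_le_one' hs.le hlt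

end Valuation

end PainleveVI

namespace PainleveVI

open Polynomial
open scoped Polynomial.Bivariate IntermediateField Topology

/-! ### Critical points of `(t - 1/2)²` and the Belyi property -/

noncomputable section

/-- The polynomial `8 s² - 11 s + 8`. -/
def quadPoly : ℂ[X] := 8 * X ^ 2 - 11 * X + 8

/-- The numerator of `t - 1/2`, as a polynomial. -/
def tNumPoly : ℂ[X] := (X + 1) * (32 * X ^ 8 - 320 * X ^ 7 + 1112 * X ^ 6 - 2420 * X ^ 5
  + 3167 * X ^ 4 - 2420 * X ^ 3 + 1112 * X ^ 2 - 320 * X + 32)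

/-- The denominator of `(t - 1/2)²`, as a polynomial. -/
def tSqDen : ℂ[X] := 2916 * X ^ 5 * (X - 1) ^ 2 * quadPoly ^ 3

theorem natDegree_quadPoly : quadPoly.natDegree = 2 := by unfold quadPoly; compute_degree!

theorem natDegree_tNumPoly : tNumPoly.natDegree = 9 := by unfold tNumPoly; compute_degree!

theorem quadPoly_ne_zero : quadPoly ≠ 0 := by
  intro h; have := natDegree_quadPoly; simp [h] at this

theorem tNumPoly_ne_zero : tNumPoly ≠ 0 := by
  intro h; have := natDegree_tNumPoly; simp [h] at this

theorem natDegree_tSqDen : tSqDen.natDegree = 13 := by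
  have h1 : (X - 1 : ℂ[X]).natDegree = 1 := natDegree_X_sub_C 1
  have h1' : (X - 1 : ℂ[X]) ≠ 0 := X_sub_C_ne_zero 1
  have hq := quadPoly_ne_zero
  have h2 : (2916 : ℂ[X]) ≠ 0 := by norm_num
  have h3 : (2916 : ℂ[X]).natDegree = 0 := natDegree_ofNat 2916
  unfold tSqDen
  rw [natDegree_mul (by simp [h1']) (by simp [hq]), natDegree_mul (by simp) (by simp [h1']),
    natDegree_mul (by simp) (by simp), natDegree_pow, natDegree_pow, natDegree_pow, h1,
    natDegree_quadPoly, natDegree_X, h3]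

theorem tSqDen_ne_zero : tSqDen ≠ 0 := by
  intro h; have := natDegree_tSqDen; simp [h] at this

/-- The only critical values of `(t - 1/2)²`, as a function of `s`, are `0`, `1/4` and `∞`. -/
theorem eval_tSqDen_critical {a c : ℂ} (h0 : tNumPoly.eval a ^ 2 = c * tSqDen.eval a)
    (h1 : 2 * tNumPoly.eval a * (derivative tNumPoly).eval a = c * (derivative tSqDen).eval a)
    (hQ : tSqDen.eval a ≠ 0) (hN : tNumPoly.eval a ≠ 0) : c = 1 / 4 := by
  -- This is, up to the factor `N`, the numerator of the derivative of `N²/Q`, where `N` is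
  -- `tNumPoly` and `Q` is `tSqDen`. Each of its factors divides either `Q` or `4N² - Q`, so a
  -- critical point with `N` and `Q` nonzero satisfies `N²/Q = 1/4`.
  have e : 2 * (derivative tNumPoly).eval a * tSqDen.eval a
      - tNumPoly.eval a * (derivative tSqDen).eval a
      = 58320 * a ^ 4 * (a - 1) * (8 * a ^ 2 - 11 * a + 8) ^ 2 *
        ((a - 2) * (2 * a - 1)) ^ 4 * (2 * a ^ 2 + a + 2) ^ 2 := by
    simp [tNumPoly, tSqDen, quadPoly, derivative_pow]
    ring
  have e2 : 4 * tNumPoly.eval a ^ 2 - tSqDen.eval a =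
      16 * ((a - 2) * (2 * a - 1)) ^ 5 * (2 * a ^ 2 + a + 2) ^ 3 * (a ^ 2 - 7 * a + 1) := by
    simp [tNumPoly, tSqDen, quadPoly]
    ring
  have e3 : tSqDen.eval a = 2916 * a ^ 5 * (a - 1) ^ 2 * (8 * a ^ 2 - 11 * a + 8) ^ 3 := by
    simp [tSqDen, quadPoly]
  have e4 : tNumPoly.eval a * (2 * (derivative tNumPoly).eval a * tSqDen.eval a
      - tNumPoly.eval a * (derivative tSqDen).eval a) = 0 := by
    linear_combination tSqDen.eval a * h1 - (derivative tSqDen).eval a * h0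
  have e5 : ((a - 2) * (2 * a - 1)) * (2 * a ^ 2 + a + 2) = 0 := by
    rw [e] at e4
    rw [e3] at hQ
    simp only [mul_eq_zero, pow_eq_zero_iff, OfNat.ofNat_ne_zero, not_false_eq_true, ne_eq, hN,
      false_or, not_or] at e4 hQ ⊢
    tauto
  have e6 : 4 * tNumPoly.eval a ^ 2 - tSqDen.eval a = 0 := by
    rw [e2]
    linear_combination 16 * ((a - 2) * (2 * a - 1)) ^ 4 * (2 * a ^ 2 + a + 2) ^ 2
      * (a ^ 2 - 7 * a + 1) * e5
  apply mul_right_cancel₀ hQ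
  linear_combination e6 / 4 - h0

/-- This treats the value `t = 1/2`, where the square `(t - 1/2)²` always has a double zero and
gives no information. By the same two factorisations a multiple root of the numerator would also be
a root of `tSqDen`. -/
theorem eval_tNumPoly_derivative_ne_zero {a : ℂ} (h0 : tNumPoly.eval a = 0)
    (hQ : tSqDen.eval a ≠ 0) : (derivative tNumPoly).eval a ≠ 0 := by
  intro h1
  have e : 2 * (derivative tNumPoly).eval a * tSqDen.eval a
      - tNumPoly.eval a * (derivative tSqDen).eval a
      = 58320 * a ^ 4 * (a - 1) * (8 * a ^ 2 - 11 * a + 8) ^ 2 *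
        ((a - 2) * (2 * a - 1)) ^ 4 * (2 * a ^ 2 + a + 2) ^ 2 := by
    simp [tNumPoly, tSqDen, quadPoly, derivative_pow]
    ring
  have e2 : 4 * tNumPoly.eval a ^ 2 - tSqDen.eval a =
      16 * ((a - 2) * (2 * a - 1)) ^ 5 * (2 * a ^ 2 + a + 2) ^ 3 * (a ^ 2 - 7 * a + 1) := by
    simp [tNumPoly, tSqDen, quadPoly]
    ring
  have e3 : tSqDen.eval a = 2916 * a ^ 5 * (a - 1) ^ 2 * (8 * a ^ 2 - 11 * a + 8) ^ 3 := by
    simp [tSqDen, quadPoly]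
  rw [h0, h1] at e
  have hQ' := hQ
  rw [h0] at e2
  apply hQ'
  rw [e3] at hQ
  have e5 : ((a - 2) * (2 * a - 1)) * (2 * a ^ 2 + a + 2) = 0 := by
    simp only [mul_zero, zero_mul, sub_zero, zero_eq_mul, mul_eq_zero, pow_eq_zero_iff,
      OfNat.ofNat_ne_zero, not_false_eq_true, ne_eq, false_or, not_or] at e hQ ⊢
    tauto
  linear_combination -e2 - 16 * ((a - 2) * (2 * a - 1)) ^ 4 * (2 * a ^ 2 + a + 2) ^ 2
      * (a ^ 2 - 7 * a + 1) * e5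

/-- A Bézout certificate that the fraction `tNumPoly² / tSqDen` does not cancel at the roots of
`quadPoly`. -/
theorem bezout_tNumPoly_quadPoly :
    (C (-80477) + C 40888 * X) * tNumPoly + (C 2290208 + C 88312 * X + C 7270412 * X ^ 2
      - C 7297397 * X ^ 3 - C 3104605 * X ^ 4 + C 6725188 * X ^ 5 - C 4624168 * X ^ 6
      + C 1568992 * X ^ 7 - C 163552 * X ^ 8) * quadPoly = 15746400 := by
  simp only [map_neg, map_ofNat, tNumPoly, quadPoly]
  ring

section Valuation

variable {K : Type*} [Field K] [Algebra ℂ K] [CharZero K] {Γ : Type*}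
  [LinearOrderedCommGroupWithZero Γ]
  {v : Valuation K Γ} (hv : ∀ c : ℂ, v (algebraMap ℂ K c) ≤ 1) {s u : K} {b : ℂ}

omit [CharZero K] in
theorem aeval_tNumPoly (s : K) : aeval s tNumPoly = tNum s := by
  simp [tNumPoly, tNum, map_ofNat]

omit [CharZero K] in
theorem aeval_quadPoly (s : K) : aeval s quadPoly = 8 * s ^ 2 - 11 * s + 8 := by
  simp [quadPoly, map_ofNat]

omit [CharZero K] in
theorem aeval_tSqDen (s : K) :
    aeval s tSqDen = 2916 * s ^ 5 * (s - 1) ^ 2 * (8 * s ^ 2 - 11 * s + 8) ^ 3 := by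
  simp [tSqDen, aeval_quadPoly, map_ofNat]

theorem GenericPoint.sub_half_sq (h : GenericPoint s u) :
    (tOf s u - 1 / 2) ^ 2 * aeval s tSqDen = aeval s tNumPoly ^ 2 := by
  rw [h.t_eq, aeval_tNumPoly, aeval_tSqDen, add_sub_cancel_left, mul_pow, h.curve, tOdd]
  obtain ⟨hc, u0, s0, s1, q0, -⟩ := h
  generalize hq : 8 * s ^ 2 - 11 * s + 8 = q at *
  generalize tNum s = N
  field_simp
  norm_num

include hv

/-- A function `t` with a finite value only takes it at points where `s` has a finite value different from
the roots of the denominator. -/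
theorem GenericPoint.valuation_s_le_one (h : GenericPoint s u) (ht : v (tOf s u) ≤ 1) :
    v s ≤ 1 := by
  by_contra hs
  rw [not_le] at hs
  have e := congrArg v h.sub_half_sq
  rw [map_mul, map_pow, map_pow, valuation_aeval_of_one_lt hv hs tSqDen_ne_zero,
    valuation_aeval_of_one_lt hv hs tNumPoly_ne_zero, natDegree_tSqDen, natDegree_tNumPoly] at e
  have h2 : v (tOf s u - 1 / 2) ≤ 1 := by
    refine v.map_sub_le ht ?_
    simpa [map_ofNat] using hv (1 / 2)
  -- The numerator has degree `18` and the denominator degree `13`, so a pole of `s` would be a pole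
  -- of `t`.
  have h3 : (v s ^ 9) ^ 2 ≤ v s ^ 13 := by
    rw [← e]; exact mul_le_of_le_one_left' (pow_le_one' h2 2)
  rw [← pow_mul] at h3
  exact absurd h3 (not_le.2 (pow_lt_pow_right₀ hs (by norm_num)))

/-- The numerator and the denominator of `(t - 1/2)²` have no common root, so `t` is infinite at the
roots of the denominator. -/
theorem GenericPoint.eval_tSqDen_ne_zero (h : GenericPoint s u) (ht : v (tOf s u) ≤ 1) {a : ℂ}
    (hs : v (s - algebraMap ℂ K a) < 1) : tSqDen.eval a ≠ 0 := by
  intro h0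
  have e := congrArg v h.sub_half_sq
  have h2 : v (tOf s u - 1 / 2) ≤ 1 := by
    refine v.map_sub_le ht ?_
    simpa [map_ofNat] using hv (1 / 2)
  have h3 : v (aeval s tSqDen) < 1 := by
    simpa [h0] using valuation_aeval_sub_lt_one hv hs tSqDen
  have h4 : tNumPoly.eval a = 0 := by
    by_contra hN
    rw [map_mul, map_pow, map_pow, valuation_aeval_eq_one hv hs hN, one_pow] at e
    rw [mul_comm] at e
    exact absurd e (mul_lt_one_of_lt_of_le h3 (pow_le_one' h2 2)).ne
  have h5 : a = 0 ∨ a - 1 = 0 ∨ quadPoly.eval a = 0 := by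
    have : tSqDen.eval a = 2916 * a ^ 5 * (a - 1) ^ 2 * quadPoly.eval a ^ 3 := by simp [tSqDen]
    rw [this] at h0
    simp only [mul_eq_zero, pow_eq_zero_iff, OfNat.ofNat_ne_zero, not_false_eq_true, ne_eq,
      false_or] at h0
    tauto
  rcases h5 with h5 | h5 | h5
  · rw [h5] at h4; simp [tNumPoly] at h4
  · rw [sub_eq_zero] at h5; rw [h5] at h4; norm_num [tNumPoly] at h4
  · have := congrArg (eval a) bezout_tNumPoly_quadPoly
    rw [eval_add, eval_mul, eval_mul, h4, h5] at this
    simp at this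

/-- In terms of `s - a`, the function `t - c` vanishes to order at most one: it divides a polynomial
in `s` with at most a simple root at `a`, up to factors that are integral or units. -/
theorem GenericPoint.le_valuation_t_sub (h : GenericPoint s u) {a c : ℂ}
    (ht : v (tOf s u) ≤ 1) (hs : v (s - algebraMap ℂ K a) < 1) (c0 : c ≠ 0) (c1 : c ≠ 1)
    (htc : v (tOf s u - algebraMap ℂ K c) < 1) :
    v (s - algebraMap ℂ K a) ≤ v (tOf s u - algebraMap ℂ K c) := by
  have hQ := h.eval_tSqDen_ne_zero hv ht hs
  have simpleRoot : ∀ p : ℂ[X], p ≠ 0 → (p.eval a = 0 → p.derivative.eval a ≠ 0) →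
      v (s - algebraMap ℂ K a) ≤ v (aeval s p) := by
    intro p hp hd
    rw [valuation_aeval hv hs hp]
    have h1 : p.rootMultiplicity a ≤ 1 := by
      by_contra hc
      rw [not_le, one_lt_rootMultiplicity_iff_isRoot hp] at hc
      exact hd hc.1 hc.2
    calc v (s - algebraMap ℂ K a) = v (s - algebraMap ℂ K a) ^ 1 := (pow_one _).symm
      _ ≤ _ := pow_le_pow_right_of_le_one' hs.le h1
  have h2 : ∀ c : ℂ, v (tOf s u - algebraMap ℂ K c) ≤ 1 := fun c => v.map_sub_le ht (hv c)
  -- For `c = 1/2` the polynomial `H` below would be a square, so the numerator of `t - 1/2` itself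
  -- is used. Otherwise `H` is `(t - c)(t - (1 - c))` times the denominator, and a double root of
  -- `H` would be a critical point with value `(c - 1/2)²`.
  by_cases hc : c = 1 / 2
  · have hN := simpleRoot tNumPoly tNumPoly_ne_zero
      fun h0 => eval_tNumPoly_derivative_ne_zero h0 hQ
    have e := congrArg v h.sub_half_sq
    rw [map_mul, map_pow, map_pow, valuation_aeval_eq_one hv hs hQ, mul_one] at e
    have e2 := (pow_left_inj₀ zero_le zero_le two_ne_zero).1 e
    subst hc
    rw [map_div₀, map_one, map_ofNat, e2]
    exact hN
  · set H : ℂ[X] := tNumPoly ^ 2 - C ((c - 1 / 2) ^ 2) * tSqDen with hH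
    have e : (tOf s u - algebraMap ℂ K c) * (tOf s u - algebraMap ℂ K (1 - c)) * aeval s tSqDen =
        aeval s H := by
      simp only [hH, map_sub, map_pow, map_mul, aeval_C, map_one, map_div₀, map_ofNat,
        ← h.sub_half_sq]
      ring
    have hH0 : H ≠ 0 := by
      intro h0
      have : (tNumPoly ^ 2).natDegree = (C ((c - 1 / 2) ^ 2) * tSqDen).natDegree := by
        rw [sub_eq_zero.1 (hH.symm.trans h0)]
      rw [natDegree_pow, natDegree_C_mul (pow_ne_zero 2 (sub_ne_zero.2 hc)), natDegree_tNumPoly,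
        natDegree_tSqDen] at this
      omega
    have hsr := simpleRoot H hH0 (by
      intro h0 h1
      have hd : H.derivative.eval a = 2 * tNumPoly.eval a * (derivative tNumPoly).eval a
          - (c - 1 / 2) ^ 2 * (derivative tSqDen).eval a := by
        simp only [hH, derivative_sub, derivative_pow, derivative_C_mul, eval_sub, eval_mul,
          eval_C, eval_pow]
        simp
      rw [hd, sub_eq_zero] at h1
      rw [hH] at h0
      simp only [eval_sub, eval_pow, eval_mul, eval_C, sub_eq_zero] at h0
      have hN : tNumPoly.eval a ≠ 0 := by
        intro hN
        rw [hN, zero_pow two_ne_zero] at h0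
        exact mul_ne_zero (pow_ne_zero 2 (sub_ne_zero.2 hc)) hQ h0.symm
      have := eval_tSqDen_critical h0 h1 hQ hN
      have h3 : c * (c - 1) = 0 := by linear_combination this
      rcases mul_eq_zero.1 h3 with h3 | h3
      · exact c0 h3
      · exact c1 (sub_eq_zero.1 h3))
    refine hsr.trans ?_
    rw [← e, map_mul, map_mul, valuation_aeval_eq_one hv hs hQ, mul_one]
    exact mul_le_of_le_one_right' (h2 _)

/-- The product `(u - b)(u + b)` vanishes for either square root `b` of `a * quadPoly(a)`, so one
factor does. The square root is nonzero because `a * quadPoly(a)` divides the value of `tSqDen`. -/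
theorem GenericPoint.exists_valuation_u_sub_lt_one (h : GenericPoint s u) {a : ℂ}
    (hs : v (s - algebraMap ℂ K a) < 1) (hQ : tSqDen.eval a ≠ 0) :
    ∃ b : ℂ, b ≠ 0 ∧ v (u - algebraMap ℂ K b) < 1 := by
  obtain ⟨b, hb⟩ := IsAlgClosed.exists_pow_nat_eq (a * quadPoly.eval a) two_pos
  have hb0 : b ≠ 0 := by
    rintro rfl
    apply hQ
    have h0 : a * quadPoly.eval a = 0 := by rw [← hb]; simp
    have : tSqDen.eval a = 2916 * a ^ 4 * (a - 1) ^ 2 * quadPoly.eval a ^ 2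
      * (a * quadPoly.eval a) := by simp [tSqDen]; ring
    rw [this, h0, mul_zero]
  have e : (u - algebraMap ℂ K b) * (u - algebraMap ℂ K (-b)) =
      aeval s (X * quadPoly) - algebraMap ℂ K ((X * quadPoly).eval a) := by
    rw [eval_mul, eval_X, ← hb, map_mul, aeval_X, aeval_quadPoly, ← h.curve, map_neg, map_pow]
    ring
  have h1 := valuation_aeval_sub_lt_one hv hs (X * quadPoly)
  rw [← e, map_mul] at h1
  by_cases h2 : v (u - algebraMap ℂ K b) < 1
  · exact ⟨b, hb0, h2⟩
  · refine ⟨-b, neg_ne_zero.2 hb0, ?_⟩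
    by_contra h3
    exact absurd h1 (not_lt.2 (one_le_mul (not_lt.1 h2) (not_lt.1 h3)))

end Valuation

/-- `t` is a Belyi map, over any field generated by the point. -/
theorem GenericPoint.isBelyi {K : Type*} [Field K] [Algebra ℂ K] [CharZero K] {s u : K}
    (h : GenericPoint s u) (hgen : ∀ k : K, ∃ p q r : ℂ[X], aeval s r ≠ 0 ∧
      k = (aeval s p + aeval s q * u) / aeval s r) : IsBelyi (tOf s u) := by
  intro O hO hc a a0 a1 ha f hf
  have hv : ∀ c : ℂ, O.valuation (algebraMap ℂ K c) ≤ 1 := fun c =>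
    (O.valuation_le_one_iff _).2 (hc c)
  rw [ValuationSubring.mem_nonunits_iff] at ha hf
  have ht : O.valuation (tOf s u) ≤ 1 := by
    have := O.valuation.map_add_le ha.le (hv a)
    rwa [sub_add_cancel] at this
  have hs1 := h.valuation_s_le_one hv ht
  -- The residue field is `ℂ`: if no `s - c` vanished at the place, every nonzero polynomial in `s`
  -- would be a unit, as a product of linear factors, and the valuation ring would be the whole
  -- field.
  obtain ⟨σ, hσ⟩ : ∃ σ : ℂ, O.valuation (s - algebraMap ℂ K σ) < 1 := by
    by_contra hcon
    push Not at hcon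
    have h1 : ∀ c : ℂ, O.valuation (s - algebraMap ℂ K c) = 1 := fun c =>
      le_antisymm (O.valuation.map_sub_le hs1 (hv c)) (hcon c)
    have h2 : ∀ p : ℂ[X], p ≠ 0 → O.valuation (aeval s p) = 1 := by
      intro p hp
      have hp2 := (IsAlgClosed.splits p).eq_prod_roots
      rw [hp2, map_mul, aeval_C, map_multiset_prod, map_mul, map_multiset_prod,
        valuation_const hv (leadingCoeff_ne_zero.2 hp), one_mul]
      refine Multiset.prod_eq_one fun x hx => ?_
      simp only [Multiset.mem_map] at hx
      obtain ⟨y, ⟨z, ⟨w, -, rfl⟩, rfl⟩, rfl⟩ := hx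
      simpa using h1 w
    apply hO
    rw [eq_top_iff]
    intro k _
    obtain ⟨p, q, r, hr, rfl⟩ := hgen k
    have hu1 : O.valuation u ≤ 1 := by
      have e := congrArg O.valuation h.curve
      have : s * (8 * s ^ 2 - 11 * s + 8) = aeval s (X * quadPoly) := by
        rw [map_mul, aeval_X, aeval_quadPoly]
      rw [this, map_pow] at e
      have h3 := valuation_aeval_le_one hv hs1 (X * quadPoly)
      rw [← e] at h3
      exact (pow_le_one_iff two_ne_zero).1 h3
    rw [← ValuationSubring.valuation_le_one_iff, map_div₀, h2 r (by rintro rfl; simp at hr), div_one]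
    refine O.valuation.map_add_le (valuation_aeval_le_one hv hs1 _) ?_
    rw [map_mul]
    exact mul_le_one' (valuation_aeval_le_one hv hs1 _) hu1
  have hQ := h.eval_tSqDen_ne_zero hv ht hσ
  obtain ⟨b, hb, hub⟩ := h.exists_valuation_u_sub_lt_one hv hσ hQ
  have h3 := h.le_valuation_t_sub hv ht hσ a0 a1 ha
  rw [← ValuationSubring.valuation_le_one_iff, map_div₀]
  refine div_le_one_of_le₀ ?_ zero_le
  refine le_trans ?_ h3
  obtain ⟨p, q, r, hr, rfl⟩ := hgen f
  exact valuation_le_of_lt_one hv hσ hub hb (w := X * quadPoly)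
    (by rw [map_mul, aeval_X, aeval_quadPoly, h.curve]) hr hf

end

theorem GenericPoint.of_transcendental {K : Type*} [Field K] [Algebra ℂ K] {s u : K}
    (hc : u ^ 2 = s * (8 * s ^ 2 - 11 * s + 8)) (hu : u ≠ 0)
    (hs : ∀ p : ℂ[X], p ≠ 0 → aeval s p ≠ 0) : GenericPoint s u := by
  -- The number `3` is a root of none of the polynomials in question, so its evaluation certifies
  -- that they are nonzero.
  have key : ∀ p : ℂ[X], p.eval 3 ≠ 0 → aeval s p ≠ 0 := fun p h =>
    hs p fun h0 => h (by simp [h0])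
  refine ⟨hc, hu, ?_, ?_, ?_, ?_, ?_, ?_, ?_, ?_, ?_, ?_⟩
  · have h := key (X) (by norm_num)
    simpa [map_ofNat] using h
  · have h := key (X - 1) (by norm_num)
    simpa [map_ofNat] using h
  · have h := key (8 * X ^ 2 - 11 * X + 8) (by norm_num)
    simpa [map_ofNat] using h
  · have h := key (X - 2) (by norm_num)
    simpa [map_ofNat] using h
  · have h := key (2 * X - 1) (by norm_num)
    simpa [map_ofNat] using h
  · have h := key (2 * X ^ 2 + X + 2) (by norm_num)
    simpa [map_ofNat] using h
  · have h := key (X ^ 2 - 7 * X + 1) (by norm_num)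
    simpa [map_ofNat] using h
  · have h := key (3 * X ^ 3 - 4 * X ^ 2 + 4 * X + 2) (by norm_num)
    simpa [map_ofNat] using h
  · have h := key (6 * X ^ 2 - 2 * X + 1) (by norm_num)
    simpa [map_ofNat] using h
  · have h := key (4 * X ^ 4 + 4 * X ^ 3 + 54 * X ^ 2 - 86 * X + 49) (by norm_num)
    simpa [map_ofNat] using h

namespace Elliptic

theorem genericPoint : GenericPoint s u :=
  GenericPoint.of_transcendental u_sq u_ne_zero fun _ hp => aeval_s_ne_zero hp

theorem isBelyi : IsBelyi (tOf s u) := genericPoint.isBelyi fun k => by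
  obtain ⟨p, q, r, hr, h⟩ := exists_eq_div k
  exact ⟨p, q, r, aeval_s_ne_zero hr, h⟩

/-- The derivation `d/dt`. -/
theorem exists_derivation_t : ∃ D : Derivation ℂ FF FF, D (tOf s u) = 1 ∧ D s = u * dsOdd s := by
  obtain ⟨D, hD, -⟩ := exists_derivation (u * dsOdd s)
  exact ⟨D, genericPoint.derivation_t D hD, hD⟩

end Elliptic

end PainleveVI

namespace PainleveVI

open Polynomial
open scoped Polynomial.Bivariate IntermediateField Topology

/-! ### Plane models of function fields of one variable -/

section FunctionFields

/-- The degree of a rational function of a transcendental element. -/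
theorem relfinrank_adjoin_div {F K : Type*} [Field F] [Field K] [Algebra F K] {s : K}
    (hs : Transcendental F s) {p q : F[X]} (hpq : IsCoprime p q) (hq : q ≠ 0) :
    (F⟮aeval s p / aeval s q⟯).relfinrank F⟮s⟯ = max p.natDegree q.natDegree := by
  let ι : RatFunc F →ₐ[F] K :=
    (F⟮s⟯.val).comp (RatFunc.algEquivOfTranscendental s hs).toAlgHom
  have hι : ∀ g : F[X], ι (algebraMap F[X] (RatFunc F) g) = aeval s g := by
    intro g
    simp [ι, aeval_def, eval₂_eq_sum_range]
  let f : RatFunc F := algebraMap F[X] (RatFunc F) p / algebraMap F[X] (RatFunc F) q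
  have hf : ι f = aeval s p / aeval s q := by rw [map_div₀, hι, hι]
  have h1 : (F⟮f⟯).map ι = F⟮aeval s p / aeval s q⟯ := by
    rw [IntermediateField.adjoin_map, Set.image_singleton, hf]
  have h2 : (⊤ : IntermediateField F (RatFunc F)).map ι = F⟮s⟯ := by
    rw [← RatFunc.adjoin_X, IntermediateField.adjoin_map, Set.image_singleton, ← RatFunc.algebraMap_X,
      hι, aeval_X]
  rw [← h1, ← h2, IntermediateField.relfinrank_map_map, IntermediateField.relfinrank_top_right,
    RatFunc.finrank_eq_max_natDegree]
  have hq' : algebraMap F[X] (RatFunc F) q ≠ 0 := RatFunc.algebraMap_ne_zero hq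
  have hd' : algebraMap F[X] (RatFunc F) f.denom ≠ 0 := RatFunc.algebraMap_ne_zero f.denom_ne_zero
  have e : f.num * q = p * f.denom := by
    have h := RatFunc.num_div_denom f
    change _ = algebraMap F[X] (RatFunc F) p / algebraMap F[X] (RatFunc F) q at h
    rw [div_eq_div_iff hd' hq', ← map_mul, ← map_mul] at h
    exact RatFunc.algebraMap_injective F h
  have hc := RatFunc.isCoprime_num_denom f
  have a1 : Associated f.num p := associated_of_dvd_dvd
    (hc.dvd_of_dvd_mul_right (Dvd.intro _ e)) (hpq.dvd_of_dvd_mul_right (Dvd.intro _ e.symm))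
  have a2 : Associated f.denom q := associated_of_dvd_dvd
    (hc.symm.dvd_of_dvd_mul_left (Dvd.intro_left _ e.symm))
    (hpq.symm.dvd_of_dvd_mul_left (Dvd.intro_left _ e))
  rw [natDegree_eq_of_degree_eq (degree_eq_degree_of_associated a1),
    natDegree_eq_of_degree_eq (degree_eq_degree_of_associated a2)]

variable {K : Type*} [Field K] [Algebra ℂ K]

/-- A derivation with `D t = 1` preserves the subfields containing `t`, if the field is algebraic
over `ℂ(t)`. -/
theorem derivation_mem [CharZero K] (D : Derivation ℂ K K) {t : K} (ht : D t = 1)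
    (hfin : Module.Finite ℂ⟮t⟯ K) {L : IntermediateField ℂ K} (htL : t ∈ L) {y : K} (hy : y ∈ L) :
    D y ∈ L := by
  have hle : ℂ⟮t⟯ ≤ L := IntermediateField.adjoin_simple_le_iff.2 htL
  have hD : ∀ k ∈ ℂ⟮t⟯, D k ∈ L := by
    intro k hk
    induction hk using IntermediateField.adjoin_induction with
    | mem x hx => rw [Set.mem_singleton_iff.1 hx, ht]; exact one_mem _
    | algebraMap c => rw [D.map_algebraMap]; exact zero_mem _
    | add a b _ _ ha hb => rw [map_add]; exact add_mem ha hb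
    | inv a h ha =>
      rw [Derivation.leibniz_inv]
      exact mul_mem (neg_mem (pow_mem (inv_mem (hle h)) 2)) ha
    | mul a b h1 h2 ha hb =>
      rw [Derivation.leibniz]
      exact add_mem (mul_mem (hle h1) hb) (mul_mem (hle h2) ha)
  have haeval : ∀ p : ℂ⟮t⟯[X], aeval y p ∈ L := by
    intro p
    induction p using Polynomial.induction_on' with
    | add p q hp hq => rw [map_add]; exact add_mem hp hq
    | monomial n a =>
      rw [aeval_monomial]
      exact mul_mem (hle a.2) (pow_mem hy n)
  -- The chain rule modulo `L`: the remaining term of `D(p(y))` differentiates only the coefficients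
  -- of `p`. Applied to the minimal polynomial of `y`, whose derivative does not vanish at `y` by
  -- separability, it solves for `D y`.
  have key : ∀ p : ℂ⟮t⟯[X], D (aeval y p) - aeval y (derivative p) * D y ∈ L := by
    intro p
    induction p using Polynomial.induction_on' with
    | add p q hp hq =>
      have e : D (aeval y (p + q)) - aeval y (derivative (p + q)) * D y =
        (D (aeval y p) - aeval y (derivative p) * D y)
          + (D (aeval y q) - aeval y (derivative q) * D y) := by
        simp only [map_add]; ring
      rw [e]; exact add_mem hp hq
    | monomial n a =>
      have e : D (aeval y (monomial n a)) - aeval y (derivative (monomial n a)) * D y =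
          D (algebraMap ℂ⟮t⟯ K a) * y ^ n := by
        rw [derivative_monomial, aeval_monomial, aeval_monomial, Derivation.leibniz,
          Derivation.leibniz_pow]
        simp only [smul_eq_mul, nsmul_eq_mul, map_mul, map_natCast]
        ring
      rw [e]
      exact mul_mem (hD _ a.2) (pow_mem hy n)
  have hint : IsIntegral ℂ⟮t⟯ y := Algebra.IsIntegral.isIntegral y
  have h1 := key (minpoly ℂ⟮t⟯ y)
  rw [minpoly.aeval, map_zero, zero_sub] at h1
  have h2 : aeval y (derivative (minpoly ℂ⟮t⟯ y)) ≠ 0 :=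
    (minpoly.irreducible hint).separable.aeval_derivative_ne_zero (minpoly.aeval _ _)
  have h3 := mul_mem (neg_mem h1) (inv_mem (haeval (derivative (minpoly ℂ⟮t⟯ y))))
  rwa [neg_neg, mul_comm, inv_mul_cancel_left₀ h2] at h3

/-- A field generated by `t` and `y` is the function field of a plane curve with coordinates `t`
and `y`. -/
theorem exists_planeCurve {t y : K} (ht : Transcendental ℂ t) (hfin : Module.Finite ℂ⟮t⟯ K)
    (hgen : ∀ L : IntermediateField ℂ K, t ∈ L → y ∈ L → L = ⊤) :
    ∃ (Γ : PlaneCurve) (φ : Γ.FunctionField ≃ₐ[ℂ] K), φ Γ.fst = t ∧ φ Γ.snd = y ∧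
      Γ.poly.natDegree = Module.finrank ℂ⟮t⟯ K ∧
      Γ.poly.eval₂ (aeval t : ℂ[X] →ₐ[ℂ] K).toRingHom y = 0 := by
  let ι : RatFunc ℂ →ₐ[ℂ] K :=
    (ℂ⟮t⟯.val).comp (RatFunc.algEquivOfTranscendental t ht).toAlgHom
  have hι : ∀ g : ℂ[X], ι (algebraMap ℂ[X] (RatFunc ℂ) g) = aeval t g := by
    intro g
    simp [ι, aeval_def, eval₂_eq_sum_range]
  let _ : Algebra (RatFunc ℂ) K := ι.toRingHom.toAlgebra
  have hιa : algebraMap (RatFunc ℂ) K = ι.toRingHom := rfl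
  have hrank : Module.finrank (RatFunc ℂ) K = Module.finrank ℂ⟮t⟯ K :=
    Algebra.finrank_eq_of_equiv_equiv (RatFunc.algEquivOfTranscendental t ht).toRingEquiv
      (RingEquiv.refl K) (by ext; rfl)
  have hint : IsIntegral (RatFunc ℂ) y := by
    have h0 : IsIntegral ℂ⟮t⟯ y := Algebra.IsIntegral.isIntegral y
    obtain ⟨p, hp, hp0⟩ := h0
    refine ⟨p.map (RatFunc.algEquivOfTranscendental t ht).symm.toRingEquiv.toRingHom, hp.map _, ?_⟩
    rw [eval₂_map, ← hp0]
    congr 1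
    ext a
    change ι ((RatFunc.algEquivOfTranscendental t ht).symm a) = a
    simp [ι]
  let ev : ℂ[X][Y] →+* K := eval₂RingHom (aeval t : ℂ[X] →ₐ[ℂ] K).toRingHom y
  have hev : ∀ P : ℂ[X][Y], ev P = aeval y (P.map (algebraMap ℂ[X] (RatFunc ℂ))) := by
    intro P
    rw [aeval_def, eval₂_map]
    change eval₂ _ _ _ = _
    congr 1
    ext g
    · exact (hι _).symm
    · exact (hι _).symm
  have hevC : ∀ g : ℂ[X], ev (C g) = aeval t g := fun g => eval₂_C _ _
  -- The kernel contains the minimal polynomial of `y` over `ℂ(t)` after its denominators are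
  -- cleared. A nonzero prime ideal of the factorial ring `ℂ[X][Y]` then contains a prime element,
  -- which is the equation of the curve.
  have hker : RingHom.ker ev ≠ ⊥ := by
    obtain ⟨b, hbM, hb⟩ := IsLocalization.integerNormalization_spec (nonZeroDivisors ℂ[X])
      (minpoly (RatFunc ℂ) y)
    intro hbot
    have hmem : IsLocalization.integerNormalization (nonZeroDivisors ℂ[X]) (minpoly (RatFunc ℂ) y) ∈
        RingHom.ker ev := by
      rw [RingHom.mem_ker, hev, hb]
      simp [Algebra.smul_def]
    rw [hbot, Ideal.mem_bot] at hmem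
    rw [hmem, Polynomial.map_zero] at hb
    have hb0 : (algebraMap ℂ[X] (RatFunc ℂ) b) ≠ 0 :=
      RatFunc.algebraMap_ne_zero (nonZeroDivisors.ne_zero hbM)
    have hm0 := minpoly.ne_zero hint
    rw [Algebra.smul_def] at hb
    rcases mul_eq_zero.1 hb.symm with h | h
    · apply hb0
      have : algebraMap ℂ[X] (RatFunc ℂ)[X] b = C (algebraMap ℂ[X] (RatFunc ℂ) b) := rfl
      rw [this] at h
      exact C_eq_zero.1 h
    · exact hm0 h
  obtain ⟨P, hPmem, hP⟩ := Ideal.IsPrime.exists_mem_prime_of_ne_bot (RingHom.ker_isPrime ev) hker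
  rw [RingHom.mem_ker] at hPmem
  have hPirr := hP.irreducible
  have hdeg : P.natDegree ≠ 0 := by
    intro h0
    obtain ⟨g, rfl⟩ := natDegree_eq_zero.1 h0
    rw [hevC] at hPmem
    exact hP.ne_zero (by rw [(transcendental_iff.1 ht) g hPmem, C_0])
  have hprim : P.IsPrimitive := hPirr.isPrimitive hdeg
  -- Gauss's lemma: `P` stays irreducible over `ℂ(t)`, so it is the minimal polynomial of `y` up to
  -- a constant. This gives the degree of the curve and, with primitivity, the injectivity below.
  have hirr : Irreducible (P.map (algebraMap ℂ[X] (RatFunc ℂ))) :=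
    (hprim.irreducible_iff_irreducible_map_fraction_map).1 hPirr
  have hmin := minpoly.eq_of_irreducible hirr (by rw [← hev]; exact hPmem)
  have hinj := RatFunc.algebraMap_injective ℂ
  have hnat : P.natDegree = (minpoly (RatFunc ℂ) y).natDegree := by
    rw [← hmin, natDegree_mul_C (inv_ne_zero (leadingCoeff_ne_zero.2 hirr.ne_zero)),
      natDegree_map_eq_of_injective hinj]
  have htop : (RatFunc ℂ)⟮y⟯ = ⊤ := by
    rw [eq_top_iff]
    intro k _
    let L : IntermediateField ℂ K :=
      { (RatFunc ℂ)⟮y⟯ with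
        algebraMap_mem' := fun c => by
          have := ((RatFunc ℂ)⟮y⟯).algebraMap_mem (algebraMap ℂ (RatFunc ℂ) c)
          rwa [hιa, show ι.toRingHom (algebraMap ℂ (RatFunc ℂ) c) = algebraMap ℂ K c from
            ι.commutes c] at this }
    have hL := hgen L (by
      have := ((RatFunc ℂ)⟮y⟯).algebraMap_mem (algebraMap ℂ[X] (RatFunc ℂ) X)
      rwa [hιa, show ι.toRingHom (algebraMap ℂ[X] (RatFunc ℂ) X) = t from (hι X).trans (aeval_X t)]
        at this) (IntermediateField.mem_adjoin_simple_self _ y)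
    have : k ∈ L := by rw [hL]; trivial
    exact this
  have hnat2 : P.natDegree = Module.finrank ℂ⟮t⟯ K := by
    rw [hnat, ← IntermediateField.adjoin.finrank hint, htop, IntermediateField.finrank_top', hrank]
  obtain ⟨Γ, rfl⟩ : ∃ Γ : PlaneCurve, Γ.poly = P := ⟨⟨P, hPirr⟩, rfl⟩
  let f₀ : AdjoinRoot Γ.poly →ₐ[ℂ] K :=
    { AdjoinRoot.lift (aeval t : ℂ[X] →ₐ[ℂ] K).toRingHom y hPmem with
      commutes' := fun c => by
        change AdjoinRoot.lift (aeval t : ℂ[X] →ₐ[ℂ] K).toRingHom y hPmem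
          (AdjoinRoot.of _ (C c)) = _
        exact (AdjoinRoot.lift_of hPmem).trans (by simp) }
  have hf₀ : ∀ Q, f₀ (AdjoinRoot.mk Γ.poly Q) = ev Q := fun Q => AdjoinRoot.lift_mk hPmem Q
  have hf₀inj : Function.Injective f₀ := by
    rw [injective_iff_map_eq_zero]
    intro a ha
    obtain ⟨Q, rfl⟩ := AdjoinRoot.mk_surjective a
    rw [hf₀, hev] at ha
    rw [AdjoinRoot.mk_eq_zero]
    refine hprim.dvd_of_fraction_map_dvd_fraction_map (K := RatFunc ℂ) ?_
    have := minpoly.dvd _ _ ha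
    rw [← hmin] at this
    exact (dvd_mul_right _ _).trans this
  have hunit : ∀ r : nonZeroDivisors (AdjoinRoot Γ.poly), IsUnit (f₀ r) := fun r =>
    isUnit_iff_ne_zero.2 ((map_ne_zero_iff f₀ hf₀inj).2 (nonZeroDivisors.ne_zero r.2))
  let f : Γ.FunctionField →ₐ[ℂ] K :=
    IsLocalization.liftAlgHom (M := nonZeroDivisors (AdjoinRoot Γ.poly)) (f := f₀) hunit
  have hfa : ∀ a : AdjoinRoot Γ.poly, f (algebraMap _ Γ.FunctionField a) = f₀ a := fun a =>
    IsLocalization.lift_eq (M := nonZeroDivisors (AdjoinRoot Γ.poly)) (S := Γ.FunctionField)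
      (g := f₀.toRingHom) hunit a
  have hfst : f Γ.fst = t := by
    rw [PlaneCurve.fst, hfa]
    exact (AdjoinRoot.lift_of hPmem).trans (aeval_X t)
  have hsnd : f Γ.snd = y := by
    rw [PlaneCurve.snd, hfa]
    exact AdjoinRoot.lift_root hPmem
  have hsurj : Function.Surjective f := by
    rw [← AlgHom.fieldRange_eq_top]
    exact hgen _ ⟨_, hfst⟩ ⟨_, hsnd⟩
  exact ⟨Γ, AlgEquiv.ofBijective f ⟨f.injective, hsurj⟩, hfst, hsnd, hnat2, hPmem⟩

end FunctionFields

end PainleveVI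

namespace PainleveVI

open Polynomial
open scoped Polynomial.Bivariate IntermediateField Topology

/-! ### The degree of `t`, and generators of the function field -/

section Generation

theorem finrank_adjoin_of_sq_mem {E K : Type*} [Field E] [Field K] [Algebra E K] {k : K} {a : E}
    (hk : ∀ e : E, algebraMap E K e ≠ k) (ha : k ^ 2 = algebraMap E K a) :
    Module.finrank E E⟮k⟯ = 2 := by
  have hm : (X ^ 2 - C a : E[X]).Monic := monic_X_pow_sub_C a two_ne_zero
  have h0 : aeval k (X ^ 2 - C a : E[X]) = 0 := by simp [ha]
  have hirr : Irreducible (X ^ 2 - C a : E[X]) := by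
    refine X_pow_sub_C_irreducible_of_prime Nat.prime_two ?_
    rintro r rfl
    have : (k - algebraMap E K r) * (k + algebraMap E K r) = 0 := by
      rw [map_pow] at ha; linear_combination ha
    rcases mul_eq_zero.1 this with h | h
    · exact hk r (sub_eq_zero.1 h).symm
    · exact hk (-r) (by rw [map_neg]; linear_combination -h)
  have hmin := minpoly.eq_of_irreducible_of_monic hirr h0 hm
  rw [IntermediateField.adjoin.finrank ⟨_, hm, h0⟩, ← hmin, natDegree_X_pow_sub_C]

theorem relfinrank_eq_two {F K : Type*} [Field F] [Field K] [Algebra F K]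
    {A B : IntermediateField F K} (hAB : A ≤ B) {k : K} (hk : k ∉ A) (hk2 : k ^ 2 ∈ A)
    (hkB : k ∈ B) (hB : ∀ L : IntermediateField F K, A ≤ L → k ∈ L → B ≤ L) :
    A.relfinrank B = 2 := by
  have h2 := finrank_adjoin_of_sq_mem (E := A) (k := k) (a := ⟨k ^ 2, hk2⟩)
    (fun e he => hk (he ▸ e.2)) rfl
  rw [IntermediateField.relfinrank_eq_finrank_of_le hAB, ← h2]
  have e : IntermediateField.extendScalars hAB = A⟮k⟯ := by
    apply le_antisymm
    · exact hB (A⟮k⟯.restrictScalars F) (fun a ha => A⟮k⟯.algebraMap_mem ⟨a, ha⟩)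
        (IntermediateField.mem_adjoin_simple_self A k)
    · rw [IntermediateField.adjoin_simple_le_iff]
      exact hkB
  rw [e]

theorem isCoprime_of_eval {p q : ℂ[X]} (h : ∀ a : ℂ, q.eval a = 0 → p.eval a ≠ 0) :
    IsCoprime p q := by
  rw [isCoprime_iff_aeval_ne_zero_of_isAlgClosed ℂ ℂ]
  intro a
  simp only [coe_aeval_eq_eval]
  by_cases hq : q.eval a = 0
  · exact Or.inl (h a hq)
  · exact Or.inr hq

theorem isCoprime_tNumPoly_sq_tSqDen : IsCoprime (tNumPoly ^ 2) tSqDen := by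
  refine IsCoprime.pow_left (isCoprime_of_eval fun a h0 h4 => ?_)
  have h5 : a = 0 ∨ a - 1 = 0 ∨ quadPoly.eval a = 0 := by
    have : tSqDen.eval a = 2916 * a ^ 5 * (a - 1) ^ 2 * quadPoly.eval a ^ 3 := by simp [tSqDen]
    rw [this] at h0
    simp only [mul_eq_zero, pow_eq_zero_iff, OfNat.ofNat_ne_zero, not_false_eq_true, ne_eq,
      false_or] at h0
    tauto
  rcases h5 with h5 | h5 | h5
  · rw [h5] at h4; simp [tNumPoly] at h4
  · rw [sub_eq_zero] at h5; rw [h5] at h4; norm_num [tNumPoly] at h4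
  · have := congrArg (eval a) bezout_tNumPoly_quadPoly
    rw [eval_add, eval_mul, eval_mul, h4, h5] at this
    simp at this

noncomputable section

/-- The numerator of `(y - 1/2)²` is the square of this polynomial. -/
def yNumPoly : ℂ[X] := 8 * X ^ 7 - 28 * X ^ 6 + 75 * X ^ 5 + 31 * X ^ 4 - 269 * X ^ 3
  + 318 * X ^ 2 - 166 * X + 56

/-- The polynomial `3 s³ - 4 s² + 4 s + 2`. -/
def cubicDen : ℂ[X] := 3 * X ^ 3 - 4 * X ^ 2 + 4 * X + 2

/-- The denominator of `(y - 1/2)²`. -/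
def ySqDen : ℂ[X] := 324 * X * (X - 1) ^ 2 * quadPoly * cubicDen ^ 2

/-- The numerator of `(y - t)² / (t (t - 1))`. -/
def diffNum : ℂ[X] := (2 * X ^ 2 + X + 2) * (X - 2) ^ 3 * (6 * X ^ 2 - 2 * X + 1) ^ 2

/-- The denominator of `(y - t)² / (t (t - 1))`. -/
def diffDen : ℂ[X] := 4 * (X ^ 2 - 7 * X + 1) * cubicDen ^ 2 * (2 * X - 1)

end

theorem isCoprime_yNumPoly_sq_ySqDen : IsCoprime (yNumPoly ^ 2) ySqDen := by
  refine IsCoprime.pow_left (isCoprime_of_eval fun a h0 h4 => ?_)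
  have h5 : a = 0 ∨ a - 1 = 0 ∨ 8 * a ^ 2 - 11 * a + 8 = 0 ∨
      3 * a ^ 3 - 4 * a ^ 2 + 4 * a + 2 = 0 := by
    simp only [ySqDen, quadPoly, cubicDen, eval_mul, eval_pow, eval_sub, eval_add, eval_X,
      eval_ofNat, eval_one, mul_eq_zero, pow_eq_zero_iff, OfNat.ofNat_ne_zero, not_false_eq_true,
      ne_eq, false_or] at h0
    tauto
  simp only [yNumPoly, eval_mul, eval_pow, eval_sub, eval_add, eval_X, eval_ofNat] at h4
  rcases h5 with h5 | h5 | h5 | h5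
  · rw [h5] at h4; norm_num at h4
  · rw [sub_eq_zero] at h5; rw [h5] at h4; norm_num at h4
  -- The cofactors here and in the cases below are Bézout relations between the numerator and a
  -- single factor of the denominator.
  · have : (437400 : ℂ) = 0 := by
      linear_combination (5111 + 3032 * a) * h4 + (18898 + 110814 * a - 6777 * a ^ 2
        - 68797 * a ^ 3 - 5673 * a ^ 4 + 1332 * a ^ 5 - 3032 * a ^ 6) * h5
    norm_num at this
  · have : (328050 : ℂ) = 0 := by
      linear_combination (1763 - 466 * a + 678 * a ^ 2) * h4 + (114661 - 69945 * a + 31233 * a ^ 2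
        - 6856 * a ^ 3 - 16710 * a ^ 4 + 5160 * a ^ 5 - 1808 * a ^ 6) * h5
    norm_num at this

theorem isCoprime_diffNum_diffDen : IsCoprime diffNum diffDen := by
  refine isCoprime_of_eval fun a h0 h4 => ?_
  have h5 : a ^ 2 - 7 * a + 1 = 0 ∨ 3 * a ^ 3 - 4 * a ^ 2 + 4 * a + 2 = 0 ∨ 2 * a - 1 = 0 := by
    simp only [diffDen, cubicDen, eval_mul, eval_pow, eval_sub, eval_add, eval_X,
      eval_ofNat, eval_one, mul_eq_zero, pow_eq_zero_iff, OfNat.ofNat_ne_zero, not_false_eq_true,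
      ne_eq, false_or] at h0
    tauto
  have h6 : 2 * a ^ 2 + a + 2 = 0 ∨ a - 2 = 0 ∨ 6 * a ^ 2 - 2 * a + 1 = 0 := by
    simp only [diffNum, eval_mul, eval_pow, eval_sub, eval_add, eval_X,
      eval_ofNat, eval_one, mul_eq_zero, pow_eq_zero_iff, OfNat.ofNat_ne_zero, not_false_eq_true,
      ne_eq] at h4
    tauto
  rcases h6 with h6 | h6 | h6
  · rcases h5 with h5 | h5 | h5
    · have : (15 : ℂ) = 0 := by linear_combination (7 - a) * h6 + (1 + 2 * a) * h5
      norm_num at this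
    · have : (30 : ℂ) = 0 := by
        linear_combination (12 - 10 * a + 3 * a ^ 2) * h6 + (3 - 2 * a) * h5
      norm_num at this
    · have : (3 : ℂ) = 0 := by linear_combination h6 - (a + 1) * h5
      norm_num at this
  · rw [sub_eq_zero] at h6; subst h6; norm_num at h5
  · rcases h5 with h5 | h5 | h5
    · have : (45 : ℂ) = 0 := by linear_combination (55 - 8 * a) * h6 + (-10 + 48 * a) * h5
      norm_num at this
    · have : (45 : ℂ) = 0 := by
        linear_combination (13 - 14 * a + 6 * a ^ 2) * h6 + (16 - 12 * a) * h5
      norm_num at this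
    · have : (3 : ℂ) / 2 = 0 := by linear_combination h6 - (3 * a + 1 / 2) * h5
      norm_num at this

theorem natDegree_yNumPoly : yNumPoly.natDegree = 7 := by unfold yNumPoly; compute_degree!

theorem natDegree_ySqDen_le : ySqDen.natDegree ≤ 11 := by
  unfold ySqDen quadPoly cubicDen; compute_degree

theorem natDegree_diffNum : diffNum.natDegree = 9 := by
  have h1 : (2 * X ^ 2 + X + 2 : ℂ[X]).natDegree = 2 := by compute_degree!
  have h2 : (X - 2 : ℂ[X]).natDegree = 1 := natDegree_X_sub_C 2
  have h3 : (6 * X ^ 2 - 2 * X + 1 : ℂ[X]).natDegree = 2 := by compute_degree!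
  have n1 : (2 * X ^ 2 + X + 2 : ℂ[X]) ≠ 0 := by intro h; simp [h] at h1
  have n2 : (X - 2 : ℂ[X]) ≠ 0 := by intro h; simp [h] at h2
  have n3 : (6 * X ^ 2 - 2 * X + 1 : ℂ[X]) ≠ 0 := by intro h; simp [h] at h3
  unfold diffNum
  rw [natDegree_mul (mul_ne_zero n1 (pow_ne_zero _ n2)) (pow_ne_zero _ n3),
    natDegree_mul n1 (pow_ne_zero _ n2), natDegree_pow, natDegree_pow, h1, h2, h3]

theorem natDegree_diffDen_le : diffDen.natDegree ≤ 9 := by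
  unfold diffDen cubicDen; compute_degree

variable {K : Type*} [Field K] [Algebra ℂ K] {s u : K}

/-- The function field of the curve is generated by the point `(s, u)`, and `s`, `u` satisfy no
other relation than the equation of the curve. -/
structure IsFunctionField (s u : K) : Prop extends GenericPoint s u where
  eq_zero : ∀ p q : ℂ[X], aeval s p + aeval s q * u = 0 → p = 0 ∧ q = 0
  exists_eq : ∀ k : K, ∃ p q r : ℂ[X], aeval s r ≠ 0 ∧ k = (aeval s p + aeval s q * u) / aeval s r

namespace IsFunctionField

variable (h : IsFunctionField s u)
include h

theorem aeval_ne_zero {p : ℂ[X]} (hp : p ≠ 0) : aeval s p ≠ 0 := fun h0 =>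
  hp (h.eq_zero p 0 (by simp [h0])).1

theorem transcendental_s : Transcendental ℂ s := by
  rw [transcendental_iff]
  intro p hp
  by_contra h0
  exact h.aeval_ne_zero h0 hp

theorem u_notMem : u ∉ ℂ⟮s⟯ := by
  intro hu
  obtain ⟨p, q, e⟩ := (IntermediateField.mem_adjoin_simple_iff ℂ u).1 hu
  by_cases hq : aeval s q = 0
  · rw [hq, div_zero] at e; exact h.u0 e
  · rw [eq_div_iff hq] at e
    have := (h.eq_zero p (-q) (by rw [← e, map_neg]; ring)).2
    rw [neg_eq_zero] at this
    exact hq (by simp [this])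

omit h in
theorem s_mem : s ∈ ℂ⟮s⟯ := IntermediateField.mem_adjoin_simple_self ℂ s

omit h in
theorem aeval_mem (p : ℂ[X]) : aeval s p ∈ ℂ⟮s⟯ := by
  rw [IntermediateField.mem_adjoin_simple_iff]
  exact ⟨p, 1, by simp⟩

theorem eq_top {L : IntermediateField ℂ K} (hs : s ∈ L) (hu : u ∈ L) : L = ⊤ := by
  rw [eq_top_iff]
  intro k _
  obtain ⟨p, q, r, -, rfl⟩ := h.exists_eq k
  have hle : ℂ⟮s⟯ ≤ L := IntermediateField.adjoin_simple_le_iff.2 hs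
  exact div_mem (add_mem (hle (aeval_mem p)) (mul_mem (hle (aeval_mem q)) hu))
    (hle (aeval_mem r))

variable [CharZero K]

omit [CharZero K] h in
theorem tOdd_mem : tOdd s ∈ ℂ⟮s⟯ := by
  have e : tOdd s = aeval s tNumPoly / aeval s (54 * X ^ 3 * (X - 1) * quadPoly ^ 2) := by
    rw [aeval_tNumPoly, tOdd]
    congr 1
    simp [aeval_quadPoly, map_ofNat]
  rw [e]
  exact div_mem (aeval_mem _) (aeval_mem _)

theorem tOdd_ne_zero : tOdd s ≠ 0 := by
  have h1 : aeval s tNumPoly ≠ 0 := h.aeval_ne_zero tNumPoly_ne_zero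
  rw [aeval_tNumPoly] at h1
  unfold tOdd
  simp only [ne_eq, div_eq_zero_iff, mul_eq_zero, pow_eq_zero_iff, OfNat.ofNat_ne_zero,
    not_false_eq_true, h.s0, h.s1, h.q0, h1, or_self]

omit [CharZero K] h in
theorem half_mem (L : IntermediateField ℂ K) : (1 / 2 : K) ∈ L := by
  have := L.algebraMap_mem (1 / 2)
  rwa [map_div₀, map_one, map_ofNat] at this

/-- Two towers over `ℂ((t - 1/2)²)` are compared. Through `ℂ(s)` the degree is `18 * 2`; through
`ℂ(t)` the first step has degree `2`, because `t - 1/2` is `u` times a nonzero function of `s` and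
so is not in `ℂ(s)`. -/
theorem finrank_t : Module.finrank ℂ⟮tOf s u⟯ K = 18 := by
  set τ := aeval s (tNumPoly ^ 2) / aeval s tSqDen with hτ
  have hQ := h.aeval_ne_zero tSqDen_ne_zero
  have eτ : (tOf s u - 1 / 2) ^ 2 = τ := by
    rw [hτ, eq_div_iff hQ, h.sub_half_sq, map_pow]
  have h18 : (ℂ⟮τ⟯).relfinrank ℂ⟮s⟯ = 18 := by
    rw [hτ, relfinrank_adjoin_div h.transcendental_s isCoprime_tNumPoly_sq_tSqDen tSqDen_ne_zero,
      natDegree_pow, natDegree_tNumPoly, natDegree_tSqDen]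
    rfl
  have hτs : ℂ⟮τ⟯ ≤ ℂ⟮s⟯ :=
    IntermediateField.adjoin_simple_le_iff.2 (div_mem (aeval_mem _) (aeval_mem _))
  have h2 : Module.finrank ℂ⟮s⟯ K = 2 := by
    rw [← IntermediateField.relfinrank_top_right]
    refine relfinrank_eq_two le_top h.u_notMem ?_ trivial fun L hs hu => ?_
    · rw [h.curve, ← aeval_quadPoly]
      exact mul_mem s_mem (aeval_mem _)
    · rw [h.eq_top (hs s_mem) hu]
  have htm : tOf s u ∈ ℂ⟮tOf s u⟯ := IntermediateField.mem_adjoin_simple_self _ _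
  have hτt : ℂ⟮τ⟯ ≤ ℂ⟮tOf s u⟯ :=
    IntermediateField.adjoin_simple_le_iff.2 (by
      rw [← eτ]
      exact pow_mem (sub_mem htm (half_mem _)) 2)
  have h2' : (ℂ⟮τ⟯).relfinrank ℂ⟮tOf s u⟯ = 2 := by
    have hnot : tOf s u - 1 / 2 ∉ ℂ⟮τ⟯ := by
      intro hm
      have hm' := hτs hm
      rw [h.t_eq, add_sub_cancel_left] at hm'
      apply h.u_notMem
      have := div_mem hm' tOdd_mem
      rwa [mul_div_cancel_right₀ _ h.tOdd_ne_zero] at this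
    refine relfinrank_eq_two hτt hnot ?_ (sub_mem htm (half_mem _)) fun L _ hL => ?_
    · rw [eτ]; exact IntermediateField.mem_adjoin_simple_self _ _
    · rw [IntermediateField.adjoin_simple_le_iff]
      have := add_mem hL (half_mem _)
      rwa [sub_add_cancel] at this
  have a1 := IntermediateField.relfinrank_mul_finrank_top hτs
  have a2 := IntermediateField.relfinrank_mul_finrank_top hτt
  rw [h18, h2] at a1
  rw [h2', ← a1] at a2
  omega

theorem finite_t : Module.Finite ℂ⟮tOf s u⟯ K :=
  Module.finite_of_finrank_pos (by rw [h.finrank_t]; norm_num)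

theorem transcendental_t : Transcendental ℂ (tOf s u) := by
  intro halg
  have h1 := h.finite_t
  have h2 : Algebra.IsAlgebraic ℂ ℂ⟮tOf s u⟯ :=
    IntermediateField.isAlgebraic_adjoin_simple halg.isIntegral
  have h3 : Algebra.IsAlgebraic ℂ K := Algebra.IsAlgebraic.trans ℂ ℂ⟮tOf s u⟯ K
  exact h.transcendental_s (h3.isAlgebraic s)

/-- The function field is generated by `t` and `y`. -/
theorem eq_top_of_t_y {L : IntermediateField ℂ K} (ht : tOf s u ∈ L) (hy : yOf s u ∈ L) :
    L = ⊤ := by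
  have hyd : ySqDen ≠ 0 := by
    intro h0
    have := isCoprime_yNumPoly_sq_ySqDen
    rw [h0, isCoprime_zero_right] at this
    have := natDegree_eq_zero_of_isUnit this
    rw [natDegree_pow, natDegree_yNumPoly] at this
    omega
  have hdd : diffDen ≠ 0 := by
    intro h0
    have := isCoprime_diffNum_diffDen
    rw [h0, isCoprime_zero_right] at this
    have := natDegree_eq_zero_of_isUnit this
    rw [natDegree_diffNum] at this
    omega
  have hA : aeval s (yNumPoly ^ 2) / aeval s ySqDen ∈ L := by
    have e : (yOf s u - 1 / 2) ^ 2 = aeval s (yNumPoly ^ 2) / aeval s ySqDen := by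
      rw [h.y_eq, add_sub_cancel_left, mul_pow, h.curve, yOdd, yNum]
      simp only [yNumPoly, ySqDen, quadPoly, cubicDen, map_sub, map_add, map_mul, map_pow,
        aeval_X, map_ofNat, map_one]
      have s0 := h.s0
      have s1 := h.s1
      have q0 := h.q0
      have c3 := h.c3
      generalize 8 * s ^ 2 - 11 * s + 8 = q at *
      generalize 3 * s ^ 3 - 4 * s ^ 2 + 4 * s + 2 = c at *
      generalize 8 * s ^ 7 - 28 * s ^ 6 + 75 * s ^ 5 + 31 * s ^ 4 - 269 * s ^ 3
        + 318 * s ^ 2 - 166 * s + 56 = N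
      field_simp
      norm_num
    rw [← e]
    exact pow_mem (sub_mem hy (half_mem _)) 2
  have hB : aeval s diffNum / aeval s diffDen ∈ L := by
    have e : (yOf s u - tOf s u) ^ 2 / (tOf s u * (tOf s u - 1)) =
        aeval s diffNum / aeval s diffDen := by
      have e1 : (yOf s u - tOf s u) ^ 2 = s * (8 * s ^ 2 - 11 * s + 8) * (yOdd s - tOdd s) ^ 2 := by
        rw [h.y_eq, h.t_eq, ← h.curve]; ring
      have e2 : tOf s u * (tOf s u - 1) = s * (8 * s ^ 2 - 11 * s + 8) * tOdd s ^ 2 - 1 / 4 := by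
        rw [h.t_eq, ← h.curve]; ring
      rw [e1, e2, h.yOdd_sub_tOdd, h.tOdd_sq]
      simp only [diffNum, diffDen, cubicDen, map_sub, map_add, map_mul, map_pow,
        aeval_X, map_ofNat, map_one]
      have s0 := h.s0
      have s1 := h.s1
      have s2 := h.s2
      have s3 := h.s3
      have q0 := h.q0
      have c3 := h.c3
      have b0 := h.b0
      have c0 := h.c0
      generalize 8 * s ^ 2 - 11 * s + 8 = q at *
      generalize 3 * s ^ 3 - 4 * s ^ 2 + 4 * s + 2 = c at *
      generalize 2 * s ^ 2 + s + 2 = b at *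
      generalize s ^ 2 - 7 * s + 1 = d at *
      generalize 2 * s - 1 = e at *
      generalize 6 * s ^ 2 - 2 * s + 1 = f at *
      field_simp
      ring
    rw [← e]
    exact div_mem (pow_mem (sub_mem hy ht) 2) (mul_mem ht (sub_mem ht (one_mem _)))
  -- The degree of `ℂ(s)` over its intersection with `L` divides the degree in `s` of every
  -- nonconstant function of `s` in `L`. The functions `(y - 1/2)²` and `(y - t)²/(t(t - 1))` have
  -- degrees `14` and `9`, so `s` lies in `L`, and then `u` does as the quotient of `t - 1/2` by
  -- `tOdd s`.
  have d1 : L.relfinrank ℂ⟮s⟯ ∣ 14 := by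
    have := IntermediateField.relfinrank_dvd_of_le_left ℂ⟮s⟯
      (IntermediateField.adjoin_simple_le_iff.2 hA)
    rw [relfinrank_adjoin_div h.transcendental_s isCoprime_yNumPoly_sq_ySqDen hyd, natDegree_pow,
      natDegree_yNumPoly, max_eq_left (natDegree_ySqDen_le.trans (by norm_num))] at this
    exact this
  have d2 : L.relfinrank ℂ⟮s⟯ ∣ 9 := by
    have := IntermediateField.relfinrank_dvd_of_le_left ℂ⟮s⟯
      (IntermediateField.adjoin_simple_le_iff.2 hB)
    rw [relfinrank_adjoin_div h.transcendental_s isCoprime_diffNum_diffDen hdd, natDegree_diffNum,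
      max_eq_left natDegree_diffDen_le] at this
    exact this
  have d3 : L.relfinrank ℂ⟮s⟯ = 1 := Nat.dvd_one.1 ((Nat.dvd_gcd d1 d2).trans (by norm_num))
  have hs : ℂ⟮s⟯ ≤ L := IntermediateField.relfinrank_eq_one_iff.1 d3
  refine h.eq_top (hs s_mem) ?_
  have h1 : u * tOdd s ∈ L := by
    have := sub_mem ht (half_mem L)
    rwa [h.t_eq, add_sub_cancel_left] at this
  have := div_mem h1 (hs tOdd_mem)
  rwa [mul_div_cancel_right₀ _ h.tOdd_ne_zero] at this

end IsFunctionField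

end Generation

namespace Elliptic

theorem isFunctionField : IsFunctionField s u where
  toGenericPoint := genericPoint
  eq_zero _ _ h := aeval_s_add_mul_u_eq_zero h
  exists_eq k := by
    obtain ⟨p, q, r, hr, h⟩ := exists_eq_div k
    exact ⟨p, q, r, aeval_s_ne_zero hr, h⟩

end Elliptic

/-- The explicit functions form an algebraic solution. -/
theorem explicitSolution_isAlgebraicSolution : explicitSolution.IsAlgebraicSolution where
  transcendental := Elliptic.isFunctionField.transcendental_t
  finite := Elliptic.isFunctionField.finite_t
  belyi := Elliptic.isBelyi
  solves := by
    obtain ⟨D, hD, hs⟩ := Elliptic.exists_derivation_t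
    exact ⟨D, hD, Elliptic.genericPoint.solvesPVI D hs⟩

end PainleveVI

namespace PainleveVI

open Polynomial
open scoped Polynomial.Bivariate IntermediateField Topology

/-! ### Values of functions at points of the curve -/

noncomputable section

/-- A square root of `-3`. -/
def ω : ℂ := (√3 : ℝ) * Complex.I

theorem ω_sq : ω ^ 2 = -3 := by
  unfold ω
  rw [mul_pow, Complex.I_sq, ← Complex.ofReal_pow, Real.sq_sqrt (by norm_num)]
  norm_num

/-- The hypothesis concerns the norm `(a + bω)(a - bω)`. For rational `a` and `b` it reduces
nonvanishing to arithmetic. -/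
theorem add_mul_ω_ne_zero {a b : ℂ} (h : a ^ 2 + 3 * b ^ 2 ≠ 0) : a + b * ω ≠ 0 := by
  intro h0
  apply h
  linear_combination (a - b * ω) * h0 + b ^ 2 * ω_sq

theorem ω_ne_zero : ω ≠ 0 := by
  intro h
  have := ω_sq
  rw [h] at this
  norm_num at this

section EvalAt

variable {K : Type*} [Field K] [Algebra ℂ K] {s u : K} {a b : ℂ}

/-- The function `k` is regular at the point `(a, b)` of the curve, with value `c`. -/
def EvalAt (s u : K) (a b : ℂ) (k : K) (c : ℂ) : Prop :=
  ∃ p q p' q' : ℂ[X], p'.eval a + q'.eval a * b ≠ 0 ∧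
    k * (aeval s p' + aeval s q' * u) = aeval s p + aeval s q * u ∧
    c * (p'.eval a + q'.eval a * b) = p.eval a + q.eval a * b

theorem EvalAt.algebraMap (c : ℂ) : EvalAt s u a b (algebraMap ℂ K c) c :=
  ⟨C c, 0, 1, 0, by simp, by simp, by simp⟩

theorem EvalAt.fst : EvalAt s u a b s a := ⟨X, 0, 1, 0, by simp, by simp, by simp⟩

theorem EvalAt.snd : EvalAt s u a b u b := ⟨0, 1, 1, 0, by simp, by simp, by simp⟩

variable (h : IsFunctionField s u)
include h

/-- The representation of an element as `p(s) + q(s) u` is unique, so zero has only the zero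
representation. This is what makes values well defined. -/
theorem EvalAt.eq_zero {c : ℂ} (hc : EvalAt s u a b 0 c) : c = 0 := by
  obtain ⟨p, q, p', q', h0, h1, h2⟩ := hc
  rw [zero_mul] at h1
  obtain ⟨rfl, rfl⟩ := h.eq_zero p q h1.symm
  simp only [eval_zero, zero_mul, add_zero, mul_eq_zero, h0, or_false] at h2
  exact h2

theorem EvalAt.ne_zero {k : K} {c : ℂ} (hk : EvalAt s u a b k c) (hc : c ≠ 0) : k ≠ 0 := by
  rintro rfl
  exact hc (hk.eq_zero h)

theorem EvalAt.inv {k : K} {c : ℂ} (hk : EvalAt s u a b k c) (hc : c ≠ 0) :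
    EvalAt s u a b k⁻¹ c⁻¹ := by
  have hk0 := hk.ne_zero h hc
  obtain ⟨p, q, p', q', h0, h1, h2⟩ := hk
  refine ⟨p', q', p, q, ?_, ?_, ?_⟩
  · rw [← h2]; exact mul_ne_zero hc h0
  · rw [← h1, inv_mul_cancel_left₀ hk0]
  · rw [← h2, inv_mul_cancel_left₀ hc]

variable (hab : b ^ 2 = a * (8 * a ^ 2 - 11 * a + 8))
include hab

theorem EvalAt.mul {k l : K} {c d : ℂ} (hk : EvalAt s u a b k c) (hl : EvalAt s u a b l d) :
    EvalAt s u a b (k * l) (c * d) := by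
  obtain ⟨p, q, p', q', h0, h1, h2⟩ := hk
  obtain ⟨P, Q, P', Q', H0, H1, H2⟩ := hl
  obtain ⟨W, hw, hw'⟩ : ∃ W : ℂ[X], Polynomial.aeval s W = u ^ 2 ∧ W.eval a = b ^ 2 :=
    ⟨X * quadPoly, by rw [map_mul, aeval_X, aeval_quadPoly, h.curve], by rw [hab]; simp [quadPoly]⟩
  refine ⟨p * P + q * Q * W, p * Q + q * P, p' * P' + q' * Q' * W,
    p' * Q' + q' * P', ?_, ?_, ?_⟩
  · simp only [eval_add, eval_mul, hw']
    convert mul_ne_zero h0 H0 using 1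
    ring
  · simp only [map_add, map_mul, hw]
    linear_combination (l * (aeval s P' + aeval s Q' * u)) * h1
      + (aeval s p + aeval s q * u) * H1
  · simp only [eval_add, eval_mul, hw']
    linear_combination (d * (P'.eval a + Q'.eval a * b)) * h2
      + (p.eval a + q.eval a * b) * H2

theorem EvalAt.add {k l : K} {c d : ℂ} (hk : EvalAt s u a b k c) (hl : EvalAt s u a b l d) :
    EvalAt s u a b (k + l) (c + d) := by
  obtain ⟨p, q, p', q', h0, h1, h2⟩ := hk
  obtain ⟨P, Q, P', Q', H0, H1, H2⟩ := hl
  obtain ⟨W, hw, hw'⟩ : ∃ W : ℂ[X], Polynomial.aeval s W = u ^ 2 ∧ W.eval a = b ^ 2 :=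
    ⟨X * quadPoly, by rw [map_mul, aeval_X, aeval_quadPoly, h.curve], by rw [hab]; simp [quadPoly]⟩
  refine ⟨(p * P' + q * Q' * W) + (p' * P + q' * Q * W),
    (p * Q' + q * P') + (p' * Q + q' * P), p' * P' + q' * Q' * W,
    p' * Q' + q' * P', ?_, ?_, ?_⟩
  · simp only [eval_add, eval_mul, hw']
    convert mul_ne_zero h0 H0 using 1
    ring
  · simp only [map_add, map_mul, hw]
    linear_combination (aeval s P' + aeval s Q' * u) * h1
      + (aeval s p' + aeval s q' * u) * H1
  · simp only [eval_add, eval_mul, hw']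
    linear_combination (P'.eval a + Q'.eval a * b) * h2
      + (p'.eval a + q'.eval a * b) * H2

theorem EvalAt.sub {k l : K} {c d : ℂ} (hk : EvalAt s u a b k c) (hl : EvalAt s u a b l d) :
    EvalAt s u a b (k - l) (c - d) := by
  have := hk.add h hab ((EvalAt.algebraMap (-1)).mul h hab hl)
  rw [map_neg, map_one] at this
  convert this using 1 <;> ring

theorem EvalAt.unique {k : K} {c d : ℂ} (hk : EvalAt s u a b k c) (hl : EvalAt s u a b k d) :
    c = d := by
  have := hk.sub h hab hl
  rw [sub_self] at this
  exact sub_eq_zero.1 (this.eq_zero h)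

theorem EvalAt.div {k l : K} {c d : ℂ} (hk : EvalAt s u a b k c) (hl : EvalAt s u a b l d)
    (hd : d ≠ 0) : EvalAt s u a b (k / l) (c / d) := by
  rw [div_eq_mul_inv, div_eq_mul_inv]
  exact hk.mul h hab (hl.inv h hd)

theorem EvalAt.pow {k : K} {c : ℂ} (hk : EvalAt s u a b k c) (n : ℕ) :
    EvalAt s u a b (k ^ n) (c ^ n) := by
  induction n with
  | zero => simpa using EvalAt.algebraMap (s := s) (u := u) (a := a) (b := b) 1
  | succ n ih => rw [pow_succ, pow_succ]; exact ih.mul h hab hk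

theorem EvalAt.aeval {k : K} {c : ℂ} (hk : EvalAt s u a b k c) (p : ℂ[X]) :
    EvalAt s u a b (Polynomial.aeval k p) (p.eval c) := by
  induction p using Polynomial.induction_on' with
  | add p q hp hq => rw [map_add, eval_add]; exact hp.add h hab hq
  | monomial n r =>
    rw [aeval_monomial, eval_monomial]
    exact (EvalAt.algebraMap r).mul h hab (hk.pow h hab n)

/-- It carries the equation of a plane model from the function field to the values along a branch,
so that the germ built below satisfies `F = 0`. -/
theorem EvalAt.eval₂ {k l : K} {c d : ℂ} (hk : EvalAt s u a b k c) (hl : EvalAt s u a b l d)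
    (P : ℂ[X][Y]) :
    EvalAt s u a b (P.eval₂ (Polynomial.aeval k : ℂ[X] →ₐ[ℂ] K).toRingHom l) (P.evalEval c d) := by
  induction P using Polynomial.induction_on' with
  | add p q hp hq => rw [eval₂_add, evalEval_add]; exact hp.add h hab hq
  | monomial n r =>
    have e : (monomial n r : ℂ[X][Y]).evalEval c d = r.eval c * d ^ n := by
      rw [← C_mul_X_pow_eq_monomial]; simp [evalEval]
    rw [eval₂_monomial, e]
    exact (hk.aeval h hab r).mul h hab (hl.pow h hab n)

end EvalAt

/-! ### Analytic germs of functions along a branch of the curve -/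

section Expands

variable {K : Type*} [Field K] [Algebra ℂ K]

/-- The restriction of the function `k` to the branch `τ ↦ (σ τ, υ τ)` of the curve is analytic at
`t₀`, with value `c`, and the derivation `D` acts there as differentiation. -/
def Expands (s u : K) (D : Derivation ℂ K K) (σ υ : ℂ → ℂ) (t₀ : ℂ) (k : K) (c : ℂ) : Prop :=
  ∃ g : ℂ → ℂ, AnalyticAt ℂ g t₀ ∧ g t₀ = c ∧
    (∀ᶠ τ in 𝓝 t₀, EvalAt s u (σ τ) (υ τ) k (g τ)) ∧
    EvalAt s u (σ t₀) (υ t₀) (D k) (deriv g t₀)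

variable {s u : K} {D : Derivation ℂ K K} {σ υ : ℂ → ℂ} {t₀ : ℂ}

theorem Expands.algebraMap (c : ℂ) : Expands s u D σ υ t₀ (algebraMap ℂ K c) c :=
  ⟨fun _ => c, analyticAt_const, rfl, Filter.Eventually.of_forall fun _ => EvalAt.algebraMap c, by
    rw [D.map_algebraMap, deriv_const]
    simpa using EvalAt.algebraMap (s := s) (u := u) (a := σ t₀) (b := υ t₀) 0⟩

theorem Expands.congr {k : K} {c d : ℂ} (hk : Expands s u D σ υ t₀ k c) (e : c = d) :
    Expands s u D σ υ t₀ k d := e ▸ hk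

theorem Expands.evalAt {k : K} {c : ℂ} (hk : Expands s u D σ υ t₀ k c) :
    EvalAt s u (σ t₀) (υ t₀) k c := by
  obtain ⟨g, -, rfl, hg, -⟩ := hk
  exact hg.self_of_nhds

variable (h : IsFunctionField s u)
include h

/-- One nonzero value at one point shows that a function is not identically zero. All nondegeneracy
conditions of the chain of transformations are verified in this way. -/
theorem Expands.ne_zero {k : K} {c : ℂ} (hk : Expands s u D σ υ t₀ k c) (hc : c ≠ 0) : k ≠ 0 :=
  hk.evalAt.ne_zero h hc

variable (hc : ∀ᶠ τ in 𝓝 t₀, υ τ ^ 2 = σ τ * (8 * σ τ ^ 2 - 11 * σ τ + 8))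
include hc

theorem Expands.add {k l : K} {c d : ℂ} (hk : Expands s u D σ υ t₀ k c)
    (hl : Expands s u D σ υ t₀ l d) : Expands s u D σ υ t₀ (k + l) (c + d) := by
  obtain ⟨f, hf, rfl, hf1, hf2⟩ := hk
  obtain ⟨g, hg, rfl, hg1, hg2⟩ := hl
  refine ⟨fun τ => f τ + g τ, hf.add hg, rfl, ?_, ?_⟩
  · filter_upwards [hc, hf1, hg1] with τ h1 h2 h3 using h2.add h h1 h3
  · rw [map_add, deriv_fun_add hf.differentiableAt hg.differentiableAt]
    exact hf2.add h hc.self_of_nhds hg2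

theorem Expands.mul {k l : K} {c d : ℂ} (hk : Expands s u D σ υ t₀ k c)
    (hl : Expands s u D σ υ t₀ l d) : Expands s u D σ υ t₀ (k * l) (c * d) := by
  obtain ⟨f, hf, rfl, hf1, hf2⟩ := hk
  obtain ⟨g, hg, rfl, hg1, hg2⟩ := hl
  refine ⟨fun τ => f τ * g τ, hf.mul hg, rfl, ?_, ?_⟩
  · filter_upwards [hc, hf1, hg1] with τ h1 h2 h3 using h2.mul h h1 h3
  · rw [Derivation.leibniz, deriv_fun_mul hf.differentiableAt hg.differentiableAt, smul_eq_mul,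
      smul_eq_mul]
    have := (hf1.self_of_nhds.mul h hc.self_of_nhds hg2).add h hc.self_of_nhds
      (hg1.self_of_nhds.mul h hc.self_of_nhds hf2)
    convert this using 1
    ring

theorem Expands.sub {k l : K} {c d : ℂ} (hk : Expands s u D σ υ t₀ k c)
    (hl : Expands s u D σ υ t₀ l d) : Expands s u D σ υ t₀ (k - l) (c - d) := by
  have := hk.add h hc ((Expands.algebraMap (-1)).mul h hc hl)
  rw [map_neg, map_one] at this
  convert this using 1 <;> ring

theorem Expands.inv {k : K} {c : ℂ} (hk : Expands s u D σ υ t₀ k c) (h0 : c ≠ 0) :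
    Expands s u D σ υ t₀ k⁻¹ c⁻¹ := by
  obtain ⟨f, hf, rfl, hf1, hf2⟩ := hk
  refine ⟨fun τ => (f τ)⁻¹, hf.inv h0, rfl, ?_, ?_⟩
  · filter_upwards [hf1, hf.continuousAt.eventually_ne h0] with τ h1 h2 using h1.inv h h2
  · rw [Derivation.leibniz_inv, deriv_fun_inv'' hf.differentiableAt h0, smul_eq_mul]
    have h2 := (hf1.self_of_nhds.inv h h0).pow h hc.self_of_nhds 2
    have := ((EvalAt.algebraMap (-1)).mul h hc.self_of_nhds h2).mul h hc.self_of_nhds hf2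
    rw [map_neg, map_one] at this
    convert this using 1
    · ring
    · field_simp

/-- Division, with the value of the quotient given. -/
theorem Expands.div {k l : K} {c d e : ℂ} (hk : Expands s u D σ υ t₀ k c)
    (hl : Expands s u D σ υ t₀ l d) (hd : d ≠ 0) (he : e * d = c) :
    Expands s u D σ υ t₀ (k / l) e := by
  have := hk.mul h hc (hl.inv h hc hd)
  rw [← div_eq_mul_inv] at this
  refine this.congr ?_
  rw [← he]; field_simp

theorem Expands.pow {k : K} {c : ℂ} (hk : Expands s u D σ υ t₀ k c) (n : ℕ) :
    Expands s u D σ υ t₀ (k ^ n) (c ^ n) := by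
  induction n with
  | zero => simpa using Expands.algebraMap (s := s) (u := u) (D := D) (σ := σ) (υ := υ) 1
  | succ n ih => rw [pow_succ, pow_succ]; exact ih.mul h hc hk

theorem Expands.aeval {k : K} {c : ℂ} (hk : Expands s u D σ υ t₀ k c) (p : ℂ[X]) :
    Expands s u D σ υ t₀ (Polynomial.aeval k p) (p.eval c) := by
  induction p using Polynomial.induction_on' with
  | add p q hp hq => rw [map_add, eval_add]; exact hp.add h hc hq
  | monomial n r =>
    rw [aeval_monomial, eval_monomial]
    exact (Expands.algebraMap r).mul h hc (hk.pow h hc n)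

end Expands

end

end PainleveVI

namespace PainleveVI

open Polynomial
open scoped Polynomial.Bivariate IntermediateField Topology

/-! ### From `θ = (1, 1, 1, 1) / 3` to `θ = (0, 0, 0, -2/3)` -/

noncomputable section

section Chain

variable {K : Type*} [Field K] [Algebra ℂ K]

/-- The parameters `(1, 1, 1, 1) / 3`. -/
def thirds : Fin 4 → ℂ := ![1 / 3, 1 / 3, 1 / 3, 1 / 3]

/-- The conjugate variable of the explicit solution. -/
def xThirds (y p t : K) : K := conjugateVar thirds y p t

/-- Okamoto's transformation of the explicit solution, with parameters `-(1, 1, 1, 1) / 3`. -/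
def yNeg (y p t : K) : K := y + algebraMap ℂ K (2 / 3) / xThirds y p t

/-- The conjugate variable, after changing three of the signs. -/
def xDM (y p t : K) : K := xThirds y p t
  - algebraMap ℂ K (1 / 3) * (1 / yNeg y p t + 1 / (yNeg y p t - t) + 1 / (yNeg y p t - 1))

/-- The transform of the explicit solution with parameters `(0, 0, 0, -2/3)`. -/
def yDM (y p t : K) : K := yNeg y p t + algebraMap ℂ K (1 / 3) / xDM y p t

/-- The quantities that must not vanish along the chain of transformations. -/
structure NonDegenerate (y p t : K) : Prop where
  t0 : t ≠ 0
  t1 : t ≠ 1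
  x : xThirds y p t ≠ 0
  yNeg0 : yNeg y p t ≠ 0
  yNeg1 : yNeg y p t ≠ 1
  yNegt : yNeg y p t ≠ t
  xDM0 : xDM y p t ≠ 0
  yDM0 : yDM y p t ≠ 0
  yDM1 : yDM y p t ≠ 1
  yDMt : yDM y p t ≠ t

variable {D : Derivation ℂ K K} {y t : K} (hD : D t = 1) (h : SolvesPVI thirds D y t)
  (hn : NonDegenerate y (D y) t)
include hD h hn

theorem NonDegenerate.solves_yNeg :
    SolvesPVI ![-1 / 3, -1 / 3, -1 / 3, -1 / 3] D (yNeg y (D y) t) t ∧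
    conjugateVar ![-1 / 3, -1 / 3, -1 / 3, -1 / 3] (yNeg y (D y) t) (D (yNeg y (D y) t)) t =
      xThirds y (D y) t :=
  h.okamoto hD hn.t0 hn.t1 hn.x (e := 2 / 3)
    (by simp only [thirds, Matrix.cons_val_zero, Matrix.cons_val_one, Matrix.cons_val]; norm_num)
    (by intro i; fin_cases i <;> simp [thirds] <;> norm_num) rfl hn.yNeg0 hn.yNeg1 hn.yNegt

/-- Painlevé VI contains `θ₁, θ₂, θ₃` only through their squares, so `y` still solves it after the
changes of sign. The conjugate variable does see the signs, and shifts by the terms in `xDM`. -/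
theorem NonDegenerate.solves_yNeg' :
    SolvesPVI ![1 / 3, 1 / 3, 1 / 3, -1 / 3] D (yNeg y (D y) t) t ∧
    conjugateVar ![1 / 3, 1 / 3, 1 / 3, -1 / 3] (yNeg y (D y) t) (D (yNeg y (D y) t)) t =
      xDM y (D y) t := by
  obtain ⟨⟨h0, h1, ht, h2⟩, h3⟩ := hn.solves_yNeg hD h
  refine ⟨⟨h0, h1, ht, ?_⟩, ?_⟩
  · rw [h2]
    simp only [Matrix.cons_val_zero, Matrix.cons_val_one, Matrix.cons_val]
    norm_num
  · rw [xDM, ← h3]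
    have : CharZero K := charZero_of_injective_algebraMap (algebraMap ℂ K).injective
    simp only [conjugateVar, Matrix.cons_val_zero, Matrix.cons_val_one, Matrix.cons_val, map_div₀,
      map_neg, map_one, map_ofNat]
    ring

theorem NonDegenerate.solves_yDM :
    SolvesPVI ![0, 0, 0, -2 / 3] D (yDM y (D y) t) t ∧
    conjugateVar ![0, 0, 0, -2 / 3] (yDM y (D y) t) (D (yDM y (D y) t)) t = xDM y (D y) t := by
  obtain ⟨h1, h2⟩ := hn.solves_yNeg' hD h
  have := h1.okamoto hD hn.t0 hn.t1 (by rw [h2]; exact hn.xDM0) (e := 1 / 3)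
    (θ' := ![0, 0, 0, -2 / 3]) (y' := yDM y (D y) t)
    (by simp only [Matrix.cons_val_zero, Matrix.cons_val_one, Matrix.cons_val]; norm_num)
    (by intro i; fin_cases i <;> simp; norm_num) (by rw [h2]; rfl) hn.yDM0 hn.yDM1 hn.yDMt
  rw [h2] at this
  exact this

theorem NonDegenerate.okamoto_equiv :
    Relation.EqvGen OkamotoStep ⟨![0, 0, 0, -2 / 3], yDM y (D y) t, t⟩ ⟨thirds, y, t⟩ := by
  refine Relation.EqvGen.symm _ _ ?_
  have s1 : OkamotoStep ⟨thirds, y, t⟩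
      ⟨![-(1 / 3), -(1 / 3), -(1 / 3), -(1 / 3)], yNeg y (D y) t, t⟩ := by
    have := OkamotoStep.okamoto (1 / 3) (1 / 3) (1 / 3) (1 / 3) y t D hD h.1 h.2.1 h.2.2.1 hn.x
      (2 / 3) (by norm_num)
    rw [show (1 / 3 - 2 / 3 : ℂ) = -(1 / 3) by norm_num] at this
    exact this
  have s2 := OkamotoStep.neg₁ (-(1 / 3)) (-(1 / 3)) (-(1 / 3)) (-(1 / 3)) (yNeg y (D y) t) t
  have s3 := OkamotoStep.neg₂ (-(-(1 / 3))) (-(1 / 3)) (-(1 / 3)) (-(1 / 3)) (yNeg y (D y) t) t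
  have s4 := OkamotoStep.neg₃ (-(-(1 / 3))) (-(-(1 / 3))) (-(1 / 3)) (-(1 / 3)) (yNeg y (D y) t) t
  have s5 : OkamotoStep ⟨![-(-(1 / 3)), -(-(1 / 3)), -(-(1 / 3)), -(1 / 3)], yNeg y (D y) t, t⟩
      ⟨![0, 0, 0, -2 / 3], yDM y (D y) t, t⟩ := by
    have e := (hn.solves_yNeg' hD h).2
    have e0 : ![(-(-(1 / 3)) : ℂ), -(-(1 / 3)), -(-(1 / 3)), -(1 / 3)] =
        ![1 / 3, 1 / 3, 1 / 3, -1 / 3] := by norm_num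
    have := OkamotoStep.okamoto (1 / 3) (1 / 3) (1 / 3) (-1 / 3) (yNeg y (D y) t) t D hD hn.yNeg0
      hn.yNeg1 hn.yNegt (by rw [e]; exact hn.xDM0) (1 / 3) (by norm_num)
    rw [e, show (1 / 3 - 1 / 3 : ℂ) = 0 by norm_num, show (-1 / 3 - 1 / 3 : ℂ) = -2 / 3 by norm_num]
      at this
    rw [e0]
    exact this
  exact ((((Relation.EqvGen.rel _ _ s1).trans _ _ _ (.rel _ _ s2)).trans _ _ _ (.rel _ _ s3)).trans
    _ _ _ (.rel _ _ s4)).trans _ _ _ (.rel _ _ s5)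

/-- The explicit solution is a rational function of `t` and of the transform and its derivatives. -/
theorem NonDegenerate.mem_of_yDM_mem (hfin : Module.Finite ℂ⟮t⟯ K) {L : IntermediateField ℂ K}
    (ht : t ∈ L) (hy : yDM y (D y) t ∈ L) : y ∈ L := by
  have : CharZero K := charZero_of_injective_algebraMap (algebraMap ℂ K).injective
  -- The field `L` is closed under `d/dt`, so it contains the conjugate variable of each of its
  -- elements. Since Okamoto's step keeps `x`, subtracting the shift `e/x` undoes it inside `L`.
  have hconj : ∀ (θ : Fin 4 → ℂ) (z : K), z ∈ L → conjugateVar θ z (D z) t ∈ L := by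
    intro θ z hz
    have hz' := derivation_mem D hD hfin ht hz
    have h2 : (1 / 2 : K) ∈ L := IsFunctionField.half_mem L
    have ha := fun c => L.algebraMap_mem c
    exact mul_mem h2 (sub_mem (add_mem (div_mem (sub_mem (mul_mem (sub_mem ht (one_mem _)) hz')
      (ha _)) hz) (div_mem (sub_mem (sub_mem hz' (one_mem _)) (ha _)) (sub_mem hz ht)))
      (div_mem (add_mem (mul_mem ht hz') (ha _)) (sub_mem hz (one_mem _))))
  have h1 : xDM y (D y) t ∈ L := by rw [← (hn.solves_yDM hD h).2]; exact hconj _ _ hy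
  have h2 : yNeg y (D y) t ∈ L := by
    have := sub_mem hy (div_mem (L.algebraMap_mem (1 / 3)) h1)
    rwa [yDM, add_sub_cancel_right] at this
  have h3 : xThirds y (D y) t ∈ L := by rw [← (hn.solves_yNeg hD h).2]; exact hconj _ _ h2
  have := sub_mem h2 (div_mem (L.algebraMap_mem (2 / 3)) h3)
  rwa [yNeg, add_sub_cancel_right] at this

end Chain

/-! ### The branch of the curve over `t = 1/2` -/

section Branch

theorem eventually_genericPoint {σ υ : ℂ → ℂ} {t₀ : ℂ} (hσ : ContinuousAt σ t₀)
    (hυ : ContinuousAt υ t₀) (h : GenericPoint (σ t₀) (υ t₀))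
    (hc : ∀ᶠ τ in 𝓝 t₀, υ τ ^ 2 = σ τ * (8 * σ τ ^ 2 - 11 * σ τ + 8)) :
    ∀ᶠ τ in 𝓝 t₀, GenericPoint (σ τ) (υ τ) := by
  have key : ∀ f : ℂ → ℂ, Continuous f → f (σ t₀) ≠ 0 → ∀ᶠ τ in 𝓝 t₀, f (σ τ) ≠ 0 :=
    fun f hf h0 => (hf.continuousAt.comp (f := σ) hσ).eventually_ne h0
  filter_upwards [hc, hυ.eventually_ne h.u0, key (fun s => s) (by fun_prop) h.s0,
    key (fun s => s - 1) (by fun_prop) h.s1,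
    key (fun s => 8 * s ^ 2 - 11 * s + 8) (by fun_prop) h.q0,
    key (fun s => s - 2) (by fun_prop) h.s2, key (fun s => 2 * s - 1) (by fun_prop) h.s3,
    key (fun s => 2 * s ^ 2 + s + 2) (by fun_prop) h.b0,
    key (fun s => s ^ 2 - 7 * s + 1) (by fun_prop) h.c0,
    key (fun s => 3 * s ^ 3 - 4 * s ^ 2 + 4 * s + 2) (by fun_prop) h.c3,
    key (fun s => 6 * s ^ 2 - 2 * s + 1) (by fun_prop) h.p2,
    key (fun s => 4 * s ^ 4 + 4 * s ^ 3 + 54 * s ^ 2 - 86 * s + 49) (by fun_prop) h.p4]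
    with τ a1 a2 a3 a4 a5 a6 a7 a8 a9 a10 a11 a12
  exact ⟨a1, a2, a3, a4, a5, a6, a7, a8, a9, a10, a11, a12⟩

/-- The numerator of `t - 1/2` has the factor `s + 1`, so `t = 1/2` at this point, midway between
`0` and `1`; there `u² = -27`, and rational functions of `s` and `u` take values in `ℚ(√-3)`. -/
theorem genericPoint_neg_one : GenericPoint (-1) (3 * ω) where
  curve := by linear_combination 9 * ω_sq
  u0 := mul_ne_zero three_ne_zero ω_ne_zero
  s0 := by norm_num
  s1 := by norm_num
  q0 := by norm_num
  s2 := by norm_num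
  s3 := by norm_num
  b0 := by norm_num
  c0 := by norm_num
  c3 := by norm_num
  p2 := by norm_num
  p4 := by norm_num

/-- The local branch of the curve, parametrized by `t`, through the point `(-1, 3 √-3)`. -/
theorem exists_branch : ∃ σ υ : ℂ → ℂ, AnalyticAt ℂ σ (1 / 2) ∧ AnalyticAt ℂ υ (1 / 2) ∧
    σ (1 / 2) = -1 ∧ υ (1 / 2) = 3 * ω ∧
    (∀ᶠ τ in 𝓝 (1 / 2), GenericPoint (σ τ) (υ τ)) ∧
    (∀ᶠ τ in 𝓝 (1 / 2), tOf (σ τ) (υ τ) = τ) ∧ deriv σ (1 / 2) = -4 * ω / 5 := by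
  -- Normalised to be `1` at `s = -1`, so that the principal logarithm supplies a holomorphic square
  -- root, and with it `u` as a function of `s`.
  let r : ℂ → ℂ := fun s => s * (8 * s ^ 2 - 11 * s + 8) / (-27)
  let U : ℂ → ℂ := fun s => 3 * ω * Complex.exp (Complex.log (r s) / 2)
  have hr1 : r (-1) = 1 := by norm_num [r]
  have hr : AnalyticAt ℂ r (-1) := by
    simp only [r]; fun_prop (disch := norm_num)
  have hU : AnalyticAt ℂ U (-1) := by
    refine analyticAt_const.mul (AnalyticAt.cexp ?_)
    refine AnalyticAt.div ?_ analyticAt_const two_ne_zero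
    refine hr.clog ?_
    rw [hr1]; exact Complex.one_mem_slitPlane
  have hU1 : U (-1) = 3 * ω := by simp [U, hr1]
  have hUc : ∀ᶠ s in 𝓝 (-1 : ℂ), U s ^ 2 = s * (8 * s ^ 2 - 11 * s + 8) := by
    filter_upwards [hr.continuousAt.eventually_ne (by rw [hr1]; exact one_ne_zero)] with s hs
    have : Complex.exp (Complex.log (r s) / 2) ^ 2 = r s := by
      rw [← Complex.exp_nat_mul, Nat.cast_ofNat, mul_div_cancel₀ _ two_ne_zero, Complex.exp_log hs]
    simp only [U]
    rw [mul_pow, this]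
    simp only [r]
    linear_combination (-(s * (8 * s ^ 2 - 11 * s + 8)) / 3) * ω_sq
  let H : ℂ → ℂ := fun s => U s * ((32 * s ^ 8 - 320 * s ^ 7 + 1112 * s ^ 6 - 2420 * s ^ 5
    + 3167 * s ^ 4 - 2420 * s ^ 3 + 1112 * s ^ 2 - 320 * s + 32)
    / (54 * s ^ 3 * (s - 1) * (8 * s ^ 2 - 11 * s + 8) ^ 2))
  have hH : AnalyticAt ℂ H (-1) := by
    refine hU.mul (AnalyticAt.div (by fun_prop) (by fun_prop) (by norm_num))
  have hH1 : H (-1) = 5 * ω / 12 := by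
    simp only [H, hU1]; norm_num; ring
  -- This is `t` as a function of `s` on the branch. The factor `s + 1` is separated, so that the
  -- derivative at `-1` is just `H(-1)`; since it is nonzero, `t` is a local coordinate.
  let T : ℂ → ℂ := fun s => 1 / 2 + (s + 1) * H s
  have hT : AnalyticAt ℂ T (-1) := by
    refine analyticAt_const.add (AnalyticAt.mul (by fun_prop) hH)
  have hT1 : T (-1) = 1 / 2 := by simp [T]
  have hT' : deriv T (-1) = 5 * ω / 12 := by
    have h1 : HasDerivAt (fun s : ℂ => s + 1) 1 (-1) := (hasDerivAt_id _).add_const 1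
    have := (h1.mul hH.differentiableAt.hasDerivAt).const_add (1 / 2)
    refine this.deriv.trans ?_
    simp [hH1]
  have hT0 : deriv T (-1) ≠ 0 := by
    rw [hT']; exact div_ne_zero (mul_ne_zero (by norm_num) ω_ne_zero) (by norm_num)
  let σ := hT.hasStrictDerivAt.localInverse T _ _ hT0
  have hσ : AnalyticAt ℂ σ (1 / 2) := by
    have := hT.analyticAt_localInverse hT0
    rwa [hT1] at this
  have hσ1 : σ (1 / 2) = -1 := by
    have : σ (T (-1)) = -1 := HasStrictFDerivAt.localInverse_apply_image ..
    rwa [hT1] at this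
  have hσ2 : ∀ᶠ τ in 𝓝 (1 / 2), T (σ τ) = τ := by
    have := hT.hasStrictDerivAt.eventually_right_inverse hT0
    rwa [hT1] at this
  have hσ' : deriv σ (1 / 2) = -4 * ω / 5 := by
    have := (hT.hasStrictDerivAt.to_localInverse hT0).hasDerivAt.deriv
    rw [hT1] at this
    refine this.trans ?_
    rw [hT']
    have h0 := ω_ne_zero
    field_simp
    linear_combination 4 * ω_sq
  have hσt : Filter.Tendsto σ (𝓝 (1 / 2)) (𝓝 (-1)) := by
    have := hσ.continuousAt.tendsto; rwa [hσ1] at this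
  have hυ : AnalyticAt ℂ (fun τ => U (σ τ)) (1 / 2) := by
    refine AnalyticAt.comp (g := U) (f := σ) ?_ hσ
    rw [hσ1]; exact hU
  have hgen : ∀ᶠ τ in 𝓝 (1 / 2), GenericPoint (σ τ) (U (σ τ)) := by
    refine eventually_genericPoint (υ := fun τ => U (σ τ)) hσ.continuousAt hυ.continuousAt ?_
      (hσt.eventually hUc)
    rw [hσ1, hU1]
    exact genericPoint_neg_one
  refine ⟨σ, fun τ => U (σ τ), hσ, hυ, hσ1, by simp only [hσ1, hU1], hgen, ?_, hσ'⟩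
  filter_upwards [hσ2, hgen] with τ h1 h2
  rw [h2.t_eq]
  refine Eq.trans ?_ h1
  simp only [T, H, tOdd, tNum]
  ring

end Branch

end

end PainleveVI

namespace PainleveVI

open Polynomial
open scoped Polynomial.Bivariate IntermediateField Topology

/-! ### Transport of algebraic solutions along isomorphisms -/

section Transport

variable {K K' : Type*} [Field K] [Algebra ℂ K] [Field K'] [Algebra ℂ K'] (φ : K' ≃ₐ[ℂ] K)

theorem isBelyi_of_algEquiv {t : K'} (h : IsBelyi (φ t)) : IsBelyi t := by
  intro O hO hc a a0 a1 ha f hf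
  let O' : ValuationSubring K := O.comap φ.symm.toRingEquiv.toRingHom
  have hmem : ∀ x, x ∈ O' ↔ φ.symm x ∈ O := fun x => Iff.rfl
  have hnon : ∀ x, φ x ∈ O'.nonunits ↔ x ∈ O.nonunits := by
    intro x
    rw [ValuationSubring.mem_nonunits_iff_or, ValuationSubring.mem_nonunits_iff_or, hmem,
      ← map_inv₀, φ.symm_apply_apply, map_eq_zero_iff φ φ.injective]
  have h1 := h O' (by
      intro htop
      apply hO
      rw [eq_top_iff]
      intro x _
      have : φ x ∈ O' := by rw [htop]; trivial
      simpa [hmem] using this)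
    (fun c => by rw [hmem]; simpa using hc c) a a0 a1
    (by
      have := (hnon _).2 ha
      simpa using this)
    (φ f) ((hnon _).2 hf)
  rw [hmem] at h1
  simpa using h1

theorem SolvesPVI.of_algEquiv {θ : Fin 4 → ℂ} {D : Derivation ℂ K K} {D' : Derivation ℂ K' K'}
    (hD : ∀ x, φ (D' x) = D (φ x)) {y t : K'} (h : SolvesPVI θ D (φ y) (φ t)) :
    SolvesPVI θ D' y t := by
  obtain ⟨h0, h1, h2, h3⟩ := h
  refine ⟨fun h => h0 (by simp [h]), fun h => h1 (by simp [h]), fun h => h2 (by simp [h]), ?_⟩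
  apply φ.injective
  simp only [map_add, map_sub, map_mul, map_div₀, map_pow, map_one, map_ofNat, hD,
    AlgEquiv.commutes] at h3 ⊢
  exact h3

/-- The derivation transported by an isomorphism. -/
theorem exists_derivation_of_algEquiv (D : Derivation ℂ K K) :
    ∃ D' : Derivation ℂ K' K', ∀ x, φ (D' x) = D (φ x) := by
  refine ⟨Derivation.mk' (φ.symm.toLinearMap ∘ₗ D.toLinearMap ∘ₗ φ.toLinearMap) ?_, ?_⟩
  · intro a b
    change φ.symm (D (φ (a * b))) = a * φ.symm (D (φ b)) + b * φ.symm (D (φ a))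
    rw [map_mul, Derivation.leibniz, map_add, smul_eq_mul, smul_eq_mul, map_mul, map_mul,
      φ.symm_apply_apply, φ.symm_apply_apply]
  · intro x
    exact φ.apply_symm_apply _

theorem SolutionData.IsAlgebraicSolution.of_algEquiv {P : SolutionData K'}
    (h : (P.map φ).IsAlgebraicSolution) : P.IsAlgebraicSolution where
  transcendental := by
    intro ht
    exact h.transcendental (ht.algHom φ.toAlgHom)
  finite := by
    have hm : (ℂ⟮P.t⟯).map φ.toAlgHom = ℂ⟮φ P.t⟯ := by
      rw [IntermediateField.adjoin_map, Set.image_singleton]; rfl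
    have hf : Module.Finite ℂ⟮φ P.t⟯ K := h.finite
    let e := (IntermediateField.equivMap ℂ⟮P.t⟯ φ.toAlgHom).trans (IntermediateField.equivOfEq hm)
    exact Module.Finite.of_equiv_equiv e.symm.toRingEquiv φ.symm.toRingEquiv (by
      ext x
      obtain ⟨z, rfl⟩ := e.surjective x
      have hz : ((e z : ℂ⟮φ P.t⟯) : K) = φ z := rfl
      change ((e.symm (e z) : ℂ⟮P.t⟯) : K') = φ.symm ((e z : ℂ⟮φ P.t⟯) : K)
      rw [hz]
      simp)
  belyi := isBelyi_of_algEquiv φ h.belyi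
  solves := by
    obtain ⟨D, hD, hs⟩ := h.solves
    obtain ⟨D', hD'⟩ := exists_derivation_of_algEquiv φ D
    refine ⟨D', φ.injective ?_, SolvesPVI.of_algEquiv φ hD' hs⟩
    rw [hD', map_one]
    exact hD

end Transport

/-! ### The branch of the solution through a given point -/

section Expansion

variable {K : Type*} [Field K] [Algebra ℂ K] [CharZero K] {s u : K} (h : IsFunctionField s u)
  {D : Derivation ℂ K K} (hs : D s = u * dsOdd s)

/-- The values at the point `(-1, 3 √-3)` of the transformed solution and of its conjugate
variable, and the germ of the solution at that point. -/
theorem IsFunctionField.exists_expansion (h : IsFunctionField s u) (hs : D s = u * dsOdd s) :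
    NonDegenerate (yOf s u) (D (yOf s u)) (tOf s u) ∧
    ∃ f : ℂ → ℂ, AnalyticAt ℂ f (1 / 2) ∧ f (1 / 2) = 1 / 2 + 169 / 2346 * ω ∧
      (∀ P : ℂ[X][Y], P.eval₂ (aeval (tOf s u) : ℂ[X] →ₐ[ℂ] K).toRingHom
        (yDM (yOf s u) (D (yOf s u)) (tOf s u)) = 0 → ∀ᶠ τ in 𝓝 (1 / 2), P.evalEval τ (f τ) = 0) ∧
      conjugateVar ![0, 0, 0, -2 / 3] (f (1 / 2)) (deriv f (1 / 2)) (1 / 2) =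
        -34408 / 68055 * ω := by
  obtain ⟨σ, υ, hσ, hυ, hσ1, hυ1, hgen, htau, hσ'⟩ := exists_branch
  have hw := ω_sq
  have hc : ∀ᶠ τ in 𝓝 (1 / 2), υ τ ^ 2 = σ τ * (8 * σ τ ^ 2 - 11 * σ τ + 8) := by
    filter_upwards [hgen] with τ hτ using hτ.curve
  have hc0 := hc.self_of_nhds
  -- Obtained by differentiating the equation of the curve along the branch at `(-1, 3ω)`.
  have hυ' : deriv υ (1 / 2) = -36 / 5 := by
    have e : (fun τ => υ τ ^ 2) =ᶠ[𝓝 (1 / 2)] fun τ => σ τ * (8 * σ τ ^ 2 - 11 * σ τ + 8) := hc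
    have e1 := e.deriv_eq
    have d1 := (hυ.differentiableAt.hasDerivAt.pow 2).deriv
    have ds := hσ.differentiableAt.hasDerivAt
    have d2 := (ds.mul ((((ds.pow 2).const_mul 8).sub (ds.const_mul 11)).add_const 8)).deriv
    have e2 := (d1.symm.trans e1).trans d2
    simp only [Pi.pow_apply, hυ1, hσ1, hσ', Pi.sub_apply] at e2
    have := ω_ne_zero
    refine mul_left_cancel₀ (mul_ne_zero (by norm_num : (6 : ℂ) ≠ 0) this) ?_
    norm_num at e2 ⊢
    linear_combination e2
  have ed : EvalAt s u (σ (1 / 2)) (υ (1 / 2)) (dsOdd s) (-4 / 15) := by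
    have e : dsOdd s = aeval s (27 * X ^ 3 * (X - 1) ^ 2 * (8 * X ^ 2 - 11 * X + 8) ^ 2 : ℂ[X]) /
        aeval s (5 * (X - 2) ^ 4 * (2 * X - 1) ^ 4 * (2 * X ^ 2 + X + 2) ^ 2 : ℂ[X]) := by
      simp only [map_sub, map_add, map_mul, map_pow, aeval_X, map_ofNat, map_one]; rfl
    rw [e]
    convert (EvalAt.fst.aeval h hc0 _).div h hc0 (EvalAt.fst.aeval h hc0 _) ?_ using 1
    · rw [hσ1]; norm_num
    · rw [hσ1]; norm_num
  have xs : Expands s u D σ υ (1 / 2) s (-1) :=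
    ⟨σ, hσ, hσ1, Filter.Eventually.of_forall fun _ => EvalAt.fst, by
      rw [hs, hσ']
      convert EvalAt.snd.mul h hc0 ed using 1
      rw [hυ1]; ring⟩
  have xu : Expands s u D σ υ (1 / 2) u (3 * ω) :=
    ⟨υ, hυ, hυ1, Filter.Eventually.of_forall fun _ => EvalAt.snd, by
      rw [h.derivation_u D hs, hυ']
      have e : (12 * s ^ 2 - 11 * s + 4 : K) = aeval s (12 * X ^ 2 - 11 * X + 4 : ℂ[X]) := by
        simp only [map_sub, map_add, map_mul, map_pow, aeval_X, map_ofNat]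
      rw [e]
      convert (EvalAt.fst.aeval h hc0 _).mul h hc0 ed using 1
      rw [hσ1]; norm_num⟩
  have ht : ∀ᶠ τ in 𝓝 (1 / 2), EvalAt s u (σ τ) (υ τ) (tOf s u) τ := by
    filter_upwards [hgen, htau] with τ h1 h2
    have e : tOf s u = algebraMap ℂ K (1 / 2) + u * (aeval s tNumPoly /
        aeval s (54 * X ^ 3 * (X - 1) * (8 * X ^ 2 - 11 * X + 8) ^ 2 : ℂ[X])) := by
      rw [h.t_eq, tOdd, aeval_tNumPoly]
      simp only [map_sub, map_add, map_mul, map_pow, aeval_X, map_ofNat, map_one, map_div₀]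
    rw [e]
    have hne : (54 * X ^ 3 * (X - 1) * (8 * X ^ 2 - 11 * X + 8) ^ 2 : ℂ[X]).eval (σ τ) ≠ 0 := by
      simp only [eval_sub, eval_add, eval_mul, eval_pow, eval_X, eval_ofNat, eval_one, ne_eq,
        mul_eq_zero, pow_eq_zero_iff, OfNat.ofNat_ne_zero, not_false_eq_true, h1.s0, h1.s1, h1.q0,
        or_self]
    convert (EvalAt.algebraMap (1 / 2)).add h h1.curve (EvalAt.snd.mul h h1.curve
      ((EvalAt.fst.aeval h h1.curve tNumPoly).div h h1.curve (EvalAt.fst.aeval h h1.curve _) hne))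
      using 1
    refine h2.symm.trans ?_
    rw [h1.t_eq, tOdd]
    simp [tNumPoly, tNum]
  have xt : Expands s u D σ υ (1 / 2) (tOf s u) (1 / 2) :=
    ⟨fun τ => τ, analyticAt_id, rfl, ht, by
      rw [h.derivation_t D hs, deriv_id'']
      simpa using EvalAt.algebraMap (s := s) (u := u) (a := σ (1 / 2)) (b := υ (1 / 2)) 1⟩
  have ratio : ∀ (p q : ℂ[X]) (e : ℂ), q.eval (-1) ≠ 0 → e * q.eval (-1) = p.eval (-1) →
      Expands s u D σ υ (1 / 2) (aeval s p / aeval s q) e := fun p q e h1 h2 =>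
    (xs.aeval h hc p).div h hc (xs.aeval h hc q) h1 h2
  have xy : Expands s u D σ υ (1 / 2) (yOf s u) (1 / 2 + 1 / 4 * ω) := by
    have e : yOf s u = algebraMap ℂ K (1 / 2) + u * (aeval s (-(8 * X ^ 7 - 28 * X ^ 6 + 75 * X ^ 5
        + 31 * X ^ 4 - 269 * X ^ 3 + 318 * X ^ 2 - 166 * X + 56) : ℂ[X]) / aeval s
        (18 * X * (X - 1) * (8 * X ^ 2 - 11 * X + 8) * (3 * X ^ 3 - 4 * X ^ 2 + 4 * X + 2) :
          ℂ[X])) := by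
      rw [h.y_eq, yOdd, yNum]
      simp only [map_sub, map_add, map_mul, map_pow, aeval_X, map_ofNat, map_one, map_div₀, map_neg]
    rw [e]
    refine ((Expands.algebraMap (1 / 2)).add h hc (xu.mul h hc (ratio _ _ (1 / 12) ?_ ?_))).congr ?_
    · norm_num
    · norm_num
    · ring
  have xp : Expands s u D σ υ (1 / 2) (D (yOf s u)) (41 / 30) := by
    have e : D (yOf s u) = aeval s (X ^ 2 * (8 * X ^ 2 - 11 * X + 8) * (-216 * X ^ 7 + 192 * X ^ 6
        - 966 * X ^ 5 + 2430 * X ^ 4 - 3465 * X ^ 3 + 2256 * X ^ 2 - 522 * X - 84) : ℂ[X]) / aeval s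
        (10 * (X - 2) * (2 * X - 1) ^ 3 * (2 * X ^ 2 + X + 2)
          * (3 * X ^ 3 - 4 * X ^ 2 + 4 * X + 2) ^ 2 : ℂ[X]) := by
      rw [h.derivation_y D hs, dyOf, dyNum]
      simp only [map_sub, map_add, map_mul, map_pow, aeval_X, map_ofNat, map_one, map_neg]
    rw [e]
    refine ratio _ _ _ ?_ ?_
    · norm_num
    · norm_num
  have sol : SolvesPVI thirds D (yOf s u) (tOf s u) := h.solvesPVI D hs
  set y := yOf s u
  set t := tOf s u
  set p := D y
  have x1 : Expands s u D σ υ (1 / 2) (1 : K) 1 := by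
    simpa using Expands.algebraMap (s := s) (u := u) (D := D) (σ := σ) (υ := υ) (t₀ := 1 / 2) 1
  have xc : ∀ c : ℂ, Expands s u D σ υ (1 / 2) (algebraMap ℂ K c) c := fun c => Expands.algebraMap c
  have half : (1 / 2 : K) = algebraMap ℂ K (1 / 2) := by simp [map_ofNat]
  -- From here on each value of a quotient is supplied in the form `a + bω` and verified by
  -- multiplying back with `ω² = -3`.
  have xx : Expands s u D σ υ (1 / 2) (xThirds y p t) (176 / 315 * ω) := by
    unfold xThirds conjugateVar thirds
    simp only [Matrix.cons_val_zero, Matrix.cons_val_one, Matrix.cons_val]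
    rw [half]
    refine ((xc (1 / 2)).mul h hc (((Expands.div h hc (e := -122 / 105 + 61 / 105 * ω)
      (((xt.sub h hc x1).mul h hc xp).sub h hc (xc (1 / 3))) xy
      (add_mul_ω_ne_zero (by norm_num)) ?_).add h hc
      (Expands.div h hc (e := -2 / 45 * ω) ((xp.sub h hc x1).sub h hc (xc (1 / 3)))
        (xy.sub h hc xt) ?_ ?_)).sub h hc
      (Expands.div h hc (e := -122 / 105 - 61 / 105 * ω)
        ((xt.mul h hc xp).add h hc (xc (1 / 3))) (xy.sub h hc x1) ?_ ?_))).congr ?_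
    · linear_combination (61 / 420) * hw
    · simpa using ω_ne_zero
    · linear_combination (-1 / 90) * hw
    · have := add_mul_ω_ne_zero (a := -1 / 2) (b := 1 / 4) (by norm_num)
      convert this using 1
      ring
    · linear_combination (-61 / 420) * hw
    · ring
  have x0 : (176 / 315 * ω : ℂ) ≠ 0 := mul_ne_zero (by norm_num) ω_ne_zero
  have xn : Expands s u D σ υ (1 / 2) (yNeg y p t) (1 / 2 - 13 / 88 * ω) := by
    refine (xy.add h hc (Expands.div h hc (e := -35 / 88 * ω) (xc (2 / 3)) xx x0 ?_)).congr ?_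
    · linear_combination (-2 / 9) * hw
    · ring
  have n0 : (1 / 2 - 13 / 88 * ω : ℂ) ≠ 0 := by
    convert add_mul_ω_ne_zero (a := 1 / 2) (b := -13 / 88) (by norm_num) using 1; ring
  have n1 : (1 / 2 - 13 / 88 * ω - 1 : ℂ) ≠ 0 := by
    convert add_mul_ω_ne_zero (a := -1 / 2) (b := -13 / 88) (by norm_num) using 1; ring
  have nt : (1 / 2 - 13 / 88 * ω - 1 / 2 : ℂ) ≠ 0 := by
    convert mul_ne_zero (by norm_num : (-13 / 88 : ℂ) ≠ 0) ω_ne_zero using 1; ring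
  have xd : Expands s u D σ υ (1 / 2) (xDM y p t) (-34408 / 68055 * ω) := by
    unfold xDM
    refine (xx.sub h hc ((xc (1 / 3)).mul h hc (((x1.div h hc
      (e := 3872 / 2443 + 1144 / 2443 * ω) xn n0 ?_).add h hc
      (x1.div h hc (e := 88 / 39 * ω) (xn.sub h hc xt) nt ?_)).add h hc
      (x1.div h hc (e := -3872 / 2443 + 1144 / 2443 * ω) (xn.sub h hc x1) n1 ?_)))).congr ?_
    · linear_combination (-169 / 2443) * hw
    · linear_combination (-1 / 3) * hw
    · linear_combination (-169 / 2443) * hw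
    · ring
  have d0 : (-34408 / 68055 * ω : ℂ) ≠ 0 := mul_ne_zero (by norm_num) ω_ne_zero
  have xD : Expands s u D σ υ (1 / 2) (yDM y p t) (1 / 2 + 169 / 2346 * ω) := by
    refine (xn.add h hc (Expands.div h hc (e := 22685 / 103224 * ω) (xc (1 / 3)) xd d0 ?_)).congr ?_
    · linear_combination (-1 / 9) * hw
    · ring
  have D0 : (1 / 2 + 169 / 2346 * ω : ℂ) ≠ 0 := add_mul_ω_ne_zero (by norm_num)
  have D1 : (1 / 2 + 169 / 2346 * ω - 1 : ℂ) ≠ 0 := by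
    convert add_mul_ω_ne_zero (a := -1 / 2) (b := 169 / 2346) (by norm_num) using 1; ring
  have Dt : (1 / 2 + 169 / 2346 * ω - 1 / 2 : ℂ) ≠ 0 := by
    convert mul_ne_zero (by norm_num : (169 / 2346 : ℂ) ≠ 0) ω_ne_zero using 1; ring
  -- Every condition holds because the function concerned has a nonzero value at the base point.
  have hn : NonDegenerate y p t :=
    { t0 := xt.ne_zero h (by norm_num)
      t1 := sub_ne_zero.1 ((xt.sub h hc x1).ne_zero h (by norm_num))
      x := xx.ne_zero h x0
      yNeg0 := xn.ne_zero h n0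
      yNeg1 := sub_ne_zero.1 ((xn.sub h hc x1).ne_zero h n1)
      yNegt := sub_ne_zero.1 ((xn.sub h hc xt).ne_zero h nt)
      xDM0 := xd.ne_zero h d0
      yDM0 := xD.ne_zero h D0
      yDM1 := sub_ne_zero.1 ((xD.sub h hc x1).ne_zero h D1)
      yDMt := sub_ne_zero.1 ((xD.sub h hc xt).ne_zero h Dt) }
  refine ⟨hn, ?_⟩
  have hDt : D t = 1 := h.derivation_t D hs
  have xD' := xD.evalAt
  obtain ⟨f, hf, hf0, hf1, hf2⟩ := xD
  refine ⟨f, hf, hf0, ?_, ?_⟩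
  · intro P hP
    filter_upwards [hc, ht, hf1] with τ h1 h2 h3
    have := h2.eval₂ h h1 h3 P
    rw [hP] at this
    exact this.eq_zero h
  · rw [hf0, ← eq_conjugateVar_iff _ D0 (sub_ne_zero.1 D1) (sub_ne_zero.1 Dt)]
    obtain ⟨hsol, hconj⟩ := hn.solves_yDM hDt sol
    have hy := (eq_conjugateVar_iff _ hn.yDM0 hn.yDM1 hn.yDMt).2 hconj
    simp only [Matrix.cons_val_zero, Matrix.cons_val_one, Matrix.cons_val, map_zero, zero_mul,
      add_zero] at hy ⊢
    -- The first Hamilton equation of the transformed solution is evaluated at the base point in two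
    -- ways; uniqueness of values turns it into a relation with the analytic derivative of `f`,
    -- which determines the conjugate variable there.
    have t1 := (xt.evalAt.mul h hc0 (xt.evalAt.sub h hc0 x1.evalAt)).mul h hc0 hf2
    rw [hy] at t1
    have two : EvalAt s u (σ (1 / 2)) (υ (1 / 2)) (2 : K) 2 := by
      simpa [map_ofNat] using
        EvalAt.algebraMap (s := s) (u := u) (a := σ (1 / 2)) (b := υ (1 / 2)) 2
    have t2 := (((two.mul h hc0 xd.evalAt).mul h hc0 ((xD'.mul h hc0
      (xD'.sub h hc0 x1.evalAt)).mul h hc0 (xD'.sub h hc0 xt.evalAt))).add h hc0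
      ((x1.evalAt).mul h hc0 (xD'.mul h hc0 (xD'.sub h hc0 x1.evalAt))))
    exact t1.unique h hc0 t2

end Expansion

/-- The curve of the transformed solution. -/
theorem exists_dubrovinMazzocco_curve : ∃ Γ : PlaneCurve,
    (dubrovinMazzoccoData Γ).IsAlgebraicSolution ∧ Γ.poly.natDegree = 18 ∧
    OkamotoEquivalent (dubrovinMazzoccoData Γ) explicitSolution ∧
    PlaneCurve.Birational Γ ellipticCurve ∧
    ∃ f : ℂ → ℂ, AnalyticAt ℂ f (1 / 2) ∧ (∀ᶠ t in 𝓝 (1 / 2), Γ.poly.evalEval t (f t) = 0) ∧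
      f (1 / 2) = 1 / 2 + 169 / 2346 * ω ∧
      conjugateVar ![0, 0, 0, -2 / 3] (f (1 / 2)) (deriv f (1 / 2)) (1 / 2) =
        -34408 / 68055 * ω := by
  have hF := Elliptic.isFunctionField
  obtain ⟨D, hD, hs⟩ := Elliptic.exists_derivation_t
  obtain ⟨hn, f, hf, hf0, hf1, hf2⟩ := hF.exists_expansion hs
  have sol : SolvesPVI thirds D (yOf Elliptic.s Elliptic.u) (tOf Elliptic.s Elliptic.u) :=
    hF.solvesPVI D hs
  obtain ⟨Γ, φ, h1, h2, h3, h4⟩ := exists_planeCurve hF.transcendental_t hF.finite_t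
    (y := yDM (yOf Elliptic.s Elliptic.u) (D (yOf Elliptic.s Elliptic.u))
      (tOf Elliptic.s Elliptic.u))
    (fun L ht hy => hF.eq_top_of_t_y ht (hn.mem_of_yDM_mem hD sol hF.finite_t ht hy))
  have hmap : (dubrovinMazzoccoData Γ).map φ = ⟨![0, 0, 0, -2 / 3],
      yDM (yOf Elliptic.s Elliptic.u) (D (yOf Elliptic.s Elliptic.u))
      (tOf Elliptic.s Elliptic.u), tOf Elliptic.s Elliptic.u⟩ := by
    simp only [SolutionData.map, dubrovinMazzoccoData, h1, h2]
  refine ⟨Γ, ?_, h3.trans hF.finrank_t, ⟨φ, ?_⟩, ⟨φ⟩, f, hf, hf1 _ h4, hf0, hf2⟩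
  · apply SolutionData.IsAlgebraicSolution.of_algEquiv φ
    rw [hmap]
    exact ⟨hF.transcendental_t, hF.finite_t, Elliptic.isBelyi, D, hD, (hn.solves_yDM hD sol).1⟩
  · rw [hmap]
    exact hn.okamoto_equiv hD sol

end PainleveVI

namespace PainleveVI

open Polynomial
open scoped Polynomial.Bivariate IntermediateField Topology

/-! ### Linear differential equations depending on a parameter -/

section LinearODE

open MeasureTheory

variable {P E : Type*} [NormedAddCommGroup E] [NormedSpace ℝ E]

/-- The iterated integrals of the Picard iteration for `x' = A x`, `x(0) = x₀`. -/
noncomputable def picardTerm (A : P → ℝ → E →L[ℝ] E) (x₀ : E) : ℕ → P → ℝ → E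
  | 0, _, _ => x₀
  | n + 1, p, r => ∫ s in (0 : ℝ)..r, A p s (picardTerm A x₀ n p s)

variable {A : P → ℝ → E →L[ℝ] E} {C : ℝ} (x₀ : E)

theorem norm_picardTerm_le (hC : ∀ p r x, ‖A p r x‖ ≤ C * ‖x‖) (hC0 : 0 ≤ C)
    (n : ℕ) (p : P) (r : ℝ) :
    ‖picardTerm A x₀ n p r‖ ≤ ‖x₀‖ * ((C * |r|) ^ n / n.factorial) := by
  induction n generalizing r with
  | zero => simp [picardTerm]
  | succ n ih =>
    have hb : ∀ s, ‖A p s (picardTerm A x₀ n p s)‖ ≤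
        ‖x₀‖ * C ^ (n + 1) / n.factorial * |s - 0| ^ n := fun s => by
      refine (hC _ _ _).trans ((mul_le_mul_of_nonneg_left (ih s) hC0).trans_eq ?_)
      rw [sub_zero, mul_pow, pow_succ]; ring
    have hint : IntegrableOn (fun s : ℝ => ‖x₀‖ * C ^ (n + 1) / n.factorial * |s - 0| ^ n)
        (Set.uIoc 0 r) :=
      (by fun_prop : Continuous fun s : ℝ => ‖x₀‖ * C ^ (n + 1) / n.factorial * |s - 0| ^ n
        ).integrableOn_uIoc
    calc ‖picardTerm A x₀ (n + 1) p r‖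
        ≤ ∫ s in Set.uIoc 0 r, ‖A p s (picardTerm A x₀ n p s)‖ :=
          intervalIntegral.norm_integral_le_integral_norm_uIoc
      _ ≤ ∫ s in Set.uIoc 0 r, ‖x₀‖ * C ^ (n + 1) / n.factorial * |s - 0| ^ n :=
          integral_mono_of_nonneg (Filter.Eventually.of_forall fun s => norm_nonneg _) hint
            (Filter.Eventually.of_forall hb)
      _ = ‖x₀‖ * ((C * |r|) ^ (n + 1) / (n + 1).factorial) := by
          rw [integral_const_mul, integral_pow_abs_sub_uIoc, Nat.factorial_succ]
          push_cast
          have : (n.factorial : ℝ) ≠ 0 := by positivity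
          rw [sub_zero, mul_pow]
          field_simp

variable [TopologicalSpace P]

theorem continuous_picardTerm (hA : Continuous fun q : P × ℝ × E => A q.1 q.2.1 q.2.2) (n : ℕ) :
    Continuous fun q : P × ℝ => picardTerm A x₀ n q.1 q.2 := by
  induction n with
  | zero => exact continuous_const
  | succ n ih =>
    have h : Continuous (Function.uncurry fun (q : P × ℝ) (s : ℝ) =>
        A q.1 s (picardTerm A x₀ n q.1 s)) := by
      have h1 : Continuous fun w : (P × ℝ) × ℝ => picardTerm A x₀ n w.1.1 w.2 :=
        ih.comp ((continuous_fst.comp continuous_fst).prodMk continuous_snd)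
      exact hA.comp ((continuous_fst.comp continuous_fst).prodMk (continuous_snd.prodMk h1))
    exact intervalIntegral.continuous_parametric_intervalIntegral_of_continuous h continuous_snd

theorem continuous_apply_picardTerm
    (hA : Continuous fun q : P × ℝ × E => A q.1 q.2.1 q.2.2) (n : ℕ) (p : P) :
    Continuous fun s => A p s (picardTerm A x₀ n p s) :=
  hA.comp (continuous_const.prodMk (continuous_id.prodMk
    ((continuous_picardTerm x₀ hA n).comp (continuous_const.prodMk continuous_id))))

theorem hasDerivAt_picardTerm [CompleteSpace E]
    (hA : Continuous fun q : P × ℝ × E => A q.1 q.2.1 q.2.2)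
    (n : ℕ) (p : P) (r : ℝ) :
    HasDerivAt (picardTerm A x₀ (n + 1) p) (A p r (picardTerm A x₀ n p r)) r :=
  (continuous_apply_picardTerm x₀ hA n p).integral_hasStrictDerivAt 0 r |>.hasDerivAt

/-- A bounded linear differential equation depending continuously on a parameter has solutions on
`[0, 1]` that depend continuously on the parameter. -/
theorem exists_linearODE_solution [CompleteSpace E]
    (hA : Continuous fun q : P × ℝ × E => A q.1 q.2.1 q.2.2)
    (hC : ∀ p r x, ‖A p r x‖ ≤ C * ‖x‖) :
    ∃ F : P → ℝ → E, (∀ p, F p 0 = x₀) ∧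
      (∀ p, ∀ r ∈ Set.Icc (0 : ℝ) 1, HasDerivAt (F p) (A p r (F p r)) r) ∧
      Continuous fun p => F p 1 := by
  have hC' : ∀ p r x, ‖A p r x‖ ≤ |C| * ‖x‖ := fun p r x =>
    (hC p r x).trans (mul_le_mul_of_nonneg_right (le_abs_self C) (norm_nonneg x))
  have hC0 := abs_nonneg C
  generalize |C| = C at hC' hC0
  -- The open interval `(-2, 2)` contains `[0, 1]`, so termwise differentiation gives two-sided
  -- derivatives at the endpoints too.
  have hterm : ∀ n p, ∀ r ∈ Set.Ioo (-2 : ℝ) 2, ‖picardTerm A x₀ n p r‖ ≤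
      ‖x₀‖ * ((C * 2) ^ n / n.factorial) := fun n p r hr => by
    refine (norm_picardTerm_le x₀ hC' hC0 n p r).trans ?_
    have : |r| ≤ 2 := (abs_lt.2 hr).le
    gcongr
  have hsum : Summable fun n : ℕ => ‖x₀‖ * ((C * 2) ^ n / n.factorial) :=
    (Real.summable_pow_div_factorial _).mul_left _
  have hmem : ∀ r ∈ Set.Icc (0 : ℝ) 1, r ∈ Set.Ioo (-2 : ℝ) 2 := fun r hr =>
    ⟨by linarith [hr.1], by linarith [hr.2]⟩
  have hs : ∀ p, ∀ r ∈ Set.Ioo (-2 : ℝ) 2, Summable fun n => picardTerm A x₀ n p r :=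
    fun p r hr => Summable.of_norm_bounded hsum fun n => hterm n p r hr
  refine ⟨fun p r => ∑' n, picardTerm A x₀ n p r, fun p => ?_, fun p r hr => ?_, ?_⟩
  · change ∑' n, picardTerm A x₀ n p 0 = x₀
    rw [tsum_eq_single 0]
    · rfl
    · intro n hn
      obtain ⟨m, rfl⟩ := Nat.exists_eq_succ_of_ne_zero hn
      simp [picardTerm]
  · have hr' := hmem r hr
    have key := hasDerivAt_tsum_of_isPreconnected (u := fun n : ℕ =>
        C * (‖x₀‖ * ((C * 2) ^ n / n.factorial)))
      (g := fun n => picardTerm A x₀ (n + 1) p)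
      (g' := fun n r => A p r (picardTerm A x₀ n p r)) (y₀ := 0) (y := r)
      (hsum.mul_left _) isOpen_Ioo isPreconnected_Ioo
      (fun n y _ => hasDerivAt_picardTerm x₀ hA n p y)
      (fun n y hy => (hC' _ _ _).trans (mul_le_mul_of_nonneg_left (hterm n p y hy) hC0))
      (hmem 0 ⟨le_rfl, zero_le_one⟩)
      ((summable_nat_add_iff 1).2 (hs p 0 (hmem 0 ⟨le_rfl, zero_le_one⟩))) hr'
    have h2 : ∑' n, A p r (picardTerm A x₀ n p r) = A p r (∑' n, picardTerm A x₀ n p r) :=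
      ((A p r).map_tsum (hs p r hr')).symm
    rw [h2] at key
    refine (key.const_add x₀).congr_of_eventuallyEq ?_
    filter_upwards [isOpen_Ioo.mem_nhds hr'] with y hy
    exact (hs p y hy).tsum_eq_zero_add
  · exact continuous_tsum (fun n => (continuous_picardTerm x₀ hA n).comp
      (continuous_id.prodMk continuous_const)) hsum fun n p =>
        hterm n p 1 (hmem 1 ⟨zero_le_one, le_rfl⟩)

end LinearODE

end PainleveVI

namespace PainleveVI

open Polynomial
open scoped Polynomial.Bivariate IntermediateField Topology

/-! ### Parallel transport for matrix equations -/

section Transport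

/-- `Φ` is the fundamental solution on `[0, 1]` of `Φ' = K Φ` with `Φ(0) = 1`. -/
structure IsFundamental (K Φ : ℝ → Matrix (Fin 3) (Fin 3) ℂ) : Prop where
  zero : Φ 0 = 1
  hasDeriv : ∀ r ∈ Set.Icc (0 : ℝ) 1, ∀ i j,
    HasDerivWithinAt (fun r => Φ r i j) ((K r * Φ r) i j) (Set.Icc 0 1) r

/-- Left multiplication by a matrix, as a continuous linear map. -/
noncomputable def mulLeftCLM (K : Matrix (Fin 3) (Fin 3) ℂ) :
    (Fin 3 → Fin 3 → ℂ) →L[ℝ] (Fin 3 → Fin 3 → ℂ) :=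
  LinearMap.toContinuousLinearMap
    { toFun := fun X i j => ∑ k, K i k * X k j
      map_add' := fun X X' => by ext i j; simp [mul_add, Finset.sum_add_distrib]
      map_smul' := fun c X => by
        ext i j
        simp only [Pi.smul_apply, Complex.real_smul, RingHom.id_apply, Finset.mul_sum]
        exact Finset.sum_congr rfl fun k _ => by ring }

theorem mulLeftCLM_apply (K : Matrix (Fin 3) (Fin 3) ℂ) (X : Fin 3 → Fin 3 → ℂ) (i j : Fin 3) :
    mulLeftCLM K X i j = ∑ k, K i k * X k j := rfl

theorem norm_mulLeftCLM_le {K : Matrix (Fin 3) (Fin 3) ℂ} {C : ℝ} (hC : ∀ i j, ‖K i j‖ ≤ C)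
    (X : Fin 3 → Fin 3 → ℂ) : ‖mulLeftCLM K X‖ ≤ 3 * C * ‖X‖ := by
  have hC0 : 0 ≤ C := (norm_nonneg _).trans (hC 0 0)
  have h0 : 0 ≤ 3 * C * ‖X‖ := by positivity
  refine (pi_norm_le_iff_of_nonneg h0).2 fun i => (pi_norm_le_iff_of_nonneg h0).2 fun j => ?_
  rw [mulLeftCLM_apply]
  calc ‖∑ k, K i k * X k j‖ ≤ ∑ k : Fin 3, C * ‖X‖ := by
        refine norm_sum_le_of_le _ fun k _ => ?_
        rw [norm_mul]
        exact mul_le_mul (hC i k) ((norm_le_pi_norm _ j).trans (norm_le_pi_norm X k))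
          (norm_nonneg _) hC0
    _ = 3 * C * ‖X‖ := by simp; ring

/-- Compactness of the parameter space and of `[0, 1]` bounds the coefficients, as the parametric
existence theorem requires. The continuity at `r = 1` is used for families of rescaled systems. -/
theorem exists_isFundamental {P : Type*} [TopologicalSpace P] [CompactSpace P]
    (K : P → ℝ → Matrix (Fin 3) (Fin 3) ℂ)
    (hK : ∀ i j, ContinuousOn (fun q : P × ℝ => K q.1 q.2 i j) (Set.univ ×ˢ Set.Icc 0 1)) :
    ∃ Φ : P → ℝ → Matrix (Fin 3) (Fin 3) ℂ, (∀ p, IsFundamental (K p) (Φ p)) ∧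
      Continuous fun p => Φ p 1 := by
  -- Composition with the projection onto `[0, 1]` extends the coefficients continuously to the
  -- whole line, with the same bound.
  let ρ : ℝ → ℝ := fun r => Set.projIcc (0 : ℝ) 1 zero_le_one r
  have hρ : Continuous ρ := continuous_subtype_val.comp continuous_projIcc
  have hρm : ∀ r, ρ r ∈ Set.Icc (0 : ℝ) 1 := fun r => (Set.projIcc (0 : ℝ) 1 zero_le_one r).2
  have hρi : ∀ r ∈ Set.Icc (0 : ℝ) 1, ρ r = r := fun r hr => by
    simp [ρ, Set.projIcc_of_mem zero_le_one hr]
  have hcont : ∀ i j, Continuous fun q : P × ℝ => K q.1 (ρ q.2) i j := fun i j =>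
    (hK i j).comp_continuous (f := fun q : P × ℝ => (q.1, ρ q.2)) (by fun_prop)
      fun q => ⟨Set.mem_univ _, hρm _⟩
  have hbd : ∀ i j, ∃ C, ∀ p r, ‖K p (ρ r) i j‖ ≤ C := fun i j => by
    obtain ⟨C, hC⟩ := (isCompact_univ.prod isCompact_Icc).exists_bound_of_continuousOn (hK i j)
    exact ⟨C, fun p r => hC (p, ρ r) ⟨Set.mem_univ _, hρm r⟩⟩
  choose C hC using hbd
  have hC' : ∀ p r i j, ‖K p (ρ r) i j‖ ≤ ∑ i, ∑ j, |C i j| := fun p r i j =>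
    (hC i j p r).trans <| (le_abs_self _).trans <|
      (Finset.single_le_sum (f := fun j => |C i j|) (fun j _ => abs_nonneg _)
        (Finset.mem_univ j)).trans <|
      Finset.single_le_sum (f := fun i => ∑ j, |C i j|)
        (fun i _ => Finset.sum_nonneg fun j _ => abs_nonneg _) (Finset.mem_univ i)
  obtain ⟨F, h0, hd, hc⟩ := exists_linearODE_solution (P := P)
    (A := fun p r => mulLeftCLM (K p (ρ r))) (1 : Matrix (Fin 3) (Fin 3) ℂ)
    (by
      refine continuous_pi fun i => continuous_pi fun j => ?_
      simp only [mulLeftCLM_apply]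
      refine continuous_finsetSum _ fun k _ => ?_
      have := (hcont i k).comp (f := fun q : P × ℝ × (Fin 3 → Fin 3 → ℂ) => (q.1, q.2.1))
        (by fun_prop)
      exact this.mul (by fun_prop))
    (fun p r x => norm_mulLeftCLM_le (hC' p r) x)
  refine ⟨F, fun p => ⟨h0 p, fun r hr i j => ?_⟩, hc⟩
  have h := hasDerivAt_pi.1 (hasDerivAt_pi.1 (hd p r hr) i) j
  rw [hρi r hr, mulLeftCLM_apply] at h
  exact h.hasDerivWithinAt

variable {K Φ Ψ : ℝ → Matrix (Fin 3) (Fin 3) ℂ}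

theorem hasDerivWithinAt_mul_apply {X X' Z Z' : ℝ → Matrix (Fin 3) (Fin 3) ℂ} {s : Set ℝ} {r : ℝ}
    (hX : ∀ i j, HasDerivWithinAt (fun r => X r i j) (X' r i j) s r)
    (hZ : ∀ i j, HasDerivWithinAt (fun r => Z r i j) (Z' r i j) s r) (i j : Fin 3) :
    HasDerivWithinAt (fun r => (X r * Z r) i j) ((X' r * Z r + X r * Z' r) i j) s r := by
  simp only [Matrix.mul_apply, Matrix.add_apply, ← Finset.sum_add_distrib]
  exact HasDerivWithinAt.fun_sum fun k _ => (hX i k).mul (hZ k j)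

theorem eq_of_hasDerivWithinAt_zero {f : ℝ → ℂ}
    (hf : ∀ r ∈ Set.Icc (0 : ℝ) 1, HasDerivWithinAt f 0 (Set.Icc 0 1) r) {r : ℝ}
    (hr : r ∈ Set.Icc (0 : ℝ) 1) : f r = f 0 :=
  constant_of_has_deriv_right_zero (fun r hr => (hf r hr).continuousWithinAt)
    (fun r hr => (hf r ⟨hr.1, hr.2.le⟩).mono_of_mem_nhdsWithin
      (Icc_mem_nhdsGE_of_mem hr)) r hr

/-- The fundamental solution has an inverse, given by the adjoint equation. -/
theorem exists_adjoint (hK : ∀ i j, ContinuousOn (fun r => K r i j) (Set.Icc 0 1)) :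
    ∃ Ψ : ℝ → Matrix (Fin 3) (Fin 3) ℂ, ∀ Φ, IsFundamental K Φ →
      ∀ r ∈ Set.Icc (0 : ℝ) 1, Ψ r * Φ r = 1 := by
  -- If `Θ' = -Kᵀ Θ` then `Θᵀ Φ` has derivative zero, and it equals `1` at the start.
  obtain ⟨Θ, h, -⟩ := exists_isFundamental (P := Unit) (fun _ r => -(K r).transpose)
    (fun i j => ((hK j i).comp (f := fun q : Unit × ℝ => q.2) (by fun_prop)
      (fun q hq => hq.2)).neg)
  have h := h ()
  refine ⟨fun r => (Θ () r).transpose, fun Φ hΦ r hr => ?_⟩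
  have h0 : (Θ () 0).transpose * Φ 0 = 1 := by rw [h.zero, hΦ.zero]; simp
  rw [← h0]
  ext i j
  refine eq_of_hasDerivWithinAt_zero (f := fun r => ((Θ () r).transpose * Φ r) i j)
    (fun r hr => ?_) hr
  have := hasDerivWithinAt_mul_apply (X := fun r => (Θ () r).transpose)
    (X' := fun r => (-(K r).transpose * Θ () r).transpose) (Z := Φ) (Z' := fun r => K r * Φ r)
    (fun i j => h.hasDeriv r hr j i) (fun i j => hΦ.hasDeriv r hr i j) i j
  convert this using 1
  simp [Matrix.transpose_mul, Matrix.mul_assoc]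

theorem IsFundamental.isUnit_det (hΦ : IsFundamental K Φ)
    (hK : ∀ i j, ContinuousOn (fun r => K r i j) (Set.Icc 0 1)) {r : ℝ}
    (hr : r ∈ Set.Icc (0 : ℝ) 1) : IsUnit (Φ r).det := by
  obtain ⟨Ψ, h⟩ := exists_adjoint hK
  exact (Matrix.isUnit_iff_isUnit_det _).1 (IsUnit.of_mul_eq_one_right _ (h Φ hΦ r hr))

/-- All fundamental solutions share the left inverse given by the adjoint equation, and a one-sided
inverse of a square matrix is two-sided. -/
theorem IsFundamental.eq (hΦ : IsFundamental K Φ) (hΨ : IsFundamental K Ψ)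
    (hK : ∀ i j, ContinuousOn (fun r => K r i j) (Set.Icc 0 1)) {r : ℝ}
    (hr : r ∈ Set.Icc (0 : ℝ) 1) : Φ r = Ψ r := by
  obtain ⟨Θ, h⟩ := exists_adjoint hK
  have h1 := h Φ hΦ r hr
  have h2 := mul_eq_one_comm.1 (h Ψ hΨ r hr)
  rw [← one_mul (Φ r), ← h2, mul_assoc, h1, mul_one]

theorem IsFundamental.congr {K' : ℝ → Matrix (Fin 3) (Fin 3) ℂ} (hΦ : IsFundamental K Φ)
    (h : ∀ r ∈ Set.Icc (0 : ℝ) 1, K r = K' r) : IsFundamental K' Φ :=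
  ⟨hΦ.zero, fun r hr i j => h r hr ▸ hΦ.hasDeriv r hr i j⟩

end Transport

end PainleveVI

namespace PainleveVI

open Polynomial
open scoped Polynomial.Bivariate IntermediateField Topology

/-! ### Parallel transport along paths -/

section Paths

theorem deriv_smoothTransition_of_nonpos {x : ℝ} (hx : x ≤ 0) :
    deriv Real.smoothTransition x = 0 :=
  IsLocalMin.deriv_eq_zero (Filter.Eventually.of_forall fun z => by
    rw [Real.smoothTransition.zero_of_nonpos hx]; exact Real.smoothTransition.nonneg z)

theorem deriv_smoothTransition_of_one_le {x : ℝ} (hx : 1 ≤ x) :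
    deriv Real.smoothTransition x = 0 :=
  IsLocalMax.deriv_eq_zero (Filter.Eventually.of_forall fun z => by
    rw [Real.smoothTransition.one_of_one_le hx]; exact Real.smoothTransition.le_one z)

theorem smoothTransition_mem_Icc (x : ℝ) : Real.smoothTransition x ∈ Set.Icc (0 : ℝ) 1 :=
  ⟨Real.smoothTransition.nonneg x, Real.smoothTransition.le_one x⟩

theorem hasDerivAt_smoothTransition_comp (c d r : ℝ) :
    HasDerivAt (fun r => Real.smoothTransition (c * r + d))
      (c * deriv Real.smoothTransition (c * r + d)) r := by
  have h1 : HasDerivAt Real.smoothTransition (deriv Real.smoothTransition (c * r + d))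
      (c * r + d) :=
    ((Real.smoothTransition.contDiff (n := 1)).differentiable one_ne_zero _).hasDerivAt
  have h2 : HasDerivAt (fun r : ℝ => c * r + d) c r := by
    simpa using ((hasDerivAt_id r).const_mul c).add_const d
  have h := h1.comp r h2
  rwa [mul_comm] at h

variable {A : ℂ → Matrix (Fin 3) (Fin 3) ℂ} {S : Set ℂ} {a b c : ℂ}
  {M N : Matrix (Fin 3) (Fin 3) ℂ}

variable (A S) in
/-- `M` is the parallel transport, for `dΦ/dz = A(z) Φ`, along a path from `a` to `b` that
avoids `S`. -/
def Transports (a b : ℂ) (M : Matrix (Fin 3) (Fin 3) ℂ) : Prop :=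
  ∃ (γ : ℝ → ℂ) (Φ : ℝ → Matrix (Fin 3) (Fin 3) ℂ), ContDiff ℝ 1 γ ∧ γ 0 = a ∧ γ 1 = b ∧
    (∀ r ∈ Set.Icc (0 : ℝ) 1, γ r ∉ S) ∧ IsFundamental (fun r => deriv γ r • A (γ r)) Φ ∧ Φ 1 = M

theorem mem_monodromyGroup_iff : M ∈ monodromyGroup A S a ↔ Transports A S a a M := by
  constructor
  · rintro ⟨γ, Φ, h1, h2, h3, h4, h5, h6, h7⟩
    exact ⟨γ, Φ, h1, h2, h3, h4, ⟨h5, by simpa using h7⟩, h6⟩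
  · rintro ⟨γ, Φ, h1, h2, h3, h4, h5, h6⟩
    exact ⟨γ, Φ, h1, h2, h3, h4, h5.zero, h6, by simpa using h5.hasDeriv⟩

theorem IsFundamental.comp_smoothTransition {K Φ : ℝ → Matrix (Fin 3) (Fin 3) ℂ}
    (h : IsFundamental K Φ) (c d r : ℝ) (i j : Fin 3) :
    HasDerivWithinAt (fun r => Φ (Real.smoothTransition (c * r + d)) i j)
      ((((c * deriv Real.smoothTransition (c * r + d) : ℝ) : ℂ) •
        (K (Real.smoothTransition (c * r + d)) * Φ (Real.smoothTransition (c * r + d)))) i j)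
      (Set.Icc 0 1) r := by
  have h1 := h.hasDeriv _ (smoothTransition_mem_Icc (c * r + d)) i j
  have h2 := h1.scomp r (hasDerivAt_smoothTransition_comp c d r).hasDerivWithinAt
    (s := Set.Icc 0 1) (fun x _ => smoothTransition_mem_Icc _)
  simpa [Function.comp_def] using h2

theorem Transports.trans (h : Transports A S a b M) (h' : Transports A S b c N) :
    Transports A S a c (N * M) := by
  obtain ⟨γ₁, Φ₁, hc₁, ha₁, hb₁, hS₁, hΦ₁, rfl⟩ := h
  obtain ⟨γ₂, Φ₂, hc₂, ha₂, hb₂, hS₂, hΦ₂, rfl⟩ := h'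
  let σ := Real.smoothTransition
  have hσ : ContDiff ℝ 1 σ := Real.smoothTransition.contDiff
  -- Both paths are slowed down to rest at the junction, so that the sum stays continuously
  -- differentiable. On each half one of the summands is the constant `b`, which the final term
  -- cancels.
  let γ : ℝ → ℂ := fun r => γ₁ (σ (2 * r + 0)) + γ₂ (σ (2 * r + (-1))) - b
  have hγd : ∀ r, HasDerivAt γ (((2 * deriv σ (2 * r + 0) : ℝ) : ℂ) * deriv γ₁ (σ (2 * r + 0)) +
      ((2 * deriv σ (2 * r + (-1)) : ℝ) : ℂ) * deriv γ₂ (σ (2 * r + (-1)))) r := fun r => by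
    have h1 := ((hc₁.differentiable one_ne_zero (σ (2 * r + 0))).hasDerivAt).scomp r
      (hasDerivAt_smoothTransition_comp 2 0 r)
    have h2 := ((hc₂.differentiable one_ne_zero (σ (2 * r + (-1)))).hasDerivAt).scomp r
      (hasDerivAt_smoothTransition_comp 2 (-1) r)
    have h := (h1.add h2).sub_const b
    simp only [Complex.real_smul] at h
    exact h
  have hlo : ∀ r : ℝ, r ≤ 1 / 2 → σ (2 * r + (-1)) = 0 ∧ deriv σ (2 * r + (-1)) = 0 ∧
      γ r = γ₁ (σ (2 * r + 0)) := fun r hr => by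
    have h0 : σ (2 * r + (-1)) = 0 := Real.smoothTransition.zero_of_nonpos (by linarith)
    refine ⟨h0, deriv_smoothTransition_of_nonpos (by linarith), ?_⟩
    simp [γ, h0, ha₂]
  have hhi : ∀ r : ℝ, 1 / 2 ≤ r → σ (2 * r + 0) = 1 ∧ deriv σ (2 * r + 0) = 0 ∧
      γ r = γ₂ (σ (2 * r + (-1))) := fun r hr => by
    have h0 : σ (2 * r + 0) = 1 := Real.smoothTransition.one_of_one_le (by linarith)
    refine ⟨h0, deriv_smoothTransition_of_one_le (by linarith), ?_⟩
    simp only [γ, h0, hb₁]; ring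
  refine ⟨γ, fun r => Φ₂ (σ (2 * r + (-1))) * Φ₁ (σ (2 * r + 0)), ?_, ?_, ?_, ?_, ⟨?_, ?_⟩, ?_⟩
  · exact ((hc₁.comp (hσ.comp (by fun_prop))).add (hc₂.comp (hσ.comp (by fun_prop)))).sub
      contDiff_const
  · rw [(hlo 0 (by norm_num)).2.2]
    simpa [σ] using ha₁
  · rw [(hhi 1 (by norm_num)).2.2, show (2 : ℝ) * 1 + -1 = 1 by norm_num]
    simpa [σ] using hb₂
  · intro r _
    rcases le_total r (1 / 2) with hr | hr
    · rw [(hlo r hr).2.2]; exact hS₁ _ (smoothTransition_mem_Icc _)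
    · rw [(hhi r hr).2.2]; exact hS₂ _ (smoothTransition_mem_Icc _)
  · show Φ₂ (σ (2 * 0 + (-1))) * Φ₁ (σ (2 * 0 + 0)) = 1
    rw [(hlo 0 (by norm_num)).1, hΦ₂.zero]
    simp [σ, hΦ₁.zero]
  · intro r _ i j
    have h := hasDerivWithinAt_mul_apply
      (X := fun r => Φ₂ (σ (2 * r + (-1)))) (X' := fun r => ((2 * deriv σ (2 * r + (-1)) : ℝ) : ℂ) •
        ((deriv γ₂ (σ (2 * r + (-1))) • A (γ₂ (σ (2 * r + (-1))))) * Φ₂ (σ (2 * r + (-1)))))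
      (Z := fun r => Φ₁ (σ (2 * r + 0))) (Z' := fun r => ((2 * deriv σ (2 * r + 0) : ℝ) : ℂ) •
        ((deriv γ₁ (σ (2 * r + 0)) • A (γ₁ (σ (2 * r + 0)))) * Φ₁ (σ (2 * r + 0))))
      (fun i j => hΦ₂.comp_smoothTransition 2 (-1) r i j)
      (fun i j => hΦ₁.comp_smoothTransition 2 0 r i j) i j
    convert h using 1
    rw [(hγd r).deriv]
    rcases le_total r (1 / 2) with hr | hr
    · obtain ⟨e1, e2, e3⟩ := hlo r hr
      rw [e1, e2, e3, hΦ₂.zero]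
      simp [smul_smul]
    · obtain ⟨e1, e2, e3⟩ := hhi r hr
      rw [e1, e2, e3]
      simp [smul_smul, mul_assoc]
  · show Φ₂ (σ (2 * 1 + (-1))) * Φ₁ (σ (2 * 1 + 0)) = _
    have h1 : σ (2 * 1 + (-1)) = 1 := Real.smoothTransition.one_of_one_le (by norm_num)
    have h2 : σ (2 * 1 + 0) = 1 := Real.smoothTransition.one_of_one_le (by norm_num)
    rw [h1, h2]

theorem continuousOn_transportCoeff (hA : ∀ i j, ContinuousOn (fun z => A z i j) Sᶜ) {γ : ℝ → ℂ}
    (hγ : ContDiff ℝ 1 γ) (hS : ∀ r ∈ Set.Icc (0 : ℝ) 1, γ r ∉ S) (i j : Fin 3) :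
    ContinuousOn (fun r => (deriv γ r • A (γ r)) i j) (Set.Icc 0 1) :=
  (hγ.continuous_deriv_one).continuousOn.mul
    ((hA i j).comp hγ.continuous.continuousOn fun r hr => hS r hr)

theorem Transports.isUnit_det (hA : ∀ i j, ContinuousOn (fun z => A z i j) Sᶜ)
    (h : Transports A S a b M) : IsUnit M.det := by
  obtain ⟨γ, Φ, hc, ha, hb, hS, hΦ, rfl⟩ := h
  exact hΦ.isUnit_det (continuousOn_transportCoeff hA hc hS) ⟨zero_le_one, le_rfl⟩

theorem Transports.symm (hA : ∀ i j, ContinuousOn (fun z => A z i j) Sᶜ)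
    (h : Transports A S a b M) : Transports A S b a M⁻¹ := by
  have hM := h.isUnit_det hA
  obtain ⟨γ, Φ, hc, ha, hb, hS, hΦ, rfl⟩ := h
  have hm : ∀ r ∈ Set.Icc (0 : ℝ) 1, 1 - r ∈ Set.Icc (0 : ℝ) 1 := fun r hr =>
    ⟨by linarith [hr.2], by linarith [hr.1]⟩
  refine ⟨fun r => γ (1 - r), fun r => Φ (1 - r) * (Φ 1)⁻¹, hc.comp (by fun_prop), by simpa using hb,
    by simpa using ha, fun r hr => hS _ (hm r hr), ⟨?_, fun r hr i j => ?_⟩, ?_⟩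
  · simp [Matrix.mul_nonsing_inv _ hM]
  · have h1 : ∀ i j, HasDerivWithinAt (fun r => Φ (1 - r) i j)
        ((-((deriv γ (1 - r) • A (γ (1 - r))) * Φ (1 - r))) i j) (Set.Icc 0 1) r := fun i j => by
      have h2 := (hΦ.hasDeriv _ (hm r hr) i j).scomp r
        (((hasDerivAt_id r).const_sub 1).hasDerivWithinAt (s := Set.Icc 0 1)) hm
      simpa [Function.comp_def] using h2
    have h3 := hasDerivWithinAt_mul_apply (X := fun r => Φ (1 - r))
      (X' := fun r => -((deriv γ (1 - r) • A (γ (1 - r))) * Φ (1 - r)))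
      (Z := fun _ => (Φ 1)⁻¹) (Z' := fun _ => 0) h1
      (fun i j => hasDerivWithinAt_const _ _ _) i j
    convert h3 using 1
    rw [deriv_comp_const_sub]
    simp [mul_assoc]
  · simp [hΦ.zero]

theorem transports_segment {Φ : ℝ → Matrix (Fin 3) (Fin 3) ℂ}
    (hS : ∀ r ∈ Set.Icc (0 : ℝ) 1, a + r * (b - a) ∉ S)
    (hΦ : IsFundamental (fun r => (b - a) • A (a + r * (b - a))) Φ) :
    Transports A S a b (Φ 1) := by
  have hd : ∀ r : ℝ, HasDerivAt (fun r : ℝ => a + r * (b - a)) (b - a) r := fun r => by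
    simpa using ((Complex.ofRealCLM.hasDerivAt (x := r)).mul_const (b - a)).const_add a
  refine ⟨fun r => a + r * (b - a), Φ, ?_, by simp, by simp, hS, ?_, rfl⟩
  · exact contDiff_const.add (Complex.ofRealCLM.contDiff.mul contDiff_const)
  · simpa only [(hd _).deriv] using hΦ

theorem exists_transports_segment (hA : ∀ i j, ContinuousOn (fun z => A z i j) Sᶜ)
    (hS : ∀ r ∈ Set.Icc (0 : ℝ) 1, a + r * (b - a) ∉ S) : ∃ M, Transports A S a b M := by
  obtain ⟨Φ, hΦ, -⟩ := exists_isFundamental (P := Unit)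
    (fun _ r => (b - a) • A (a + r * (b - a)))
    (fun i j => by
      refine continuousOn_const.mul ((hA i j).comp ?_ fun q hq => hS q.2 hq.2)
      have : Continuous fun q : Unit × ℝ => a + q.2 * (b - a) := by fun_prop
      exact this.continuousOn)
  exact ⟨_, transports_segment hS (hΦ ())⟩

end Paths

end PainleveVI

namespace PainleveVI

open Polynomial
open scoped Polynomial.Bivariate IntermediateField Topology ComplexConjugate

/-! ### Traces of local monodromies -/

section Scaling

/-- The coefficient, on the segment from `u` to `v`, of the system with residues the rows of `B`
and poles at the zeros of `p j * w + q j`. -/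
noncomputable def segmentCoeff (B : Matrix (Fin 3) (Fin 3) ℂ) (p q : Fin 3 → ℝ) (u v : ℂ) (r : ℝ) :
    Matrix (Fin 3) (Fin 3) ℂ :=
  Matrix.diagonal (fun j => p j * (v - u) / (p j * (u + r * (v - u)) + q j)) * B

/-- The coefficient of the system with poles at the points `a j`. -/
noncomputable def fuchsian (B : Matrix (Fin 3) (Fin 3) ℂ) (a : Fin 3 → ℝ) (z : ℂ) :
    Matrix (Fin 3) (Fin 3) ℂ :=
  Matrix.diagonal (fun j => 1 / (z - a j)) * B

variable {B : Matrix (Fin 3) (Fin 3) ℂ} {a : Fin 3 → ℝ}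

theorem continuousOn_fuchsian (i j : Fin 3) :
    ContinuousOn (fun z => fuchsian B a z i j) (Set.range fun j => (a j : ℂ))ᶜ := by
  simp only [fuchsian, Matrix.diagonal_mul]
  refine ContinuousOn.mul (continuousOn_const.div (by fun_prop) fun z hz => ?_) continuousOn_const
  exact sub_ne_zero.2 fun h => hz ⟨i, h.symm⟩

/-- This is the substitution `z = c + ρ w`: the hypothesis says that `p j * w + q j` is `(p j / ρ)(z
- a j)`, and `dz/(z - a j)` is invariant. Letting `p j` tend to zero with `q j` nonzero sends a pole
to infinity, which the coordinate `z` cannot express. -/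
theorem segmentCoeff_eq {p q : Fin 3 → ℝ} {c ρ : ℝ} (hρ : ρ ≠ 0) (hp : ∀ j, p j ≠ 0)
    (h : ∀ j, p j * (c - a j) = ρ * q j) (u v : ℂ) (r : ℝ) :
    segmentCoeff B p q u v r =
      ((c + ρ * v) - (c + ρ * u)) • fuchsian B a ((c + ρ * u) + r * ((c + ρ * v) - (c + ρ * u))) := by
  rw [segmentCoeff, fuchsian, ← Matrix.smul_mul, ← Matrix.diagonal_smul]
  congr 2
  funext j
  have h1 : (p j : ℂ) ≠ 0 := by exact_mod_cast hp j
  have h2 : (ρ : ℂ) ≠ 0 := by exact_mod_cast hρ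
  have h3 : (p j : ℂ) * (c - a j) = ρ * q j := by exact_mod_cast h j
  have h4 : (p j * (u + r * (v - u)) + q j : ℂ) =
      p j / ρ * (c + ρ * u + r * (c + ρ * v - (c + ρ * u)) - a j) := by
    field_simp
    linear_combination -h3
  rw [h4, Pi.smul_apply, smul_eq_mul, show (c + ρ * v - (c + ρ * u) : ℂ) = ρ * (v - u) by ring]
  generalize (c + ρ * u + r * (ρ * (v - u)) - a j : ℂ) = d
  by_cases hd : d = 0
  · simp [hd]
  · field_simp

theorem transports_of_segmentCoeff {p q : Fin 3 → ℝ} {c ρ : ℝ} (hρ : ρ ≠ 0) (hp : ∀ j, p j ≠ 0)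
    (h : ∀ j, p j * (c - a j) = ρ * q j) {u v : ℂ}
    (hne : ∀ j, ∀ r ∈ Set.Icc (0 : ℝ) 1, (p j * (u + r * (v - u)) + q j : ℂ) ≠ 0)
    {Φ : ℝ → Matrix (Fin 3) (Fin 3) ℂ} (hΦ : IsFundamental (segmentCoeff B p q u v) Φ) :
    Transports (fuchsian B a) (Set.range fun j => (a j : ℂ)) (c + ρ * u) (c + ρ * v) (Φ 1) := by
  refine transports_segment ?_ (hΦ.congr fun r _ => segmentCoeff_eq hρ hp h u v r)
  rintro r hr ⟨j, hj⟩
  refine hne j r hr ?_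
  have h2 : (ρ : ℂ) ≠ 0 := by exact_mod_cast hρ
  have h3 : (p j : ℂ) * (c - a j) = ρ * q j := by exact_mod_cast h j
  refine (mul_eq_zero.1 (?_ : (ρ : ℂ) * _ = 0)).resolve_left h2
  linear_combination -h3 - p j * hj

/-- The limit system at `ε = 0` belongs to the family, although the change of coordinate degenerates
there; only the poles in the coordinate `w` have to stay off the segment. -/
theorem exists_segment_family {p q : Fin 3 → ℝ → ℝ} (hp : ∀ j, Continuous (p j))
    (hq : ∀ j, Continuous (q j)) {u v : ℂ}
    (hne : ∀ ε ∈ Set.Icc (0 : ℝ) 1, ∀ j, ∀ r ∈ Set.Icc (0 : ℝ) 1,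
      (p j ε * (u + r * (v - u)) + q j ε : ℂ) ≠ 0) :
    ∃ Φ : Set.Icc (0 : ℝ) 1 → ℝ → Matrix (Fin 3) (Fin 3) ℂ,
      (∀ ε : Set.Icc (0 : ℝ) 1, IsFundamental (segmentCoeff B (fun j => p j ε) (fun j => q j ε) u v) (Φ ε)) ∧
      Continuous fun ε => Φ ε 1 := by
  refine exists_isFundamental _ fun i j => ?_
  simp only [segmentCoeff, Matrix.diagonal_mul]
  refine ContinuousOn.mul (ContinuousOn.div ?_ ?_ fun x hx => hne x.1 x.1.2 i x.2 hx.2)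
    continuousOn_const
  · have := hp i; fun_prop
  · have := hp i; have := hq i; fun_prop

theorem continuousOn_segmentCoeff {p q : Fin 3 → ℝ} {u v : ℂ}
    (hne : ∀ j, ∀ r ∈ Set.Icc (0 : ℝ) 1, (p j * (u + r * (v - u)) + q j : ℂ) ≠ 0) (i j : Fin 3) :
    ContinuousOn (fun r => segmentCoeff B p q u v r i j) (Set.Icc 0 1) := by
  simp only [segmentCoeff, Matrix.diagonal_mul]
  exact ContinuousOn.mul (ContinuousOn.div (by fun_prop) (by fun_prop) fun r hr => hne i r hr)
    continuousOn_const

/-- On the segment from the upper half plane to a real point, a real affine function vanishes at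
most at the end. -/
theorem affine_ne_zero {p q g : ℝ} {w : ℂ} (hw : w.im ≠ 0) (h : p * g + q ≠ 0) (r : ℝ) :
    (p * (g + r * (w - g)) + q : ℂ) ≠ 0 := by
  intro h0
  have him := congrArg Complex.im h0
  have hre := congrArg Complex.re h0
  simp at him hre
  rcases him with hp | hr | hr
  · apply h; simp [hp] at hre ⊢; exact hre
  · apply h; simp [hr] at hre; linarith
  · exact hw hr

theorem affine_ne_zero' {p q g : ℝ} {w : ℂ} (hw : w.im ≠ 0) (h : p * g + q ≠ 0) (r : ℝ) :
    (p * (w + r * (g - w)) + q : ℂ) ≠ 0 := by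
  have := affine_ne_zero hw h (1 - r)
  convert this using 2
  push_cast; ring

end Scaling

/-! #### The limit system -/

section Limit

variable {ι : Type*} [Fintype ι]

/-- The exponential `z ↦ exp (z B)` of a matrix `B = ∑ μ k pr k` with spectral projections `pr k`. -/
noncomputable def spectralExp (μ : ι → ℂ) (pr : ι → Matrix (Fin 3) (Fin 3) ℂ) (z : ℂ) :
    Matrix (Fin 3) (Fin 3) ℂ := ∑ k, Complex.exp (μ k * z) • pr k

variable {μ : ι → ℂ} {pr : ι → Matrix (Fin 3) (Fin 3) ℂ}

theorem spectralExp_zero (h1 : ∑ k, pr k = 1) : spectralExp μ pr 0 = 1 := by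
  simp [spectralExp, h1]

theorem spectralExp_mul [DecidableEq ι] (hpr : ∀ k l, pr k * pr l = if k = l then pr k else 0) (z z' : ℂ) :
    spectralExp μ pr z * spectralExp μ pr z' = spectralExp μ pr (z + z') := by
  simp only [spectralExp, Finset.sum_mul, Finset.mul_sum, Matrix.smul_mul, Matrix.mul_smul, hpr]
  refine Finset.sum_congr rfl fun k _ => ?_
  rw [Finset.sum_eq_single k]
  · rw [if_pos rfl, smul_smul, mul_add, Complex.exp_add, mul_comm]
  · intro l _ hl; rw [if_neg hl]; simp
  · simp

/-- The system `dΦ/dw = (B/w) Φ` is solved by `(w/u)^B`. The slit plane condition makes the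
principal logarithm differentiable along the whole segment. -/
theorem isFundamental_spectralExp {B : Matrix (Fin 3) (Fin 3) ℂ} (h1 : ∑ k, pr k = 1)
    (hB : ∀ k, B * pr k = μ k • pr k) {u v : ℂ} (hu : u ≠ 0)
    (hs : ∀ r ∈ Set.Icc (0 : ℝ) 1, (u + r * (v - u)) / u ∈ Complex.slitPlane) :
    IsFundamental (fun r : ℝ => ((v - u) / (u + r * (v - u))) • B)
      (fun r => spectralExp μ pr (Complex.log ((u + r * (v - u)) / u))) := by
  refine ⟨by simp [hu, spectralExp_zero h1], fun r hr i j => ?_⟩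
  have hd : HasDerivAt (fun r : ℝ => (u + r * (v - u)) / u) ((v - u) / u) r := by
    simpa using (((Complex.ofRealCLM.hasDerivAt (x := r)).mul_const (v - u)).const_add u).div_const u
  have hl := hd.clog_real (hs r hr)
  rw [div_div_div_cancel_right₀ hu] at hl
  have he : HasDerivAt (fun r : ℝ => spectralExp μ pr (Complex.log ((u + r * (v - u)) / u)) i j)
      (∑ k, Complex.exp (μ k * Complex.log ((u + r * (v - u)) / u)) *
        (μ k * ((v - u) / (u + r * (v - u)))) * pr k i j) r := by
    simp only [spectralExp, Matrix.sum_apply, Matrix.smul_apply, smul_eq_mul]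
    exact HasDerivAt.fun_sum fun k _ => ((hl.const_mul (μ k)).cexp).mul_const _
  refine he.hasDerivWithinAt.congr_deriv ?_
  simp only [spectralExp, Finset.mul_sum, Matrix.smul_mul, Matrix.mul_smul, hB, Matrix.sum_apply,
    Matrix.smul_apply, smul_eq_mul]
  exact Finset.sum_congr rfl fun k _ => by ring

/-- A quotient of two points of the closed upper half plane is a negative real number only if both
are real, which `0 < w.im` excludes. -/
theorem div_mem_slitPlane {w z : ℂ} (hw : 0 < w.im) (hz : 0 ≤ z.im) (h0 : z ≠ 0) :
    z / w ∈ Complex.slitPlane := by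
  rw [Complex.mem_slitPlane_iff_not_le_zero]
  intro h
  obtain ⟨hr, hi⟩ := Complex.le_def.1 h
  have hw0 : w ≠ 0 := by rintro rfl; simp at hw
  have e : z = z / w * w := by field_simp
  have him := congrArg Complex.im e
  simp only [Complex.zero_re, Complex.zero_im] at hr hi
  rw [Complex.mul_im, hi, zero_mul, add_zero] at him
  have hr0 : (z / w).re = 0 := by
    by_contra hne
    have := mul_neg_of_neg_of_pos (lt_of_le_of_ne hr hne) hw
    linarith
  have : z / w = 0 := Complex.ext hr0 hi
  rw [this, zero_mul] at e
  exact h0 e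

/-- The increment of the logarithm along a path from `w` to its complex conjugate through a positive
real number. -/
theorem log_add_log_of_pos {w : ℂ} {g : ℝ} (hw : 0 < w.im) (hg : 0 < g) :
    Complex.log (g / w) + Complex.log (conj w / g) = -(2 * w.arg * Complex.I) := by
  have hw0 : w ≠ 0 := by rintro rfl; simp at hw
  have harg : w.arg ≠ Real.pi := fun h => by
    rw [Complex.arg_eq_pi_iff] at h; linarith [h.2]
  have h1 : Complex.log (g / w) = Real.log g - Complex.log w := by
    rw [div_eq_mul_inv, Complex.log_ofReal_mul hg (inv_ne_zero hw0), Complex.log_inv _ harg]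
    ring
  have h2 : Complex.log (conj w / g) = conj (Complex.log w) - Real.log g := by
    rw [div_eq_inv_mul, ← Complex.ofReal_inv, Complex.log_ofReal_mul (inv_pos.2 hg) (by simpa),
      Complex.log_conj _ harg, Real.log_inv]
    push_cast; ring
  rw [h1, h2]
  apply Complex.ext <;> simp [Complex.log_re, Complex.log_im]
  ring

/-- The increment of the logarithm along a path from `w` to its complex conjugate through a negative
real number. -/
theorem log_add_log_of_neg {w : ℂ} {g : ℝ} (hw : 0 < w.im) (hg : g < 0) :
    Complex.log (g / w) + Complex.log (conj w / g) =
      2 * Real.pi * Complex.I - 2 * w.arg * Complex.I := by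
  have hw0 : w ≠ 0 := by rintro rfl; simp at hw
  have hg' : 0 < -g := by linarith
  have him : 0 < (-conj w).im := by simpa using hw
  have hargn : (-conj w).arg = Real.pi - w.arg := by
    have hcw : (conj w).im < 0 := by simpa using hw
    rw [Complex.arg_neg_eq_arg_add_pi_of_im_neg hcw, Complex.arg_conj, if_neg]
    · ring
    · intro h; rw [Complex.arg_eq_pi_iff] at h; linarith [h.2]
  have hW := log_add_log_of_pos (w := -conj w) him hg'
  have e1 : (conj (-conj w) / ((-g : ℝ) : ℂ)) = w / g := by
    rw [map_neg, Complex.conj_conj]; push_cast; rw [neg_div_neg_eq]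
  have e2 : (((-g : ℝ) : ℂ) / (-conj w)) = g / conj w := by
    push_cast; rw [neg_div_neg_eq]
  rw [e1, e2, hargn] at hW
  have hinv : ∀ z : ℂ, z.im ≠ 0 → Complex.log z⁻¹ = -Complex.log z := fun z hz =>
    Complex.log_inv _ fun h => hz (Complex.arg_eq_pi_iff.1 h).2
  have hgne : g ≠ 0 := hg.ne
  have i1 : (w / g : ℂ).im ≠ 0 := by
    rw [Complex.div_ofReal_im]; exact div_ne_zero hw.ne' hgne
  have i2 : (conj w / g : ℂ).im ≠ 0 := by
    rw [Complex.div_ofReal_im]; simpa using ⟨hw.ne', hgne⟩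
  have j1 := hinv _ i1
  have j2 := hinv _ i2
  rw [inv_div] at j1 j2
  rw [j1]
  rw [j2] at hW
  push_cast at hW
  linear_combination -hW

end Limit

end PainleveVI

namespace PainleveVI

open Polynomial
open scoped Polynomial.Bivariate IntermediateField Topology ComplexConjugate

/-! ### Loops through two points of the real line, and constancy of the trace -/

section Gates

/-- `E` is the transport from `z₀` to its complex conjugate along the two segments through the real
point `g`. -/
def IsGateTransport (A : ℂ → Matrix (Fin 3) (Fin 3) ℂ) (z₀ : ℂ) (g : ℝ)
    (E : Matrix (Fin 3) (Fin 3) ℂ) : Prop :=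
  ∃ Φ₁ Φ₂, IsFundamental (fun r : ℝ => (g - z₀) • A (z₀ + r * (g - z₀))) Φ₁ ∧
    IsFundamental (fun r : ℝ => (conj z₀ - g) • A (g + r * (conj z₀ - g))) Φ₂ ∧ E = Φ₂ 1 * Φ₁ 1

variable {B : Matrix (Fin 3) (Fin 3) ℂ} {a : Fin 3 → ℝ} {z₀ : ℂ} {g : ℝ}

theorem segment_notMem (hz : z₀.im ≠ 0) (hg : ∀ j, g ≠ a j) (r : ℝ) :
    z₀ + r * (g - z₀) ∉ (Set.range fun j => (a j : ℂ)) := by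
  rintro ⟨j, hj⟩
  refine affine_ne_zero' (p := 1) (q := -a j) hz (g := g) ?_ r ?_
  · simpa [← sub_eq_add_neg, sub_eq_zero] using hg j
  · push_cast; simp only at hj; linear_combination -hj

theorem segment_notMem' (hz : z₀.im ≠ 0) (hg : ∀ j, g ≠ a j) (r : ℝ) :
    g + r * (z₀ - g) ∉ (Set.range fun j => (a j : ℂ)) := by
  have h := segment_notMem hz hg (1 - r)
  convert h using 2
  push_cast; ring

theorem exists_isGateTransport (hz : z₀.im ≠ 0) (hg : ∀ j, g ≠ a j) :
    ∃ E, IsGateTransport (fuchsian B a) z₀ g E ∧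
      Transports (fuchsian B a) (Set.range fun j => (a j : ℂ)) z₀ (conj z₀) E := by
  have hz' : (conj z₀).im ≠ 0 := by simpa using hz
  have key : ∀ u v : ℂ, (∀ r ∈ Set.Icc (0 : ℝ) 1,
      u + r * (v - u) ∉ (Set.range fun j => (a j : ℂ))) →
      ∃ Φ, IsFundamental (fun r : ℝ => (v - u) • fuchsian B a (u + r * (v - u))) Φ := by
    intro u v h
    obtain ⟨Φ, hΦ, -⟩ := exists_isFundamental (P := Unit)
      (fun _ r => (v - u) • fuchsian B a (u + r * (v - u)))
      (fun i j => by
        refine continuousOn_const.mul ((continuousOn_fuchsian i j).comp ?_ fun q hq => h q.2 hq.2)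
        have : Continuous fun q : Unit × ℝ => u + q.2 * (v - u) := by fun_prop
        exact this.continuousOn)
    exact ⟨_, hΦ ()⟩
  obtain ⟨Φ₁, h1⟩ := key z₀ g fun r _ => segment_notMem hz hg r
  obtain ⟨Φ₂, h2⟩ := key g (conj z₀) fun r _ => segment_notMem' hz' hg r
  exact ⟨_, ⟨Φ₁, Φ₂, h1, h2, rfl⟩,
    (transports_segment (fun r _ => segment_notMem hz hg r) h1).trans
      (transports_segment (fun r _ => segment_notMem' hz' hg r) h2)⟩

theorem continuous_trace_inv_mul {P : Type*} [TopologicalSpace P]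
    {X Z : P → Matrix (Fin 3) (Fin 3) ℂ} (hX : Continuous X) (hZ : Continuous Z)
    (h : ∀ p, IsUnit (X p).det) : Continuous fun p => ((X p)⁻¹ * Z p).trace := by
  simp only [Matrix.inv_def, Ring.inverse_eq_inv']
  exact (((hX.matrix_det.inv₀ fun p => (h p).ne_zero).smul hX.matrix_adjugate).matrix_mul
    hZ).matrix_trace

/-- The trace of the monodromy along a loop that crosses the real line in two points is
determined by the limit of the system under rescaling, if the traces of the monodromies form
a finite set. -/
theorem trace_gates {ι : Type*} [Fintype ι] [DecidableEq ι] {μ : ι → ℂ}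
    {pr : ι → Matrix (Fin 3) (Fin 3) ℂ} (h1 : ∑ k, pr k = 1)
    (hpr : ∀ k l, pr k * pr l = if k = l then pr k else 0)
    {p q : Fin 3 → ℝ → ℝ} {c ρ : ℝ → ℝ} {gm gp : ℝ} (hp : ∀ j, Continuous (p j))
    (hq : ∀ j, Continuous (q j)) (hz : 0 < z₀.im) (hgm : gm < 0) (hgp : 0 < gp)
    (hne : ∀ ε ∈ Set.Icc (0 : ℝ) 1, ∀ j, p j ε * gm + q j ε ≠ 0 ∧ p j ε * gp + q j ε ≠ 0)
    (hρ : ∀ ε ∈ Set.Ioc (0 : ℝ) 1, 0 < ρ ε ∧ ∀ j, p j ε ≠ 0 ∧ p j ε * (c ε - a j) = ρ ε * q j ε)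
    (hρ1 : ρ 1 = 1) (h0 : ∀ j, (p j 0 = 1 ∧ q j 0 = 0) ∨ p j 0 = 0)
    (hB : ∀ k, Matrix.diagonal (fun j => (p j 0 : ℂ)) * B * pr k = μ k • pr k)
    (hfin : (Matrix.trace '' monodromyGroup (fuchsian B a) (Set.range fun j => (a j : ℂ)) z₀).Finite)
    {Em Ep : Matrix (Fin 3) (Fin 3) ℂ} (hEm : IsGateTransport (fuchsian B a) z₀ (c 1 + gm) Em)
    (hEp : IsGateTransport (fuchsian B a) z₀ (c 1 + gp) Ep) :
    (Ep⁻¹ * Em).trace = ∑ k, Complex.exp (2 * Real.pi * Complex.I * μ k) * (pr k).trace := by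
  set S : Set ℂ := Set.range fun j => (a j : ℂ) with hS
  obtain ⟨w, hw⟩ : ∃ w : ℂ, w = z₀ - c 1 := ⟨_, rfl⟩
  have hwim : 0 < w.im := by simpa [hw] using hz
  have hw0 : w ≠ 0 := by rintro rfl; simp at hwim
  have hwim' : (conj w).im ≠ 0 := by simpa using hwim.ne'
  have one_mem : (1 : ℝ) ∈ Set.Icc (0 : ℝ) 1 := ⟨zero_le_one, le_rfl⟩
  have zero_mem : (0 : ℝ) ∈ Set.Icc (0 : ℝ) 1 := ⟨le_rfl, zero_le_one⟩
  -- For a gate `g` in the coordinate `w`, this is the transport from `w` to its conjugate as a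
  -- continuous function of `ε`: at `1` it belongs to the given system, for `ε > 0` to a rescaled
  -- loop in that system, and at `0` to the limit system, which is solved by an exponential.
  have half : ∀ g : ℝ, g ≠ 0 → (∀ ε ∈ Set.Icc (0 : ℝ) 1, ∀ j, p j ε * g + q j ε ≠ 0) →
      ∃ E : Set.Icc (0 : ℝ) 1 → Matrix (Fin 3) (Fin 3) ℂ, Continuous E ∧
        (∀ ε, IsUnit (E ε).det) ∧
        (∀ ε : Set.Icc (0 : ℝ) 1, 0 < (ε : ℝ) → Transports (fuchsian B a) S (c ε + ρ ε * w)
          (c ε + ρ ε * conj w) (E ε)) ∧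
        (∀ E', IsGateTransport (fuchsian B a) z₀ (c 1 + g) E' → E' = E ⟨1, one_mem⟩) ∧
        E ⟨0, zero_mem⟩ =
          spectralExp μ pr (Complex.log (g / w) + Complex.log (conj w / g)) := by
    intro g hg0 hg
    have hne1 : ∀ ε ∈ Set.Icc (0 : ℝ) 1, ∀ j, ∀ r ∈ Set.Icc (0 : ℝ) 1,
        (p j ε * (w + r * (g - w)) + q j ε : ℂ) ≠ 0 := fun ε hε j r _ =>
      affine_ne_zero' hwim.ne' (hg ε hε j) r
    have hne2 : ∀ ε ∈ Set.Icc (0 : ℝ) 1, ∀ j, ∀ r ∈ Set.Icc (0 : ℝ) 1,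
        (p j ε * (g + r * (conj w - g)) + q j ε : ℂ) ≠ 0 := fun ε hε j r _ =>
      affine_ne_zero hwim' (hg ε hε j) r
    obtain ⟨Φ₁, hΦ₁, hc₁⟩ := exists_segment_family (B := B) hp hq hne1
    obtain ⟨Φ₂, hΦ₂, hc₂⟩ := exists_segment_family (B := B) hp hq hne2
    have hu1 := fun ε : Set.Icc (0 : ℝ) 1 =>
      continuousOn_segmentCoeff (B := B) (p := fun j => p j ε) (q := fun j => q j ε) (hne1 ε ε.2)
    have hu2 := fun ε : Set.Icc (0 : ℝ) 1 =>
      continuousOn_segmentCoeff (B := B) (p := fun j => p j ε) (q := fun j => q j ε) (hne2 ε ε.2)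
    refine ⟨fun ε => Φ₂ ε 1 * Φ₁ ε 1, hc₂.matrix_mul hc₁, fun ε => ?_, fun ε hε => ?_,
      fun E' hE' => ?_, ?_⟩
    · rw [Matrix.det_mul]
      exact ((hΦ₂ ε).isUnit_det (hu2 ε) one_mem).mul ((hΦ₁ ε).isUnit_det (hu1 ε) one_mem)
    · obtain ⟨hρ0, hj⟩ := hρ ε ⟨hε, ε.2.2⟩
      exact (transports_of_segmentCoeff hρ0.ne' (fun j => (hj j).1) (fun j => (hj j).2)
        (hne1 ε ε.2) (hΦ₁ ε)).trans (transports_of_segmentCoeff hρ0.ne' (fun j => (hj j).1)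
        (fun j => (hj j).2) (hne2 ε ε.2) (hΦ₂ ε))
    · obtain ⟨Θ₁, Θ₂, hΘ₁, hΘ₂, rfl⟩ := hE'
      obtain ⟨hρ0, hj⟩ := hρ 1 ⟨zero_lt_one, le_rfl⟩
      have e1 : ∀ r : ℝ, segmentCoeff B (fun j => p j 1) (fun j => q j 1) w g r =
          ((c 1 + g : ℝ) - z₀) • fuchsian B a (z₀ + r * ((c 1 + g : ℝ) - z₀)) := fun r => by
        rw [segmentCoeff_eq hρ0.ne' (fun j => (hj j).1) (fun j => (hj j).2), hρ1, hw]
        push_cast; congr 2 <;> ring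
      have e2 : ∀ r : ℝ, segmentCoeff B (fun j => p j 1) (fun j => q j 1) g (conj w) r =
          (conj z₀ - (c 1 + g : ℝ)) •
            fuchsian B a ((c 1 + g : ℝ) + r * (conj z₀ - (c 1 + g : ℝ))) := fun r => by
        rw [segmentCoeff_eq hρ0.ne' (fun j => (hj j).1) (fun j => (hj j).2), hρ1, hw]
        simp only [map_sub, Complex.conj_ofReal]
        push_cast; congr 2 <;> ring
      have k1 := (hΦ₁ ⟨1, one_mem⟩).eq (hΘ₁.congr fun r _ => (e1 r).symm) (hu1 ⟨1, one_mem⟩) one_mem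
      have k2 := (hΦ₂ ⟨1, one_mem⟩).eq (hΘ₂.congr fun r _ => (e2 r).symm) (hu2 ⟨1, one_mem⟩) one_mem
      beta_reduce
      rw [k1, k2]
    · have e : ∀ (u v : ℂ) (r : ℝ), segmentCoeff B (fun j => p j 0) (fun j => q j 0) u v r =
          ((v - u) / (u + r * (v - u))) • (Matrix.diagonal (fun j => (p j 0 : ℂ)) * B) :=
        fun u v r => by
          rw [segmentCoeff, ← Matrix.smul_mul, ← Matrix.diagonal_smul]
          congr 2
          funext j
          rcases h0 j with ⟨hp1, hq1⟩ | hp1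
          · simp [hp1, hq1]
          · simp [hp1]
      have hgc : (g : ℂ) ≠ 0 := by exact_mod_cast hg0
      have s1 : ∀ r ∈ Set.Icc (0 : ℝ) 1, (w + r * (g - w)) / w ∈ Complex.slitPlane := fun r hr => by
        refine div_mem_slitPlane hwim ?_ ?_
        · have : 0 ≤ (1 - r) * w.im := mul_nonneg (by linarith [hr.2]) hwim.le
          simp; linarith
        · have := affine_ne_zero' (p := 1) (q := 0) hwim.ne' (g := g) (by simpa using hg0) r
          simpa using this
      have s2 : ∀ r ∈ Set.Icc (0 : ℝ) 1, (g + r * (conj w - g)) / g ∈ Complex.slitPlane :=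
        fun r hr => by
          rcases hr.1.eq_or_lt with h | h
          · simp [← h, hgc]
          · refine Complex.mem_slitPlane_iff.2 (Or.inr ?_)
            rw [Complex.div_ofReal_im]
            simpa using ⟨⟨h.ne', hwim.ne'⟩, hg0⟩
      have f1 := isFundamental_spectralExp h1 hB (v := (g : ℂ)) hw0 s1
      have f2 := isFundamental_spectralExp h1 hB (v := conj w) hgc s2
      have k1 := (hΦ₁ ⟨0, zero_mem⟩).eq (f1.congr fun r _ => (e _ _ r).symm) (hu1 ⟨0, zero_mem⟩)
        one_mem
      have k2 := (hΦ₂ ⟨0, zero_mem⟩).eq (f2.congr fun r _ => (e _ _ r).symm) (hu2 ⟨0, zero_mem⟩)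
        one_mem
      beta_reduce
      rw [k1, k2, spectralExp_mul hpr, add_comm]
      simp
  obtain ⟨M, hMc, hMu, hMt, hM1, hM0⟩ := half gm hgm.ne fun ε hε j => (hne ε hε j).1
  obtain ⟨P, hPc, hPu, hPt, hP1, hP0⟩ := half gp hgp.ne' fun ε hε j => (hne ε hε j).2
  rw [hM1 _ hEm, hP1 _ hEp]
  let f : Set.Icc (0 : ℝ) 1 → ℂ := fun ε => ((P ε)⁻¹ * M ε).trace
  have hf : Continuous f := continuous_trace_inv_mul hPc hMc hPu
  -- The rescaled loop starts at `c ε + ρ ε * w` in the upper half plane. It is joined to `z₀` by a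
  -- segment that avoids the real poles, and the resulting conjugation does not change the trace.
  have hmem : ∀ ε : Set.Icc (0 : ℝ) 1, 0 < (ε : ℝ) →
      f ε ∈ Matrix.trace '' monodromyGroup (fuchsian B a) S z₀ := fun ε hε => by
    obtain ⟨hρ0, -⟩ := hρ ε ⟨hε, ε.2.2⟩
    have hloop := (hMt ε hε).trans ((hPt ε hε).symm continuousOn_fuchsian)
    obtain ⟨N, hN⟩ := exists_transports_segment (A := fuchsian B a) (S := S) (a := z₀)
      (b := c ε + ρ ε * w) continuousOn_fuchsian (by
        rintro r hr ⟨j, hj⟩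
        have him := congrArg Complex.im hj
        have h3 : 0 < ρ ε * w.im := mul_pos hρ0 hwim
        have h4 : 0 < (1 - r) * z₀.im + r * (ρ ε * w.im) := by
          rcases hr.1.eq_or_lt with h | h
          · simpa [← h] using hz
          · exact add_pos_of_nonneg_of_pos (mul_nonneg (by linarith [hr.2]) hz.le) (mul_pos h h3)
        simp at him
        linarith)
    have hNu := hN.isUnit_det continuousOn_fuchsian
    refine ⟨_, mem_monodromyGroup_iff.2 ((hN.trans hloop).trans (hN.symm continuousOn_fuchsian)), ?_⟩
    rw [Matrix.trace_mul_comm, Matrix.mul_assoc, Matrix.mul_nonsing_inv _ hNu, mul_one]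
  have hrange : (Set.range f).Finite := by
    refine (hfin.insert (f ⟨0, zero_mem⟩)).subset ?_
    rintro _ ⟨ε, rfl⟩
    rcases ε.2.1.eq_or_lt with h | h
    · exact Or.inl (congrArg f (Subtype.ext h.symm))
    · exact Or.inr (hmem ε h)
  have hsub : (Set.range f).Subsingleton := by
    by_contra hnt
    exact (isPreconnected_range hf).infinite_of_nontrivial
      (Set.not_subsingleton_iff.1 hnt) hrange
  -- A continuous function on an interval with finitely many values is constant, so the trace may be
  -- computed at `ε = 0`. There the two logarithms differ by `2πi`.
  have hconst : f ⟨1, one_mem⟩ = f ⟨0, zero_mem⟩ := hsub ⟨_, rfl⟩ ⟨_, rfl⟩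
  refine hconst.trans ?_
  show ((P ⟨0, zero_mem⟩)⁻¹ * M ⟨0, zero_mem⟩).trace = _
  rw [hM0, hP0, log_add_log_of_neg hwim hgm, log_add_log_of_pos hwim hgp,
    Matrix.inv_eq_left_inv (B := spectralExp μ pr (2 * w.arg * Complex.I))
      (by rw [spectralExp_mul hpr, add_neg_cancel, spectralExp_zero h1]),
    spectralExp_mul hpr, spectralExp, Matrix.trace_sum]
  refine Finset.sum_congr rfl fun k _ => ?_
  rw [Matrix.trace_smul, smul_eq_mul]
  congr 2
  ring

end Gates

end PainleveVI

namespace PainleveVI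

open Polynomial
open scoped Polynomial.Bivariate IntermediateField Topology ComplexConjugate

/-! ### Invariant forms -/

section Invariants

/-- The coefficients `(α, β)` (standing for `α + β ω`) and the pairs of exponents `(e, a)` (standing
for the factors `p ^ e * m ^ a`) of the terms of the invariant form of degree six. -/
def sexticTerms : List ((ℤ × ℤ) × (ℕ × ℕ) × (ℕ × ℕ) × (ℕ × ℕ)) :=
  [
   ((0, 24), (0, 0), (0, 0), (3, 6)), ((4, -12), (0, 0), (1, 0), (3, 6)),
    ((32, 0), (0, 0), (2, 0), (3, 6)), ((-120, -144), (0, 0), (1, 1), (3, 5)),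
    ((96, -96), (0, 0), (2, 1), (3, 5)), ((333, -9), (0, 0), (1, 2), (2, 4)),
    ((-480, 240), (0, 0), (2, 2), (2, 4)), ((-240, -240), (0, 0), (3, 2), (2, 4)),
    ((360, 360), (0, 0), (2, 3), (2, 3)), ((-640, 0), (0, 0), (3, 3), (2, 3)),
    ((-27, 81), (0, 0), (2, 4), (1, 2)), ((480, -360), (0, 0), (3, 4), (1, 2)),
    ((-240, 240), (0, 0), (4, 4), (1, 2)), ((-252, -36), (0, 0), (3, 5), (1, 1)),
    ((96, 96), (0, 0), (4, 5), (1, 1)), ((36, 12), (0, 0), (3, 6), (0, 0)),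
    ((0, 48), (0, 0), (4, 6), (0, 0)), ((32, 0), (0, 0), (5, 6), (0, 0)),
    ((-36, 108), (1, 1), (0, 0), (3, 5)), ((-96, -96), (1, 1), (1, 0), (3, 5)),
    ((780, 180), (1, 1), (1, 1), (2, 4)), ((-960, 0), (1, 1), (2, 1), (2, 4)),
    ((360, -360), (1, 1), (1, 2), (2, 3)), ((-960, 960), (1, 1), (2, 2), (2, 3)),
    ((-1440, -720), (1, 1), (2, 3), (1, 2)), ((960, 960), (1, 1), (3, 3), (1, 2)),
    ((0, 360), (1, 1), (2, 4), (1, 1)), ((960, 0), (1, 1), (3, 4), (1, 1)),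
    ((252, -36), (1, 1), (3, 5), (0, 0)), ((96, -96), (1, 1), (4, 5), (0, 0)),
    ((153, -99), (1, 2), (0, 0), (2, 4)), ((420, -60), (1, 2), (1, 0), (2, 4)),
    ((-240, 240), (1, 2), (2, 0), (2, 4)), ((120, 360), (1, 2), (1, 1), (2, 3)),
    ((960, 960), (1, 2), (2, 1), (2, 3)), ((-864, 72), (1, 2), (1, 2), (1, 2)),
    ((0, 720), (1, 2), (2, 2), (1, 2)), ((2880, 0), (1, 2), (3, 2), (1, 2)),
    ((1440, -720), (1, 2), (2, 3), (1, 1)), ((960, -960), (1, 2), (3, 3), (1, 1)),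
    ((-27, -9), (1, 2), (2, 4), (0, 0)), ((-480, -360), (1, 2), (3, 4), (0, 0)),
    ((-240, -240), (1, 2), (4, 4), (0, 0)), ((0, -240), (2, 3), (0, 0), (2, 3)),
    ((640, 0), (2, 3), (1, 0), (2, 3)), ((-120, 360), (2, 3), (1, 1), (1, 2)),
    ((960, -960), (2, 3), (2, 1), (1, 2)), ((-360, -360), (2, 3), (1, 2), (1, 1)),
    ((-960, -960), (2, 3), (2, 2), (1, 1)), ((-360, 360), (2, 3), (2, 3), (0, 0)),
    ((-640, 0), (2, 3), (3, 3), (0, 0)), ((153, 171), (2, 4), (0, 0), (1, 2)),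
    ((-420, -60), (2, 4), (1, 0), (1, 2)), ((-240, -240), (2, 4), (2, 0), (1, 2)),
    ((-780, 180), (2, 4), (1, 1), (1, 1)), ((-960, 0), (2, 4), (2, 1), (1, 1)),
    ((333, 81), (2, 4), (1, 2), (0, 0)), ((480, 240), (2, 4), (2, 2), (0, 0)),
    ((-240, 240), (2, 4), (3, 2), (0, 0)), ((36, 108), (3, 5), (0, 0), (1, 1)),
    ((-96, 96), (3, 5), (1, 0), (1, 1)), ((120, -144), (3, 5), (1, 1), (0, 0)),
    ((96, 96), (3, 5), (2, 1), (0, 0)), ((-4, -12), (3, 6), (1, 0), (0, 0)),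
    ((32, 0), (3, 6), (2, 0), (0, 0))
  ]

/-- The value of the factor `p ^ e * m ^ a`. -/
def factorValue (p m : ℂ) (e : ℕ × ℕ) : ℂ := p ^ e.1 * m ^ e.2

/-- The derivative of the factor `p ^ e * m ^ a`, if `p' = 1` and `p m' = n`. -/
def factorDeriv (p m n : ℂ) (e : ℕ × ℕ) : ℂ :=
  e.1 * p ^ (e.1 - 1) * m ^ e.2 + e.2 * p ^ (e.1 - 1) * m ^ (e.2 - 1) * n

/-- Since only `p m'` is known, and not `m'`, a factor `p` is needed in each monomial that contains
`m`. The condition on exponents guarantees it, so that no division by `p` occurs. -/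
theorem hasDerivWithinAt_factorValue {p m : ℝ → ℂ} {s : Set ℝ} {r : ℝ} {κ m' n : ℂ}
    (hp : HasDerivWithinAt p κ s r) (hm : HasDerivWithinAt m m' s r) (h : p r * m' = κ * n)
    {e : ℕ × ℕ} (he : e.2 = 0 ∨ e.1 ≠ 0) :
    HasDerivWithinAt (fun r => factorValue (p r) (m r) e)
      (κ * factorDeriv (p r) (m r) n e) s r := by
  refine ((hp.fun_pow e.1).mul (hm.fun_pow e.2)).congr_deriv ?_
  obtain ⟨e, a⟩ := e
  rcases he with he | he
  · simp only at he; subst he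
    simp [factorDeriv]; ring
  · obtain ⟨k, rfl⟩ := Nat.exists_eq_succ_of_ne_zero he
    simp only [factorDeriv, Nat.succ_eq_add_one, Nat.add_sub_cancel]
    push_cast
    linear_combination (a : ℂ) * p r ^ k * m r ^ (a - 1) * h

/-- The invariant quadratic form. -/
def quadraticForm (p m : Fin 3 → ℂ) : ℂ := p 0 * m 0 ^ 2 + p 1 * m 1 ^ 2 + p 2 * m 2 ^ 2

/-- The invariant form of degree six. -/
noncomputable def sexticForm (p m : Fin 3 → ℂ) : ℂ :=
  (sexticTerms.map fun t => (t.1.1 + t.1.2 * ω) * (factorValue (p 0) (m 0) t.2.1 *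
    factorValue (p 1) (m 1) t.2.2.1 * factorValue (p 2) (m 2) t.2.2.2)).sum

theorem hasDerivWithinAt_list_sum {α : Type*} (l : List α) {f : α → ℝ → ℂ} {f' : α → ℂ} {s : Set ℝ}
    {r : ℝ} (h : ∀ t ∈ l, HasDerivWithinAt (f t) (f' t) s r) :
    HasDerivWithinAt (fun r => (l.map fun t => f t r).sum) (l.map f').sum s r := by
  induction l with
  | nil => simpa using hasDerivWithinAt_const r s (0 : ℂ)
  | cons t l ih =>
    simp only [List.map_cons, List.sum_cons]
    exact (h t (by simp)).add (ih fun t ht => h t (by simp [ht]))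

/-- The antisymmetric part of the residues, times `30`, applied to `m`. -/
noncomputable def skewPart (m : Fin 3 → ℂ) : Fin 3 → ℂ :=
  ![-(1 + 3 * ω) * m 1 - 4 * ω * m 2, (1 + 3 * ω) * m 0 + (1 - 3 * ω) * m 2,
    4 * ω * m 0 - (1 - 3 * ω) * m 1]

/-- This is the derivative of the sextic form along the connection, divided by the common velocity
of the three pole coordinates, which are `x + 1`, `x` and `x - 1`. Its vanishing says that the form
is flat. -/
theorem sextic_identity (x m₀ m₁ m₂ n₀ n₁ n₂ : ℂ)
    (h₀ : n₀ = (-(1 + 3 * ω) * m₁ - 4 * ω * m₂) / 30 - m₀ / 2)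
    (h₁ : n₁ = ((1 + 3 * ω) * m₀ + (1 - 3 * ω) * m₂) / 30 - m₁ / 2)
    (h₂ : n₂ = (4 * ω * m₀ - (1 - 3 * ω) * m₁) / 30 - m₂ / 2) :
    (sexticTerms.map fun t => (t.1.1 + t.1.2 * ω) *
      (factorDeriv (x + 1) m₀ n₀ t.2.1 * factorValue x m₁ t.2.2.1 *
          factorValue (x - 1) m₂ t.2.2.2 +
        factorValue (x + 1) m₀ t.2.1 * factorDeriv x m₁ n₁ t.2.2.1 *
          factorValue (x - 1) m₂ t.2.2.2 +
        factorValue (x + 1) m₀ t.2.1 * factorValue x m₁ t.2.2.1 *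
          factorDeriv (x - 1) m₂ n₂ t.2.2.2)).sum = 0 := by
  -- The whole expression is quadratic in `ω`. It equals its coefficient of `ω²` times `ω² + 3`, and
  -- in this form the identity holds with `ω` as an indeterminate.
  have hw : (sexticTerms.map fun t => (t.1.2 : ℂ) *
      ((t.2.1.2 * (x + 1) ^ (t.2.1.1 - 1) * m₀ ^ (t.2.1.2 - 1) * (-3 * m₁ - 4 * m₂)) *
          factorValue x m₁ t.2.2.1 * factorValue (x - 1) m₂ t.2.2.2 +
        factorValue (x + 1) m₀ t.2.1 *
          (t.2.2.1.2 * x ^ (t.2.2.1.1 - 1) * m₁ ^ (t.2.2.1.2 - 1) * (3 * m₀ - 3 * m₂)) *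
          factorValue (x - 1) m₂ t.2.2.2 +
        factorValue (x + 1) m₀ t.2.1 * factorValue x m₁ t.2.2.1 *
          (t.2.2.2.2 * (x - 1) ^ (t.2.2.2.1 - 1) * m₂ ^ (t.2.2.2.2 - 1) * (4 * m₀ + 3 * m₁)))).sum
      / 30 * (ω ^ 2 + 3) = 0 := by rw [ω_sq]; ring
  rw [← hw, h₀, h₁, h₂]
  simp only [sexticTerms, List.map_cons, List.map_nil, List.sum_cons, List.sum_nil, factorDeriv,
    factorValue, Nat.reduceSub, Nat.cast_ofNat, Nat.cast_zero, Nat.cast_one, Int.cast_ofNat,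
    Int.cast_neg, Int.cast_zero, zero_mul, mul_zero, add_zero, zero_add, pow_zero,
    pow_one, one_mul, mul_one]
  ring

end Invariants

end PainleveVI

namespace PainleveVI

open Polynomial
open scoped Polynomial.Bivariate IntermediateField Topology ComplexConjugate

/-! ### Flatness of the invariant forms along parallel transport -/

section Horizontal

/-- The rows of the residues of the connection attached to the solution at `t = 1 / 2`. -/
noncomputable def icosaResidues : Matrix (Fin 3) (Fin 3) ℂ :=
  !![1 / 2, 1 / 6 - 43 / 390 * ω, 391 / 3490 + 169 / 10470 * ω;
     572 / 5235 + 169 / 5235 * ω, 1 / 2, 286 / 5235 - 169 / 10470 * ω;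
     782 / 1745 - 338 / 5235 * ω, 1 / 3 + 43 / 195 * ω, 1 / 2]

/-- The poles of the connection. -/
noncomputable def icosaPoles : Fin 3 → ℝ := ![0, 1 / 2, 1]

/-- The diagonal matrix that makes the residues skew-symmetric up to `1 / 2`. -/
noncomputable def icosaScale : Fin 3 → ℂ :=
  ![1, 23 / 26 + 17 / 26 * ω, -169 / 1396 + 391 / 1396 * ω]

/-- The coordinates `m` of a vector in the fibre at `z`. -/
noncomputable def fibreCoord (z : ℂ) (v : Fin 3 → ℂ) (j : Fin 3) : ℂ :=
  icosaScale j * (icosaResidues.mulVec v) j / (2 * (z - icosaPoles j))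

/-- Conjugation by the diagonal matrix `icosaScale` turns the residue rows into `1/2` plus a
skew-symmetric matrix. Skew-symmetry is the reason for the flatness of the quadratic form. -/
theorem icosaScale_mul (v : Fin 3 → ℂ) (j : Fin 3) :
    icosaScale j * (icosaResidues.mulVec v) j =
      icosaScale j * v j / 2 + skewPart (fun k => icosaScale k * v k) j / 30 := by
  have h := ω_sq
  fin_cases j <;>
    simp [icosaScale, icosaResidues, skewPart, Matrix.mulVec, dotProduct, Fin.sum_univ_three]
  · linear_combination (17 / 260 * v 1 + 391 / 10470 * v 2) * h
  · linear_combination (2873 / 136110 * v 0 - 2873 / 272220 * v 2 + 391 / 13960 * v 2) * h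
  · linear_combination (-66079 / 3654030 * v 0 + 16813 / 272220 * v 1 - 17 / 260 * v 1) * h

theorem scaled_fundamental_deriv {γ : ℝ → ℂ} {Φ : ℝ → Matrix (Fin 3) (Fin 3) ℂ} {r : ℝ}
    (hr : r ∈ Set.Icc (0 : ℝ) 1)
    (hΦ : IsFundamental (fun r => deriv γ r • fuchsian icosaResidues icosaPoles (γ r)) Φ)
    (v : Fin 3 → ℂ) (j : Fin 3) :
    HasDerivWithinAt (fun r => icosaScale j * (Φ r).mulVec v j)
      (2 * deriv γ r * fibreCoord (γ r) ((Φ r).mulVec v) j) (Set.Icc 0 1) r := by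
  have h1 : HasDerivWithinAt (fun r => (Φ r).mulVec v j)
      (((deriv γ r • fuchsian icosaResidues icosaPoles (γ r)) * Φ r).mulVec v j) (Set.Icc 0 1) r := by
    simp only [Matrix.mulVec, dotProduct]
    exact HasDerivWithinAt.fun_sum fun k _ => (hΦ.hasDeriv r hr j k).mul_const _
  refine (h1.const_mul (icosaScale j)).congr_deriv ?_
  have e : ((deriv γ r • fuchsian icosaResidues icosaPoles (γ r)) * Φ r).mulVec v j =
      deriv γ r * (1 / (γ r - icosaPoles j)) * (icosaResidues.mulVec ((Φ r).mulVec v)) j := by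
    rw [fuchsian, Matrix.smul_mul, Matrix.mul_assoc, Matrix.smul_mulVec, ← Matrix.mulVec_mulVec,
      ← Matrix.mulVec_mulVec, Pi.smul_apply, Matrix.mulVec_diagonal, smul_eq_mul, mul_assoc]
  rw [e, fibreCoord, one_div, div_eq_mul_inv _ (2 * _), mul_inv]
  ring

/-- With `x` the scaled vector and `p = 2(z - a)`, one has `p m = x/2 + skew(x)/30` and `x' = p' m`.
Differentiating the first relation and substituting the second gives a closed equation for `m`. -/
theorem fibreCoord_deriv {γ : ℝ → ℂ} {Φ : ℝ → Matrix (Fin 3) (Fin 3) ℂ} {r : ℝ}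
    (hγ : ContDiff ℝ 1 γ) (hr : r ∈ Set.Icc (0 : ℝ) 1) (hS : ∀ j, γ r ≠ icosaPoles j)
    (hΦ : IsFundamental (fun r => deriv γ r • fuchsian icosaResidues icosaPoles (γ r)) Φ)
    (v : Fin 3 → ℂ) (j : Fin 3) :
    ∃ m', HasDerivWithinAt (fun r => fibreCoord (γ r) ((Φ r).mulVec v) j) m' (Set.Icc 0 1) r ∧
      2 * (γ r - icosaPoles j) * m' = 2 * deriv γ r *
        (skewPart (fibreCoord (γ r) ((Φ r).mulVec v)) j / 30 -
          fibreCoord (γ r) ((Φ r).mulVec v) j / 2) := by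
  have hγd : HasDerivWithinAt (fun r => 2 * (γ r - icosaPoles j)) (2 * deriv γ r) (Set.Icc 0 1) r :=
    (((hγ.differentiable one_ne_zero r).hasDerivAt.sub_const _).const_mul 2).hasDerivWithinAt
  have hne : 2 * (γ r - icosaPoles j) ≠ 0 := mul_ne_zero two_ne_zero (sub_ne_zero.2 (hS j))
  have hs := scaled_fundamental_deriv hr hΦ v
  have hg : HasDerivWithinAt (fun r => icosaScale j * (icosaResidues.mulVec ((Φ r).mulVec v)) j)
      (2 * deriv γ r * (fibreCoord (γ r) ((Φ r).mulVec v) j / 2 +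
        skewPart (fibreCoord (γ r) ((Φ r).mulVec v)) j / 30)) (Set.Icc 0 1) r := by
    simp only [icosaScale_mul]
    fin_cases j
    · refine (((hs 0).div_const 2).add (((((hs 1).const_mul (-(1 + 3 * ω))).sub
        ((hs 2).const_mul (4 * ω)))).div_const 30)).congr_deriv ?_
      simp [skewPart]; ring
    · refine (((hs 1).div_const 2).add (((((hs 0).const_mul (1 + 3 * ω)).add
        ((hs 2).const_mul (1 - 3 * ω)))).div_const 30)).congr_deriv ?_
      simp [skewPart]; ring
    · refine (((hs 2).div_const 2).add (((((hs 0).const_mul (4 * ω)).sub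
        ((hs 1).const_mul (1 - 3 * ω)))).div_const 30)).congr_deriv ?_
      simp [skewPart]; ring
  refine ⟨_, hg.div hγd hne, ?_⟩
  have e : icosaScale j * (icosaResidues.mulVec ((Φ r).mulVec v)) j =
      fibreCoord (γ r) ((Φ r).mulVec v) j * (2 * (γ r - icosaPoles j)) := by
    rw [fibreCoord, div_mul_cancel₀ _ hne]
  rw [e]
  generalize 2 * (γ r - (icosaPoles j : ℂ)) = d at hne ⊢
  field_simp
  ring

/-- The functions `2 (z - a)`, for the poles `a`. -/
noncomputable def poleCoord (z : ℂ) (j : Fin 3) : ℂ := 2 * (z - icosaPoles j)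

theorem sexticTerms_exponents : ∀ t ∈ sexticTerms, (t.2.1.2 = 0 ∨ t.2.1.1 ≠ 0) ∧
    (t.2.2.1.2 = 0 ∨ t.2.2.1.1 ≠ 0) ∧ (t.2.2.2.2 = 0 ∨ t.2.2.2.1 ≠ 0) := by
  decide

/-- Parallel transport preserves the invariant forms. -/
theorem Transports.forms_eq {z z' : ℂ} {M : Matrix (Fin 3) (Fin 3) ℂ}
    (h : Transports (fuchsian icosaResidues icosaPoles) (Set.range fun j => (icosaPoles j : ℂ))
      z z' M) (v : Fin 3 → ℂ) :
    quadraticForm (poleCoord z') (fibreCoord z' (M.mulVec v)) =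
        quadraticForm (poleCoord z) (fibreCoord z v) ∧
      sexticForm (poleCoord z') (fibreCoord z' (M.mulVec v)) =
        sexticForm (poleCoord z) (fibreCoord z v) := by
  obtain ⟨γ, Φ, hγ, rfl, rfl, hS, hΦ, rfl⟩ := h
  have one_mem : (1 : ℝ) ∈ Set.Icc (0 : ℝ) 1 := ⟨zero_le_one, le_rfl⟩
  have hS' : ∀ r ∈ Set.Icc (0 : ℝ) 1, ∀ j, γ r ≠ icosaPoles j := fun r hr j hj =>
    hS r hr ⟨j, hj.symm⟩
  have hp : ∀ r, ∀ j, HasDerivWithinAt (fun r => poleCoord (γ r) j) (2 * deriv γ r)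
      (Set.Icc 0 1) r := fun r j =>
    (((hγ.differentiable one_ne_zero r).hasDerivAt.sub_const _).const_mul 2).hasDerivWithinAt
  have v0 : v = (Φ 0).mulVec v := by rw [hΦ.zero, Matrix.one_mulVec]
  constructor
  · nth_rw 2 [v0]
    refine eq_of_hasDerivWithinAt_zero (f := fun r => quadraticForm (poleCoord (γ r))
      (fibreCoord (γ r) ((Φ r).mulVec v))) (fun r hr => ?_) one_mem
    obtain ⟨m₀, d₀, e₀⟩ := fibreCoord_deriv hγ hr (hS' r hr) hΦ v 0
    obtain ⟨m₁, d₁, e₁⟩ := fibreCoord_deriv hγ hr (hS' r hr) hΦ v 1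
    obtain ⟨m₂, d₂, e₂⟩ := fibreCoord_deriv hγ hr (hS' r hr) hΦ v 2
    refine ((((hp r 0).mul (d₀.fun_pow 2)).add ((hp r 1).mul (d₁.fun_pow 2))).add
      ((hp r 2).mul (d₂.fun_pow 2))).congr_deriv ?_
    generalize fibreCoord (γ r) ((Φ r).mulVec v) = m at e₀ e₁ e₂
    simp only [skewPart, Matrix.cons_val] at e₀ e₁ e₂
    simp only [poleCoord, Nat.cast_ofNat, Nat.add_one_sub_one, pow_one]
    linear_combination 2 * m 0 * e₀ + 2 * m 1 * e₁ + 2 * m 2 * e₂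
  · nth_rw 2 [v0]
    refine eq_of_hasDerivWithinAt_zero (f := fun r => sexticForm (poleCoord (γ r))
      (fibreCoord (γ r) ((Φ r).mulVec v))) (fun r hr => ?_) one_mem
    obtain ⟨m₀, d₀, e₀⟩ := fibreCoord_deriv hγ hr (hS' r hr) hΦ v 0
    obtain ⟨m₁, d₁, e₁⟩ := fibreCoord_deriv hγ hr (hS' r hr) hΦ v 1
    obtain ⟨m₂, d₂, e₂⟩ := fibreCoord_deriv hγ hr (hS' r hr) hΦ v 2
    have key := hasDerivWithinAt_list_sum sexticTerms (s := Set.Icc 0 1) (r := r)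
      fun t ht => by
        obtain ⟨h₀, h₁, h₂⟩ := sexticTerms_exponents t ht
        exact (((hasDerivWithinAt_factorValue (hp r 0) d₀ e₀ h₀).fun_mul
          (hasDerivWithinAt_factorValue (hp r 1) d₁ e₁ h₁)).fun_mul
          (hasDerivWithinAt_factorValue (hp r 2) d₂ e₂ h₂)).const_mul (t.1.1 + t.1.2 * ω)
    refine key.congr_deriv ?_
    clear key
    generalize fibreCoord (γ r) ((Φ r).mulVec v) = m
    have hid := sextic_identity (poleCoord (γ r) 1) (m 0) (m 1) (m 2) _ _ _ rfl rfl rfl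
    have x0 : poleCoord (γ r) 0 = poleCoord (γ r) 1 + 1 := by
      simp [poleCoord, icosaPoles]; ring
    have x2 : poleCoord (γ r) 2 = poleCoord (γ r) 1 - 1 := by
      simp [poleCoord, icosaPoles]; ring
    have hz := congrArg (fun x => 2 * deriv γ r * x) hid
    simp only [mul_zero] at hz
    rw [← hz, ← List.sum_map_mul_left]
    refine congrArg List.sum (List.map_congr_left fun t _ => ?_)
    rw [x0, x2]
    simp only [skewPart, Matrix.cons_val]
    ring

end Horizontal

end PainleveVI

namespace PainleveVI

open Polynomial
open scoped Polynomial.Bivariate IntermediateField Topology ComplexConjugate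

/-! ### The invariant forms at the base point -/

section BasePoint

/-- The base point, in the upper half plane. -/
noncomputable def basePoint : ℂ := (1 + 3 * ω) / 2

theorem poleCoord_basePoint :
    poleCoord basePoint 0 = 3 * ω + 1 ∧ poleCoord basePoint 1 = 3 * ω ∧
      poleCoord basePoint 2 = 3 * ω - 1 := by
  refine ⟨?_, ?_, ?_⟩ <;> simp [poleCoord, basePoint, icosaPoles] <;> ring

/-- The linear form of a five-fold axis. -/
noncomputable def axisForm (m : Fin 3 → ℂ) : ℂ :=
  (9 - ω) * m 0 + 12 * ω * m 1 - (9 + ω) * m 2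

/-- The first coordinate in the plane orthogonal to the axis. -/
noncomputable def planeForm₁ (m : Fin 3 → ℂ) : ℂ := 28 * ω * (m 0 + m 2)

/-- The second coordinate in the plane orthogonal to the axis. -/
noncomputable def planeForm₂ (m : Fin 3 → ℂ) : ℂ :=
  (18 - 2 * ω) * m 0 + 9 * ω * m 1 - (18 + 2 * ω) * m 2

/-- The splitting is along a five-fold axis: `axisForm` is the coordinate on the axis, and the
remaining binary form factors below into two isotropic coordinates. -/
theorem quadraticForm_basePoint (m : Fin 3 → ℂ) :
    30 * ω * quadraticForm (poleCoord basePoint) m =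
      axisForm m ^ 2 + (5 * planeForm₁ m ^ 2 - 56 * planeForm₂ m ^ 2) / 84 := by
  obtain ⟨e0, e1, e2⟩ := poleCoord_basePoint
  simp only [quadraticForm, e0, e1, e2, axisForm, planeForm₁, planeForm₂]
  have h2 := ω_sq
  ring_nf
  simp only [h2]
  ring

/-- The multiple of the cube of the quadratic form is chosen to reach Klein's normal form `X⁶ -
5X⁴(YZ) + 5X²(YZ)² + X(Y⁵ + Z⁵)` of the product of six axes, with `X` along one of them. -/
theorem sexticForm_basePoint (m : Fin 3 → ℂ) :
    1500 * ω * sexticForm (poleCoord basePoint) m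
        + (54000 - 54000 * ω) * quadraticForm (poleCoord basePoint) m ^ 3 =
      axisForm m ^ 6 - 5 * axisForm m ^ 4 * ((5 * planeForm₁ m ^ 2 - 56 * planeForm₂ m ^ 2) / 84)
        + 5 * axisForm m ^ 2 * ((5 * planeForm₁ m ^ 2 - 56 * planeForm₂ m ^ 2) / 84) ^ 2
        + axisForm m * (2336 / 243 * planeForm₂ m ^ 5 + 3500 / 243 * planeForm₁ m * planeForm₂ m ^ 4
          + 14600 / 1701 * planeForm₁ m ^ 2 * planeForm₂ m ^ 3
          + 625 / 243 * planeForm₁ m ^ 3 * planeForm₂ m ^ 2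
          + 9125 / 23814 * planeForm₁ m ^ 4 * planeForm₂ m + 625 / 27216 * planeForm₁ m ^ 5) := by
  obtain ⟨e0, e1, e2⟩ := poleCoord_basePoint
  simp only [quadraticForm, sexticForm, e0, e1, e2, axisForm, planeForm₁, planeForm₂]
  have h2 := ω_sq
  have h3 : ω ^ 3 = -3 * ω := by linear_combination ω * h2
  have h4 : ω ^ 4 = 9 := by linear_combination (ω ^ 2 - 3) * h2
  have h5 : ω ^ 5 = 9 * ω := by linear_combination ω * h4
  have h6 : ω ^ 6 = -27 := by linear_combination ω ^ 2 * h4 + 9 * h2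
  have h7 : ω ^ 7 = -27 * ω := by linear_combination ω * h6
  simp only [sexticTerms, List.map_cons, List.map_nil, List.sum_cons, List.sum_nil,
    factorValue, Int.cast_ofNat, Int.cast_neg, Int.cast_zero, zero_mul,
    add_zero, zero_add, pow_zero, pow_one, one_mul, mul_one]
  ring_nf
  simp only [h2, h3, h4, h5, h6, h7]
  ring

/-- Over `ℚ(√70)` the binary quadratic form splits, which determines `Y` and `Z` up to scalars `μ`
and `ν`; a fifth root adjusts them so that the quintic becomes `Y⁵ + Z⁵`. -/
theorem exists_planeForms : ∃ μ ν κ : ℂ, μ ≠ 0 ∧ ν ≠ 0 ∧ κ ≠ 0 ∧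
    (∀ T V : ℂ, (μ * (T + κ * V)) * (ν * (T - κ * V)) = (5 * T ^ 2 - 56 * V ^ 2) / 84) ∧
    ∀ T V : ℂ, (μ * (T + κ * V)) ^ 5 + (ν * (T - κ * V)) ^ 5 =
      2336 / 243 * V ^ 5 + 3500 / 243 * T * V ^ 4 + 14600 / 1701 * T ^ 2 * V ^ 3
        + 625 / 243 * T ^ 3 * V ^ 2 + 9125 / 23814 * T ^ 4 * V + 625 / 27216 * T ^ 5 := by
  obtain ⟨r, hr⟩ := IsAlgClosed.exists_pow_nat_eq (70 : ℂ) (n := 2) (by norm_num)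
  -- The coefficients of `T⁵` and `T⁴V` in the quintic determine `α = μ⁵` and `β = ν⁵`. Their
  -- product is `(5/84)⁵`, so the choice of `ν` with `μν = 5/84` is consistent.
  obtain ⟨α, hα⟩ : ∃ α : ℂ, α = (625 / 27216 + 9125 / 47628 / 70 * r) / 2 := ⟨_, rfl⟩
  obtain ⟨β, hβ⟩ : ∃ β : ℂ, β = (625 / 27216 - 9125 / 47628 / 70 * r) / 2 := ⟨_, rfl⟩
  have hαβ : α * β = (5 / 84) ^ 5 := by
    rw [hα, hβ]; linear_combination -(9125 / 47628 / 70) ^ 2 / 4 * hr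
  have hα0 : α ≠ 0 := by rintro rfl; norm_num at hαβ
  obtain ⟨μ, hμ⟩ := IsAlgClosed.exists_pow_nat_eq α (n := 5) (by norm_num)
  have hμ0 : μ ≠ 0 := by rintro rfl; apply hα0; rw [← hμ]; norm_num
  have hr0 : r ≠ 0 := by rintro rfl; norm_num at hr
  obtain ⟨ν, hν⟩ : ∃ ν, μ * ν = 5 / 84 := ⟨5 / 84 / μ, by field_simp⟩
  have hν0 : ν ≠ 0 := by rintro rfl; norm_num at hν
  have hν5 : ν ^ 5 = β := by
    refine mul_left_cancel₀ hα0 ?_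
    rw [hαβ, ← hμ, ← mul_pow, hν]
  refine ⟨μ, ν, 2 / 5 * r, hμ0, hν0, mul_ne_zero (by norm_num) hr0, fun T V => ?_, fun T V => ?_⟩
  · linear_combination (T ^ 2 - 4 / 25 * r ^ 2 * V ^ 2) * hν - 5 / 84 * (4 / 25) * V ^ 2 * hr
  · rw [mul_pow, mul_pow, hμ, hν5, hα, hβ]
    have h4 : r ^ 4 = 4900 := by linear_combination (r ^ 2 + 70) * hr
    have h6 : r ^ 6 = 343000 := by linear_combination r ^ 2 * h4 + 4900 * hr
    ring_nf
    simp only [hr, h4, h6]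
    ring

end BasePoint

/-! ### The six axes of the icosahedron -/

section Icosahedral

/-- The golden ratio as a complex number. -/
noncomputable def φc : ℂ := (Real.goldenRatio : ℂ)

theorem φc_sq : φc ^ 2 = φc + 1 := by
  unfold φc; exact_mod_cast congrArg (fun x : ℝ => (x : ℂ)) Real.goldenRatio_sq

/-- The product of the linear forms of the six axes of the icosahedron. -/
noncomputable def sixAxes (x : Fin 3 → ℂ) : ℂ :=
  (x 1 + φc * x 2) * (x 1 - φc * x 2) * (x 0 + φc * x 1) * (x 0 - φc * x 1) *
    (φc * x 0 + x 2) * (x 2 - φc * x 0)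

/-- Coordinates adapted to the axis `(0, 1, φ)`: the bracket with factor `2` is the real part of the
fifth power of `q + i√(φ + 2) x₀`, when these are real. The scale `φ + 2` is the squared length of a
vertex. -/
theorem sixAxes_eq (x : Fin 3 → ℂ) (p q R : ℂ) (hp : p = x 1 + φc * x 2) (hq : q = x 2 - φc * x 1)
    (hR : R = q ^ 2 + (φc + 2) * x 0 ^ 2) :
    p * (p ^ 5 - 5 * p ^ 3 * R + 5 * p * R ^ 2
      + 2 * (q ^ 5 - 10 * (φc + 2) * q ^ 3 * x 0 ^ 2 + 5 * (φc + 2) ^ 2 * q * x 0 ^ 4)) =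
      25 * (2 * φc - 1) * sixAxes x := by
  subst hR hp hq
  have h2 := φc_sq
  have h3 : φc ^ 3 = 2 * φc + 1 := by linear_combination (φc + 1) * h2
  have h4 : φc ^ 4 = 3 * φc + 2 := by linear_combination φc * h3 + 2 * h2
  have h5 : φc ^ 5 = 5 * φc + 3 := by linear_combination φc * h4 + 3 * h2
  have h6 : φc ^ 6 = 8 * φc + 5 := by linear_combination φc * h5 + 5 * h2
  have h7 : φc ^ 7 = 13 * φc + 8 := by linear_combination φc * h6 + 8 * h2
  unfold sixAxes
  ring_nf
  simp only [h2, h3, h4, h5, h6, h7]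
  ring

end Icosahedral

end PainleveVI

namespace PainleveVI

open Polynomial
open scoped Polynomial.Bivariate IntermediateField Topology ComplexConjugate

/-! ### The frame that identifies the flat forms with the icosahedral ones -/

section Frame

theorem φc_add_two_ne_zero : φc + 2 ≠ 0 := by
  have h := Real.goldenRatio_pos
  have : (Real.goldenRatio + 2 : ℝ) ≠ 0 := by positivity
  unfold φc; exact_mod_cast this

theorem two_mul_φc_sub_one_ne_zero : 2 * φc - 1 ≠ 0 := by
  have h := Real.one_lt_goldenRatio
  have : (2 * Real.goldenRatio - 1 : ℝ) ≠ 0 := by linarith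
  unfold φc; exact_mod_cast this

/-- Coordinates of the fibre at the base point in which the invariant forms are the sum of squares
and the product of the six axes of the icosahedron. -/
theorem exists_icosahedral_frame : ∃ (W : Matrix (Fin 3) (Fin 3) ℂ) (c : ℂ), IsUnit W ∧
    ∀ m, (∑ i, W.mulVec m i ^ 2 = 30 * ω * quadraticForm (poleCoord basePoint) m) ∧
      sixAxes (W.mulVec m) = c * (1500 * ω * sexticForm (poleCoord basePoint) m
        + (54000 - 54000 * ω) * quadraticForm (poleCoord basePoint) m ^ 3) := by
  obtain ⟨μ, ν, κ, hμ, hν, hκ, hYZ, hYZ5⟩ := exists_planeForms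
  obtain ⟨N, hN⟩ := IsAlgClosed.exists_pow_nat_eq (φc + 2) (n := 2) (by norm_num)
  have hφ := φc_sq
  have hφ2 := φc_add_two_ne_zero
  have hφ1 := two_mul_φc_sub_one_ne_zero
  have hN0 : N ≠ 0 := by rintro rfl; apply hφ2; rw [← hN]; norm_num
  have hI := Complex.I_sq
  let X : Fin 3 → ℂ := ![9 - ω, 12 * ω, -(9 + ω)]
  let T : Fin 3 → ℂ := ![28 * ω, 0, 28 * ω]
  let V : Fin 3 → ℂ := ![18 - 2 * ω, 9 * ω, -(18 + 2 * ω)]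
  let P : Fin 3 → ℂ := fun j => μ * (T j + κ * V j)
  let Q : Fin 3 → ℂ := fun j => ν * (T j - κ * V j)
  let W : Matrix (Fin 3) (Fin 3) ℂ := Matrix.of ![fun j => (P j - Q j) * Complex.I / 2,
    fun j => (X j - φc * ((P j + Q j) / 2)) / N, fun j => ((P j + Q j) / 2 + φc * X j) / N]
  have hW : ∀ m, W.mulVec m = ![
      (μ * (planeForm₁ m + κ * planeForm₂ m) - ν * (planeForm₁ m - κ * planeForm₂ m)) * Complex.I / 2,
      (axisForm m - φc * ((μ * (planeForm₁ m + κ * planeForm₂ m)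
        + ν * (planeForm₁ m - κ * planeForm₂ m)) / 2)) / N,
      ((μ * (planeForm₁ m + κ * planeForm₂ m) + ν * (planeForm₁ m - κ * planeForm₂ m)) / 2
        + φc * axisForm m) / N] := by
    intro m
    ext i
    fin_cases i <;>
      simp [W, P, Q, X, T, V, Matrix.mulVec, dotProduct, Fin.sum_univ_three, axisForm, planeForm₁,
        planeForm₂] <;> ring
  refine ⟨W, (φc + 2) ^ 3 / (25 * (2 * φc - 1)), ?_, fun m => ?_⟩
  · rw [← Matrix.mulVec_injective_iff_isUnit]
    refine (injective_iff_map_eq_zero W.mulVecLin).2 fun m hm => ?_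
    rw [Matrix.mulVecLin_apply, hW m] at hm
    have h0 := congrFun hm 0
    have h1 := congrFun hm 1
    have h2 := congrFun hm 2
    simp only [Matrix.cons_val, Pi.zero_apply, div_eq_zero_iff, hN0, or_false, mul_eq_zero,
      Complex.I_ne_zero, OfNat.ofNat_ne_zero] at h0 h1 h2
    have hX : axisForm m = 0 := by
      refine (mul_eq_zero.1 (?_ : (φc + 2) * axisForm m = 0)).resolve_left hφ2
      linear_combination h1 + φc * h2 - axisForm m * hφ
    rw [hX] at h1 h2
    have hP : planeForm₁ m + κ * planeForm₂ m = 0 := by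
      refine (mul_eq_zero.1 (?_ : μ * _ = 0)).resolve_left hμ
      linear_combination h0 / 2 + h2
    have hQ : planeForm₁ m - κ * planeForm₂ m = 0 := by
      refine (mul_eq_zero.1 (?_ : ν * _ = 0)).resolve_left hν
      linear_combination h2 - h0 / 2
    have hT : planeForm₁ m = 0 := by linear_combination (hP + hQ) / 2
    have hV : planeForm₂ m = 0 := by
      refine (mul_eq_zero.1 (?_ : κ * _ = 0)).resolve_left hκ
      linear_combination (hP - hQ) / 2
    simp only [axisForm, planeForm₁, planeForm₂] at hX hT hV
    have hω := ω_ne_zero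
    have h02 : m 0 + m 2 = 0 := by
      refine (mul_eq_zero.1 (?_ : ω * _ = 0)).resolve_left hω
      linear_combination hT / 28
    have m0 : m 0 = 0 := by linear_combination (4 * hV - 3 * hX) / 90 + (5 * ω + 45) / 90 * h02
    have m2 : m 2 = 0 := by linear_combination h02 - m0
    have m1 : m 1 = 0 := by
      refine (mul_eq_zero.1 (?_ : ω * _ = 0)).resolve_left hω
      rw [m0, m2] at hV
      linear_combination hV / 9
    ext i; fin_cases i <;> simp [m0, m1, m2]
  · have hYZm := hYZ (planeForm₁ m) (planeForm₂ m)
    have hYZ5m := hYZ5 (planeForm₁ m) (planeForm₂ m)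
    rw [quadraticForm_basePoint, sexticForm_basePoint, ← hYZm, ← hYZ5m, hW m]
    generalize axisForm m = X
    generalize μ * (planeForm₁ m + κ * planeForm₂ m) = Y'
    generalize ν * (planeForm₁ m - κ * planeForm₂ m) = Z'
    constructor
    · simp only [Fin.sum_univ_three, Matrix.cons_val]
      field_simp
      rw [hN, hI]
      linear_combination (4 * X ^ 2 + (Y' + Z') ^ 2) * hφ
    · obtain ⟨y, hy⟩ : ∃ y, y = (Y' + Z') / 2 := ⟨_, rfl⟩
      obtain ⟨z, hz⟩ : ∃ z, z = (Y' - Z') * Complex.I / 2 := ⟨_, rfl⟩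
      have eY : Y' = y - Complex.I * z := by rw [hy, hz]; linear_combination (Y' - Z') / 2 * hI
      have eZ : Z' = y + Complex.I * z := by rw [hy, hz]; linear_combination (Z' - Y') / 2 * hI
      rw [← hy, ← hz]
      have key := sixAxes_eq ![z, (X - φc * y) / N, (y + φc * X) / N] (N * X) (N * y)
        (N ^ 2 * (y ^ 2 + z ^ 2))
        (by simp only [Matrix.cons_val]; field_simp; rw [hN]; linear_combination -X * hφ)
        (by simp only [Matrix.cons_val]; field_simp; rw [hN]; linear_combination -y * hφ)
        (by simp only [Matrix.cons_val]; rw [← hN]; ring)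
      rw [eq_comm, div_mul_eq_mul_div, div_eq_iff (by simpa using hφ1), mul_comm (sixAxes _),
        ← key, ← hN, eY, eZ]
      simp only [Matrix.cons_val]
      have hI4 : Complex.I ^ 4 = 1 := Complex.I_pow_four
      ring_nf
      simp only [hI, hI4]
      ring

end Frame

end PainleveVI

namespace PainleveVI

open Polynomial
open scoped Polynomial.Bivariate IntermediateField Topology ComplexConjugate Matrix

/-! ### Linear maps that preserve the icosahedral forms -/

section Vertices

/-- One vertex of the icosahedron on each of the six axes. -/
noncomputable def axisVertex : Fin 6 → Fin 3 → ℝ :=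
  ![![0, 1, Real.goldenRatio], ![0, 1, -Real.goldenRatio], ![1, Real.goldenRatio, 0],
    ![1, -Real.goldenRatio, 0], ![Real.goldenRatio, 0, 1], ![-Real.goldenRatio, 0, 1]]

theorem mem_icosahedronVertices_iff {v : Fin 3 → ℝ} :
    v ∈ icosahedronVertices ↔ ∃ k, v = axisVertex k ∨ v = -axisVertex k := by
  constructor
  · rintro ⟨a, b, ha | ha, hb | hb, hv | hv | hv⟩ <;> subst ha hb hv
    · exact ⟨0, Or.inl rfl⟩
    · exact ⟨2, Or.inl rfl⟩
    · exact ⟨4, Or.inl rfl⟩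
    · exact ⟨1, Or.inl rfl⟩
    · exact ⟨3, Or.inl rfl⟩
    · exact ⟨5, Or.inl rfl⟩
    · exact ⟨1, Or.inr (by ext i; fin_cases i <;> simp [axisVertex])⟩
    · exact ⟨3, Or.inr (by ext i; fin_cases i <;> simp [axisVertex])⟩
    · exact ⟨5, Or.inr (by ext i; fin_cases i <;> simp [axisVertex])⟩
    · exact ⟨0, Or.inr (by ext i; fin_cases i <;> simp [axisVertex])⟩
    · exact ⟨2, Or.inr (by ext i; fin_cases i <;> simp [axisVertex])⟩
    · exact ⟨4, Or.inr (by ext i; fin_cases i <;> simp [axisVertex])⟩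
  · rintro ⟨k, rfl | rfl⟩
    · fin_cases k
      · exact ⟨1, _, Or.inl rfl, Or.inl rfl, Or.inl rfl⟩
      · exact ⟨1, _, Or.inl rfl, Or.inr rfl, Or.inl rfl⟩
      · exact ⟨1, _, Or.inl rfl, Or.inl rfl, Or.inr (Or.inl rfl)⟩
      · exact ⟨1, _, Or.inl rfl, Or.inr rfl, Or.inr (Or.inl rfl)⟩
      · exact ⟨1, _, Or.inl rfl, Or.inl rfl, Or.inr (Or.inr rfl)⟩
      · exact ⟨1, _, Or.inl rfl, Or.inr rfl, Or.inr (Or.inr rfl)⟩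
    · fin_cases k
      · exact ⟨-1, _, Or.inr rfl, Or.inr rfl, Or.inl (by ext i; fin_cases i <;> simp [axisVertex])⟩
      · exact ⟨-1, _, Or.inr rfl, Or.inl rfl, Or.inl (by ext i; fin_cases i <;> simp [axisVertex])⟩
      · exact ⟨-1, _, Or.inr rfl, Or.inr rfl,
          Or.inr (Or.inl (by ext i; fin_cases i <;> simp [axisVertex]))⟩
      · exact ⟨-1, _, Or.inr rfl, Or.inl rfl,
          Or.inr (Or.inl (by ext i; fin_cases i <;> simp [axisVertex]))⟩
      · exact ⟨-1, _, Or.inr rfl, Or.inr rfl,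
          Or.inr (Or.inr (by ext i; fin_cases i <;> simp [axisVertex]))⟩
      · exact ⟨-1, _, Or.inr rfl, Or.inl rfl,
          Or.inr (Or.inr (by ext i; fin_cases i <;> simp [axisVertex]))⟩

/-- The vertices as complex vectors. -/
noncomputable def axisVector (k : Fin 6) (i : Fin 3) : ℂ := (axisVertex k i : ℂ)

theorem axisVector_dotProduct_self (k : Fin 6) : axisVector k ⬝ᵥ axisVector k = φc + 2 := by
  have h := φc_sq
  unfold φc at h
  unfold axisVector axisVertex φc
  generalize Real.goldenRatio = g at h
  fin_cases k <;> simp [dotProduct, Fin.sum_univ_three] <;> linear_combination h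

theorem sixAxes_eq_prod (x : Fin 3 → ℂ) : sixAxes x = ∏ k, axisVector k ⬝ᵥ x := by
  simp [Fin.prod_univ_six, sixAxes, axisVector, axisVertex, dotProduct, Fin.sum_univ_three, φc]
  ring

variable {N : Matrix (Fin 3) (Fin 3) ℂ}

theorem transpose_mul_self_of_sum_sq (h : ∀ x, ∑ i, (N *ᵥ x) i ^ 2 = ∑ i, x i ^ 2) :
    Nᵀ * N = 1 := by
  have hb : ∀ x x' : Fin 3 → ℂ, (N *ᵥ x) ⬝ᵥ (N *ᵥ x') = x ⬝ᵥ x' := fun x x' => by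
    have h1 := h (x + x')
    have h2 := h x
    have h3 := h x'
    simp only [Matrix.mulVec_add, Pi.add_apply, Fin.sum_univ_three] at h1 h2 h3
    simp only [dotProduct, Fin.sum_univ_three]
    linear_combination (h1 - h2 - h3) / 2
  refine Matrix.ext_of_mulVec_single fun j => funext fun i => ?_
  have := hb (Pi.single i 1) (Pi.single j 1)
  rw [← Matrix.mulVec_mulVec, Matrix.one_mulVec]
  rw [Matrix.dotProduct_mulVec, ← Matrix.mulVec_transpose, dotProduct_comm] at this
  rw [Matrix.mulVec_mulVec] at this ⊢
  simpa [Matrix.mulVec, dotProduct, Pi.single_apply, Matrix.mul_apply, mul_comm] using this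

/-- The plane orthogonal to one axis is mapped into the union of the six planes, hence into one of
them. By orthogonality the axis goes to a multiple of an axis, and since all vertices have the same
length, the factor is `1` or `-1`. -/
theorem exists_axis_of_preserves (hN : Nᵀ * N = 1) (h6 : ∀ x, sixAxes (N *ᵥ x) = sixAxes x)
    (k : Fin 6) : ∃ j, N *ᵥ axisVector k = axisVector j ∨ N *ᵥ axisVector k = -axisVector j := by
  have hN' : N * Nᵀ = 1 := mul_eq_one_comm.1 hN
  let f : Fin 6 → (Fin 3 → ℂ) →ₗ[ℂ] ℂ := fun j =>
    { toFun := fun x => axisVector j ⬝ᵥ x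
      map_add' := fun x x' => dotProduct_add _ _ _
      map_smul' := fun c x => dotProduct_smul _ _ _ }
  let E := LinearMap.ker (f k)
  let p : Fin 6 → Subspace ℂ E := fun j => LinearMap.ker ((f j ∘ₗ N.mulVecLin) ∘ₗ E.subtype)
  -- A vector space over an infinite field is not a finite union of proper subspaces, so one of
  -- these preimages is the whole plane.
  have hcov : ⋃ j, (p j : Set E) = Set.univ := by
    refine Set.eq_univ_of_forall fun x => ?_
    have hx : axisVector k ⬝ᵥ (x : Fin 3 → ℂ) = 0 := x.2
    have h0 : sixAxes (N *ᵥ (x : Fin 3 → ℂ)) = 0 := by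
      rw [h6, sixAxes_eq_prod]; exact Finset.prod_eq_zero (Finset.mem_univ k) hx
    rw [sixAxes_eq_prod, Finset.prod_eq_zero_iff] at h0
    obtain ⟨j, -, hj⟩ := h0
    exact Set.mem_iUnion.2 ⟨j, hj⟩
  obtain ⟨j, hj⟩ := Subspace.exists_eq_top_of_iUnion_eq_univ hcov
  have hker : ∀ x, axisVector k ⬝ᵥ x = 0 → axisVector j ⬝ᵥ (N *ᵥ x) = 0 := fun x hx => by
    have : (⟨x, hx⟩ : E) ∈ p j := hj ▸ Submodule.mem_top
    exact this
  have hφ := φc_add_two_ne_zero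
  set c := axisVector j ⬝ᵥ (N *ᵥ axisVector k) / (φc + 2) with hc
  have hlin : Nᵀ *ᵥ axisVector j = c • axisVector k := by
    refine dotProduct_eq _ _ fun x => ?_
    have h1 := hker (x - (axisVector k ⬝ᵥ x / (φc + 2)) • axisVector k) (by
      rw [dotProduct_sub, dotProduct_smul, axisVector_dotProduct_self, smul_eq_mul,
        div_mul_cancel₀ _ hφ, sub_self])
    rw [Matrix.mulVec_sub, Matrix.mulVec_smul, dotProduct_sub, dotProduct_smul, sub_eq_zero] at h1
    rw [Matrix.mulVec_transpose, ← Matrix.dotProduct_mulVec, h1, smul_dotProduct, hc, smul_eq_mul,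
      smul_eq_mul]
    ring
  have hc2 : c ^ 2 = 1 := by
    have h1 : (Nᵀ *ᵥ axisVector j) ⬝ᵥ (Nᵀ *ᵥ axisVector j) = φc + 2 := by
      rw [Matrix.dotProduct_mulVec, Matrix.vecMul_transpose, Matrix.mulVec_mulVec, hN',
        Matrix.one_mulVec, axisVector_dotProduct_self]
    rw [hlin, smul_dotProduct, dotProduct_smul, axisVector_dotProduct_self, smul_eq_mul,
      smul_eq_mul] at h1
    refine mul_right_cancel₀ hφ ?_
    linear_combination h1
  have hj' : axisVector j = c • (N *ᵥ axisVector k) := by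
    rw [← Matrix.mulVec_smul, ← hlin, Matrix.mulVec_mulVec, hN', Matrix.one_mulVec]
  refine ⟨j, ?_⟩
  rcases sq_eq_one_iff.1 hc2 with h | h
  · left; rw [hj', h, one_smul]
  · right; rw [hj', h]; simp

/-- Twice each standard basis vector is a sum of two vertices, whose images are real. -/
theorem isReal_of_axes (h : ∀ k, ∃ j, N *ᵥ axisVector k = axisVector j ∨
    N *ᵥ axisVector k = -axisVector j) (i j : Fin 3) : ((N i j).re : ℂ) = N i j := by
  have hr : ∀ k i, ∃ x : ℝ, (N *ᵥ axisVector k) i = x := fun k i => by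
    obtain ⟨j, hj | hj⟩ := h k
    · exact ⟨axisVertex j i, by rw [hj, axisVector]⟩
    · exact ⟨-axisVertex j i, by rw [hj]; simp [axisVector]⟩
  have key : ∃ x : ℝ, N i j = x := by
    have pair : ∀ k l, (∀ i, axisVector k i + axisVector l i = if i = j then 2 else 0) →
        ∃ x : ℝ, N i j = x := fun k l hkl => by
      obtain ⟨x, hx⟩ := hr k i
      obtain ⟨x', hx'⟩ := hr l i
      refine ⟨(x + x') / 2, ?_⟩
      have e : axisVector k + axisVector l = (2 : ℂ) • Pi.single j 1 := by
        ext i; rw [Pi.add_apply, hkl]; simp [Pi.single_apply]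
      have e2 : (N *ᵥ (axisVector k + axisVector l)) i = 2 * N i j := by
        rw [e, Matrix.mulVec_smul]; simp
      rw [Matrix.mulVec_add, Pi.add_apply, hx, hx'] at e2
      push_cast
      linear_combination -e2 / 2
    fin_cases j
    · exact pair 2 3 fun i => by fin_cases i <;> simp [axisVector, axisVertex] <;> norm_num
    · exact pair 0 1 fun i => by fin_cases i <;> simp [axisVector, axisVertex] <;> norm_num
    · exact pair 4 5 fun i => by fin_cases i <;> simp [axisVector, axisVertex] <;> norm_num
  obtain ⟨x, hx⟩ := key
  rw [hx, Complex.ofReal_re]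

/-- The icosahedral reflection group is the symmetry group of the two invariant forms. -/
theorem mem_icosahedralReflectionGroup (h2 : ∀ x, ∑ i, (N *ᵥ x) i ^ 2 = ∑ i, x i ^ 2)
    (h6 : ∀ x, sixAxes (N *ᵥ x) = sixAxes x) : N ∈ icosahedralReflectionGroup := by
  have hN := transpose_mul_self_of_sum_sq h2
  have hax := exists_axis_of_preserves hN h6
  have hre := isReal_of_axes hax
  have hinj : Function.Injective (fun r : ℝ => (r : ℂ)) := Complex.ofReal_injective
  have hmap : N = (N.map Complex.re).map (fun r : ℝ => (r : ℂ)) := by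
    ext i j; exact (hre i j).symm
  have hvec : ∀ v : Fin 3 → ℝ, N *ᵥ (fun i => (v i : ℂ)) =
      fun i => (((N.map Complex.re) *ᵥ v) i : ℂ) := fun v => by
    ext i
    simp only [Matrix.mulVec, dotProduct, Matrix.map_apply]
    push_cast
    exact Finset.sum_congr rfl fun j _ => by rw [hre i j]
  refine ⟨N.map Complex.re, ?_, ?_, hmap⟩
  · rw [Matrix.mem_orthogonalGroup_iff']
    refine Matrix.map_injective hinj ?_
    have e := hN
    rw [hmap] at e
    ext i j
    have := congrFun (congrFun e i) j
    simp only [Matrix.mul_apply, Matrix.transpose_apply, Matrix.map_apply] at this ⊢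
    push_cast
    rw [this]
    simp [Matrix.one_apply, apply_ite (fun r : ℝ => (r : ℂ))]
  · intro v hv
    obtain ⟨k, hk⟩ := mem_icosahedronVertices_iff.1 hv
    rw [mem_icosahedronVertices_iff]
    have key : ∃ j, (N.map Complex.re) *ᵥ axisVertex k = axisVertex j ∨
        (N.map Complex.re) *ᵥ axisVertex k = -axisVertex j := by
      have e := hvec (axisVertex k)
      obtain ⟨j, hj | hj⟩ := hax k
      · refine ⟨j, Or.inl (funext fun i => hinj ?_)⟩
        exact (congrFun e i).symm.trans (congrFun hj i)
      · refine ⟨j, Or.inr (funext fun i => hinj ?_)⟩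
        refine (congrFun e i).symm.trans ((congrFun hj i).trans ?_)
        simp [axisVector]
    obtain ⟨j, hj⟩ := key
    rcases hk with rfl | rfl
    · exact ⟨j, hj⟩
    · rw [Matrix.mulVec_neg]
      rcases hj with hj | hj
      · exact ⟨j, Or.inr (by rw [hj])⟩
      · exact ⟨j, Or.inl (by rw [hj, neg_neg])⟩

end Vertices

end PainleveVI

namespace PainleveVI

open Polynomial
open scoped Polynomial.Bivariate IntermediateField Topology ComplexConjugate Matrix

/-! ### Generation of the icosahedral reflection group

The twelve vertices are numbered so that `n` and `n + 6` are opposite. A permutation of the vertices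
is encoded by the number with digits its values in base `16`, and the image of the face `(0, 2, 4)`
by a number with digits in base `12`. -/

section Generation

/-- Evaluation of a function at a natural number, after reducing it to a numeral. -/
noncomputable def force {α : Type} (n : ℕ) (k : ℕ → α) : α :=
  Nat.rec (motive := fun _ => α) (k 0) (fun m _ => k (Nat.succ m)) n

theorem force_eq {α : Type} (n : ℕ) (k : ℕ → α) : force n k = k n := by cases n <;> rfl

/-- The scalar products of the vertices, encoded by `3`, `2`, `1`, `0` for `φ + 2`, `φ`, `-φ`,
`-(φ + 2)`. -/
def gramCode (i j : ℕ) : ℕ :=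
  Nat.mod (Nat.div 414537175782167644551939184261333473087975468939740189075316284021585153994097830759015
    (Nat.pow 4 (Nat.add (Nat.mul 12 i) j))) 4

/-- The value at `i` of the encoded permutation `p`. -/
def permApp (p i : ℕ) : ℕ := Nat.mod (Nat.div p (Nat.pow 16 i)) 16

/-- The image of the encoded face `f` under the encoded permutation `p`. -/
def permAct (p f : ℕ) : ℕ :=
  Nat.add (permApp p (Nat.mod f 12)) (Nat.add (Nat.mul 12 (permApp p (Nat.mod (Nat.div f 12) 12)))
    (Nat.mul 144 (permApp p (Nat.div f 144))))

/-- The sum of the first `n` values of a function. -/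
def sumTo (f : ℕ → ℕ) : ℕ → ℕ
  | 0 => 0
  | n + 1 => Nat.add (sumTo f n) (f n)

theorem sumTo_eq (f : ℕ → ℕ) (n : ℕ) : sumTo f n = ∑ i ∈ Finset.range n, f i := by
  induction n with
  | zero => rfl
  | succ n ih => rw [sumTo, ih, Finset.sum_range_succ, Nat.add_eq]

/-- Whether the first `n` values of a function are true. -/
def allTo (f : ℕ → Bool) : ℕ → Bool
  | 0 => true
  | n + 1 => f n && allTo f n

theorem allTo_eq_true {f : ℕ → Bool} {n : ℕ} (h : allTo f n = true) : ∀ i < n, f i = true := by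
  induction n with
  | zero => intro i hi; omega
  | succ n ih =>
    rw [allTo, Bool.and_eq_true] at h
    intro i hi
    rcases Nat.lt_succ_iff_lt_or_eq.1 hi with hi | rfl
    · exact ih h.2 i hi
    · exact h.1

/-- Whether `(i, j, k)` is an oriented face. -/
def isFace (i j k : ℕ) : Bool :=
  Nat.beq (gramCode i j) 2 && (Nat.beq (gramCode i k) 2 && Nat.beq (gramCode j k) 2)

/-- Whether the vertex `n` is to the face `(i, j, k)` as the vertex `m` to the face `(0, 2, 4)`. -/
def corresponds (i j k m n : ℕ) : Bool :=
  Nat.beq (gramCode n i) (gramCode m 0) && (Nat.beq (gramCode n j) (gramCode m 2) &&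
    Nat.beq (gramCode n k) (gramCode m 4))

/-- The permutation of the vertices that maps `0, 2, 4` to `i, j, k`. -/
def facePerm (i j k : ℕ) : ℕ :=
  sumTo (fun m => sumTo (fun n => bif corresponds i j k m n then n * 16 ^ m else 0) 12) 12

/-- The number of vertices `m < 12` with `gramCode m (c m) = x`. -/
def codeCount (c : ℕ → ℕ) (x : ℕ) : ℕ :=
  sumTo (fun m => bif Nat.beq (gramCode m (c m)) x then 1 else 0) 12

/-- The permutations given by the fifteen reflections. -/
def reflectionPerms : List ℕ :=
  [11099091268251, 21201409385136, 46615318760211, 64120214042496, 76520876618241,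
   108389858818581, 134787752013906, 142503896888736, 165719068135956, 188168796473616,
   194164806791466, 201247727641161, 202836647482416, 204098763965976, 205097595577191]

/-- Whether the bit `n` of `m` is set. -/
def hasBit (m n : ℕ) : Bool := Nat.beq (Nat.mod (Nat.div m (Nat.pow 2 n)) 2) 1

/-- Add `n` to the list `q` unless the bit `n` of `m` is set. -/
noncomputable def extend (m n : ℕ) (q : List ℕ) : List ℕ :=
  Bool.rec (motive := fun _ => List ℕ) (n :: q) q (hasBit m n)

/-- The orbit of faces under three permutations, as a bit mask, by a search with queue `q`. -/
noncomputable def orbitMask (a b c n : ℕ) : List ℕ → ℕ → ℕ :=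
  Nat.rec (motive := fun _ => List ℕ → ℕ → ℕ) (fun _ m => m)
    (fun _ ih q m => List.rec (motive := fun _ => ℕ) m (fun f q _ =>
      force (permAct a f) fun x => force (permAct b f) fun y => force (permAct c f) fun z =>
      force (m.lor (Nat.pow 2 x)) fun m₁ => force (m₁.lor (Nat.pow 2 y)) fun m₂ =>
      force (m₂.lor (Nat.pow 2 z)) fun m₃ =>
      ih (extend m₂ z (extend m₁ y (extend m x q))) m₃) q) n

/-- The mask of all the faces. -/
def faceMask : ℕ :=
  sumTo (fun k => sumTo (fun j => sumTo (fun i =>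
    bif isFace i j k then 2 ^ (i + 12 * j + 144 * k) else 0) 12) 12) 12

/-- A statement about all the faces, checked by computation. -/
def allFaces (P : ℕ → ℕ → ℕ → Bool) : Bool :=
  allTo (fun i => allTo (fun j => allTo (fun k => !isFace i j k || P i j k) 12) 12) 12

/-- An ordered face determines the images of all the vertices through scalar products; it is checked
that the encoded permutation records every admissible image. -/
theorem allFaces_facePerm : allFaces (fun i j k => force (facePerm i j k) fun p =>
    allTo (fun m => allTo (fun n => !corresponds i j k m n || Nat.beq n (permApp p m)) 12) 12) =
      true := by
  decide +kernel

/-- The two equalities of counts express trace one (see `codeCount_of_trace`). Among the symmetries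
they hold only for the listed reflections. -/
theorem allFaces_reflection : allFaces (fun i j k => force (facePerm i j k) fun p =>
    !(Nat.beq (codeCount (permApp p) 3) (codeCount (permApp p) 0 + 4) &&
      Nat.beq (codeCount (permApp p) 2) (codeCount (permApp p) 1)) ||
      reflectionPerms.any (Nat.beq p)) = true := by
  decide +kernel

theorem allFaces_faceMask : force faceMask (fun s =>
    allFaces fun i j k => hasBit s (i + 12 * j + 144 * k)) = true := by
  decide +kernel

/-- Whether the product of three permutations has trace zero. -/
def traceZero (a b c : ℕ) : Bool :=
  Nat.beq (codeCount (fun m => permApp c (permApp b (permApp a m))) 3)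
      (codeCount (fun m => permApp c (permApp b (permApp a m))) 0) &&
    Nat.beq (codeCount (fun m => permApp c (permApp b (permApp a m))) 2)
      (codeCount (fun m => permApp c (permApp b (permApp a m))) 1)

/-- Whether the reflection `a`, together with any two reflections that follow it in the list and such
that the product has trace zero, acts transitively on the faces. -/
noncomputable def generates (a : ℕ) : Bool :=
  force faceMask fun s => reflectionPerms.all fun b => reflectionPerms.all fun c =>
    !(Nat.ble a b && (Nat.ble a c && traceZero a b c)) ||
      Nat.beq (orbitMask a b c 120 [600] (2 ^ 600)) s

/-- The heart of the finite check: whenever the product of the three reflections has trace zero,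
their orbit of the face `600 = 0 + 12 * 2 + 144 * 4`, that is `(0, 2, 4)`, consists of all the
ordered faces. A symmetry is determined by the image of this face, so transitivity means generation.
-/
theorem generates_of_mem : ∀ a ∈ reflectionPerms, generates a = true := by
  simp only [reflectionPerms, List.forall_mem_cons, List.not_mem_nil, false_imp_iff, implies_true,
    and_true]
  refine ⟨?_, ?_, ?_, ?_, ?_, ?_, ?_, ?_, ?_, ?_, ?_, ?_, ?_, ?_, ?_⟩ <;> decide +kernel

theorem hasBit_eq_testBit (m n : ℕ) : hasBit m n = m.testBit n := by
  rw [Nat.testBit_eq_decide_div_mod_eq, Bool.eq_iff_iff, decide_eq_true_iff]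
  exact Iff.of_eq Nat.beq_eq

/-- Only soundness of the search is needed, namely that marked faces are reachable. Completeness,
and the sufficiency of `120` steps, follow from the comparison with the full mask in `generates`. -/
theorem orbitMask_sound {a b c : ℕ} {R : ℕ → Prop} (ha : ∀ f, R f → R (permAct a f))
    (hb : ∀ f, R f → R (permAct b f)) (hc : ∀ f, R f → R (permAct c f)) (n : ℕ) (q : List ℕ) (m : ℕ)
    (hq : ∀ f ∈ q, R f) (hm : ∀ f, hasBit m f = true → R f) :
    ∀ f, hasBit (orbitMask a b c n q m) f = true → R f := by
  have hext : ∀ {m x q}, (∀ f ∈ q, R f) → R x → ∀ f ∈ extend m x q, R f := by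
    intro m x q hq hx f hf
    unfold extend at hf
    revert hf
    cases hasBit m x <;> intro hf
    · rcases List.mem_cons.1 hf with rfl | hf
      · exact hx
      · exact hq f hf
    · exact hq f hf
  have hor : ∀ {m x}, (∀ f, hasBit m f = true → R f) → R x →
      ∀ f, hasBit (m.lor (Nat.pow 2 x)) f = true → R f := by
    intro m x hm hx f hf
    rw [hasBit_eq_testBit] at hf
    have hf : (m ||| 2 ^ x).testBit f = true := hf
    rw [Nat.testBit_or, Bool.or_eq_true, Nat.testBit_two_pow, decide_eq_true_iff] at hf
    rcases hf with hf | rfl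
    · exact hm f (by rw [hasBit_eq_testBit]; exact hf)
    · exact hx
  induction n generalizing q m with
  | zero => exact hm
  | succ n ih =>
    cases q with
    | nil => exact hm
    | cons f q =>
      have hf := hq f (by simp)
      have hq' : ∀ f ∈ q, R f := fun f hf => hq f (by simp [hf])
      have e : orbitMask a b c (n + 1) (f :: q) m =
          force (permAct a f) fun x => force (permAct b f) fun y => force (permAct c f) fun z =>
          force (m.lor (Nat.pow 2 x)) fun m₁ => force (m₁.lor (Nat.pow 2 y)) fun m₂ =>
          force (m₂.lor (Nat.pow 2 z)) fun m₃ =>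
            orbitMask a b c n (extend m₂ z (extend m₁ y (extend m x q))) m₃ := rfl
      rw [e]
      simp only [force_eq]
      exact ih _ _ (hext (hext (hext hq' (ha f hf)) (hb f hf)) (hc f hf))
        (hor (hor (hor hm (ha f hf)) (hb f hf)) (hc f hf))

theorem of_allFaces {P : ℕ → ℕ → ℕ → Bool} (h : allFaces P = true) {i j k : ℕ} (hi : i < 12)
    (hj : j < 12) (hk : k < 12) (hf : isFace i j k = true) : P i j k = true := by
  have := allTo_eq_true (allTo_eq_true (allTo_eq_true h i hi) j hj) k hk
  simpa [hf] using this

end Generation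

end PainleveVI

namespace PainleveVI

open Polynomial
open scoped Polynomial.Bivariate IntermediateField Topology ComplexConjugate Matrix

/-! ### From matrices to permutations of the vertices, and generation by three reflections -/

section Symmetries

/-- The numbered vertices of the icosahedron. -/
noncomputable def vertex (n : ℕ) : Fin 3 → ℝ :=
  if n < 6 then axisVertex (Fin.ofNat 6 n) else -axisVertex (Fin.ofNat 6 n)

theorem mem_icosahedronVertices_iff_vertex {v : Fin 3 → ℝ} :
    v ∈ icosahedronVertices ↔ ∃ n < 12, v = vertex n := by
  rw [mem_icosahedronVertices_iff]
  constructor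
  · rintro ⟨k, rfl | rfl⟩
    · exact ⟨k, by omega, by rw [vertex, if_pos k.2]; congr 1; ext; simp⟩
    · refine ⟨k + 6, by omega, ?_⟩
      rw [vertex, if_neg (by omega)]; congr 2; ext; simp [Nat.mod_eq_of_lt k.2]
  · rintro ⟨n, hn, rfl⟩
    refine ⟨Fin.ofNat 6 n, ?_⟩
    rw [vertex]; split_ifs
    · exact Or.inl rfl
    · exact Or.inr rfl

/-- The scalar product with a given code. -/
noncomputable def gramValue (x : ℕ) : ℝ :=
  if x = 3 then Real.goldenRatio + 2 else if x = 2 then Real.goldenRatio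
  else if x = 1 then -Real.goldenRatio else -(Real.goldenRatio + 2)

theorem gramValue_injective {x x' : ℕ} (hx : x < 4) (hx' : x' < 4)
    (h : gramValue x = gramValue x') : x = x' := by
  have hφ := Real.goldenRatio_pos
  unfold gramValue at h
  generalize Real.goldenRatio = g at h hφ
  interval_cases x <;> interval_cases x' <;> first | rfl | (exfalso; norm_num at h <;> linarith)

theorem gramCode_lt (i j : ℕ) : gramCode i j < 4 := Nat.mod_lt _ (by norm_num)

theorem gramCode_axes : ∀ k l : Fin 6, gramCode k l =
    (![![3, 1, 2, 1, 2, 2], ![1, 3, 2, 1, 1, 1], ![2, 2, 3, 1, 2, 1], ![1, 1, 1, 3, 2, 1],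
      ![2, 1, 2, 2, 3, 1], ![2, 1, 1, 1, 1, 3]] : Fin 6 → Fin 6 → ℕ) k l := by
  decide +kernel

theorem gramCode_opposite : ∀ k l : Fin 6, gramCode (k + 6) l = 3 - gramCode k l ∧
    gramCode k (l + 6) = 3 - gramCode k l ∧ gramCode (k + 6) (l + 6) = gramCode k l := by
  decide +kernel

theorem gramValue_sub {x : ℕ} (hx : x < 4) : gramValue (3 - x) = -gramValue x := by
  interval_cases x <;> simp [gramValue]

theorem axisVertex_dotProduct (k l : Fin 6) :
    axisVertex k ⬝ᵥ axisVertex l = gramValue (gramCode k l) := by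
  rw [gramCode_axes]
  have h := Real.goldenRatio_sq
  unfold axisVertex gramValue
  generalize Real.goldenRatio = g at h
  fin_cases k <;> fin_cases l <;> simp [dotProduct, Fin.sum_univ_three] <;> linarith

theorem vertex_dotProduct {i j : ℕ} (hi : i < 12) (hj : j < 12) :
    vertex i ⬝ᵥ vertex j = gramValue (gramCode i j) := by
  have key : ∀ n : ℕ, n < 12 → (∃ k : Fin 6, n = k ∧ vertex n = axisVertex k) ∨
      ∃ k : Fin 6, n = k + 6 ∧ vertex n = -axisVertex k := fun n hn => by
    rcases lt_or_ge n 6 with h | h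
    · left
      refine ⟨⟨n, h⟩, rfl, ?_⟩
      rw [vertex, if_pos h]; congr 1; ext; simp [Nat.mod_eq_of_lt h]
    · right
      refine ⟨⟨n - 6, by omega⟩, by simp; omega, ?_⟩
      rw [vertex, if_neg (by omega)]; congr 2; ext; simp; omega
  rcases key i hi with ⟨k, rfl, hk⟩ | ⟨k, rfl, hk⟩ <;>
    rcases key j hj with ⟨l, rfl, hl⟩ | ⟨l, rfl, hl⟩ <;> rw [hk, hl] <;>
    obtain ⟨h1, h2, h3⟩ := gramCode_opposite k l
  · exact axisVertex_dotProduct k l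
  · rw [dotProduct_neg, h2, gramValue_sub (gramCode_lt _ _), axisVertex_dotProduct]
  · rw [neg_dotProduct, h1, gramValue_sub (gramCode_lt _ _), axisVertex_dotProduct]
  · rw [neg_dotProduct_neg, h3, axisVertex_dotProduct]

variable {A A' : Matrix (Fin 3) (Fin 3) ℝ}

/-- Symmetries of the icosahedron. -/
structure IsSymmetry (A : Matrix (Fin 3) (Fin 3) ℝ) : Prop where
  transpose_mul : Aᵀ * A = 1
  maps : ∀ n < 12, ∃ m < 12, A *ᵥ vertex n = vertex m

theorem IsSymmetry.mul (hA : IsSymmetry A) (hA' : IsSymmetry A') : IsSymmetry (A * A') := by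
  refine ⟨?_, fun n hn => ?_⟩
  · rw [Matrix.transpose_mul, Matrix.mul_assoc, ← Matrix.mul_assoc Aᵀ, hA.transpose_mul,
      Matrix.one_mul, hA'.transpose_mul]
  · obtain ⟨m, hm, e⟩ := hA'.maps n hn
    obtain ⟨l, hl, e'⟩ := hA.maps m hm
    exact ⟨l, hl, by rw [← Matrix.mulVec_mulVec, e, e']⟩

/-- Orthogonality preserves scalar products, and their four possible values are distinct, so the
codes agree. -/
theorem IsSymmetry.gramCode_eq (hA : IsSymmetry A) {m n i j : ℕ} (hm : m < 12) (hn : n < 12)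
    (hi : i < 12) (hj : j < 12) (ei : A *ᵥ vertex m = vertex i) (ej : A *ᵥ vertex n = vertex j) :
    gramCode i j = gramCode m n := by
  refine gramValue_injective (gramCode_lt _ _) (gramCode_lt _ _) ?_
  rw [← vertex_dotProduct hi hj, ← vertex_dotProduct hm hn, ← ei, ← ej, Matrix.dotProduct_mulVec,
    ← Matrix.mulVec_transpose, Matrix.mulVec_mulVec, hA.transpose_mul, Matrix.one_mulVec]

/-- A symmetry of the icosahedron is determined by the image of a face. -/
theorem eq_of_mulVec_face (h0 : A *ᵥ vertex 0 = A' *ᵥ vertex 0)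
    (h2 : A *ᵥ vertex 2 = A' *ᵥ vertex 2) (h4 : A *ᵥ vertex 4 = A' *ᵥ vertex 4) : A = A' := by
  have hφ := Real.goldenRatio_sq
  have hpos := Real.goldenRatio_pos
  have v0 : vertex 0 = ![0, 1, Real.goldenRatio] := rfl
  have v2 : vertex 2 = ![1, Real.goldenRatio, 0] := rfl
  have v4 : vertex 4 = ![Real.goldenRatio, 0, 1] := rfl
  rw [v0] at h0
  rw [v2] at h2
  rw [v4] at h4
  generalize Real.goldenRatio = g at *
  ext i j
  have e0 := congrFun h0 i
  have e2 := congrFun h2 i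
  have e4 := congrFun h4 i
  simp only [Matrix.mulVec, dotProduct, Fin.sum_univ_three, Matrix.cons_val] at e0 e2 e4
  have hg : (2 * g + 2) ≠ 0 := by positivity
  have d0 : A i 0 = A' i 0 := by
    refine mul_left_cancel₀ hg ?_
    linear_combination e2 - g * e0 + g ^ 2 * e4 - (A i 0 - A' i 0) * (g + 1) * hφ
  have d1 : A i 1 = A' i 1 := by
    refine mul_left_cancel₀ hpos.ne' ?_
    linear_combination e2 - d0
  have d2 : A i 2 = A' i 2 := by linear_combination e4 - g * d0
  fin_cases j
  · exact d0
  · exact d1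
  · exact d2

/-- The action of a symmetry on the vertices, in terms of the image of a face. -/
theorem IsSymmetry.facePerm (hA : IsSymmetry A) {i j k : ℕ} (hi : i < 12) (hj : j < 12)
    (hk : k < 12) (ei : A *ᵥ vertex 0 = vertex i) (ej : A *ᵥ vertex 2 = vertex j)
    (ek : A *ᵥ vertex 4 = vertex k) : isFace i j k = true ∧
      ∀ m < 12, permApp (PainleveVI.facePerm i j k) m < 12 ∧
        A *ᵥ vertex m = vertex (permApp (PainleveVI.facePerm i j k) m) := by
  have hf : isFace i j k = true := by
    rw [isFace, hA.gramCode_eq (by norm_num) (by norm_num) hi hj ei ej,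
      hA.gramCode_eq (by norm_num) (by norm_num) hi hk ei ek,
      hA.gramCode_eq (by norm_num) (by norm_num) hj hk ej ek]
    decide +kernel
  refine ⟨hf, fun m hm => ?_⟩
  obtain ⟨n, hn, en⟩ := hA.maps m hm
  have h := of_allFaces allFaces_facePerm hi hj hk hf
  rw [force_eq] at h
  have h := allTo_eq_true (allTo_eq_true h m hm) n hn
  have hc : corresponds i j k m n = true := by
    rw [corresponds, hA.gramCode_eq hm (by norm_num) hn hi en ei,
      hA.gramCode_eq hm (by norm_num) hn hj en ej, hA.gramCode_eq hm (by norm_num) hn hk en ek]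
    simp
  have hnm : n = permApp (PainleveVI.facePerm i j k) m := by
    simpa [hc] using h
  rw [← hnm]
  exact ⟨hn, en⟩

/-- The vertices form a tight frame. Summing `⟨v, A v⟩` over them therefore gives a multiple of the
trace, which is how traces become visible in the permutations. -/
theorem sum_vertex (i j : Fin 3) : ∑ n ∈ Finset.range 12, vertex n i * vertex n j =
    if i = j then 4 * (Real.goldenRatio + 2) else 0 := by
  have h := Real.goldenRatio_sq
  simp only [Finset.sum_range_succ, Finset.sum_range_zero, vertex, axisVertex]
  generalize Real.goldenRatio = g at h
  fin_cases i <;> fin_cases j <;> simp [Fin.ofNat] <;> linarith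

theorem sum_vertex_dotProduct (A : Matrix (Fin 3) (Fin 3) ℝ) :
    ∑ n ∈ Finset.range 12, vertex n ⬝ᵥ (A *ᵥ vertex n) = 4 * (Real.goldenRatio + 2) * A.trace := by
  have e : ∀ n, vertex n ⬝ᵥ (A *ᵥ vertex n) = ∑ i, ∑ j, A i j * (vertex n i * vertex n j) := fun n => by
    simp only [dotProduct, Matrix.mulVec, Finset.mul_sum]
    exact Finset.sum_congr rfl fun i _ => Finset.sum_congr rfl fun j _ => by ring
  simp only [e]
  rw [Finset.sum_comm]
  simp only [Finset.sum_comm (s := Finset.range 12), ← Finset.mul_sum, sum_vertex]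
  simp [Matrix.trace, Finset.mul_sum, mul_comm]

theorem sum_gramValue (c : ℕ → ℕ) :
    ∑ n ∈ Finset.range 12, gramValue (gramCode n (c n)) =
      ((codeCount c 3 : ℝ) - codeCount c 0) * (Real.goldenRatio + 2) +
        ((codeCount c 2 : ℝ) - codeCount c 1) * Real.goldenRatio := by
  have e : ∀ x, (codeCount c x : ℝ) =
      ∑ n ∈ Finset.range 12, if gramCode n (c n) = x then (1 : ℝ) else 0 := fun x => by
    rw [codeCount, sumTo_eq]
    push_cast
    refine Finset.sum_congr rfl fun n _ => ?_
    by_cases h : gramCode n (c n) = x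
    · simp [h]
    · have : Nat.beq (gramCode n (c n)) x = false := by
        rw [Bool.eq_false_iff]; intro h'; exact h (Nat.eq_of_beq_eq_true h')
      simp [h, this]
  rw [e, e, e, e, ← Finset.sum_sub_distrib, ← Finset.sum_sub_distrib, Finset.sum_mul,
    Finset.sum_mul, ← Finset.sum_add_distrib]
  refine Finset.sum_congr rfl fun n _ => ?_
  have := gramCode_lt n (c n)
  generalize gramCode n (c n) = x at this
  unfold gramValue
  interval_cases x <;> simp

theorem int_eq_zero_of_goldenRatio {x x' : ℤ}
    (h : (x : ℝ) * (Real.goldenRatio + 2) + x' * Real.goldenRatio = 0) : x = 0 ∧ x' = 0 := by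
  have hirr := Real.goldenRatio_irrational
  have hs : x + x' = 0 := by
    by_contra hne
    refine hirr ⟨-(2 * x) / (x + x'), ?_⟩
    have hne' : ((x : ℝ) + x') ≠ 0 := by exact_mod_cast hne
    push_cast
    rw [div_eq_iff hne']
    linarith
  have hs' : (x : ℝ) + x' = 0 := by exact_mod_cast hs
  have hx : (x : ℝ) = 0 := by linear_combination h / 2 - Real.goldenRatio / 2 * hs'
  have hx : x = 0 := by exact_mod_cast hx
  exact ⟨hx, by omega⟩

/-- The trace is a combination of `φ + 2` and `φ` with integral coefficients up to the common
factor, and these two numbers are linearly independent over `ℚ`. So an integral trace amounts to two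
equalities between counts. -/
theorem codeCount_of_trace {c : ℕ → ℕ} (hc : ∀ n < 12, c n < 12 ∧ A *ᵥ vertex n = vertex (c n)) {x : ℤ}
    (h : A.trace = x) : (codeCount c 3 : ℤ) = codeCount c 0 + 4 * x ∧
      codeCount c 2 = codeCount c 1 := by
  have h1 := sum_vertex_dotProduct A
  have h2 := sum_gramValue c
  have h3 : ∑ n ∈ Finset.range 12, vertex n ⬝ᵥ (A *ᵥ vertex n) =
      ∑ n ∈ Finset.range 12, gramValue (gramCode n (c n)) := Finset.sum_congr rfl fun n hn => by
    have hn := Finset.mem_range.1 hn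
    rw [(hc n hn).2, vertex_dotProduct hn (hc n hn).1]
  obtain ⟨h5, h6⟩ := int_eq_zero_of_goldenRatio (x := codeCount c 3 - codeCount c 0 - 4 * x)
    (x' := codeCount c 2 - codeCount c 1) (by
      push_cast
      linear_combination h1 - h3 - h2 + 4 * (Real.goldenRatio + 2) * h)
  constructor <;> omega

/-- The encoded face `f` is the image of the face `(0, 2, 4)`. -/
structure HasFace (A : Matrix (Fin 3) (Fin 3) ℝ) (f : ℕ) : Prop where
  lt : f < 1728
  fst : A *ᵥ vertex 0 = vertex (f % 12)
  snd : A *ᵥ vertex 2 = vertex (f / 12 % 12)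
  thd : A *ᵥ vertex 4 = vertex (f / 144)

theorem HasFace.mul {f p : ℕ} (h : HasFace A' f)
    (hp : ∀ m < 12, permApp p m < 12 ∧ A *ᵥ vertex m = vertex (permApp p m)) :
    HasFace (A * A') (permAct p f) := by
  obtain ⟨h1, e1⟩ := hp (f % 12) (Nat.mod_lt _ (by norm_num))
  obtain ⟨h2, e2⟩ := hp (f / 12 % 12) (Nat.mod_lt _ (by norm_num))
  obtain ⟨h3, e3⟩ := hp (f / 144) (by have := h.lt; omega)
  have e : permAct p f = permApp p (f % 12) + (12 * permApp p (f / 12 % 12)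
    + 144 * permApp p (f / 144)) := rfl
  rw [e]
  generalize permApp p (f % 12) = x at *
  generalize permApp p (f / 12 % 12) = x' at *
  generalize permApp p (f / 144) = x'' at *
  refine ⟨by omega, ?_, ?_, ?_⟩ <;> rw [← Matrix.mulVec_mulVec]
  · rw [h.fst, e1]; congr 1; omega
  · rw [h.snd, e2]; congr 1; omega
  · rw [h.thd, e3]; congr 1; omega

theorem IsSymmetry.exists_perm (hA : IsSymmetry A) : ∃ i < 12, ∃ j < 12, ∃ k < 12,
    isFace i j k = true ∧ A *ᵥ vertex 0 = vertex i ∧ A *ᵥ vertex 2 = vertex j ∧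
      A *ᵥ vertex 4 = vertex k ∧ ∀ m < 12, permApp (PainleveVI.facePerm i j k) m < 12 ∧
        A *ᵥ vertex m = vertex (permApp (PainleveVI.facePerm i j k) m) := by
  obtain ⟨i, hi, ei⟩ := hA.maps 0 (by norm_num)
  obtain ⟨j, hj, ej⟩ := hA.maps 2 (by norm_num)
  obtain ⟨k, hk, ek⟩ := hA.maps 4 (by norm_num)
  obtain ⟨hf, hp⟩ := hA.facePerm hi hj hk ei ej ek
  exact ⟨i, hi, j, hj, k, hk, hf, ei, ej, ek, hp⟩

/-- A symmetry of trace one acts on the vertices as one of the fifteen reflections. -/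
theorem IsSymmetry.exists_reflectionPerm (hA : IsSymmetry A) (ht : A.trace = 1) :
    ∃ p ∈ reflectionPerms, ∀ m < 12, permApp p m < 12 ∧ A *ᵥ vertex m = vertex (permApp p m) := by
  obtain ⟨i, hi, j, hj, k, hk, hf, -, -, -, hp⟩ := hA.exists_perm
  refine ⟨_, ?_, hp⟩
  have h := of_allFaces allFaces_reflection hi hj hk hf
  rw [force_eq] at h
  obtain ⟨h3, h2⟩ := codeCount_of_trace hp (x := 1) (by simpa using ht)
  have h3 : codeCount (permApp (PainleveVI.facePerm i j k)) 3 =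
      codeCount (permApp (PainleveVI.facePerm i j k)) 0 + 4 := by omega
  rw [h2, h3] at h
  simpa using h

variable {G : Set (Matrix (Fin 3) (Fin 3) ℝ)}

set_option exponentiation.threshold 600 in
theorem mem_of_generates (hone : (1 : Matrix (Fin 3) (Fin 3) ℝ) ∈ G)
    (hmul : ∀ A ∈ G, ∀ A' ∈ G, A * A' ∈ G) {A₁ A₂ A₃ : Matrix (Fin 3) (Fin 3) ℝ} (h₁ : A₁ ∈ G)
    (h₂ : A₂ ∈ G) (h₃ : A₃ ∈ G) (ht : (A₃ * A₂ * A₁).trace = 0) {p₁ p₂ p₃ : ℕ}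
    (hp₁ : p₁ ∈ reflectionPerms) (hp₂ : p₂ ∈ reflectionPerms) (hp₃ : p₃ ∈ reflectionPerms)
    (e₁ : ∀ m < 12, permApp p₁ m < 12 ∧ A₁ *ᵥ vertex m = vertex (permApp p₁ m))
    (e₂ : ∀ m < 12, permApp p₂ m < 12 ∧ A₂ *ᵥ vertex m = vertex (permApp p₂ m))
    (e₃ : ∀ m < 12, permApp p₃ m < 12 ∧ A₃ *ᵥ vertex m = vertex (permApp p₃ m))
    (h12 : p₁ ≤ p₂) (h13 : p₁ ≤ p₃) (hA : IsSymmetry A) : A ∈ G := by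
  have hz : traceZero p₁ p₂ p₃ = true := by
    obtain ⟨h3, h2⟩ := codeCount_of_trace (A := A₃ * A₂ * A₁) (x := 0)
      (c := fun m => permApp p₃ (permApp p₂ (permApp p₁ m))) (fun m hm => by
        obtain ⟨l1, q1⟩ := e₁ m hm
        obtain ⟨l2, q2⟩ := e₂ _ l1
        obtain ⟨l3, q3⟩ := e₃ _ l2
        exact ⟨l3, by rw [← Matrix.mulVec_mulVec, ← Matrix.mulVec_mulVec, q1, q2, q3]⟩)
      (by simpa using ht)
    rw [mul_zero, add_zero] at h3
    rw [traceZero, h2, Int.natCast_inj.1 h3]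
    simp
  have hg := generates_of_mem p₁ hp₁
  rw [generates, force_eq, List.all_eq_true] at hg
  have hg := List.all_eq_true.1 (hg p₂ hp₂) p₃ hp₃
  rw [Nat.ble_eq_true_of_le h12, Nat.ble_eq_true_of_le h13, hz] at hg
  -- Since the search reaches every ordered face, some product of the three matrices agrees with `A`
  -- on the face `(0, 2, 4)`, whose vertices form a basis.
  have hmask : orbitMask p₁ p₂ p₃ 120 [600] (2 ^ 600) = faceMask :=
    Nat.eq_of_beq_eq_true hg
  have hstart : ∃ B ∈ G, HasFace B 600 := ⟨1, hone, by norm_num, by simp, by simp, by simp⟩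
  have hsound := orbitMask_sound (a := p₁) (b := p₂) (c := p₃) (R := fun f => ∃ B ∈ G, HasFace B f)
    (fun f ⟨B, hB, hf⟩ => ⟨_, hmul _ h₁ _ hB, hf.mul e₁⟩)
    (fun f ⟨B, hB, hf⟩ => ⟨_, hmul _ h₂ _ hB, hf.mul e₂⟩)
    (fun f ⟨B, hB, hf⟩ => ⟨_, hmul _ h₃ _ hB, hf.mul e₃⟩) 120 [600] (2 ^ 600)
    (fun f hf => by rw [List.mem_singleton.1 hf]; exact hstart)
    (fun f hf => by
      rw [hasBit_eq_testBit, Nat.testBit_two_pow, decide_eq_true_iff] at hf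
      rw [← hf]; exact hstart)
  obtain ⟨i, hi, j, hj, k, hk, hf, ei, ej, ek, -⟩ := hA.exists_perm
  have hbit := allFaces_faceMask
  rw [force_eq] at hbit
  have hbit := of_allFaces hbit hi hj hk hf
  rw [← hmask] at hbit
  obtain ⟨B, hB, hBf⟩ := hsound _ hbit
  have b1 := hBf.fst
  have b2 := hBf.snd
  have b3 := hBf.thd
  rw [show (i + 12 * j + 144 * k) % 12 = i by omega] at b1
  rw [show (i + 12 * j + 144 * k) / 12 % 12 = j by omega] at b2
  rw [show (i + 12 * j + 144 * k) / 144 = k by omega] at b3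
  rwa [eq_of_mulVec_face (ei.trans b1.symm) (ej.trans b2.symm) (ek.trans b3.symm)]

/-- Three reflections of the icosahedron whose product has trace zero generate the group of
symmetries. -/
theorem mem_of_reflections (hG : ∀ A ∈ G, IsSymmetry A)
    (hone : (1 : Matrix (Fin 3) (Fin 3) ℝ) ∈ G) (hmul : ∀ A ∈ G, ∀ A' ∈ G, A * A' ∈ G)
    {A₁ A₂ A₃ : Matrix (Fin 3) (Fin 3) ℝ} (h₁ : A₁ ∈ G) (h₂ : A₂ ∈ G) (h₃ : A₃ ∈ G)
    (t₁ : A₁.trace = 1) (t₂ : A₂.trace = 1) (t₃ : A₃.trace = 1)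
    (ht : (A₃ * A₂ * A₁).trace = 0) (hA : IsSymmetry A) : A ∈ G := by
  obtain ⟨p₁, m₁, e₁⟩ := (hG _ h₁).exists_reflectionPerm t₁
  obtain ⟨p₂, m₂, e₂⟩ := (hG _ h₂).exists_reflectionPerm t₂
  obtain ⟨p₃, m₃, e₃⟩ := (hG _ h₃).exists_reflectionPerm t₃
  -- The trace is invariant under cyclic rotation of the factors, so the reflection with the
  -- smallest code may come first. The finite check only covers triples ordered in this way.
  have ht' : (A₁ * A₃ * A₂).trace = 0 := by rw [← ht, mul_assoc, Matrix.trace_mul_comm]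
  have ht'' : (A₂ * A₁ * A₃).trace = 0 := by rw [← ht', mul_assoc, Matrix.trace_mul_comm]
  rcases le_total p₁ p₂ with h12 | h12
  · rcases le_total p₁ p₃ with h13 | h13
    · exact mem_of_generates hone hmul h₁ h₂ h₃ ht m₁ m₂ m₃ e₁ e₂ e₃ h12 h13 hA
    · exact mem_of_generates hone hmul h₃ h₁ h₂ ht'' m₃ m₁ m₂ e₃ e₁ e₂ h13 (h13.trans h12) hA
  · rcases le_total p₂ p₃ with h23 | h23
    · exact mem_of_generates hone hmul h₂ h₃ h₁ ht' m₂ m₃ m₁ e₂ e₃ e₁ h23 h12 hA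
    · exact mem_of_generates hone hmul h₃ h₁ h₂ ht'' m₃ m₁ m₂ e₃ e₁ e₂ (h23.trans h12) h23 hA

end Symmetries

end PainleveVI

namespace PainleveVI

open Polynomial
open scoped Polynomial.Bivariate IntermediateField Topology ComplexConjugate Matrix

/-! ### The monodromy group of the connection -/

section Monodromy

theorem basePoint_im_pos : 0 < basePoint.im := by
  have h : basePoint.im = 3 * √3 / 2 := by
    rw [basePoint, show (2 : ℂ) = ((2 : ℝ) : ℂ) by norm_num, Complex.div_ofReal_im]
    simp [ω]
  rw [h]
  positivity

theorem ne_icosaPoles {z : ℂ} (hz : 0 < z.im) (j : Fin 3) : z - icosaPoles j ≠ 0 := by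
  intro h
  have := congrArg Complex.im h
  simp at this
  linarith

/-- The value is the product `1/2 * 5/6 * 1/6` of the prescribed eigenvalues. Its nonvanishing makes
the fibre coordinates a genuine coordinate system. -/
theorem det_icosaResidues : icosaResidues.det = 5 / 72 := by
  rw [icosaResidues, Matrix.det_fin_three]
  simp
  have h := ω_sq
  ring_nf
  simp only [h]
  ring

theorem icosaScale_ne_zero (j : Fin 3) : icosaScale j ≠ 0 := by
  fin_cases j
  · simp [icosaScale]
  · exact add_mul_ω_ne_zero (by norm_num)
  · exact add_mul_ω_ne_zero (by norm_num)

/-- The fibre coordinates at the base point, as a matrix. -/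
noncomputable def fibreMatrix : Matrix (Fin 3) (Fin 3) ℂ :=
  Matrix.diagonal (fun j => icosaScale j / (2 * (basePoint - icosaPoles j))) * icosaResidues

theorem fibreMatrix_mulVec (v : Fin 3 → ℂ) : fibreMatrix *ᵥ v = fibreCoord basePoint v := by
  ext j
  rw [fibreMatrix, ← Matrix.mulVec_mulVec, Matrix.mulVec_diagonal, fibreCoord]
  ring

theorem isUnit_fibreMatrix : IsUnit fibreMatrix := by
  rw [Matrix.isUnit_iff_isUnit_det, fibreMatrix, Matrix.det_mul, Matrix.det_diagonal,
    det_icosaResidues]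
  refine IsUnit.mk0 _ (mul_ne_zero (Finset.prod_ne_zero_iff.2 fun j _ => ?_) (by norm_num))
  exact div_ne_zero (icosaScale_ne_zero j)
    (mul_ne_zero two_ne_zero (ne_icosaPoles basePoint_im_pos j))

/-- The monodromy group of the connection at the base point. -/
abbrev icosaMonodromy : Set (Matrix (Fin 3) (Fin 3) ℂ) :=
  monodromyGroup (fuchsian icosaResidues icosaPoles) (Set.range fun j => (icosaPoles j : ℂ)) basePoint

/-- The monodromy group is conjugate to a subset of the icosahedral reflection group. -/
theorem exists_conj_mem_icosahedral : ∃ U : GL (Fin 3) ℂ, ∀ M ∈ icosaMonodromy,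
    (U : Matrix (Fin 3) (Fin 3) ℂ) * M * ((U⁻¹ : GL (Fin 3) ℂ) : Matrix (Fin 3) (Fin 3) ℂ) ∈
      icosahedralReflectionGroup := by
  obtain ⟨W, c, hW, hWm⟩ := exists_icosahedral_frame
  obtain ⟨U, hU⟩ := hW.mul isUnit_fibreMatrix
  refine ⟨U, fun M hM => ?_⟩
  have hforms := (mem_monodromyGroup_iff.1 hM).forms_eq
  have hx : ∀ x : Fin 3 → ℂ, ∃ v, (U : Matrix (Fin 3) (Fin 3) ℂ) *ᵥ v = x ∧
      ((U : Matrix (Fin 3) (Fin 3) ℂ) * M * ((U⁻¹ : GL (Fin 3) ℂ) : Matrix (Fin 3) (Fin 3) ℂ)) *ᵥ x =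
        (U : Matrix (Fin 3) (Fin 3) ℂ) *ᵥ (M *ᵥ v) := fun x => by
    refine ⟨((U⁻¹ : GL (Fin 3) ℂ) : Matrix (Fin 3) (Fin 3) ℂ) *ᵥ x, ?_, ?_⟩
    · rw [Matrix.mulVec_mulVec, Units.mul_inv, Matrix.one_mulVec]
    · rw [Matrix.mulVec_mulVec, Matrix.mulVec_mulVec, Matrix.mul_assoc]
  have hUv : ∀ v, (U : Matrix (Fin 3) (Fin 3) ℂ) *ᵥ v = W *ᵥ fibreCoord basePoint v := fun v => by
    rw [hU, ← Matrix.mulVec_mulVec, fibreMatrix_mulVec]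
  refine mem_icosahedralReflectionGroup (fun x => ?_) (fun x => ?_)
  · obtain ⟨v, rfl, h⟩ := hx x
    rw [h, hUv, hUv, (hWm _).1, (hWm _).1, (hforms v).1]
  · obtain ⟨v, rfl, h⟩ := hx x
    rw [h, hUv, hUv, (hWm _).2, (hWm _).2, (hforms v).1, (hforms v).2]

theorem mem_icosahedralReflectionGroup_iff {M : Matrix (Fin 3) (Fin 3) ℂ} :
    M ∈ icosahedralReflectionGroup ↔
      ∃ A : Matrix (Fin 3) (Fin 3) ℝ, IsSymmetry A ∧ M = A.map (fun r : ℝ => (r : ℂ)) := by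
  constructor
  · rintro ⟨A, hA, hv, rfl⟩
    refine ⟨A, ⟨(Matrix.mem_orthogonalGroup_iff' _ _).1 hA, fun n hn => ?_⟩, rfl⟩
    exact mem_icosahedronVertices_iff_vertex.1
      (hv _ (mem_icosahedronVertices_iff_vertex.2 ⟨n, hn, rfl⟩))
  · rintro ⟨A, hA, rfl⟩
    refine ⟨A, (Matrix.mem_orthogonalGroup_iff' _ _).2 hA.transpose_mul, fun v hv => ?_, rfl⟩
    obtain ⟨n, hn, rfl⟩ := mem_icosahedronVertices_iff_vertex.1 hv
    exact mem_icosahedronVertices_iff_vertex.2 (hA.maps n hn)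

theorem finite_isSymmetry : {A : Matrix (Fin 3) (Fin 3) ℝ | IsSymmetry A}.Finite := by
  let F : ℕ × ℕ × ℕ → Set (Matrix (Fin 3) (Fin 3) ℝ) := fun f =>
    {A | A *ᵥ vertex 0 = vertex f.1 ∧ A *ᵥ vertex 2 = vertex f.2.1 ∧ A *ᵥ vertex 4 = vertex f.2.2}
  have hF : ∀ f, (F f).Finite := fun f => Set.Subsingleton.finite fun A hA A' hA' =>
    eq_of_mulVec_face (hA.1.trans hA'.1.symm) (hA.2.1.trans hA'.2.1.symm) (hA.2.2.trans hA'.2.2.symm)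
  refine (((Set.finite_Iio 12).prod ((Set.finite_Iio 12).prod (Set.finite_Iio 12))).biUnion
    fun f _ => hF f).subset fun A hA => ?_
  obtain ⟨i, hi, j, hj, k, hk, -, ei, ej, ek, -⟩ := IsSymmetry.exists_perm hA
  exact Set.mem_biUnion (x := (i, j, k)) ⟨hi, hj, hk⟩ ⟨ei, ej, ek⟩

/-- This is all that `trace_gates` needs from the upper bound on the monodromy group: finitely many
symmetries have finitely many traces. -/
theorem finite_trace_icosaMonodromy : (Matrix.trace '' icosaMonodromy).Finite := by
  obtain ⟨U, hU⟩ := exists_conj_mem_icosahedral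
  refine (finite_isSymmetry.image fun A => (A.map (fun r : ℝ => (r : ℂ))).trace).subset ?_
  rintro _ ⟨M, hM, rfl⟩
  obtain ⟨A, hA, e⟩ := mem_icosahedralReflectionGroup_iff.1 (hU M hM)
  refine ⟨A, hA, ?_⟩
  simp only
  rw [← e, Matrix.trace_mul_comm, ← Matrix.mul_assoc, Units.inv_mul, Matrix.one_mul]

theorem exp_half : Complex.exp (2 * Real.pi * Complex.I * (1 / 2)) = -1 := by
  rw [← Complex.exp_pi_mul_I]; congr 1; ring

/-- The monodromy around one pole has trace one. -/
theorem trace_small_loop (i : Fin 3) {Em Ep : Matrix (Fin 3) (Fin 3) ℂ}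
    (hEm : IsGateTransport (fuchsian icosaResidues icosaPoles) basePoint
      (icosaPoles i + (-1 / 4)) Em)
    (hEp : IsGateTransport (fuchsian icosaResidues icosaPoles) basePoint (icosaPoles i + 1 / 4) Ep) :
    (Ep⁻¹ * Em).trace = 1 := by
  -- Zooming in on the pole `i` by `z = a i + ε w`: this pole stays at `w = 0`, and the other two
  -- move to infinity as `ε` tends to zero. The limit system has as its residue the `i`-th row
  -- alone.
  let p : Fin 3 → ℝ → ℝ := fun j ε => if j = i then 1 else ε
  let q : Fin 3 → ℝ → ℝ := fun j _ => if j = i then 0 else icosaPoles i - icosaPoles j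
  let R : Matrix (Fin 3) (Fin 3) ℂ := Matrix.diagonal (fun j => (p j 0 : ℂ)) * icosaResidues
  have hR : ∀ j k, R j k = if j = i then icosaResidues i k else 0 := fun j k => by
    simp only [R, p, Matrix.diagonal_mul]
    by_cases h : j = i
    · subst h; simp
    · simp [h]
  have hdiag : ∀ i, icosaResidues i i = 1 / 2 := fun i => by
    fin_cases i <;> simp [icosaResidues]
  have hRR : R * R = (1 / 2 : ℂ) • R := by
    ext j k
    simp only [Matrix.mul_apply, hR, Matrix.smul_apply, smul_eq_mul]
    by_cases h : j = i
    · simp [h, hdiag]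
    · simp [h]
  have htr : R.trace = 1 / 2 := by
    simp [Matrix.trace, hR, hdiag]
  have key := trace_gates (z₀ := basePoint) (a := icosaPoles) (B := icosaResidues)
    -- The limit residue `R` satisfies `R² = R/2`, so `2R` and `1 - 2R` are its spectral
    -- projections, of traces `1` and `2`. The trace of the loop is `-1 + 2`.
    (μ := ![1 / 2, 0]) (pr := ![(2 : ℂ) • R, 1 - (2 : ℂ) • R]) (p := p) (q := q)
    (c := fun _ => icosaPoles i) (ρ := fun ε => ε) (gm := -1 / 4) (gp := 1 / 4)
    (by simp [Fin.sum_univ_two])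
    (fun k l => by
      fin_cases k <;> fin_cases l <;>
        simp [mul_sub, sub_mul, hRR, smul_smul])
    (fun j => by simp only [p]; split_ifs <;> fun_prop) (fun j => by simp only [q]; fun_prop)
    basePoint_im_pos (by norm_num) (by norm_num)
    (fun ε hε j => by
      simp only [p, q]
      split_ifs with h
      · norm_num
      · have h1 := hε.1
        have h2 := hε.2
        constructor <;> intro h0 <;> revert h <;> fin_cases i <;> fin_cases j <;>
          simp [icosaPoles] at h0 ⊢ <;> linarith)
    (fun ε hε => ⟨hε.1, fun j => by
      simp only [p, q]
      split_ifs with h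
      · subst h; simp
      · exact ⟨hε.1.ne', rfl⟩⟩) rfl
    (fun j => by
      simp only [p, q]
      split_ifs
      · exact Or.inl ⟨rfl, rfl⟩
      · exact Or.inr rfl)
    (fun k => by
      change R * _ = _
      fin_cases k <;> simp [mul_sub, hRR, smul_smul])
    finite_trace_icosaMonodromy hEm hEp
  rw [key, Fin.sum_univ_two]
  simp only [Matrix.cons_val]
  rw [exp_half]
  simp [htr]
  norm_num

/-- The monodromy around all the poles has trace zero. -/
theorem trace_big_loop {Em Ep : Matrix (Fin 3) (Fin 3) ℂ}
    (hEm : IsGateTransport (fuchsian icosaResidues icosaPoles) basePoint (0 + (-1 / 4)) Em)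
    (hEp : IsGateTransport (fuchsian icosaResidues icosaPoles) basePoint (0 + 5 / 4) Ep) :
    (Ep⁻¹ * Em).trace = 0 := by
  obtain ⟨V, hV⟩ : ∃ V, V = icosaResidues - (1 / 2 : ℂ) • (1 : Matrix (Fin 3) (Fin 3) ℂ) := ⟨_, rfl⟩
  have hB : icosaResidues = (1 / 2 : ℂ) • (1 : Matrix (Fin 3) (Fin 3) ℂ) + V := by rw [hV]; abel
  have h := ω_sq
  have h3 : ω ^ 3 = -3 * ω := by linear_combination ω * h
  have hVe : V = !![0, 1 / 6 - 43 / 390 * ω, 391 / 3490 + 169 / 10470 * ω;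
     572 / 5235 + 169 / 5235 * ω, 0, 286 / 5235 - 169 / 10470 * ω;
     782 / 1745 - 338 / 5235 * ω, 1 / 3 + 43 / 195 * ω, 0] := by
    rw [hV]
    ext i j
    fin_cases i <;> fin_cases j <;> simp [icosaResidues]
  -- With this relation `V` has its eigenvalues among `0, 1/3, -1/3`, which are `1/2, 5/6, 1/6`
  -- shifted by `-1/2`. The projections below are the interpolation polynomials in `V`; the traces
  -- of `V` and `V²` show that each has trace `1`.
  have hV3 : V * V * V = (1 / 9 : ℂ) • V := by
    rw [hVe]
    ext i j
    fin_cases i <;> fin_cases j <;> simp [Matrix.mul_apply, Fin.sum_univ_three] <;> ring_nf <;>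
      simp only [h, h3] <;> ring
  have htV : V.trace = 0 := by rw [hVe]; simp [Matrix.trace, Fin.sum_univ_three]
  have htV2 : (V * V).trace = 2 / 9 := by
    rw [hVe]
    simp [Matrix.trace, Fin.sum_univ_three]
    ring_nf
    simp only [h]
    ring
  have hV3' : V * (V * V) = (1 / 9 : ℂ) • V := by rw [← mul_assoc, hV3]
  have hV4 : V * V * (V * V) = (1 / 9 : ℂ) • (V * V) := by
    rw [← mul_assoc, hV3, Matrix.smul_mul]
  have key := trace_gates (z₀ := basePoint) (a := icosaPoles) (B := icosaResidues)
    (μ := ![1 / 2, 5 / 6, 1 / 6]) (pr := ![1 - (9 : ℂ) • (V * V),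
      (9 / 2 : ℂ) • (V * V) + (3 / 2 : ℂ) • V, (9 / 2 : ℂ) • (V * V) - (3 / 2 : ℂ) • V])
    -- Zooming out by `z = w/ε`: all the poles merge at `w = 0`, and the limit residue is the full
    -- matrix. The default value `0⁻¹ = 0` of the scale is harmless, since conditions on `ρ` are
    -- imposed only for `ε > 0`.
    (p := fun _ _ => 1) (q := fun j ε => -ε * icosaPoles j)
    (c := fun _ => 0) (ρ := fun ε => ε⁻¹) (gm := -1 / 4) (gp := 5 / 4)
    (by simp [Fin.sum_univ_three]; module)
    (fun k l => by
      fin_cases k <;> fin_cases l <;>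
        simp [mul_sub, sub_mul, mul_add, add_mul, hV3, hV3', hV4, smul_smul] <;> module)
    (fun j => by fun_prop) (fun j => by fun_prop)
    basePoint_im_pos (by norm_num) (by norm_num)
    (fun ε hε j => by
      have h1 := hε.1
      have h2 := hε.2
      constructor <;> intro h0 <;> fin_cases j <;> simp [icosaPoles] at h0 <;> linarith)
    (fun ε hε => ⟨inv_pos.2 hε.1, fun j => ⟨one_ne_zero, by
      have := hε.1.ne'
      field_simp; ring⟩⟩) (by simp)
    (fun j => Or.inl ⟨rfl, by simp⟩)
    (fun k => by
      have e : Matrix.diagonal (fun _ : Fin 3 => ((1 : ℝ) : ℂ)) * icosaResidues = icosaResidues := by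
        simp
      rw [e, hB]
      fin_cases k <;>
        simp [mul_sub, mul_add, add_mul, hV3', smul_smul] <;> module)
    finite_trace_icosaMonodromy hEm hEp
  rw [key, Fin.sum_univ_three]
  simp only [Matrix.cons_val]
  rw [exp_half]
  -- The eigenvalues of the loop are `-1` and the two primitive sixth roots of unity, whose sum is
  -- `1`, so the trace is zero.
  have e1 : Complex.exp (2 * Real.pi * Complex.I * (5 / 6)) =
      Complex.exp (-(2 * Real.pi * Complex.I * (1 / 6))) := by
    rw [← Complex.exp_periodic (-(2 * Real.pi * Complex.I * (1 / 6)))]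
    congr 1; ring
  have e2 : Complex.exp (2 * Real.pi * Complex.I * (1 / 6)) +
      Complex.exp (-(2 * Real.pi * Complex.I * (1 / 6))) = 1 := by
    have hc := Complex.two_cos (Real.pi / 3)
    have hcos : Complex.cos (Real.pi / 3) = 1 / 2 := by
      have := Real.cos_pi_div_three
      rw [show (Real.pi / 3 : ℂ) = ((Real.pi / 3 : ℝ) : ℂ) by push_cast; ring, ← Complex.ofReal_cos,
        this]
      norm_num
    rw [hcos] at hc
    rw [show (2 * Real.pi * Complex.I * (1 / 6) : ℂ) = Real.pi / 3 * Complex.I by ring,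
      ← neg_mul, ← hc]
    norm_num
  rw [e1]
  simp only [Matrix.trace_sub, Matrix.trace_add, Matrix.trace_smul, htV, htV2, Matrix.trace_one,
    smul_eq_mul, Fintype.card_fin]
  linear_combination e2

end Monodromy

end PainleveVI

namespace PainleveVI

open Polynomial
open scoped Polynomial.Bivariate IntermediateField Topology ComplexConjugate Matrix

/-! ### The monodromy group is the full icosahedral reflection group -/

section MonodromyGroup

theorem trace_conj_map (U : GL (Fin 3) ℂ) {M : Matrix (Fin 3) (Fin 3) ℂ}
    {A : Matrix (Fin 3) (Fin 3) ℝ}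
    (h : (U : Matrix (Fin 3) (Fin 3) ℂ) * M * ((U⁻¹ : GL (Fin 3) ℂ) : Matrix (Fin 3) (Fin 3) ℂ) =
      A.map (fun r : ℝ => (r : ℂ))) : (A.trace : ℂ) = M.trace := by
  have e : M.trace = (A.map (fun r : ℝ => (r : ℂ))).trace := by
    rw [← h, Matrix.trace_mul_comm, ← Matrix.mul_assoc, Units.inv_mul, Matrix.one_mul]
  rw [e]
  simp [Matrix.trace]

/-- The monodromy group of the connection is conjugate to the icosahedral reflection group. -/
theorem icosaMonodromy_eq : ∃ g : GL (Fin 3) ℂ, icosaMonodromy =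
    {M | ∃ h ∈ icosahedralReflectionGroup,
      M = (g : Matrix (Fin 3) (Fin 3) ℂ) * h * ((g⁻¹ : GL (Fin 3) ℂ) : Matrix _ _ ℂ)} := by
  obtain ⟨U, hU⟩ := exists_conj_mem_icosahedral
  have hmulmap : ∀ A A' : Matrix (Fin 3) (Fin 3) ℝ, (A * A').map (fun r : ℝ => (r : ℂ)) =
      A.map (fun r : ℝ => (r : ℂ)) * A'.map (fun r : ℝ => (r : ℂ)) := fun A A' =>
    Matrix.map_mul (f := Complex.ofRealHom)
  have hback : ∀ M : Matrix (Fin 3) (Fin 3) ℂ, ((U⁻¹ : GL (Fin 3) ℂ) : Matrix _ _ ℂ) *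
      ((U : Matrix (Fin 3) (Fin 3) ℂ) * M * ((U⁻¹ : GL (Fin 3) ℂ) : Matrix _ _ ℂ)) *
      (U : Matrix (Fin 3) (Fin 3) ℂ) = M := fun M => by
    rw [← Matrix.mul_assoc, ← Matrix.mul_assoc, Units.inv_mul, Matrix.one_mul, Matrix.mul_assoc,
      Units.inv_mul, Matrix.mul_one]
  have hcont := continuousOn_fuchsian (B := icosaResidues) (a := icosaPoles)
  have hz := basePoint_im_pos
  have hmul : ∀ M ∈ icosaMonodromy, ∀ M' ∈ icosaMonodromy, M * M' ∈ icosaMonodromy :=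
    fun M hM M' hM' => mem_monodromyGroup_iff.2
      ((mem_monodromyGroup_iff.1 hM').trans (mem_monodromyGroup_iff.1 hM))
  -- The gates `-1/4, 1/4, 3/4, 5/4` separate the poles `0, 1/2, 1`. Consecutive gates bound a loop
  -- around one pole, and the outer two a loop around all three.
  have gate : ∀ g : ℝ, (∀ j, g ≠ icosaPoles j) → _ := fun g hg =>
    exists_isGateTransport (B := icosaResidues) (a := icosaPoles) (z₀ := basePoint) (g := g) hz.ne' hg
  obtain ⟨E₀, g₀, t₀⟩ := gate (-1 / 4) fun j => by fin_cases j <;> simp [icosaPoles] <;> norm_num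
  obtain ⟨E₁, g₁, t₁⟩ := gate (1 / 4) fun j => by fin_cases j <;> simp [icosaPoles]
  obtain ⟨E₂, g₂, t₂⟩ := gate (3 / 4) fun j => by fin_cases j <;> simp [icosaPoles] <;> norm_num
  obtain ⟨E₃, g₃, t₃⟩ := gate (5 / 4) fun j => by fin_cases j <;> simp [icosaPoles] <;> norm_num
  have mem : ∀ {E E'}, Transports (fuchsian icosaResidues icosaPoles)
      (Set.range fun j => (icosaPoles j : ℂ)) basePoint (conj basePoint) E →
      Transports (fuchsian icosaResidues icosaPoles)
      (Set.range fun j => (icosaPoles j : ℂ)) basePoint (conj basePoint) E' →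
      E'⁻¹ * E ∈ icosaMonodromy := fun h h' =>
    mem_monodromyGroup_iff.2 (h.trans (h'.symm hcont))
  have hone : (1 : Matrix (Fin 3) (Fin 3) ℂ) ∈ icosaMonodromy := by
    have := mem t₀ t₀
    rwa [Matrix.nonsing_inv_mul _ (t₀.isUnit_det hcont)] at this
  have tr₁ : (E₁⁻¹ * E₀).trace = 1 :=
    trace_small_loop 0 (by convert g₀ using 1; norm_num [icosaPoles])
      (by convert g₁ using 1; norm_num [icosaPoles])
  have tr₂ : (E₂⁻¹ * E₁).trace = 1 :=
    trace_small_loop 1 (by convert g₁ using 1; norm_num [icosaPoles])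
      (by convert g₂ using 1; norm_num [icosaPoles])
  have tr₃ : (E₃⁻¹ * E₂).trace = 1 :=
    trace_small_loop 2 (by convert g₂ using 1; simp [icosaPoles]; norm_num)
      (by convert g₃ using 1; simp [icosaPoles]; norm_num)
  have tr : (E₃⁻¹ * E₀).trace = 0 :=
    trace_big_loop (by convert g₀ using 1; norm_num) (by convert g₃ using 1; norm_num)
  -- The product of the three small loops telescopes to the big loop exactly, as an identity of
  -- matrices.
  have hprod : (E₃⁻¹ * E₂) * (E₂⁻¹ * E₁) * (E₁⁻¹ * E₀) = E₃⁻¹ * E₀ := by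
    rw [Matrix.mul_assoc E₃⁻¹, ← Matrix.mul_assoc E₂,
      Matrix.mul_nonsing_inv _ (t₂.isUnit_det hcont), Matrix.one_mul, Matrix.mul_assoc E₃⁻¹,
      ← Matrix.mul_assoc E₁, Matrix.mul_nonsing_inv _ (t₁.isUnit_det hcont), Matrix.one_mul]
  -- The symmetries of the icosahedron realised by the monodromy. This set is closed under products
  -- and contains three reflections whose product has trace zero, hence it is everything.
  let G : Set (Matrix (Fin 3) (Fin 3) ℝ) := {A | IsSymmetry A ∧ ∃ M ∈ icosaMonodromy,
    (U : Matrix (Fin 3) (Fin 3) ℂ) * M * ((U⁻¹ : GL (Fin 3) ℂ) : Matrix _ _ ℂ) =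
      A.map (fun r : ℝ => (r : ℂ))}
  have hG : ∀ M ∈ icosaMonodromy, ∃ A ∈ G,
      (U : Matrix (Fin 3) (Fin 3) ℂ) * M * ((U⁻¹ : GL (Fin 3) ℂ) : Matrix _ _ ℂ) =
        A.map (fun r : ℝ => (r : ℂ)) := fun M hM => by
    obtain ⟨A, hA, e⟩ := mem_icosahedralReflectionGroup_iff.1 (hU M hM)
    exact ⟨A, ⟨hA, M, hM, e⟩, e⟩
  have hconj : ∀ M M' : Matrix (Fin 3) (Fin 3) ℂ,
      (U : Matrix (Fin 3) (Fin 3) ℂ) * (M * M') * ((U⁻¹ : GL (Fin 3) ℂ) : Matrix _ _ ℂ) =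
      ((U : Matrix (Fin 3) (Fin 3) ℂ) * M * ((U⁻¹ : GL (Fin 3) ℂ) : Matrix _ _ ℂ)) *
      ((U : Matrix (Fin 3) (Fin 3) ℂ) * M' * ((U⁻¹ : GL (Fin 3) ℂ) : Matrix _ _ ℂ)) := fun M M' => by
    simp only [Matrix.mul_assoc]
    rw [Units.inv_mul_cancel_left]
  obtain ⟨A₁, hA₁, e₁⟩ := hG _ (mem t₀ t₁)
  obtain ⟨A₂, hA₂, e₂⟩ := hG _ (mem t₁ t₂)
  obtain ⟨A₃, hA₃, e₃⟩ := hG _ (mem t₂ t₃)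
  have one_mem : (1 : Matrix (Fin 3) (Fin 3) ℝ) ∈ G := by
    refine ⟨⟨by simp, fun n hn => ⟨n, hn, by simp⟩⟩, 1, hone, ?_⟩
    rw [Matrix.mul_one, Units.mul_inv]
    exact (Matrix.map_one _ Complex.ofReal_zero Complex.ofReal_one).symm
  have mul_mem : ∀ A ∈ G, ∀ A' ∈ G, A * A' ∈ G := by
    rintro A ⟨hA, M, hM, e⟩ A' ⟨hA', M', hM', e'⟩
    exact ⟨hA.mul hA', M * M', hmul _ hM _ hM', by rw [hconj, e, e', hmulmap]⟩
  have s₁ : A₁.trace = 1 := by exact_mod_cast (trace_conj_map U e₁).trans tr₁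
  have s₂ : A₂.trace = 1 := by exact_mod_cast (trace_conj_map U e₂).trans tr₂
  have s₃ : A₃.trace = 1 := by exact_mod_cast (trace_conj_map U e₃).trans tr₃
  have s : (A₃ * A₂ * A₁).trace = 0 := by
    have e : (U : Matrix (Fin 3) (Fin 3) ℂ) * (E₃⁻¹ * E₀) *
        ((U⁻¹ : GL (Fin 3) ℂ) : Matrix _ _ ℂ) = (A₃ * A₂ * A₁).map (fun r : ℝ => (r : ℂ)) := by
      rw [← hprod, hconj, hconj, e₁, e₂, e₃, hmulmap, hmulmap]
    exact_mod_cast (trace_conj_map U e).trans tr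
  refine ⟨U⁻¹, Set.ext fun M => ⟨fun hM => ⟨_, hU M hM, ?_⟩, ?_⟩⟩
  · rw [inv_inv, hback]
  · rintro ⟨h, hh, rfl⟩
    obtain ⟨A, hA, rfl⟩ := mem_icosahedralReflectionGroup_iff.1 hh
    obtain ⟨-, M, hM, e⟩ := mem_of_reflections (fun A hA => hA.1) one_mem mul_mem hA₁ hA₂ hA₃ s₁ s₂ s₃
      s hA
    rw [inv_inv, ← e, hback]
    exact hM

/-- It joins the two halves of the proof: the values of the transformed solution and of its
conjugate variable over `t = 1/2` give exactly the connection whose monodromy is computed. -/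
theorem residueRows_eq {y y' : ℂ} (hy : y = 1 / 2 + 169 / 2346 * ω)
    (hx : conjugateVar ![0, 0, 0, -2 / 3] y y' (1 / 2) = -34408 / 68055 * ω) :
    residueRows dmTraces dmEigenvalues y y' (1 / 2) = icosaResidues := by
  have h := ω_sq
  have h3 : ω ^ 3 = -3 * ω := by linear_combination ω * h
  simp only [residueRows, thetaOf_dm, hx]
  rw [hy]
  ext i j
  fin_cases i <;> fin_cases j <;> simp [dmTraces, dmEigenvalues, icosaResidues] <;> ring_nf <;>
    simp only [h, h3] <;> ring

theorem connectionMatrix_eq : connectionMatrix icosaResidues (1 / 2) =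
    fuchsian icosaResidues icosaPoles := by
  funext z
  rw [connectionMatrix, fuchsian]
  congr 2
  funext j
  fin_cases j <;> simp [icosaPoles]

theorem range_icosaPoles : (Set.range fun j => (icosaPoles j : ℂ)) = {0, 1 / 2, 1} := by
  ext z
  simp only [Set.mem_range, Fin.exists_fin_succ, Set.mem_insert_iff, Set.mem_singleton_iff]
  simp [icosaPoles, eq_comm]

/-- The solution of Dubrovin and Mazzocco exists and is equivalent to the explicit solution. -/
theorem exists_isDubrovinMazzocco : ∃ Γ : PlaneCurve, IsDubrovinMazzocco Γ ∧
    OkamotoEquivalent (dubrovinMazzoccoData Γ) explicitSolution ∧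
    PlaneCurve.Birational Γ ellipticCurve := by
  obtain ⟨Γ, h1, h2, h3, h4, f, hf, hev, hf0, hx⟩ := exists_dubrovinMazzocco_curve
  refine ⟨Γ, ⟨h1, h2, 1 / 2, f, by norm_num, by norm_num, hf, hev, ?_, ?_, ?_, basePoint, ?_, ?_⟩,
    h3, h4⟩
  · rw [hf0]; exact add_mul_ω_ne_zero (by norm_num)
  · rw [hf0, ← sub_ne_zero, show (1 / 2 + 169 / 2346 * ω - 1 : ℂ) = -1 / 2 + 169 / 2346 * ω by ring]
    exact add_mul_ω_ne_zero (by norm_num)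
  · rw [hf0]; simpa using ω_ne_zero
  · rw [← range_icosaPoles]
    rintro ⟨j, hj⟩
    exact ne_icosaPoles basePoint_im_pos j (sub_eq_zero.2 hj.symm)
  · rw [residueRows_eq hf0 hx, connectionMatrix_eq, ← range_icosaPoles]
    exact icosaMonodromy_eq

end MonodromyGroup

end PainleveVI

theorem theorem3 :
    PainleveVI.explicitSolution.IsAlgebraicSolution ∧
    ∃ C : PainleveVI.PlaneCurve,
      PainleveVI.IsDubrovinMazzocco C ∧
      PainleveVI.OkamotoEquivalent
        (PainleveVI.dubrovinMazzoccoData C) PainleveVI.explicitSolution ∧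
      PainleveVI.PlaneCurve.Birational C PainleveVI.ellipticCurve :=
  ⟨PainleveVI.explicitSolution_isAlgebraicSolution, PainleveVI.exists_isDubrovinMazzocco⟩
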